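/- **Setting.** Let $H$ be a finite-dimensional $C^*$ Hopf algebra over $\mathbb C$ (comultiplication $\Delta$ a $*$-homomorphism, and a faithful $*$-representation on a Hilbert space exists), with counit $\varepsilon$, antipode $S$, dual Hopf algebra $\hat H$, and Haar integrals (normalized two-sided integrals) $h_H\in H$, $\varphi_{\hat H}\in\hat H$. Let $\mathfrak A\neq 0$ be a finite-dimensional right $H$-comodule algebra with coaction $\beta(x)=\sum x^{[0]}\otimes x^{[1]}$ which is $H$-indecomposable (not a direct sum of two nonzero two-sided ideals that are also $H$-subcomodules) and which has a symmetric separability idempotent $\lambda=\sum\lambda^{\langle1\rangle}\otimes\lambda^{\langle2\rangle}\in\mathfrak A\otimes\mathfrak A$: $\sum x\lambda^{\langle1\rangle}\otimes\lambda^{\langle2\rangle}=\sum\lambda^{\langle1\rangle}\otimes\lambda^{\langle2\rangle}x$ for all $x$, $\sum\lambda^{\langle1\rangle}\lambda^{\langle2\rangle}=1$, and $\lambda$ is invariant under exchange of the tensor factors. Take a finite cellulation of a closed disk $\Sigma$ with directed edges, without loops (an edge never starts and ends at the same vertex), whose boundary $\partial\Sigma$ is a simple cycle of edges directed so that $\Sigma$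 lies on their right. The total space is $\mathcal H=\bigotimes_{e\text{ bulk edge}}H\otimes\bigotimes_{e\text{ boundary edge}}\mathfrak A$. A site $s=(v,f)$ is a corner of a face $f$ at a vertex $v$. *Edge operators.* On $H$: $L_+^hx=hx$, $L_-^hx=xS(h)$, $T_+^\varphi x=\sum\varphi(x^{(2)})x^{(1)}$, $T_-^\varphi x=\sum\varphi(S(x^{(1)}))x^{(2)}$. On $\mathfrak A$: $\bar T_+^\varphi x=\sum\varphi(x^{[1]})x^{[0]}$. *Face operators.* $B^\varphi(s)=\sum_{(\varphi)}T^{\varphi^{(1)}}(j_1,f)\cdots T^{\varphi^{(n)}}(j_n,f)$, where $j_1,\dots,j_n$ are the edges around $f$ counterclockwise from $s$, and $T(j,f)$ is $T_-$ if $f$ is to the left of the bulk edge $j$, $T_+$ if $f$ is to its right, and $\bar T_+$ if $j$ is a boundary edge. *Bulk vertex operators.* For $v\notin\partial\Sigma$, $A^h(s)=\sum_{(h)}L^{h^{(1)}}(j_1,v)\cdots L^{h^{(n)}}(j_n,v)$, where $j_1,\dots,j_n$ are the edges around $v$ counterclockwise from $s$, and $L(j,v)$ is $L_-$ if $v$ is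 the origin of $j$ and $L_+$ otherwise. *Boundary vertex operators.* For $v\in\partial\Sigma$ let $x,y$ be the labels of the incoming and the outgoing boundary edge at $v$, let $e_1,\dots,e_k$ ($k\ge0$) be the bulk edges at $v$ counterclockwise from the incoming to the outgoing boundary edge, and let $s$ lie after $e_j$ and before $e_{j+1}$ ($0\le j\le k$). Then for $a,b\in\mathfrak A$, $A^{a\otimes b}(s)$ acts by $x\mapsto a^{[0]}x$, $y\mapsto y\,b^{[0]}$, by $L^{a^{[i]}}(e_i,v)$ for $1\le i\le j$, and by $L^{S(b^{[i]})}(e_{k+1-i},v)$ for $1\le i\le k-j$, summed over the iterated coactions of $a$ and $b$. *Hamiltonian.* $$\mathbb H=\sum_{v\text{ bulk}}\bigl(I-A^{h_H}(v)\bigr)+\sum_{f\text{ bulk}}\bigl(I-B^{\varphi_{\hat H}}(f)\bigr)+\sum_{s\text{ boundary site}}\bigl(I-A^{\lambda}(s)\bigr)+\sum_{s\text{ boundary site}}\bigl(I-B^{\varphi_{\hat H}}(s)\bigr),$$ where bulk vertices are those not on $\partial\Sigma$, bulk faces are those without a boundary edge, boundary sites are those whose vertex is on $\partial\Sigma$,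 and $A^{h_H}(v)$, $B^{\varphi_{\hat H}}(f)$ are formed at any site at $v$, respectively of $f$. A ground state is a nonzero eigenvector of $\mathbb H$ for its smallest eigenvalue (all eigenvalues being real). *Hopf tensor network states.* For labels $h_e\in H$ on bulk edges, $x_e\in\mathfrak A$ on boundary edges, $\phi_f\in\hat H$ on faces, put $$|\Psi(\{h_e\},\{\phi_f\};\{x_e\})\rangle=\sum\operatorname{ttr}\bigl(\{h_e^{(2)}\},\{\phi_f\};\{x_e^{[1]}\}\bigr)\bigotimes_{e\text{ bulk}}|h_e^{(1)}\rangle\otimes\bigotimes_{e\text{ boundary}}|x_e^{[0]}\rangle .$$ Here, for $y_e,z_e\in H$, $\operatorname{ttr}(\{y_e\},\{\phi_f\};\{z_e\})=\sum\prod_f\phi_f(w_f)$, where $w_f\in H$ is the product, counterclockwise around $f$ from a fixed starting site, of the following elements of its edges: $z_e$ for a boundary edge $e$, $y_e^{(1)}$ for a bulk edge $e$ having $f$ on its right, $S(y_e^{(2)})$ for a bulk edge $e$ having $f$ on its left. **Proposition.** 1. The model has a ground state, and it is unique up to a scalar factor. 2. Suppose in addition that $\mathfrak A$ is augmented by an algebra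 homomorphism $\varepsilon_{\mathfrak A}:\mathfrak A\to\mathbb C$, and put $h_{\mathfrak A}=\sum\lambda^{\langle1\rangle}\varepsilon_{\mathfrak A}(\lambda^{\langle2\rangle})$. Then the Hopf tensor network state $|\Psi_{GS}\rangle$ with $h_e=h_H$ on all bulk edges, $\phi_f=\varphi_{\hat H}$ on all faces and $x_e=h_{\mathfrak A}$ on all boundary edges is a ground state (in particular it is nonzero). For every site $s=(v,f)$ with $v\notin\partial\Sigma$, and all $g\in H$, $\varphi\in\hat H$, $$B^\varphi(s)A^g(s)|\Psi_{GS}\rangle=\varepsilon(g)\,\varphi(1_H)\,|\Psi_{GS}\rangle .$$ -/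

import Mathlib

open scoped TensorProduct

noncomputable section

namespace HopfDisk

/-! ## Finite-dimensional C* Hopf algebras, Haar integrals, comodule algebras -/

/-- A Hopf `*`-algebra structure which is C*: the comultiplication is a `*`-homomorphism and there
is a faithful `*`-representation by bounded operators on a Hilbert space. (Finite dimensionality is
a separate hypothesis.) -/
structure IsCStarHopfAlgebra (H : Type*) [Ring H] [HopfAlgebra ℂ H] [StarRing H] [StarModule ℂ H] :
    Prop where
  comul_star : ∀ x : H,
    Coalgebra.comul (R := ℂ) (star x) = star (Coalgebra.comul (R := ℂ) x : H ⊗[ℂ] H)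
  faithful_rep : ∃ (K : Type) (_ : NormedAddCommGroup K) (_ : InnerProductSpace ℂ K)
    (_ : CompleteSpace K) (ρ : H →⋆ₐ[ℂ] (K →L[ℂ] K)), Function.Injective ρ

/-- Normalized two-sided integral of `H`. -/
def IsHaarIntegral (H : Type*) [Ring H] [HopfAlgebra ℂ H] (h : H) : Prop :=
  (∀ x : H, x * h = Coalgebra.counit (R := ℂ) x • h) ∧
  (∀ x : H, h * x = Coalgebra.counit (R := ℂ) x • h) ∧
  Coalgebra.counit (R := ℂ) h = 1

/-- The product of the dual Hopf algebra: `(φψ)(x) = ∑ φ(x⁽¹⁾) ψ(x⁽²⁾)`. -/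
def dualMul {H : Type*} [Ring H] [HopfAlgebra ℂ H] (φ ψ : Module.Dual ℂ H) : Module.Dual ℂ H :=
  LinearMap.mul' ℂ ℂ ∘ₗ TensorProduct.map φ ψ ∘ₗ Coalgebra.comul

/-- Normalized two-sided integral of the dual Hopf algebra, whose unit is the counit of `H` and
whose counit is `φ ↦ φ(1)`. -/
def IsDualHaarIntegral (H : Type*) [Ring H] [HopfAlgebra ℂ H] (φ : Module.Dual ℂ H) : Prop :=
  (∀ ψ : Module.Dual ℂ H, dualMul ψ φ = ψ 1 • φ) ∧
  (∀ ψ : Module.Dual ℂ H, dualMul φ ψ = ψ 1 • φ) ∧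
  φ 1 = 1

/-- The Haar integral of `H` (unique when it exists, as it does for finite-dimensional C* Hopf
algebras). -/
def haarIntegral (H : Type*) [Ring H] [HopfAlgebra ℂ H] : H :=
  Classical.epsilon (IsHaarIntegral H)

/-- The Haar integral of the dual Hopf algebra. -/
def dualHaarIntegral (H : Type*) [Ring H] [HopfAlgebra ℂ H] : Module.Dual ℂ H :=
  Classical.epsilon (IsDualHaarIntegral H)

/-- Comultiplication of the dual Hopf algebra: `Δ(φ)(x ⊗ y) = φ(xy)`. -/
def dualComul (H : Type*) [Ring H] [HopfAlgebra ℂ H] [FiniteDimensional ℂ H] :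
    Module.Dual ℂ H →ₗ[ℂ] Module.Dual ℂ H ⊗[ℂ] Module.Dual ℂ H :=
  (TensorProduct.dualDistribEquiv ℂ H H).symm.toLinearMap ∘ₗ (LinearMap.mul' ℂ H).dualMap

/-- Counit of the dual Hopf algebra: `φ ↦ φ(1)`. -/
def dualCounit (H : Type*) [Ring H] [HopfAlgebra ℂ H] : Module.Dual ℂ H →ₗ[ℂ] ℂ :=
  Module.Dual.eval ℂ H 1

/-- A right `H`-comodule algebra structure on `A`: a coassociative and counital right coaction
`β : A → A ⊗ H` that is a homomorphism of unital algebras. -/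
structure RightComoduleAlgebra (H A : Type*) [Ring H] [HopfAlgebra ℂ H] [Ring A] [Algebra ℂ A] where
  coact : A →ₐ[ℂ] A ⊗[ℂ] H
  coassoc : (TensorProduct.assoc ℂ A H H).toLinearMap ∘ₗ coact.toLinearMap.rTensor H ∘ₗ
    coact.toLinearMap = (Coalgebra.comul (R := ℂ) (A := H)).lTensor A ∘ₗ coact.toLinearMap
  counit_coact : (TensorProduct.rid ℂ A).toLinearMap ∘ₗ
    (Coalgebra.counit (R := ℂ) (A := H)).lTensor A ∘ₗ coact.toLinearMap = LinearMap.id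

section ComoduleAlgebra

variable {H A : Type*} [Ring H] [HopfAlgebra ℂ H] [Ring A] [Algebra ℂ A]

/-- A two-sided ideal of `A` that is also an `H`-subcomodule. -/
structure IsHIdeal (β : RightComoduleAlgebra H A) (I : Submodule ℂ A) : Prop where
  mul_left : ∀ a : A, ∀ x ∈ I, a * x ∈ I
  mul_right : ∀ a : A, ∀ x ∈ I, x * a ∈ I
  coact_mem : ∀ x ∈ I, β.coact x ∈ LinearMap.range (I.subtype.rTensor H)

/-- `A` is not a direct sum of two non-trivial two-sided `H`-ideals. -/
def IsHIndecomposable (β : RightComoduleAlgebra H A) : Prop :=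
  ∀ I J : Submodule ℂ A, IsHIdeal β I → IsHIdeal β J → IsCompl I J → I = ⊥ ∨ J = ⊥

end ComoduleAlgebra

/-- Symmetric separability idempotent `λ = ∑ λ⟨1⟩ ⊗ λ⟨2⟩` of an algebra. -/
structure IsSymmSeparabilityIdempotent {A : Type*} [Ring A] [Algebra ℂ A] (lam : A ⊗[ℂ] A) :
    Prop where
  central : ∀ x : A, (LinearMap.mulLeft ℂ x).rTensor A lam = (LinearMap.mulRight ℂ x).lTensor A lam
  mul_eq_one : LinearMap.mul' ℂ A lam = 1
  symm : TensorProduct.comm ℂ A A lam = lam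

/-- `h_A = ∑ λ⟨1⟩ ε(λ⟨2⟩)`. -/
def augmentedIntegral {A : Type*} [Ring A] [Algebra ℂ A] (lam : A ⊗[ℂ] A) (ε : A →ₐ[ℂ] ℂ) : A :=
  TensorProduct.rid ℂ A (ε.toLinearMap.lTensor A lam)

/-! ## Sweedler products -/

/-- For operator-valued linear maps `f₁, …, fₙ` on a coalgebra,
the linear map `c ↦ ∑ f₁(c⁽¹⁾) ⋯ fₙ(c⁽ⁿ⁾)`. -/
def sweedlerProd {C V : Type*} [AddCommGroup C] [Module ℂ C] [AddCommGroup V] [Module ℂ V]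
    (Δ : C →ₗ[ℂ] C ⊗[ℂ] C) (ε : C →ₗ[ℂ] ℂ) :
    List (C →ₗ[ℂ] Module.End ℂ V) → (C →ₗ[ℂ] Module.End ℂ V)
  | [] => Algebra.linearMap ℂ (Module.End ℂ V) ∘ₗ ε
  | f :: l => LinearMap.mul' ℂ (Module.End ℂ V) ∘ₗ
      TensorProduct.map f (sweedlerProd Δ ε l) ∘ₗ Δ

/-- For operator-valued linear maps `g` on `A` and `f₁, …, fₙ` on `H`, the linear map
`a ↦ ∑ g(a⁽⁰⁾) f₁(a⁽¹⁾) ⋯ fₙ(a⁽ⁿ⁾)` built from the coaction. -/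
def coactProd {H A V : Type*} [Ring H] [HopfAlgebra ℂ H] [Ring A] [Algebra ℂ A]
    [AddCommGroup V] [Module ℂ V] (β : RightComoduleAlgebra H A) (g : A →ₗ[ℂ] Module.End ℂ V)
    (l : List (H →ₗ[ℂ] Module.End ℂ V)) : A →ₗ[ℂ] Module.End ℂ V :=
  LinearMap.mul' ℂ (Module.End ℂ V) ∘ₗ
    TensorProduct.map g (sweedlerProd Coalgebra.comul Coalgebra.counit l) ∘ₗ β.coact.toLinearMap

/-- `t = ∑ m ⊗ n ↦ ∑ f(n) m`. -/
def sliceRight {M N : Type*} [AddCommGroup M] [Module ℂ M] [AddCommGroup N] [Module ℂ N] :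
    Module.Dual ℂ N →ₗ[ℂ] (M ⊗[ℂ] N) →ₗ[ℂ] M :=
  (LinearMap.compRight ℂ (TensorProduct.rid ℂ M).toLinearMap) ∘ₗ LinearMap.lTensorHom M

/-- `t = ∑ n ⊗ m ↦ ∑ f(n) m`. -/
def sliceLeft {M N : Type*} [AddCommGroup M] [Module ℂ M] [AddCommGroup N] [Module ℂ N] :
    Module.Dual ℂ N →ₗ[ℂ] (N ⊗[ℂ] M) →ₗ[ℂ] M :=
  (LinearMap.compRight ℂ (TensorProduct.lid ℂ M).toLinearMap) ∘ₗ LinearMap.rTensorHom M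

section SingleEdge

variable (H : Type*) [Ring H] [HopfAlgebra ℂ H]

/-- `L₊ʰ x = h x`. -/
def Lplus : H →ₗ[ℂ] Module.End ℂ H := LinearMap.mul ℂ H

/-- `L₋ʰ x = x S(h)`. -/
def Lminus : H →ₗ[ℂ] Module.End ℂ H := (LinearMap.mul ℂ H).flip ∘ₗ HopfAlgebra.antipode ℂ

/-- `T₊^φ x = ∑ φ(x⁽²⁾) x⁽¹⁾`. -/
def Tplus : Module.Dual ℂ H →ₗ[ℂ] Module.End ℂ H :=
  (LinearMap.lcomp ℂ H (Coalgebra.comul (R := ℂ) (A := H))) ∘ₗ sliceRight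

/-- `T₋^φ x = ∑ φ(S(x⁽¹⁾)) x⁽²⁾`. -/
def Tminus : Module.Dual ℂ H →ₗ[ℂ] Module.End ℂ H :=
  (LinearMap.lcomp ℂ H (Coalgebra.comul (R := ℂ) (A := H))) ∘ₗ sliceLeft ∘ₗ
    (HopfAlgebra.antipode ℂ (A := H)).dualMap

/-- `φ ⇀ x = ∑ φ(x⁽¹⁾) x⁽⁰⁾` on a right comodule algebra. -/
def TbarPlus {H A : Type*} [Ring H] [HopfAlgebra ℂ H] [Ring A] [Algebra ℂ A]
    (β : RightComoduleAlgebra H A) : Module.Dual ℂ H →ₗ[ℂ] Module.End ℂ A :=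
  (LinearMap.lcomp ℂ A β.coact.toLinearMap) ∘ₗ sliceRight

end SingleEdge

/-! ## Lattices on a disk

A lattice is encoded by its rotation system on the set `D` of darts (edges together with one of
their two directions): `rot d` is the next dart counterclockwise around the origin of `d`, and
`flip d` is `d` with the reversed direction. Vertices are the cycles of `rot`; the face lying to the
left of a dart `d` is its cycle under `next = rot⁻¹ ∘ flip`, which traverses the boundary of that
face counterclockwise. A connected rotation system with `V - E + F = 2` is a cellulation of the
sphere, and the disk is obtained by deleting one face (the outer face, to the left of the dart
`root`) whose boundary is a simple closed curve. -/

/-- The list `[x, p x, p² x, …]` running once through the cycle of `x`. -/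
def cycleList {D : Type*} (p : Equiv.Perm D) (x : D) : List D :=
  (List.range (Function.minimalPeriod p x)).map fun i => (p ^ i) x

/-- A lattice on a disk together with a direction for every edge. -/
structure DiskLattice (D : Type*) where
  rot : Equiv.Perm D
  flip : Equiv.Perm D
  root : D
  /-- the darts which point in the chosen direction of their edge -/
  pos : D → Prop
  flip_flip : ∀ d, flip (flip d) = d
  pos_flip : ∀ d, pos (flip d) ↔ ¬ pos d
  /-- the surface is connected -/
  connected : ∀ d d' : D, ∃ g ∈ Subgroup.closure {rot, flip}, g d = d'
  /-- no edge starts and ends at the same vertex -/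
  no_loop : ∀ d, ¬ rot.SameCycle d (flip d)
  /-- Euler's formula `V + F = E + 2` for the sphere -/
  euler : 2 * (Nat.card (Quotient (Equiv.Perm.SameCycle.setoid rot)) +
      Nat.card (Quotient (Equiv.Perm.SameCycle.setoid (rot⁻¹ * flip)))) = Nat.card D + 4
  /-- the boundary of the outer face visits every vertex at most once -/
  outer_simple : ∀ d d', (rot⁻¹ * flip).SameCycle root d → (rot⁻¹ * flip).SameCycle root d' →
    rot.SameCycle d d' → d = d'
  /-- boundary edges are directed so that the disk is on their right -/
  outer_pos : ∀ d, (rot⁻¹ * flip).SameCycle root d → pos d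

namespace DiskLattice

variable {D : Type*} (L : DiskLattice D)

/-- The next dart along the boundary of the face to the left. -/
def next : Equiv.Perm D := L.rot⁻¹ * L.flip

/-- The dart has the outer face on its left. -/
def IsOuter (d : D) : Prop := L.next.SameCycle L.root d

theorem isOuter_flip_rot {d : D} (h : L.IsOuter d) : L.IsOuter (L.flip (L.rot d)) := by
  refine Equiv.Perm.SameCycle.trans h ?_
  refine Equiv.Perm.SameCycle.symm ⟨1, ?_⟩
  simp [next, L.flip_flip]

/-- Boundary edges; each is represented by its outer dart, which has the direction of the edge. -/
abbrev BdryEdge : Type _ := {d : D // L.IsOuter d}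

/-- Bulk edges; each is represented by its dart pointing in the chosen direction. -/
abbrev BulkEdge : Type _ := {d : D // L.pos d ∧ ¬ L.IsOuter d}

abbrev Vertex : Type _ := Quotient (Equiv.Perm.SameCycle.setoid L.rot)

abbrev Face : Type _ := Quotient (Equiv.Perm.SameCycle.setoid L.next)

/-- The vertex from which a dart emanates. -/
def origin (d : D) : L.Vertex := Quotient.mk _ d

/-- The face to the left of a dart. -/
def leftFace (d : D) : L.Face := Quotient.mk _ d

/-- The vertex lies on the boundary of the disk. -/
def IsBdryVertex (v : L.Vertex) : Prop := ∃ o, L.IsOuter o ∧ L.origin o = v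

/-- The faces of the disk. -/
abbrev InnerFace : Type _ := {f : L.Face // f ≠ L.leftFace L.root}

/-- The face of the disk contains a boundary edge. -/
def IsBdryFace (f : L.InnerFace) : Prop := ∃ o, L.IsOuter o ∧ L.leftFace (L.flip o) = f.1

/-- A boundary edge `o`, through its outer dart, determines the boundary vertex it starts from. The
darts at this vertex are, counterclockwise, `o`, the reverse of the incoming boundary edge, and then
the bulk darts listed here. -/
def bulkDartsAt (o : L.BdryEdge) : List D :=
  (List.range (Function.minimalPeriod L.rot o.1 - 2)).map fun i => (L.rot ^ (i + 2)) o.1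

/-- The boundary edge that ends at the vertex from which the boundary edge `o` starts. -/
def incoming (o : L.BdryEdge) : L.BdryEdge := ⟨L.flip (L.rot o.1), L.isOuter_flip_rot o.2⟩

/-- Boundary sites: a boundary vertex and one of the corners of the disk at that vertex, numbered
counterclockwise starting from the incoming boundary edge. -/
abbrev BdrySite : Type _ := (o : L.BdryEdge) × Fin (Function.minimalPeriod L.rot o.1 - 1)

end DiskLattice

/-! ## The model -/

section Model

variable {D : Type*} (L : DiskLattice D)
variable (H A : Type*) [Ring H] [HopfAlgebra ℂ H] [FiniteDimensional ℂ H] [Ring A] [Algebra ℂ A]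

/-- The total space: one copy of `H` per bulk edge, one copy of `A` per boundary edge. -/
abbrev TotalSpace : Type _ := (⨂[ℂ] _ : L.BulkEdge, H) ⊗[ℂ] (⨂[ℂ] _ : L.BdryEdge, A)

open scoped Classical in
/-- An operator on `H`, acting at one bulk edge. -/
def onBulkEdge (e : L.BulkEdge) : Module.End ℂ H →ₗ[ℂ] Module.End ℂ (TotalSpace L H A) :=
  LinearMap.rTensorHom (⨂[ℂ] _ : L.BdryEdge, A) ∘ₗ
    (PiTensorProduct.mapMultilinear ℂ (fun _ : L.BulkEdge => H) (fun _ => H)).toLinearMap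
      (fun _ => LinearMap.id) e

open scoped Classical in
/-- An operator on `A`, acting at one boundary edge. -/
def onBdryEdge (e : L.BdryEdge) : Module.End ℂ A →ₗ[ℂ] Module.End ℂ (TotalSpace L H A) :=
  LinearMap.lTensorHom (⨂[ℂ] _ : L.BulkEdge, H) ∘ₗ
    (PiTensorProduct.mapMultilinear ℂ (fun _ : L.BdryEdge => A) (fun _ => A)).toLinearMap
      (fun _ => LinearMap.id) e

open scoped Classical in
/-- `L^h(j, v)` where `j` is the bulk edge of the dart `d` and `v` is the origin of `d`: it is `L₋`
if `v` is the origin of `j` and `L₊` otherwise. (Zero if `d` belongs to a boundary edge; this case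
is never used.) -/
def dartL (d : D) : H →ₗ[ℂ] Module.End ℂ (TotalSpace L H A) :=
  if h : L.pos d ∧ ¬ L.IsOuter d then onBulkEdge L H A ⟨d, h⟩ ∘ₗ Lminus H
  else if h : L.pos (L.flip d) ∧ ¬ L.IsOuter (L.flip d) then
    onBulkEdge L H A ⟨L.flip d, h⟩ ∘ₗ Lplus H
  else 0

variable {H A} in
open scoped Classical in
/-- `T^φ(j, f)` where `j` is the edge of the dart `d` and `f` is the face to the left of `d`: it is
`T₋` if `f` is to the left of `j` and `T₊` if `f` is to the right of `j`; boundary edges always have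
the disk on their right, and the action on `A` through the coaction is used for them. (Zero if `f`
is the outer face; this case is never used.) -/
def dartT (β : RightComoduleAlgebra H A) (d : D) :
    Module.Dual ℂ H →ₗ[ℂ] Module.End ℂ (TotalSpace L H A) :=
  if h : L.IsOuter (L.flip d) then onBdryEdge L H A ⟨L.flip d, h⟩ ∘ₗ TbarPlus β
  else if h : L.pos d ∧ ¬ L.IsOuter d then onBulkEdge L H A ⟨d, h⟩ ∘ₗ Tminus H
  else if h : L.pos (L.flip d) ∧ ¬ L.IsOuter (L.flip d) then
    onBulkEdge L H A ⟨L.flip d, h⟩ ∘ₗ Tplus H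
  else 0

/-- The vertex operator `A^h(s)` at the site `s` formed by the origin `v` of the dart `d` and the
face `f` to the left of `d`; the edges around `v` are taken counterclockwise starting from `s`. -/
def vertexOp (d : D) : H →ₗ[ℂ] Module.End ℂ (TotalSpace L H A) :=
  sweedlerProd Coalgebra.comul Coalgebra.counit ((cycleList L.rot (L.rot d)).map (dartL L H A))

variable {H A}

/-- The face operator `B^φ(s)` at the site `s` formed by the origin of the dart `d` and the face `f`
to the left of `d`; the edges around `f` are taken counterclockwise starting from `s`. -/
def faceOp (β : RightComoduleAlgebra H A) (d : D) :
    Module.Dual ℂ H →ₗ[ℂ] Module.End ℂ (TotalSpace L H A) :=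
  sweedlerProd (dualComul H) (dualCounit H) ((cycleList L.next d).map (dartT L β))

/-- The boundary vertex operator `A^{a ⊗ b}(s)`. Let `x` be the incoming and `y` the outgoing
boundary edge of the vertex, and `e₁, …, e_k` the bulk edges counterclockwise from `x` to `y`, with
the site `s` between `e_j` and `e_{j+1}`. Then `x ↦ a⁽⁰⁾ x` and `y ↦ y b⁽⁰⁾`, while `e₁, …, e_j` are
acted on by `a⁽¹⁾, …, a⁽ʲ⁾` and `e_k, …, e_{j+1}` by `S(b⁽¹⁾), …, S(b⁽ᵏ⁻ʲ⁾)`. -/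
def bdryVertexOp (β : RightComoduleAlgebra H A) (s : L.BdrySite) :
    A ⊗[ℂ] A →ₗ[ℂ] Module.End ℂ (TotalSpace L H A) :=
  LinearMap.mul' ℂ _ ∘ₗ TensorProduct.map
    (coactProd β (onBdryEdge L H A (L.incoming s.1) ∘ₗ LinearMap.mul ℂ A)
      (((L.bulkDartsAt s.1).take s.2).map (dartL L H A)))
    (coactProd β (onBdryEdge L H A s.1 ∘ₗ (LinearMap.mul ℂ A).flip)
      (((L.bulkDartsAt s.1).drop s.2).reverse.map fun d =>
        dartL L H A d ∘ₗ HopfAlgebra.antipode ℂ))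

/-- The boundary face operator `B^φ(s)`. -/
def bdryFaceOp (β : RightComoduleAlgebra H A) (s : L.BdrySite) :
    Module.Dual ℂ H →ₗ[ℂ] Module.End ℂ (TotalSpace L H A) :=
  faceOp L β ((L.rot ^ (s.2.1 + 1)) s.1.1)

open scoped Classical in
/-- The Hamiltonian of the disk with boundary: for the bulk, the sum of `1 - A_v` over bulk vertices
and of `1 - B_f` over bulk faces; for the boundary, the sum of `1 - A^λ(s)` and of `1 - B^φ(s)` over
boundary sites. At a bulk vertex or face the operator does not depend on the site used to write it,
since the Haar integrals are cocommutative. -/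
def hamiltonian [Fintype D] (β : RightComoduleAlgebra H A) (lam : A ⊗[ℂ] A) :
    Module.End ℂ (TotalSpace L H A) :=
  (∑ v : {v : L.Vertex // ¬ L.IsBdryVertex v}, (1 - vertexOp L H A v.1.out (haarIntegral H))) +
  (∑ f : {f : L.InnerFace // ¬ L.IsBdryFace f}, (1 - faceOp L β f.1.1.out (dualHaarIntegral H))) +
  (∑ s : L.BdrySite, (1 - bdryVertexOp L β s lam)) +
  (∑ s : L.BdrySite, (1 - bdryFaceOp L β s (dualHaarIntegral H)))

/-! ## Ground states -/

/-- The real number `E` is an eigenvalue of `T`, every eigenvalue of `T` is real, and `E` is the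
smallest one. -/
def IsGroundEnergy {V : Type*} [AddCommGroup V] [Module ℂ V] (T : Module.End ℂ V) (E : ℝ) : Prop :=
  T.HasEigenvalue (E : ℂ) ∧ ∀ μ : ℂ, T.HasEigenvalue μ → ∃ r : ℝ, μ = (r : ℂ) ∧ E ≤ r

/-- A nonzero vector of lowest energy. -/
def IsGroundState {V : Type*} [AddCommGroup V] [Module ℂ V] (T : Module.End ℂ V) (ψ : V) : Prop :=
  ψ ≠ 0 ∧ ∃ E : ℝ, IsGroundEnergy T E ∧ T ψ = (E : ℂ) • ψ

/-! ## Hopf tensor network states -/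

open scoped Classical in
/-- The element of `H` that a dart `d` contributes to the face on its left: `r e` if this face is to
the right of the bulk edge `e`, `l e` if it is to the left of the bulk edge `e`, and `z e` for a
boundary edge `e`. -/
def dartLetter (r l : L.BulkEdge → H) (z : L.BdryEdge → H) (d : D) : H :=
  if h : L.IsOuter (L.flip d) then z ⟨L.flip d, h⟩
  else if h : L.pos d ∧ ¬ L.IsOuter d then l ⟨d, h⟩
  else if h : L.pos (L.flip d) ∧ ¬ L.IsOuter (L.flip d) then r ⟨L.flip d, h⟩
  else 1

open scoped Classical in
/-- Gluing along faces: `∏_f φ_f(z₁ ⋯ zₙ)`, where `z₁, …, zₙ` are the elements contributed by the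
edges around `f`, read counterclockwise from the starting site of `f`. -/
def faceEvaluation [Fintype D] (φ : L.InnerFace → Module.Dual ℂ H) (r l : L.BulkEdge → H)
    (z : L.BdryEdge → H) : ℂ :=
  ∏ f : L.InnerFace, φ f ((cycleList L.next f.1.out).map (dartLetter L r l z)).prod

open scoped Classical in
/-- The Hopf trace of the network with label `y e` on the bulk edge `e`, `z e` on the boundary edge
`e` and `φ f` on the face `f`:
`∑ faceEvaluation φ (y_e⁽¹⁾) (S(y_e⁽²⁾)) (z_e)`, that is, the label of a bulk edge is split by the
comultiplication, `y⁽¹⁾` going to the face on its right and `S(y⁽²⁾)` to the face on its left. The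
Sweedler sum is written by expanding `∑ y_e⁽¹⁾ ⊗ S(y_e⁽²⁾)` in a basis of `H ⊗ H`; the value does
not depend on the basis. -/
def hopfTrace [Fintype D] (φ : L.InnerFace → Module.Dual ℂ H) (y : L.BulkEdge → H)
    (z : L.BdryEdge → H) : ℂ :=
  let b := Module.finBasis ℂ H
  ∑ c : L.BulkEdge → Fin (Module.finrank ℂ H) × Fin (Module.finrank ℂ H),
    (∏ e, (b.tensorProduct b).repr
      ((HopfAlgebra.antipode ℂ (A := H)).lTensor H (Coalgebra.comul (R := ℂ) (y e))) (c e)) *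
    faceEvaluation L φ (fun e => b (c e).1) (fun e => b (c e).2) z

open scoped Classical in
/-- The Hopf tensor network state
`∑ ttr({h_e⁽²⁾}, {φ_f}; {x_e⁽¹⁾}) ⨂_e |h_e⁽¹⁾⟩ ⨂_e |x_e⁽⁰⁾⟩` with labels `h` on bulk edges, `x` on
boundary edges and `φ` on faces. The Sweedler sums are written by expanding the second tensor factor
of `Δ(h_e)` and of `β(x_e)` in a basis of `H`; the value does not depend on the basis. -/
def tensorNetworkState [Fintype D] (β : RightComoduleAlgebra H A) (h : L.BulkEdge → H)
    (φ : L.InnerFace → Module.Dual ℂ H) (x : L.BdryEdge → A) : TotalSpace L H A :=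
  let b := Module.finBasis ℂ H
  ∑ k : L.BulkEdge → Fin (Module.finrank ℂ H), ∑ l : L.BdryEdge → Fin (Module.finrank ℂ H),
    hopfTrace L φ (fun e => b (k e)) (fun e => b (l e)) •
      ((⨂ₜ[ℂ] e, sliceRight (b.coord (k e)) (Coalgebra.comul (R := ℂ) (h e))) ⊗ₜ[ℂ]
       (⨂ₜ[ℂ] e, sliceRight (b.coord (l e)) (β.coact (x e))))

end Model

end HopfDisk

end

/-! Every term of the Hamiltonian is 1 − P, and the operators P are commuting idempotents. The
eigenvalues of a sum of commuting idempotents are natural numbers. Hence, once a nonzero vector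
fixed by all P exists, the ground states are exactly the nonzero common fixed vectors
(`isGroundState_hamiltonian_iff`). The theorem thus says that the space of invariant vectors is a
line, and that the network state spans it.

Algebraic input. Positivity of the regular trace of a finite-dimensional C* Hopf algebra gives the
Haar integrals h of H and χ of the dual, then S² = 1, the trace property of χ and the
cocommutativity of h. For the comodule algebra, the regular trace τ is invariant under the coaction
and λ is its dual basis. Hence λ is coinvariant (`IsSymmSeparabilityIdempotent.collectCoact_coact`).
By a Fitting decomposition, every invariant trace on an indecomposable comodule algebra is a
multiple of τ (`IsHIndecomposable.eq_smul_regTrace`).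

Commutation. A Sweedler sum around a face is a slice of a product in End V ⊗ H. A Sweedler sum
around a vertex is a product in a convolution ring. A single edge then satisfies T l = l X T, with a
twist X, and at a corner the twist produced by one edge is absorbed by the next one. At the corner
where the sum around a bulk vertex starts, the cyclic invariance of h and the trace property of χ
take over (`IsCStarHopfAlgebra.commute_of_twisted`). At a boundary vertex it is the coinvariance of
λ.

Uniqueness. Let the pin of a bulk edge be the rank-one projection x ↦ ε(x) h on that edge. Pinning
an edge between two different faces deletes it and merges the faces. For the face operator B of d·p
and the pin P of d one has P B P = χ(h) P and B P B = χ(h) B, and the other face operator becomes,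
behind B P, the one of the merged face. Since χ(h) ≠ 0, nothing is lost by pinning. When a single
face is left, Euler's formula says that the remaining bulk edges form a forest hanging on the
boundary. Its leaves are pinned automatically by the bulk vertex operators and can be cut off. In
the end only the boundary circle remains. The boundary vertex operators move labels along it, so a
functional invariant under them and under the pins is a trace of the product of the boundary labels.
The face operator of the circle averages this trace to a multiple of τ. Therefore one functional,
`collapseTrace` (counit on the bulk edges, τ of the product along the boundary), is injective on
invariant vectors (`detects_collapseTrace`), and the space is at most one-dimensional.

Existence. The same induction shows that on pinned vectors the product of all face operators
multiplies `collapseTrace` by a nonzero constant. Take a pinned vector that is fixed by the boundary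
vertex operators and on which `collapseTrace` does not vanish. Applying the face operators to it
produces a nonzero invariant vector. Projecting the vector with labels h and 1 gives a starting
point in general. With an augmentation, the labels h and h_A already work, and expanding the product
of face operators in a basis shows that the result is the tensor network state
(`tensorNetworkState_eq`). Its behaviour under general g and φ follows from the absorption
properties of the integrals. -/

open scoped TensorProduct

noncomputable section

namespace HopfDisk

/-! ## The antipode and the star -/

section Antipode

open Coalgebra HopfAlgebra WithConv

variable {H : Type*} [Ring H] [HopfAlgebra ℂ H]

/-- The identity and S are inverse to each other for convolution, and composing with an algebra map
is multiplicative. The case of interest is that of the two inclusions of H in H ⊗ H. -/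
theorem conv_algHom_mul_antipode {B : Type*} [Ring B] [Algebra ℂ B] (f : H →ₐ[ℂ] B) :
    toConv f.toLinearMap * toConv (f.toLinearMap ∘ₗ antipode ℂ) = 1 := by
  have := LinearMap.algHom_comp_convMul_distrib f (toConv LinearMap.id) (toConv (antipode ℂ (A := H)))
  rw [LinearMap.id_mul_antipode] at this
  apply WithConv.ofConv_injective
  simp only [LinearMap.comp_id] at this
  rw [← this]
  ext x
  simp

theorem conv_antipode_mul_algHom {B : Type*} [Ring B] [Algebra ℂ B] (f : H →ₐ[ℂ] B) :
    toConv (f.toLinearMap ∘ₗ antipode ℂ) * toConv f.toLinearMap = 1 := by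
  have := LinearMap.algHom_comp_convMul_distrib f (toConv (antipode ℂ (A := H))) (toConv LinearMap.id)
  rw [LinearMap.antipode_mul_id] at this
  apply WithConv.ofConv_injective
  simp only [LinearMap.comp_id] at this
  rw [← this]
  ext x
  simp

/-- The antipode is an anti-homomorphism of coalgebras. -/
theorem comul_antipode (x : H) : comul (R := ℂ) (antipode ℂ x) =
    TensorProduct.map (antipode ℂ) (antipode ℂ) (TensorProduct.comm ℂ H H (comul x)) := by
  let i₁ : H →ₐ[ℂ] H ⊗[ℂ] H := Algebra.TensorProduct.includeLeft
  let i₂ : H →ₐ[ℂ] H ⊗[ℂ] H := Algebra.TensorProduct.includeRight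
  -- Δ is the convolution product of the two inclusions, so its convolution inverse is i₂S * i₁S,
  -- which is (S ⊗ S) after the flip. The composite Δ ∘ S is an inverse as well.
  have h12 : toConv i₁.toLinearMap * toConv i₂.toLinearMap = toConv (comul (R := ℂ) (A := H)) := by
    ext y
    simp only [LinearMap.convMul_apply]
    induction comul (R := ℂ) y with
    | zero => simp
    | add a b ha hb => simp [ha, hb]
    | tmul a b => simp [i₁, i₂]
  have hinv : toConv (comul (R := ℂ) (A := H)) * (toConv (i₂.toLinearMap ∘ₗ antipode ℂ) *
      toConv (i₁.toLinearMap ∘ₗ antipode ℂ)) = 1 := by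
    rw [← h12, mul_assoc, ← mul_assoc (toConv i₂.toLinearMap), conv_algHom_mul_antipode, one_mul,
      conv_algHom_mul_antipode]
  have hinv' : (toConv (i₂.toLinearMap ∘ₗ antipode ℂ) *
      toConv (i₁.toLinearMap ∘ₗ antipode ℂ)) * toConv (comul (R := ℂ) (A := H)) = 1 := by
    rw [← h12, mul_assoc, ← mul_assoc _ (toConv i₁.toLinearMap), conv_antipode_mul_algHom, one_mul,
      conv_antipode_mul_algHom]
  have key := left_inv_eq_right_inv hinv' (LinearMap.comul_right_inv (R := ℂ) (C := H))
  have := LinearMap.congr_fun (congrArg ofConv key) x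
  simp only [LinearMap.convMul_apply, LinearMap.comp_apply] at this
  rw [← this]
  induction comul (R := ℂ) x with
  | zero => simp
  | add a b ha hb => simp [ha, hb]
  | tmul a b => simp [i₁, i₂]

end Antipode

section Star

open Coalgebra HopfAlgebra WithConv

variable {H : Type*} [Ring H] [HopfAlgebra ℂ H] [StarRing H] [StarModule ℂ H]

/-- The inverse of the antipode of a Hopf `*`-algebra. -/
def starAntipode (H : Type*) [Ring H] [HopfAlgebra ℂ H] [StarRing H] [StarModule ℂ H] :
    H →ₗ[ℂ] H where
  toFun x := star (antipode ℂ (star x))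
  map_add' x y := by simp
  map_smul' c x := by simp [star_smul]

/-- Since Δ is a *-map, conjugating ε by the star gives another counit, and counits are unique: the
convolution of the two is evaluated in two ways. -/
theorem IsCStarHopfAlgebra.counit_star (hH : IsCStarHopfAlgebra H) (x : H) :
    counit (R := ℂ) (star x) = star (counit (R := ℂ) x) := by
  let r := Repr.arbitrary ℂ x
  have h1 : ∑ i ∈ r.index, star (r.left i) ⊗ₜ[ℂ] star (r.right i) = comul (R := ℂ) (star x) := by
    rw [hH.comul_star, ← r.eq]
    simp
  let r' : Repr ℂ (star x) (H × H) := ⟨r.index, fun i => star (r.left i), fun i => star (r.right i), h1⟩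
  have h8 : ∑ i ∈ r.index, counit (R := ℂ) (r.right i) • r.left i = x := by
    have := congrArg (TensorProduct.rid ℂ H) (sum_tmul_counit_eq r)
    simpa only [map_sum, TensorProduct.rid_tmul, one_smul] using this
  have h9 := congrArg (fun f => star (counit (R := ℂ) (star f))) h8
  have h11 : ∑ i ∈ r.index, star (counit (R := ℂ) (star (r.left i))) • r.right i = x := by
    have := congrArg star (sum_counit_smul r')
    simpa only [r', star_sum, star_smul, star_star] using this
  have h12 := congrArg (fun f => counit (R := ℂ) f) h11
  simp only [star_sum, star_smul, map_sum, map_smul, smul_eq_mul, star_mul', star_star] at h9 h12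
  rw [← star_star (counit (R := ℂ) (star x)), ← h9, ← h12]
  exact congrArg star (Finset.sum_congr rfl fun i _ => mul_comm _ _)

theorem IsCStarHopfAlgebra.sum_starAntipode_mul (hH : IsCStarHopfAlgebra H) {x : H} {ι : Type*}
    (r : Repr ℂ x ι) :
    ∑ i ∈ r.index, starAntipode H (r.right i) * r.left i = counit (R := ℂ) x • 1 := by
  have h1 : ∑ i ∈ r.index, star (r.left i) ⊗ₜ[ℂ] star (r.right i) = comul (R := ℂ) (star x) := by
    rw [hH.comul_star, ← r.eq]
    simp
  let r' : Repr ℂ (star x) ι := ⟨r.index, fun i => star (r.left i), fun i => star (r.right i), h1⟩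
  have := congrArg star (sum_mul_antipode_eq_smul r')
  simpa [r', star_sum, star_smul, hH.counit_star, starAntipode] using this

/-- The composite is a right convolution inverse of S, because S reverses products and
`starAntipode` satisfies the skew antipode identity. The identity map is a left inverse of S. -/
theorem IsCStarHopfAlgebra.antipode_starAntipode (hH : IsCStarHopfAlgebra H) (x : H) :
    antipode ℂ (starAntipode H x) = x := by
  have h : toConv (antipode ℂ (A := H)) * toConv (antipode ℂ ∘ₗ starAntipode H) = 1 := by
    ext y
    rw [(Repr.arbitrary ℂ y).convMul_apply]
    simp only [LinearMap.comp_apply, ← antipode_mul_antidistrib]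
    rw [← map_sum, hH.sum_starAntipode_mul]
    simp [Algebra.algebraMap_eq_smul_one, antipode_one]
  have := left_inv_eq_right_inv (LinearMap.id_mul_antipode (R := ℂ) (C := H)) h
  exact (LinearMap.congr_fun (congrArg ofConv this) x).symm

variable [FiniteDimensional ℂ H]

theorem IsCStarHopfAlgebra.starAntipode_antipode (hH : IsCStarHopfAlgebra H) (x : H) :
    starAntipode H (antipode ℂ x) = x := by
  have h : antipode ℂ (A := H) ∘ₗ starAntipode H = LinearMap.id :=
    LinearMap.ext hH.antipode_starAntipode
  exact LinearMap.congr_fun (mul_eq_one_comm.1 h : starAntipode H * antipode ℂ = 1) x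

end Star

/-! ## Positivity of the regular trace -/

section Trace

/-- A hermitian functional which is strictly positive on `x* x` for nonzero `x`. -/
structure IsFaithfulPositive {H : Type*} [Ring H] [Algebra ℂ H] [StarRing H]
    (f : H →ₗ[ℂ] ℂ) : Prop where
  star_apply : ∀ x, f (star x) = star (f x)
  nonneg : ∀ x, 0 ≤ (f (star x * x)).re
  definite : ∀ x, f (star x * x) = 0 → x = 0

/-- The trace of left multiplication. -/
def regTrace (B : Type*) [Ring B] [Algebra ℂ B] : B →ₗ[ℂ] ℂ :=
  LinearMap.trace ℂ B ∘ₗ LinearMap.mul ℂ B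

theorem regTrace_mul_comm {B : Type*} [Ring B] [Algebra ℂ B] (x y : B) :
    regTrace B (x * y) = regTrace B (y * x) := by
  have h : ∀ a b : B, LinearMap.mul ℂ B (a * b) = LinearMap.mul ℂ B a * LinearMap.mul ℂ B b :=
    fun a b => by ext; simp [mul_assoc]
  simp only [regTrace, LinearMap.comp_apply, h]
  exact LinearMap.trace_mul_comm ℂ _ _

variable {H : Type*} [Ring H] [Algebra ℂ H] [StarRing H] [StarModule ℂ H] [FiniteDimensional ℂ H]

/-- The inner product `⟨x, y⟩ = f(x* y)`. -/
abbrev IsFaithfulPositive.core {f : H →ₗ[ℂ] ℂ} (hf : IsFaithfulPositive f) :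
    InnerProductSpace.Core ℂ H where
  inner x y := f (star x * y)
  conj_inner_symm x y := by
    rw [starRingEnd_apply, ← hf.star_apply]
    simp
  re_inner_nonneg x := hf.nonneg x
  add_left x y z := by simp [add_mul]
  smul_left x y r := by simp [star_smul]
  definite x := hf.definite x

/-- The hypothesis says that T' is the adjoint of T for the inner product f(x* y). In an orthonormal
basis b, the trace of T'T is the sum of the ‖T b_i‖². -/
theorem IsFaithfulPositive.trace_adjoint {f : H →ₗ[ℂ] ℂ} (hf : IsFaithfulPositive f)
    (T T' : Module.End ℂ H) (h : ∀ x y, f (star (T x) * y) = f (star x * T' y)) :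
    LinearMap.trace ℂ H T' = star (LinearMap.trace ℂ H T) ∧
    0 ≤ (LinearMap.trace ℂ H (T' * T)).re ∧ (LinearMap.trace ℂ H (T' * T) = 0 → T = 0) := by
  let _ : NormedAddCommGroup H := hf.core.toNormedAddCommGroup
  let _ : InnerProductSpace ℂ H := InnerProductSpace.ofCore hf.core.toCore
  have hin : ∀ x y : H, inner ℂ x y = f (star x * y) := fun x y => rfl
  let b := stdOrthonormalBasis ℂ H
  have key : LinearMap.trace ℂ H (T' * T) = ∑ i, ((‖T (b i)‖ ^ 2 : ℝ) : ℂ) := by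
    rw [LinearMap.trace_eq_sum_inner _ b]
    refine Finset.sum_congr rfl fun i _ => ?_
    rw [hin, Module.End.mul_apply, ← h, ← hin, inner_self_eq_norm_sq_to_K]
    simp
  refine ⟨?_, ?_, ?_⟩
  · rw [LinearMap.trace_eq_sum_inner _ b, LinearMap.trace_eq_sum_inner _ b, star_sum]
    refine Finset.sum_congr rfl fun i _ => ?_
    rw [hin, ← h, ← hin]
    exact (inner_conj_symm (𝕜 := ℂ) _ _).symm
  · rw [key, ← Complex.ofReal_sum, Complex.ofReal_re]
    positivity
  · intro h0
    rw [key, ← Complex.ofReal_sum, Complex.ofReal_eq_zero,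
      Finset.sum_eq_zero_iff_of_nonneg fun i _ => by positivity] at h0
    refine b.toBasis.ext fun i => ?_
    have := h0 i (Finset.mem_univ i)
    simpa using this

/-- For the inner product of f, left multiplication by a* is the adjoint of left multiplication by
a. -/
theorem IsFaithfulPositive.regTrace {f : H →ₗ[ℂ] ℂ} (hf : IsFaithfulPositive f) :
    IsFaithfulPositive (regTrace H) := by
  have h : ∀ a x y : H, f (star (LinearMap.mul ℂ H a x) * y) =
      f (star x * LinearMap.mul ℂ H (star a) y) := fun a x y => by simp [mul_assoc]
  have h2 : ∀ a : H, HopfDisk.regTrace H (star a * a) =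
      LinearMap.trace ℂ H (LinearMap.mul ℂ H (star a) * LinearMap.mul ℂ H a) := fun a => by
    simp only [HopfDisk.regTrace, LinearMap.comp_apply]
    congr 1
    ext; simp [mul_assoc]
  refine ⟨fun x => (hf.trace_adjoint _ _ (h x)).1, fun x => ?_, fun x hx => ?_⟩
  · rw [h2]; exact (hf.trace_adjoint _ _ (h x)).2.1
  · rw [h2] at hx
    simpa using LinearMap.congr_fun ((hf.trace_adjoint _ _ (h x)).2.2 hx) 1

end Trace

/-- By finite dimensionality, finitely many vectors v of the representation space already separate
H. The functional is the sum of the vector functionals ⟨v, ρ(x) v⟩. -/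
theorem IsCStarHopfAlgebra.exists_isFaithfulPositive {H : Type*} [Ring H] [HopfAlgebra ℂ H]
    [StarRing H] [StarModule ℂ H] [FiniteDimensional ℂ H] (hH : IsCStarHopfAlgebra H) :
    ∃ f : H →ₗ[ℂ] ℂ, IsFaithfulPositive f := by
  obtain ⟨K, _, _, _, ρ, hρ⟩ := hH.faithful_rep
  let N : Finset K → Submodule ℂ H := fun F =>
    { carrier := {x | ∀ v ∈ F, ρ x v = 0}
      add_mem' := fun {x y} hx hy v hv => by simp [hx v hv, hy v hv]
      zero_mem' := fun v _ => by simp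
      smul_mem' := fun c x hx v hv => by simp [hx v hv] }
  obtain ⟨_, ⟨F, rfl⟩, hF⟩ := IsArtinian.set_has_minimal (Set.range N) ⟨_, ⟨∅, rfl⟩⟩
  have hN : ∀ x, (∀ v ∈ F, ρ x v = 0) → x = 0 := by
    classical
    intro x hx
    apply hρ
    ext v
    have h1 : N (insert v F) ≤ N F := fun y hy w hw => hy w (Finset.mem_insert_of_mem hw)
    -- Minimality: one more vector cannot shrink the annihilator any further.
    have h2 := hF _ ⟨insert v F, rfl⟩
    have h3 : N (insert v F) = N F := by
      by_contra hne
      exact h2 (lt_of_le_of_ne h1 hne)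
    have h4 : x ∈ N (insert v F) := h3 ▸ hx
    simpa using h4 v (Finset.mem_insert_self v F)
  have hpos : ∀ x : H, ∑ v ∈ F, inner ℂ v (ρ (star x * x) v) = ((∑ v ∈ F, ‖ρ x v‖ ^ 2 : ℝ) : ℂ) := by
    intro x
    push_cast
    refine Finset.sum_congr rfl fun v _ => ?_
    rw [map_mul, map_star, mul_apply_eq_comp, ContinuousLinearMap.star_eq_adjoint,
      ContinuousLinearMap.adjoint_inner_right, inner_self_eq_norm_sq_to_K]
    simp
  refine ⟨{ toFun := fun x => ∑ v ∈ F, inner ℂ v (ρ x v), map_add' := ?_, map_smul' := ?_ }, ?_, ?_, ?_⟩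
  · intro x y
    simp [Finset.sum_add_distrib]
  · intro c x
    simp [Finset.mul_sum]
  · intro x
    simp only [LinearMap.coe_mk, AddHom.coe_mk, star_sum]
    refine Finset.sum_congr rfl fun v _ => ?_
    rw [map_star, ContinuousLinearMap.star_eq_adjoint, ContinuousLinearMap.adjoint_inner_right]
    exact (inner_conj_symm (𝕜 := ℂ) _ _).symm
  · intro x
    simp only [LinearMap.coe_mk, AddHom.coe_mk, hpos, Complex.ofReal_re]
    positivity
  · intro x hx
    simp only [LinearMap.coe_mk, AddHom.coe_mk, hpos] at hx
    rw [Complex.ofReal_eq_zero, Finset.sum_eq_zero_iff_of_nonneg fun i _ => by positivity] at hx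
    exact hN x fun v hv => by simpa using hx v hv

theorem sum_repr_smul_apply {ι M N : Type*} [Fintype ι] [AddCommGroup M] [Module ℂ M]
    [AddCommGroup N] [Module ℂ N] (b : Module.Basis ι ℂ M) (F : M →ₗ[ℂ] N) (x : M) :
    ∑ k, b.repr x k • F (b k) = F x := by
  simp only [← map_smul, ← map_sum, b.sum_repr]

/-! ### Slices of tensors and the action of the dual -/

section Slices

open Coalgebra HopfAlgebra WithConv

@[simp] theorem sliceRight_tmul {M N : Type*} [AddCommGroup M] [Module ℂ M] [AddCommGroup N]
    [Module ℂ N] (f : Module.Dual ℂ N) (m : M) (n : N) : sliceRight f (m ⊗ₜ[ℂ] n) = f n • m := by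
  simp [sliceRight]

@[simp] theorem sliceLeft_tmul {M N : Type*} [AddCommGroup M] [Module ℂ M] [AddCommGroup N]
    [Module ℂ N] (f : Module.Dual ℂ N) (m : M) (n : N) : sliceLeft f (n ⊗ₜ[ℂ] m) = f n • m := by
  simp [sliceLeft]

variable {H : Type*} [Ring H] [HopfAlgebra ℂ H]

theorem dualMul_apply_repr (φ ψ : Module.Dual ℂ H) {x : H} {ι : Type*} (r : Repr ℂ x ι) :
    dualMul φ ψ x = ∑ i ∈ r.index, φ (r.left i) * ψ (r.right i) := by
  simp [dualMul, ← r.eq]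

theorem Tplus_apply_repr (φ : Module.Dual ℂ H) {x : H} {ι : Type*} (r : Repr ℂ x ι) :
    Tplus H φ x = ∑ i ∈ r.index, φ (r.right i) • r.left i := by
  simp [Tplus, ← r.eq]

theorem Tminus_apply_repr (φ : Module.Dual ℂ H) {x : H} {ι : Type*} (r : Repr ℂ x ι) :
    Tminus H φ x = ∑ i ∈ r.index, φ (antipode ℂ (r.left i)) • r.right i := by
  simp [Tminus, ← r.eq]

/-- `T₊` makes `H` a left module over its dual. -/
theorem Tplus_dualMul (φ ψ : Module.Dual ℂ H) :
    Tplus H (dualMul φ ψ) = Tplus H φ * Tplus H ψ := by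
  ext x
  have h := congrArg (fun t => TensorProduct.rid ℂ H ((LinearMap.mul' ℂ ℂ ∘ₗ
    TensorProduct.map φ ψ).lTensor H t)) (coassoc_apply (R := ℂ) x)
  have h1 : Tplus H (dualMul φ ψ) x = TensorProduct.rid ℂ H ((LinearMap.mul' ℂ ℂ ∘ₗ
    TensorProduct.map φ ψ).lTensor H (comul.lTensor H (comul x))) := by
    simp only [Tplus, LinearMap.comp_apply, LinearMap.lcomp_apply]
    induction comul (R := ℂ) x with
    | zero => simp
    | add a b ha hb => simp only [map_add, ha, hb]
    | tmul a b => simp [dualMul]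
  have h2 : (Tplus H φ * Tplus H ψ) x = TensorProduct.rid ℂ H ((LinearMap.mul' ℂ ℂ ∘ₗ
    TensorProduct.map φ ψ).lTensor H
      (TensorProduct.assoc ℂ H H H (comul.rTensor H (comul x)))) := by
    simp only [Tplus, LinearMap.comp_apply, Module.End.mul_apply, LinearMap.lcomp_apply]
    induction comul (R := ℂ) x with
    | zero => simp
    | add a b ha hb => simp only [map_add, ha, hb]
    | tmul a b =>
      simp only [sliceRight_tmul, map_smul, LinearMap.rTensor_tmul]
      induction comul (R := ℂ) a with
      | zero => simp
      | add c d hc hd => simp only [map_add, smul_add, TensorProduct.add_tmul, hc, hd]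
      | tmul c d => simp [smul_smul, mul_comm]
  rw [h1, h2, h]

theorem Tplus_counit : Tplus H counit = 1 := by
  ext x
  rw [Tplus_apply_repr _ (Repr.arbitrary ℂ x), Module.End.one_apply]
  have := congrArg (TensorProduct.rid ℂ H) (sum_tmul_counit_eq (Repr.arbitrary ℂ x))
  simpa only [map_sum, TensorProduct.rid_tmul, one_smul] using this

/-- `∑ (x y⁽¹⁾)⁽¹⁾ ⊗ (x y⁽¹⁾)⁽²⁾ S(y⁽²⁾) = ∑ x⁽¹⁾ y ⊗ x⁽²⁾`. -/
theorem sum_comul_mul_antipode (x : H) {y : H} {ι : Type*} (r : Repr ℂ y ι) :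
    ∑ i ∈ r.index, comul (R := ℂ) (x * r.left i) * (1 ⊗ₜ[ℂ] antipode ℂ (r.right i)) =
      comul (R := ℂ) x * (y ⊗ₜ[ℂ] 1) := by
  let i₁ : H →ₐ[ℂ] H ⊗[ℂ] H := Algebra.TensorProduct.includeLeft
  let i₂ : H →ₐ[ℂ] H ⊗[ℂ] H := Algebra.TensorProduct.includeRight
  have h12 : toConv i₁.toLinearMap * toConv i₂.toLinearMap = toConv (comul (R := ℂ) (A := H)) := by
    ext y
    simp only [LinearMap.convMul_apply]
    induction comul (R := ℂ) y with
    | zero => simp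
    | add a b ha hb => simp [ha, hb]
    | tmul a b => simp [i₁, i₂]
  have h : toConv (comul (R := ℂ) (A := H)) * toConv (i₂.toLinearMap ∘ₗ antipode ℂ) =
      toConv i₁.toLinearMap := by
    rw [← h12, mul_assoc, conv_algHom_mul_antipode, mul_one]
  have h' := LinearMap.congr_fun (congrArg ofConv h) y
  rw [r.convMul_apply] at h'
  simp only [i₁, i₂, LinearMap.comp_apply, AlgHom.toLinearMap_apply,
    Algebra.TensorProduct.includeLeft_apply, Algebra.TensorProduct.includeRight_apply] at h'
  simp only [Bialgebra.comul_mul, mul_assoc, ← Finset.mul_sum]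
  rw [h']

end Slices

/-! ### Integrals and the antipode -/

section Integrals

open Coalgebra HopfAlgebra WithConv

variable {H : Type*} [Ring H] [HopfAlgebra ℂ H]

theorem IsHaarIntegral.eq {h h' : H} (hh : IsHaarIntegral H h) (hh' : IsHaarIntegral H h') :
    h = h' := by
  have h1 := hh.2.1 h'
  rw [hh'.1 h, hh.2.2, hh'.2.2, one_smul, one_smul] at h1
  exact h1.symm

/-- `φ` satisfies `∑ φ(x⁽¹⁾) x⁽²⁾ = φ(x) 1`. -/
theorem sum_left_smul_right {φ : Module.Dual ℂ H}
    (hφ : ∀ ψ : Module.Dual ℂ H, dualMul φ ψ = ψ 1 • φ) {x : H} {ι : Type*} (r : Repr ℂ x ι) :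
    ∑ i ∈ r.index, φ (r.left i) • r.right i = φ x • 1 := by
  rw [← sub_eq_zero, ← Module.forall_dual_apply_eq_zero_iff ℂ]
  intro ψ
  have := LinearMap.congr_fun (hφ ψ) x
  rw [dualMul_apply_repr _ _ r] at this
  simp only [map_sub, map_sum, map_smul, smul_eq_mul, this, LinearMap.smul_apply]
  ring

theorem sum_right_smul_left {φ : Module.Dual ℂ H}
    (hφ : ∀ ψ : Module.Dual ℂ H, dualMul ψ φ = ψ 1 • φ) {x : H} {ι : Type*} (r : Repr ℂ x ι) :
    ∑ i ∈ r.index, φ (r.right i) • r.left i = φ x • 1 := by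
  rw [← sub_eq_zero, ← Module.forall_dual_apply_eq_zero_iff ℂ]
  intro ψ
  have := LinearMap.congr_fun (hφ ψ) x
  rw [dualMul_apply_repr _ _ r] at this
  simp only [map_sub, map_sum, map_smul, smul_eq_mul, LinearMap.smul_apply] at this ⊢
  rw [mul_comm, ← this, sub_eq_zero]
  exact Finset.sum_congr rfl fun _ _ => mul_comm _ _

/-- `∑ φ(x⁽¹⁾ y) x⁽²⁾ = ∑ φ(x y⁽¹⁾) S(y⁽²⁾)`. -/
theorem sum_integral_mul_left {φ : Module.Dual ℂ H}
    (hφ : ∀ ψ : Module.Dual ℂ H, dualMul φ ψ = ψ 1 • φ) {x y : H} {ι κ : Type*}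
    (r : Repr ℂ x ι) (q : Repr ℂ y κ) :
    ∑ i ∈ r.index, φ (r.left i * y) • r.right i =
      ∑ j ∈ q.index, φ (x * q.left j) • antipode ℂ (q.right j) := by
  let F : H →ₗ[ℂ] H := LinearMap.toSpanSingleton ℂ H 1 ∘ₗ φ ∘ₗ LinearMap.mulLeft ℂ x
  let K : H →ₗ[ℂ] H := ∑ i ∈ r.index,
    (φ ∘ₗ LinearMap.mulLeft ℂ (r.left i)).smulRight (r.right i)
  -- The invariance of φ, applied to the product of x with the argument, computes this convolution.
  -- Convolving with S then removes the identity map.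
  have h : toConv K * toConv LinearMap.id = toConv F := by
    ext z
    let s := Repr.arbitrary ℂ z
    rw [s.convMul_apply]
    simp only [K, F, LinearMap.sum_apply, LinearMap.smulRight_apply, LinearMap.comp_apply,
      LinearMap.mulLeft_apply, LinearMap.id_apply, LinearMap.toSpanSingleton_apply]
    rw [← sum_left_smul_right hφ (r.mul s)]
    simp [Finset.sum_product, Finset.sum_mul, Finset.sum_comm (s := r.index)]
  have h2 : toConv K = toConv F * toConv (antipode ℂ) := by
    rw [← h, mul_assoc, LinearMap.id_mul_antipode, mul_one]
  have h3 := LinearMap.congr_fun (congrArg ofConv h2) y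
  rw [q.convMul_apply] at h3
  simpa [K, F] using h3

/-- `∑ S(x⁽¹⁾) φ(x⁽²⁾ y) = ∑ y⁽¹⁾ φ(x y⁽²⁾)`. -/
theorem sum_integral_mul_right {φ : Module.Dual ℂ H}
    (hφ : ∀ ψ : Module.Dual ℂ H, dualMul ψ φ = ψ 1 • φ) {x y : H} {ι κ : Type*}
    (r : Repr ℂ x ι) (q : Repr ℂ y κ) :
    ∑ i ∈ r.index, φ (r.right i * y) • antipode ℂ (r.left i) =
      ∑ j ∈ q.index, φ (x * q.right j) • q.left j := by
  let F : H →ₗ[ℂ] H := LinearMap.toSpanSingleton ℂ H 1 ∘ₗ φ ∘ₗ LinearMap.mulRight ℂ y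
  let K : H →ₗ[ℂ] H := ∑ j ∈ q.index,
    (φ ∘ₗ LinearMap.mulRight ℂ (q.right j)).smulRight (q.left j)
  have h : toConv LinearMap.id * toConv K = toConv F := by
    ext z
    let s := Repr.arbitrary ℂ z
    rw [s.convMul_apply]
    simp only [K, F, LinearMap.sum_apply, LinearMap.smulRight_apply, LinearMap.comp_apply,
      LinearMap.mulRight_apply, LinearMap.id_apply, LinearMap.toSpanSingleton_apply]
    rw [← sum_right_smul_left hφ (s.mul q)]
    simp [Finset.sum_product, Finset.mul_sum]
  have h2 : toConv K = toConv (antipode ℂ) * toConv F := by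
    rw [← h, ← mul_assoc, LinearMap.antipode_mul_id, one_mul]
  have h3 := LinearMap.congr_fun (congrArg ofConv h2) x
  rw [r.convMul_apply] at h3
  simpa [K, F] using h3.symm

end Integrals

/-! ## Haar integrals of finite-dimensional C* Hopf algebras -/

section TraceMulRight

/-- In the presence of a nondegenerate functional the two regular traces agree. -/
theorem trace_mulRight_eq {B : Type*} [Ring B] [Algebra ℂ B] [FiniteDimensional ℂ B]
    (f : B →ₗ[ℂ] ℂ) (hnd : ∀ x, (∀ y, f (x * y) = 0) → x = 0)
    (x : B) : LinearMap.trace ℂ B (LinearMap.mulRight ℂ x) = regTrace B x := by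
  let Φ : B →ₗ[ℂ] Module.Dual ℂ B := (LinearMap.mul ℂ B).compr₂ f
  have hΦ : Function.Injective Φ := by
    rw [injective_iff_map_eq_zero]
    exact fun a ha => hnd a fun y => LinearMap.congr_fun ha y
  let e : B ≃ₗ[ℂ] Module.Dual ℂ B :=
    LinearEquiv.ofInjectiveOfFinrankEq Φ hΦ (Subspace.dual_finrank_eq).symm
  have he : ∀ a, e a = Φ a := fun a => rfl
  rw [← LinearMap.trace_conj' _ e]
  -- Under the identification a ↦ f(a ·) of B with its dual, right multiplication by x becomes the
  -- transpose of left multiplication by x.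
  have : e.conj (LinearMap.mulRight ℂ x) = Module.Dual.transpose (R := ℂ) (LinearMap.mul ℂ B x) := by
    refine LinearMap.ext fun g => ?_
    obtain ⟨a, rfl⟩ := e.surjective g
    rw [LinearEquiv.conj_apply_apply, e.symm_apply_apply, he, he]
    ext b
    simp only [Φ, LinearMap.compr₂_apply, LinearMap.mul_apply', LinearMap.mulRight_apply,
      Module.Dual.transpose_apply, LinearMap.comp_apply, mul_assoc]
  rw [this, LinearMap.trace_transpose']
  rfl

end TraceMulRight

section CStar

open Coalgebra HopfAlgebra WithConv

variable {H : Type*} [Ring H] [HopfAlgebra ℂ H]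

theorem nontrivial_of_hopfAlgebra (H : Type*) [Ring H] [HopfAlgebra ℂ H] : Nontrivial H := by
  refine ⟨1, 0, fun h => ?_⟩
  have := congrArg (counit (R := ℂ)) h
  simp at this

variable [StarRing H] [StarModule ℂ H] [FiniteDimensional ℂ H]

theorem IsCStarHopfAlgebra.regTrace_pos (hH : IsCStarHopfAlgebra H) :
    IsFaithfulPositive (regTrace H) := by
  obtain ⟨f, hf⟩ := hH.exists_isFaithfulPositive
  exact hf.regTrace

theorem IsCStarHopfAlgebra.regTrace_nondeg (hH : IsCStarHopfAlgebra H) (x : H)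
    (h : ∀ y, regTrace H (x * y) = 0) : x = 0 :=
  hH.regTrace_pos.definite x (by rw [regTrace_mul_comm]; exact h _)

theorem starAntipode_mul (x y : H) :
    starAntipode H (x * y) = starAntipode H y * starAntipode H x := by
  simp [starAntipode, antipode_mul_antidistrib]

/-- The anti-automorphism S conjugates right multiplication by x into left multiplication by S(x),
and the two regular traces agree. -/
theorem IsCStarHopfAlgebra.regTrace_antipode (hH : IsCStarHopfAlgebra H) (x : H) :
    regTrace H (antipode ℂ x) = regTrace H x := by
  let e : H ≃ₗ[ℂ] H := LinearEquiv.ofLinearMap (antipode ℂ) (starAntipode H)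
    (LinearMap.ext hH.antipode_starAntipode) (LinearMap.ext hH.starAntipode_antipode)
  rw [← trace_mulRight_eq (regTrace H) hH.regTrace_nondeg x,
    ← LinearMap.trace_conj' _ e, regTrace, LinearMap.comp_apply]
  congr 1
  ext y
  simp [e, LinearEquiv.conj_apply_apply, antipode_mul_antidistrib, hH.antipode_starAntipode]

theorem IsCStarHopfAlgebra.regTrace_starAntipode (hH : IsCStarHopfAlgebra H) (x : H) :
    regTrace H (starAntipode H x) = regTrace H x := by
  rw [← hH.regTrace_antipode, hH.antipode_starAntipode]

/-- S⁻¹ is self-adjoint for the inner product of the regular trace, so the trace of its square is a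
squared Hilbert–Schmidt norm, and S⁻¹ is not zero since it fixes 1. -/
theorem IsCStarHopfAlgebra.trace_starAntipode_sq_ne_zero (hH : IsCStarHopfAlgebra H) :
    LinearMap.trace ℂ H (starAntipode H * starAntipode H) ≠ 0 := by
  intro h0
  have h : ∀ x y, regTrace H (star (starAntipode H x) * y) =
      regTrace H (star x * starAntipode H y) := by
    intro x y
    have : star (starAntipode H x) = antipode ℂ (star x) := by simp [starAntipode]
    rw [this, ← hH.regTrace_starAntipode, starAntipode_mul, hH.starAntipode_antipode,
      regTrace_mul_comm]
  have h1 := (hH.regTrace_pos.trace_adjoint _ _ h).2.2 h0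
  have h2 : starAntipode H (1 : H) = 1 := by simp [starAntipode]
  rw [h1] at h2
  have := nontrivial_of_hopfAlgebra H
  exact zero_ne_one h2

/-- The element representing ε with respect to the nondegenerate regular trace is an integral; it is
two-sided because the trace is symmetric. It remains to see that it can be normalized. -/
theorem IsCStarHopfAlgebra.isHaarIntegral (hH : IsCStarHopfAlgebra H) :
    IsHaarIntegral H (haarIntegral H) := by
  refine Classical.epsilon_spec (p := IsHaarIntegral H) ?_
  let Φ : H →ₗ[ℂ] Module.Dual ℂ H := (LinearMap.mul ℂ H).compr₂ (regTrace H)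
  have hΦ : Function.Injective Φ := by
    rw [injective_iff_map_eq_zero]
    exact fun a ha => hH.regTrace_nondeg a fun y => LinearMap.congr_fun ha y
  let e : H ≃ₗ[ℂ] Module.Dual ℂ H :=
    LinearEquiv.ofInjectiveOfFinrankEq Φ hΦ (Subspace.dual_finrank_eq).symm
  obtain ⟨h, hh⟩ := e.surjective (counit (R := ℂ) (A := H))
  have hh' : ∀ y, regTrace H (h * y) = counit (R := ℂ) y := fun y => LinearMap.congr_fun hh y
  have hr : ∀ x : H, h * x = counit (R := ℂ) x • h := fun x => by
    rw [← sub_eq_zero]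
    refine hH.regTrace_nondeg _ fun y => ?_
    rw [sub_mul, map_sub, mul_assoc, hh', smul_mul_assoc, map_smul, hh']
    simp
  have hl : ∀ x : H, x * h = counit (R := ℂ) x • h := fun x => by
    rw [← sub_eq_zero]
    refine hH.regTrace_nondeg _ fun y => ?_
    rw [sub_mul, map_sub, mul_assoc, regTrace_mul_comm, mul_assoc, hh', smul_mul_assoc, map_smul,
      hh']
    simp [mul_comm]
  have htr : regTrace H h = counit (R := ℂ) h := by
    have : LinearMap.mul ℂ H h = (counit (R := ℂ) (A := H)).smulRight h :=
      LinearMap.ext fun y => by simp [hr]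
    rw [regTrace, LinearMap.comp_apply, this, LinearMap.trace_smulRight]
  -- Left multiplication by h has rank one and trace ε(h). If this were 0, the trace of h* h would
  -- vanish and positivity would give h = 0, whereas the trace of h is ε(1) = 1.
  have hne : counit (R := ℂ) h ≠ 0 := by
    intro h0
    have h1 : regTrace H (star h * h) = 0 := by rw [hl, map_smul, htr, h0, smul_zero]
    have h2 := hH.regTrace_pos.definite h h1
    have h3 := hh' 1
    rw [h2] at h3
    simp at h3
  refine ⟨(counit (R := ℂ) h)⁻¹ • h, fun x => ?_, fun x => ?_, ?_⟩
  · rw [mul_smul_comm, hl, smul_comm]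
  · rw [smul_mul_assoc, hr, smul_comm]
  · simp [hne]

/-- The twisted trace `x ↦ tr(L_x S⁻²)`. -/
def twistedTrace (H : Type*) [Ring H] [HopfAlgebra ℂ H] [StarRing H] [StarModule ℂ H] :
    Module.Dual ℂ H :=
  LinearMap.trace ℂ H ∘ₗ (LinearMap.mul ℂ (Module.End ℂ H)).flip
    (starAntipode H * starAntipode H) ∘ₗ LinearMap.mul ℂ H

theorem IsCStarHopfAlgebra.comul_starAntipode (hH : IsCStarHopfAlgebra H) (x : H) :
    comul (R := ℂ) (starAntipode H x) = TensorProduct.map (starAntipode H) (starAntipode H)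
      (TensorProduct.comm ℂ H H (comul x)) := by
  have h := comul_antipode (starAntipode H x)
  rw [hH.antipode_starAntipode] at h
  rw [h]
  induction comul (R := ℂ) (starAntipode H x) with
  | zero => simp
  | add a b ha hb => simp only [map_add, ← ha, ← hb]
  | tmul a b => simp [hH.starAntipode_antipode]

theorem IsCStarHopfAlgebra.sum_mul_starAntipode (hH : IsCStarHopfAlgebra H) {x : H} {ι : Type*}
    (r : Repr ℂ x ι) :
    ∑ i ∈ r.index, r.right i * starAntipode H (r.left i) = counit (R := ℂ) x • 1 := by
  have h1 : ∑ i ∈ r.index, star (r.left i) ⊗ₜ[ℂ] star (r.right i) = comul (R := ℂ) (star x) := by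
    rw [hH.comul_star, ← r.eq]
    simp
  let r' : Repr ℂ (star x) ι := ⟨r.index, fun i => star (r.left i), fun i => star (r.right i), h1⟩
  have := congrArg star (sum_antipode_mul_eq_smul r')
  simpa [r', star_sum, star_smul, hH.counit_star, starAntipode] using this

/-- Acting with ψ on x conjugates the operator L_x S⁻² by operators of the dual action. Cyclicity of
the trace puts these next to each other, and the skew antipode identity collapses them to ψ(1). The
factor S⁻² is there to produce that identity, since S² = 1 is not yet known. -/
theorem IsCStarHopfAlgebra.dualMul_twistedTrace (hH : IsCStarHopfAlgebra H)
    (ψ : Module.Dual ℂ H) : dualMul (twistedTrace H) ψ = ψ 1 • twistedTrace H := by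
  let b := Module.finBasis ℂ H
  let g : Module.End ℂ H := starAntipode H * starAntipode H
  let ψ' : Fin (Module.finrank ℂ H) → Module.Dual ℂ H := fun k =>
    ψ ∘ₗ LinearMap.mulLeft ℂ (b k) ∘ₗ starAntipode H
  have hsum : ∑ k, dualMul (ψ' k) (b.coord k) = ψ 1 • counit := by
    ext z
    let r := Repr.arbitrary ℂ z
    simp only [LinearMap.sum_apply, dualMul_apply_repr _ _ r]
    rw [Finset.sum_comm]
    have : ∀ i, ∑ k, ψ' k (r.left i) * b.coord k (r.right i) =
        ψ (r.right i * starAntipode H (r.left i)) := by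
      intro i
      rw [← LinearMap.mulRight_apply (R := ℂ), ← LinearMap.comp_apply, ← sum_repr_smul_apply b]
      simp [ψ', mul_comm]
    simp only [this, ← map_sum, hH.sum_mul_starAntipode]
    simp [mul_comm]
  ext x
  have key : LinearMap.mul ℂ H (Tplus H ψ x) * g =
      ∑ k, Tplus H (b.coord k) * (LinearMap.mul ℂ H x * g) * Tplus H (ψ' k) := by
    ext y
    let r := Repr.arbitrary ℂ y
    have hr : ∑ i ∈ r.index, g (r.left i) ⊗ₜ[ℂ] g (r.right i) = comul (R := ℂ) (g y) := by
      simp only [g, Module.End.mul_apply, hH.comul_starAntipode]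
      rw [← r.eq]
      simp
    let rg : Repr ℂ (g y) (H × H) :=
      ⟨r.index, fun i => g (r.left i), fun i => g (r.right i), hr⟩
    have h1 := congrArg (sliceRight ψ) (sum_comul_mul_antipode x rg)
    have h2 : sliceRight ψ (comul (R := ℂ) x * (g y ⊗ₜ[ℂ] 1)) = Tplus H ψ x * g y := by
      simp only [Tplus, LinearMap.comp_apply, LinearMap.lcomp_apply]
      induction comul (R := ℂ) x with
      | zero => simp
      | add a b ha hb => simp only [map_add, add_mul, ha, hb]
      | tmul a b => simp
    have h3 : ∀ (z w : H), sliceRight ψ (comul (R := ℂ) z * (1 ⊗ₜ[ℂ] w)) =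
        ∑ k, ψ (b k * w) • Tplus H (b.coord k) z := by
      intro z w
      simp only [Tplus, LinearMap.comp_apply, LinearMap.lcomp_apply]
      induction comul (R := ℂ) z with
      | zero => simp
      | add a b ha hb => simp only [map_add, add_mul, ha, hb, smul_add, Finset.sum_add_distrib]
      | tmul c d =>
        simp only [Algebra.TensorProduct.tmul_mul_tmul, mul_one, sliceRight_tmul, smul_smul,
          ← Finset.sum_smul]
        congr 1
        rw [← LinearMap.mulRight_apply (R := ℂ), ← LinearMap.comp_apply, ← sum_repr_smul_apply b]
        simp [mul_comm]
    have h4 : ∀ z, antipode ℂ (g z) = starAntipode H z := fun z => by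
      simp [g, hH.antipode_starAntipode]
    rw [h2, map_sum] at h1
    simp only [h3, rg, h4] at h1
    simp only [Module.End.mul_apply, LinearMap.mul_apply', LinearMap.sum_apply]
    rw [← h1, Finset.sum_comm]
    refine Finset.sum_congr rfl fun k _ => ?_
    rw [Tplus_apply_repr (ψ' k) r]
    simp [ψ', Finset.mul_sum]
  have h5 : dualMul (twistedTrace H) ψ x = LinearMap.trace ℂ H (LinearMap.mul ℂ H (Tplus H ψ x) * g) := by
    rw [dualMul_apply_repr _ _ (Repr.arbitrary ℂ x), Tplus_apply_repr _ (Repr.arbitrary ℂ x)]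
    simp [twistedTrace, g, Finset.sum_mul, mul_comm]
  rw [h5, key, map_sum]
  have h6 : ∀ k, LinearMap.trace ℂ H (Tplus H (b.coord k) * (LinearMap.mul ℂ H x * g) *
      Tplus H (ψ' k)) = LinearMap.trace ℂ H ((LinearMap.mul ℂ H x * g) *
        Tplus H (dualMul (ψ' k) (b.coord k))) := fun k => by
    rw [Tplus_dualMul, mul_assoc, LinearMap.trace_mul_comm, mul_assoc]
  simp only [h6, ← map_sum, ← Finset.mul_sum, hsum]
  rw [map_smul, Tplus_counit, mul_smul_comm, mul_one, map_smul]
  simp [twistedTrace, g]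

theorem dualMul_comp_antipode (φ ψ : Module.Dual ℂ H) :
    dualMul φ ψ ∘ₗ antipode ℂ = dualMul (ψ ∘ₗ antipode ℂ) (φ ∘ₗ antipode ℂ) := by
  ext x
  simp only [LinearMap.comp_apply, dualMul, comul_antipode]
  induction comul (R := ℂ) x with
  | zero => simp
  | add a b ha hb => simp only [map_add, ha, hb]
  | tmul a b => simp [mul_comm]

/-- The normalized twisted trace is a dual Haar integral. -/
theorem IsCStarHopfAlgebra.isDualHaarIntegral_twistedTrace (hH : IsCStarHopfAlgebra H) :
    IsDualHaarIntegral H ((twistedTrace H 1)⁻¹ • twistedTrace H) := by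
  have h1 : twistedTrace H 1 ≠ 0 := by
    have : twistedTrace H 1 = LinearMap.trace ℂ H (starAntipode H * starAntipode H) := by
      simp only [twistedTrace, LinearMap.comp_apply, LinearMap.flip_apply, LinearMap.mul_apply']
      congr 1
      ext y
      simp
    rw [this]
    exact hH.trace_starAntipode_sq_ne_zero
  set χ := (twistedTrace H 1)⁻¹ • twistedTrace H with hχ
  have hn : χ 1 = 1 := by simp [hχ, h1]
  have hl : ∀ ψ : Module.Dual ℂ H, dualMul χ ψ = ψ 1 • χ := fun ψ => by
    have := hH.dualMul_twistedTrace ψ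
    have h2 : dualMul χ ψ = (twistedTrace H 1)⁻¹ • dualMul (twistedTrace H) ψ := by
      simp [hχ, dualMul, TensorProduct.map_smul_left, LinearMap.smul_comp, LinearMap.comp_smul]
    rw [h2, this, smul_comm]
  have hr : ∀ ψ : Module.Dual ℂ H, dualMul ψ (χ ∘ₗ antipode ℂ) = ψ 1 • (χ ∘ₗ antipode ℂ) := by
    intro ψ
    have h2 := dualMul_comp_antipode χ (ψ ∘ₗ starAntipode H)
    have h3 : (ψ ∘ₗ starAntipode H) ∘ₗ antipode ℂ = ψ :=
      LinearMap.ext fun x => by simp [hH.starAntipode_antipode]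
    rw [h3, hl] at h2
    rw [← h2]
    simp [starAntipode, LinearMap.smul_comp]
  -- χ absorbs factors on its right and χ ∘ S absorbs factors on its left. Their product, evaluated
  -- in both ways, identifies them.
  have he : χ = χ ∘ₗ antipode ℂ := by
    have h2 := hl (χ ∘ₗ antipode ℂ)
    rw [hr χ, hn, one_smul] at h2
    rw [h2]
    simp [hn]
  refine ⟨?_, hl, hn⟩
  rw [he]
  simpa using hr

theorem IsDualHaarIntegral.eq {φ φ' : Module.Dual ℂ H} (h : IsDualHaarIntegral H φ)
    (h' : IsDualHaarIntegral H φ') : φ = φ' := by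
  have h1 := h.2.1 φ'
  rw [h'.1 φ, h.2.2, h'.2.2, one_smul, one_smul] at h1
  exact h1.symm

theorem IsCStarHopfAlgebra.isDualHaarIntegral (hH : IsCStarHopfAlgebra H) :
    IsDualHaarIntegral H (dualHaarIntegral H) :=
  Classical.epsilon_spec (p := IsDualHaarIntegral H) ⟨_, hH.isDualHaarIntegral_twistedTrace⟩

/-- The operator L_h S⁻² is the rank-one operator ε(·) h, of trace ε(h) = 1. Hence χ(h) is the
normalization constant of the twisted trace. This number is the constant of all merging identities
below. -/
theorem IsCStarHopfAlgebra.dualHaarIntegral_haarIntegral_ne_zero (hH : IsCStarHopfAlgebra H) :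
    dualHaarIntegral H (haarIntegral H) ≠ 0 := by
  have hh := hH.isHaarIntegral
  have h2 := hH.isDualHaarIntegral_twistedTrace
  rw [hH.isDualHaarIntegral.eq h2]
  have h3 : twistedTrace H (haarIntegral H) = 1 := by
    have h1 : (LinearMap.mul ℂ H (haarIntegral H)) * (starAntipode H * starAntipode H) =
        (counit (R := ℂ) (A := H)).smulRight (haarIntegral H) := by
      ext y
      have h4 : ∀ z : H, counit (R := ℂ) (starAntipode H z) = counit (R := ℂ) z := fun z => by
        conv_rhs => rw [← hH.antipode_starAntipode z, counit_antipode]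
      simp [hh.2.1, h4]
    simp only [twistedTrace, LinearMap.comp_apply, LinearMap.flip_apply, LinearMap.mul_apply',
      h1, LinearMap.trace_smulRight, hh.2.2]
  have h4 := h2.2.2
  simp only [LinearMap.smul_apply, smul_eq_mul, h3, mul_one] at h4 ⊢
  intro h5
  rw [h5, zero_mul] at h4
  exact zero_ne_one h4

end CStar

/-! ### Involutivity of the antipode, traciality of χ and cocommutativity of h -/

section Involutive

open Coalgebra HopfAlgebra WithConv

variable {H : Type*} [Ring H] [HopfAlgebra ℂ H] [StarRing H] [StarModule ℂ H]
  [FiniteDimensional ℂ H]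

local notation "χ" => dualHaarIntegral H
local notation "hI" => haarIntegral H

theorem IsCStarHopfAlgebra.antipode_haarIntegral (hH : IsCStarHopfAlgebra H) :
    antipode ℂ hI = hI := by
  refine IsHaarIntegral.eq ⟨fun x => ?_, fun x => ?_, ?_⟩ hH.isHaarIntegral
  · have := congrArg (antipode ℂ) (hH.isHaarIntegral.2.1 (starAntipode H x))
    rw [antipode_mul_antidistrib, hH.antipode_starAntipode, map_smul] at this
    rw [this, ← counit_antipode, hH.antipode_starAntipode]
  · have := congrArg (antipode ℂ) (hH.isHaarIntegral.1 (starAntipode H x))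
    rw [antipode_mul_antidistrib, hH.antipode_starAntipode, map_smul] at this
    rw [this, ← counit_antipode, hH.antipode_starAntipode]
  · rw [counit_antipode, hH.isHaarIntegral.2.2]

theorem IsCStarHopfAlgebra.dualHaarIntegral_antipode (hH : IsCStarHopfAlgebra H) (x : H) :
    χ (antipode ℂ x) = χ x := by
  have hχ := hH.isDualHaarIntegral
  have h1 : ∀ ψ : Module.Dual ℂ H, (ψ ∘ₗ starAntipode H) ∘ₗ antipode ℂ = ψ := fun ψ =>
    LinearMap.ext fun x => by simp [hH.starAntipode_antipode]
  have h2 : ∀ ψ : Module.Dual ℂ H, (ψ ∘ₗ starAntipode H) 1 = ψ 1 := fun ψ => by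
    simp [starAntipode]
  have : IsDualHaarIntegral H (χ ∘ₗ antipode ℂ) := by
    refine ⟨fun ψ => ?_, fun ψ => ?_, ?_⟩
    · have h := dualMul_comp_antipode χ (ψ ∘ₗ starAntipode H)
      rw [hχ.2.1, h1, h2] at h
      rw [← h, LinearMap.smul_comp]
    · have h := dualMul_comp_antipode (ψ ∘ₗ starAntipode H) χ
      rw [hχ.1, h1, h2] at h
      rw [← h, LinearMap.smul_comp]
    · simp [hχ.2.2]
  exact LinearMap.congr_fun (this.eq hχ) x

/-- Transfer the comultiplication from h to x by `sum_integral_mul_left`; then h absorbs x⁽¹⁾. The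
identity makes Δ(h) a dual basis for the form χ(xy). -/
theorem IsCStarHopfAlgebra.sum_dualHaar_mul_haar (hH : IsCStarHopfAlgebra H) (x : H) {ι : Type*}
    (r : Repr ℂ hI ι) :
    ∑ i ∈ r.index, χ (x * r.left i) • antipode ℂ (r.right i) = χ hI • x := by
  have q := Repr.arbitrary ℂ x
  rw [← sum_integral_mul_left hH.isDualHaarIntegral.2.1 q r]
  simp only [hH.isHaarIntegral.1, map_smul, smul_eq_mul, mul_comm _ (χ hI), mul_smul,
    ← Finset.smul_sum]
  rw [sum_counit_smul]

theorem IsCStarHopfAlgebra.sum_dualHaar_haar_mul (hH : IsCStarHopfAlgebra H) (x : H) {ι : Type*}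
    (r : Repr ℂ hI ι) :
    ∑ i ∈ r.index, χ (r.left i * x) • r.right i = χ hI • antipode ℂ x := by
  have q := Repr.arbitrary ℂ x
  rw [sum_integral_mul_left hH.isDualHaarIntegral.2.1 r q]
  simp only [hH.isHaarIntegral.2.1, map_smul, smul_eq_mul, mul_comm _ (χ hI), mul_smul,
    ← Finset.smul_sum]
  simp only [← map_smul, ← map_sum, sum_counit_smul]

theorem IsCStarHopfAlgebra.dualHaarIntegral_nondeg (hH : IsCStarHopfAlgebra H) (x : H)
    (h : ∀ y, χ (y * x) = 0) : x = 0 := by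
  have h1 := hH.sum_dualHaar_haar_mul x (Repr.arbitrary ℂ hI)
  simp only [h, zero_smul, Finset.sum_const_zero] at h1
  have h2 : antipode ℂ x = 0 :=
    (smul_eq_zero.1 h1.symm).resolve_left hH.dualHaarIntegral_haarIntegral_ne_zero
  rw [← hH.starAntipode_antipode x, h2, map_zero]

/-- The Nakayama automorphism of χ is S²: both functionals of y are sent to χ(h) S²(x) by the map f
↦ ∑ f(h⁽¹⁾) S(h⁽²⁾), which is surjective and hence, by dimension, injective. -/
theorem IsCStarHopfAlgebra.dualHaarIntegral_twist (hH : IsCStarHopfAlgebra H) (x y : H) :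
    χ (y * x) = χ (antipode ℂ (antipode ℂ x) * y) := by
  let r := Repr.arbitrary ℂ hI
  let Θ : Module.Dual ℂ H →ₗ[ℂ] H := (antipode ℂ) ∘ₗ
    ∑ i ∈ r.index, (Module.Dual.eval ℂ H (r.left i)).smulRight (r.right i)
  have hΘ : ∀ f, Θ f = ∑ i ∈ r.index, f (r.left i) • antipode ℂ (r.right i) := fun f => by
    simp [Θ]
  have hsurj : Function.Surjective Θ := fun x => by
    refine ⟨(χ hI)⁻¹ • (χ ∘ₗ LinearMap.mulLeft ℂ x), ?_⟩
    rw [map_smul, hΘ]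
    simp only [LinearMap.comp_apply, LinearMap.mulLeft_apply]
    rw [hH.sum_dualHaar_mul_haar, inv_smul_smul₀ hH.dualHaarIntegral_haarIntegral_ne_zero]
  have hinj : Function.Injective Θ :=
    (LinearMap.injective_iff_surjective_of_finrank_eq_finrank Subspace.dual_finrank_eq).2 hsurj
  have : χ ∘ₗ LinearMap.mulRight ℂ x = χ ∘ₗ LinearMap.mulLeft ℂ (antipode ℂ (antipode ℂ x)) := by
    apply hinj
    rw [hΘ, hΘ]
    simp only [LinearMap.comp_apply, LinearMap.mulLeft_apply, LinearMap.mulRight_apply]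
    rw [hH.sum_dualHaar_mul_haar, ← map_smul, ← hH.sum_dualHaar_haar_mul x r]
    simp
  exact LinearMap.congr_fun this y

/-- The antipode of a finite-dimensional C* Hopf algebra is involutive. -/
theorem IsCStarHopfAlgebra.antipode_antipode (hH : IsCStarHopfAlgebra H) (x : H) :
    antipode ℂ (antipode ℂ x) = x := by
  -- Applying χ ∘ S = χ before the twist gives the same formula with S² on the other factor. The two
  -- together force S⁴ = 1.
  have h1 : ∀ x y : H, χ (y * x) = χ (x * antipode ℂ (antipode ℂ y)) := fun x y => by
    rw [← hH.dualHaarIntegral_antipode, antipode_mul_antidistrib, hH.dualHaarIntegral_twist,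
      ← antipode_mul_antidistrib, hH.dualHaarIntegral_antipode]
  have h4 : ∀ x : H, antipode ℂ (antipode ℂ (antipode ℂ (antipode ℂ x))) = x := fun x => by
    rw [← sub_eq_zero]
    refine hH.dualHaarIntegral_nondeg _ fun y => ?_
    rw [mul_sub, map_sub, ← h1, ← hH.dualHaarIntegral_twist, sub_self]
  -- It remains to exclude the eigenvalue −1 of S². On such a z, passing to S(z) changes the sign of
  -- the nonnegative number tr(z* z).
  set z := antipode ℂ (antipode ℂ x) - x with hz
  have hz2 : antipode ℂ (antipode ℂ z) = -z := by
    rw [hz]; simp [h4]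
  have h5 : regTrace H (star (antipode ℂ z) * antipode ℂ z) = -regTrace H (star z * z) := by
    have : star (antipode ℂ z) = starAntipode H (star z) := by simp [starAntipode]
    rw [this, ← hH.regTrace_antipode, antipode_mul_antidistrib, hH.antipode_starAntipode, hz2,
      regTrace_mul_comm]
    simp
  have hpos := hH.regTrace_pos
  have h6 := hpos.nonneg (antipode ℂ z)
  have h7 := hpos.nonneg z
  rw [h5, Complex.neg_re] at h6
  have h8 : (regTrace H (star z * z)).im = 0 := by
    have := congrArg Complex.im (hpos.star_apply (star z * z))
    simp at this
    linarith
  have h9 : z = 0 := hpos.definite z (Complex.ext (by simp; linarith) (by simpa using h8))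
  exact sub_eq_zero.1 h9

theorem IsCStarHopfAlgebra.dualHaarIntegral_mul_comm (hH : IsCStarHopfAlgebra H) (x y : H) :
    χ (x * y) = χ (y * x) := by
  rw [hH.dualHaarIntegral_twist, hH.antipode_antipode]

/-- Both sides are compared after pairing one leg with the nondegenerate trace χ. The pairings agree
because S(h) = h, χ ∘ S = χ, S² = 1 and χ is a trace. -/
theorem IsCStarHopfAlgebra.comm_comul_haarIntegral (hH : IsCStarHopfAlgebra H) :
    TensorProduct.comm ℂ H H (comul (R := ℂ) hI) = comul (R := ℂ) hI := by
  let r := Repr.arbitrary ℂ hI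
  let b := Module.finBasis ℂ H
  have hS : ∑ i ∈ r.index, antipode ℂ (r.right i) ⊗ₜ[ℂ] antipode ℂ (r.left i) =
      comul (R := ℂ) hI := by
    conv_rhs => rw [← hH.antipode_haarIntegral, comul_antipode, ← r.eq]
    simp
  let r' : Repr ℂ hI (H × H) := ⟨r.index, _, _, hS⟩
  have key : ∀ x : H, ∑ i ∈ r.index, χ (r.left i * x) • r.right i =
      ∑ i ∈ r.index, χ (r.right i * x) • r.left i := by
    intro x
    rw [hH.sum_dualHaar_haar_mul]
    have h1 := hH.sum_dualHaar_haar_mul x r'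
    have h2 := congrArg (antipode ℂ) (hH.sum_dualHaar_haar_mul (antipode ℂ x) r)
    have h3 : ∀ i, χ (r.left i * antipode ℂ x) = χ (antipode ℂ (r.left i) * x) := by
      intro i
      rw [← hH.dualHaarIntegral_antipode, antipode_mul_antidistrib, hH.antipode_antipode,
        hH.dualHaarIntegral_mul_comm]
    rw [← h1]
    simp only [r']
    have h4 := hH.sum_dualHaar_mul_haar (antipode ℂ x) r'
    rw [h1, ← h4]
    simp only [r', hH.antipode_antipode]
    refine Finset.sum_congr rfl fun i _ => ?_
    rw [← hH.dualHaarIntegral_antipode (r.right i * x), antipode_mul_antidistrib]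
  have hinj : Function.Injective (TensorProduct.map ((LinearMap.mul ℂ H).compr₂ χ)
      (LinearMap.id (R := ℂ) (M := H))) := by
    have h1 : Function.Injective ((LinearMap.mul ℂ H).compr₂ χ) := by
      rw [injective_iff_map_eq_zero]
      intro a ha
      refine hH.dualHaarIntegral_nondeg a fun y => ?_
      rw [hH.dualHaarIntegral_mul_comm]
      exact LinearMap.congr_fun ha y
    exact Module.Flat.rTensor_preserves_injective_linearMap _ h1
  apply hinj
  have hinj2 : Function.Injective (dualTensorHom ℂ H H) :=
    (dualTensorHomEquiv ℂ H H).injective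
  apply hinj2
  ext x
  rw [← r.eq]
  simpa using (key x).symm

end Involutive

theorem sum_sliceRight_tmul {ι M N : Type*} [Fintype ι] [AddCommGroup M] [Module ℂ M]
    [AddCommGroup N] [Module ℂ N] (b : Module.Basis ι ℂ N) (t : M ⊗[ℂ] N) :
    ∑ k, sliceRight (b.coord k) t ⊗ₜ[ℂ] b k = t := by
  induction t with
  | zero => simp
  | add x y hx hy => simp only [map_add, TensorProduct.add_tmul, Finset.sum_add_distrib, hx, hy]
  | tmul m n =>
    simp only [sliceRight_tmul, TensorProduct.smul_tmul, ← TensorProduct.tmul_sum,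
      Module.Basis.coord_apply, b.sum_repr]

theorem sliceRight_eq_sum {ι M N : Type*} [Fintype ι] [AddCommGroup M] [Module ℂ M]
    [AddCommGroup N] [Module ℂ N] (b : Module.Basis ι ℂ N) (f : Module.Dual ℂ N) (t : M ⊗[ℂ] N) :
    sliceRight f t = ∑ k, f (b k) • sliceRight (b.coord k) t := by
  conv_lhs => rw [← sum_sliceRight_tmul b t]
  simp only [map_sum, sliceRight_tmul]

theorem sliceLeft_eq_sum {ι M N : Type*} [Fintype ι] [AddCommGroup M] [Module ℂ M]
    [AddCommGroup N] [Module ℂ N] (b : Module.Basis ι ℂ N) (f : Module.Dual ℂ M) (t : M ⊗[ℂ] N) :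
    sliceLeft f t = ∑ k, f (sliceRight (b.coord k) t) • b k := by
  conv_lhs => rw [← sum_sliceRight_tmul b t]
  simp only [map_sum, sliceLeft_tmul]

theorem eq_of_sliceRight_eq {M N : Type*} [AddCommGroup M] [Module ℂ M] [AddCommGroup N]
    [Module ℂ N] [FiniteDimensional ℂ N] {s t : M ⊗[ℂ] N}
    (h : ∀ f : Module.Dual ℂ N, sliceRight f s = sliceRight f t) : s = t := by
  rw [← sum_sliceRight_tmul (Module.finBasis ℂ N) s, ← sum_sliceRight_tmul (Module.finBasis ℂ N) t]
  simp only [h]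

theorem sliceRight_map {M N M' N' : Type*} [AddCommGroup M] [Module ℂ M] [AddCommGroup N]
    [Module ℂ N] [AddCommGroup M'] [Module ℂ M'] [AddCommGroup N'] [Module ℂ N']
    (f : Module.Dual ℂ N') (g : M →ₗ[ℂ] M') (k : N →ₗ[ℂ] N') (t : M ⊗[ℂ] N) :
    sliceRight f (TensorProduct.map g k t) = g (sliceRight (f ∘ₗ k) t) := by
  induction t with
  | zero => simp
  | add x y hx hy => simp only [map_add, hx, hy]
  | tmul m n => simp

/-! ### Coactions and the invariance of the regular trace -/

section Coaction

open Coalgebra HopfAlgebra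

variable {H A : Type*} [Ring H] [HopfAlgebra ℂ H] [Ring A] [Algebra ℂ A]
  (β : RightComoduleAlgebra H A)

theorem TbarPlus_apply (ψ : Module.Dual ℂ H) (a : A) :
    TbarPlus β ψ a = sliceRight ψ (β.coact a) := rfl

theorem TbarPlus_dualMul (φ ψ : Module.Dual ℂ H) :
    TbarPlus β (dualMul φ ψ) = TbarPlus β φ * TbarPlus β ψ := by
  ext x
  have h := congrArg (fun t => TensorProduct.rid ℂ A ((LinearMap.mul' ℂ ℂ ∘ₗ
    TensorProduct.map φ ψ).lTensor A t)) (LinearMap.congr_fun β.coassoc x)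
  simp only [LinearMap.comp_apply, LinearEquiv.coe_coe, AlgHom.toLinearMap_apply] at h
  have h1 : TbarPlus β (dualMul φ ψ) x = TensorProduct.rid ℂ A ((LinearMap.mul' ℂ ℂ ∘ₗ
    TensorProduct.map φ ψ).lTensor A (comul.lTensor A (β.coact x))) := by
    rw [TbarPlus_apply]
    induction β.coact x with
    | zero => simp
    | add a b ha hb => simp only [map_add, ha, hb]
    | tmul a b => simp [dualMul]
  have h2 : (TbarPlus β φ * TbarPlus β ψ) x = TensorProduct.rid ℂ A ((LinearMap.mul' ℂ ℂ ∘ₗ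
    TensorProduct.map φ ψ).lTensor A (TensorProduct.assoc ℂ A H H
      (β.coact.toLinearMap.rTensor H (β.coact x)))) := by
    rw [Module.End.mul_apply, TbarPlus_apply β ψ]
    induction β.coact x with
    | zero => simp
    | add a b ha hb => simp only [map_add, ha, hb]
    | tmul a b =>
      simp only [sliceRight_tmul, map_smul, LinearMap.rTensor_tmul, TbarPlus_apply,
        AlgHom.toLinearMap_apply]
      induction β.coact a with
      | zero => simp
      | add c d hc hd => simp only [map_add, smul_add, TensorProduct.add_tmul, hc, hd]
      | tmul c d => simp [smul_smul, mul_comm]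
  rw [h1, h2, h]

theorem TbarPlus_counit : TbarPlus β counit = 1 := by
  ext x
  have := LinearMap.congr_fun β.counit_coact x
  simp only [LinearMap.comp_apply, LinearEquiv.coe_coe, AlgHom.toLinearMap_apply,
    LinearMap.id_apply] at this
  rw [TbarPlus_apply, Module.End.one_apply]
  conv_rhs => rw [← this]
  induction β.coact x with
  | zero => simp
  | add a b ha hb => simp only [map_add, ha, hb]
  | tmul a b => simp

/-- `∑ a⁽⁰⁾⁽⁰⁾ ⊗ a⁽⁰⁾⁽¹⁾ S(a⁽¹⁾) = a ⊗ 1`, applied in the middle of a product. -/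
theorem sum_coact_mul_antipode (x y : A) {ι : Type*} (s : Finset ι) (l : ι → A) (r : ι → H)
    (h : ∑ i ∈ s, l i ⊗ₜ[ℂ] r i = β.coact y) :
    ∑ i ∈ s, β.coact (x * l i) * (1 ⊗ₜ[ℂ] antipode ℂ (r i)) = β.coact x * (y ⊗ₜ[ℂ] 1) := by
  have h0 : ∑ i ∈ s, β.coact (l i) * (1 ⊗ₜ[ℂ] antipode ℂ (r i)) = y ⊗ₜ[ℂ] (1 : H) := by
    have h1 := congrArg (fun t => (LinearMap.mul' ℂ H ∘ₗ (antipode ℂ).lTensor H).lTensor A t)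
      (LinearMap.congr_fun β.coassoc y)
    simp only [LinearMap.comp_apply, LinearEquiv.coe_coe, AlgHom.toLinearMap_apply, ← h] at h1
    simp only [map_sum, LinearMap.rTensor_tmul, LinearMap.lTensor_tmul, LinearMap.comp_apply,
      mul_antipode_lTensor_comul_apply, AlgHom.toLinearMap_apply] at h1
    have h2 : ∀ i, (LinearMap.mul' ℂ H ∘ₗ (antipode ℂ).lTensor H).lTensor A
        (TensorProduct.assoc ℂ A H H (β.coact (l i) ⊗ₜ[ℂ] r i)) =
        β.coact (l i) * (1 ⊗ₜ[ℂ] antipode ℂ (r i)) := by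
      intro i
      induction β.coact (l i) with
      | zero => simp
      | add c d hc hd => simp only [TensorProduct.add_tmul, map_add, add_mul, hc, hd]
      | tmul c d => simp
    simp only [h2] at h1
    rw [h1]
    have h3 : (∑ i ∈ s, counit (R := ℂ) (r i) • l i) = y := by
      have := LinearMap.congr_fun (TbarPlus_counit β) y
      rw [TbarPlus_apply, ← h] at this
      simpa using this
    conv_rhs => rw [← h3]
    simp [TensorProduct.sum_tmul, TensorProduct.smul_tmul, Algebra.algebraMap_eq_smul_one]
  simp only [map_mul, mul_assoc, ← Finset.mul_sum, h0]

/-- The skew version of the antipode axiom, obtained by applying S to the usual one; this is where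
S² = 1 is needed. -/
theorem sum_right_mul_antipode (hS : ∀ x : H, antipode ℂ (antipode ℂ x) = x) {x : H}
    {ι : Type*} (r : Repr ℂ x ι) :
    ∑ i ∈ r.index, r.right i * antipode ℂ (r.left i) = counit (R := ℂ) x • 1 := by
  rw [← hS (∑ i ∈ r.index, _), map_sum]
  simp only [antipode_mul_antidistrib, hS]
  rw [sum_mul_antipode_eq_smul r]
  simp [antipode_one]

variable [FiniteDimensional ℂ H] [FiniteDimensional ℂ A]

/-- The regular trace of a comodule algebra is invariant. -/
theorem regTrace_TbarPlus (hS : ∀ x : H, antipode ℂ (antipode ℂ x) = x) (ψ : Module.Dual ℂ H)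
    (a : A) : regTrace A (TbarPlus β ψ a) = ψ 1 * regTrace A a := by
  let b := Module.finBasis ℂ H
  let ψ' : Fin (Module.finrank ℂ H) → Module.Dual ℂ H := fun k =>
    ψ ∘ₗ LinearMap.mulLeft ℂ (b k) ∘ₗ antipode ℂ
  have hsum : ∑ k, dualMul (ψ' k) (b.coord k) = ψ 1 • counit := by
    ext z
    let r := Repr.arbitrary ℂ z
    simp only [LinearMap.sum_apply, dualMul_apply_repr _ _ r]
    rw [Finset.sum_comm]
    have : ∀ i, ∑ k, ψ' k (r.left i) * b.coord k (r.right i) =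
        ψ (r.right i * antipode ℂ (r.left i)) := by
      intro i
      rw [← LinearMap.mulRight_apply (R := ℂ), ← LinearMap.comp_apply, ← sum_repr_smul_apply b]
      simp [ψ', mul_comm]
    simp only [this, ← map_sum, sum_right_mul_antipode hS]
    simp [mul_comm]
  -- As for the twisted trace: the translated multiplication operator is a sum of operators b · L_a
  -- · c, whose outer factors combine to ψ(1) under the trace.
  have key : LinearMap.mul ℂ A (TbarPlus β ψ a) =
      ∑ k, TbarPlus β (b.coord k) * LinearMap.mul ℂ A a * TbarPlus β (ψ' k) := by
    ext y
    have hy := sum_sliceRight_tmul b (β.coact y)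
    have h1 := congrArg (sliceRight ψ) (sum_coact_mul_antipode β a y _ _ _ hy)
    have h2 : sliceRight ψ (β.coact a * (y ⊗ₜ[ℂ] 1)) = TbarPlus β ψ a * y := by
      rw [TbarPlus_apply]
      induction β.coact a with
      | zero => simp
      | add a b ha hb => simp only [map_add, add_mul, ha, hb]
      | tmul a b => simp
    have h3 : ∀ (z : A) (w : H), sliceRight ψ (β.coact z * (1 ⊗ₜ[ℂ] w)) =
        ∑ k, ψ (b k * w) • TbarPlus β (b.coord k) z := by
      intro z w
      simp only [TbarPlus_apply]
      induction β.coact z with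
      | zero => simp
      | add a b ha hb => simp only [map_add, add_mul, ha, hb, smul_add, Finset.sum_add_distrib]
      | tmul c d =>
        simp only [Algebra.TensorProduct.tmul_mul_tmul, mul_one, sliceRight_tmul, smul_smul,
          ← Finset.sum_smul]
        congr 1
        rw [← LinearMap.mulRight_apply (R := ℂ), ← LinearMap.comp_apply, ← sum_repr_smul_apply b]
        simp [mul_comm]
    rw [h2, map_sum] at h1
    simp only [h3] at h1
    simp only [Module.End.mul_apply, LinearMap.mul_apply', LinearMap.sum_apply]
    rw [← h1, Finset.sum_comm]
    refine Finset.sum_congr rfl fun k _ => ?_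
    rw [TbarPlus_apply β (ψ' k), sliceRight_eq_sum b]
    simp [ψ', Finset.mul_sum]
  rw [regTrace, LinearMap.comp_apply, key, map_sum]
  have h6 : ∀ k, LinearMap.trace ℂ A (TbarPlus β (b.coord k) * LinearMap.mul ℂ A a *
      TbarPlus β (ψ' k)) = LinearMap.trace ℂ A (LinearMap.mul ℂ A a *
        TbarPlus β (dualMul (ψ' k) (b.coord k))) := fun k => by
    rw [TbarPlus_dualMul, mul_assoc, LinearMap.trace_mul_comm, mul_assoc]
  simp only [h6, ← map_sum, ← Finset.mul_sum, hsum]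
  rw [map_smul, TbarPlus_counit, mul_smul_comm, mul_one, map_smul]
  rfl

end Coaction

/-! ### Symmetric separability idempotents and the regular trace -/

section Separability

variable {A : Type*} [Ring A] [Algebra ℂ A] {lam : A ⊗[ℂ] A}

theorem IsSymmSeparabilityIdempotent.central' (h : IsSymmSeparabilityIdempotent lam) (x : A) :
    (LinearMap.mulRight ℂ x).rTensor A lam = (LinearMap.mulLeft ℂ x).lTensor A lam := by
  have h1 := congrArg (TensorProduct.comm ℂ A A) (h.central x)
  have h2 : ∀ (f : A →ₗ[ℂ] A) (t : A ⊗[ℂ] A), TensorProduct.comm ℂ A A (f.rTensor A t) =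
      f.lTensor A (TensorProduct.comm ℂ A A t) := fun f t => by
    induction t with
    | zero => simp
    | add a b ha hb => simp only [map_add, ha, hb]
    | tmul a b => simp
  have h3 : ∀ (f : A →ₗ[ℂ] A) (t : A ⊗[ℂ] A), TensorProduct.comm ℂ A A (f.lTensor A t) =
      f.rTensor A (TensorProduct.comm ℂ A A t) := fun f t => by
    induction t with
    | zero => simp
    | add a b ha hb => simp only [map_add, ha, hb]
    | tmul a b => simp
  rw [h2, h3, h.symm] at h1
  exact h1.symm

theorem sliceRight_rTensor {M N M' : Type*} [AddCommGroup M] [Module ℂ M] [AddCommGroup N]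
    [Module ℂ N] [AddCommGroup M'] [Module ℂ M']
    (f : Module.Dual ℂ N) (g : M →ₗ[ℂ] M') (t : M ⊗[ℂ] N) :
    sliceRight f (g.rTensor N t) = g (sliceRight f t) := by
  rw [LinearMap.rTensor, sliceRight_map]; rfl

theorem sliceRight_lTensor {M N N' : Type*} [AddCommGroup M] [Module ℂ M] [AddCommGroup N]
    [Module ℂ N] [AddCommGroup N'] [Module ℂ N']
    (f : Module.Dual ℂ N') (g : N →ₗ[ℂ] N') (t : M ⊗[ℂ] N) :
    sliceRight f (g.lTensor M t) = sliceRight (f ∘ₗ g) t := by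
  rw [LinearMap.lTensor, sliceRight_map]; rfl

theorem IsSymmSeparabilityIdempotent.sliceRight_mulRight (h : IsSymmSeparabilityIdempotent lam)
    (f : Module.Dual ℂ A) (x : A) :
    sliceRight (f ∘ₗ LinearMap.mulRight ℂ x) lam = x * sliceRight f lam := by
  rw [← sliceRight_lTensor, ← h.central, sliceRight_rTensor]; rfl

theorem IsSymmSeparabilityIdempotent.sliceRight_mulLeft (h : IsSymmSeparabilityIdempotent lam)
    (f : Module.Dual ℂ A) (x : A) :
    sliceRight (f ∘ₗ LinearMap.mulLeft ℂ x) lam = sliceRight f lam * x := by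
  rw [← sliceRight_lTensor, ← h.central', sliceRight_rTensor]; rfl

variable [FiniteDimensional ℂ A]

/-- For a pure tensor a ⊗ b the operator is f(· b) a, of rank one and trace f(ab). -/
theorem trace_sliceRight_mulLeft (f : Module.Dual ℂ A) (t : A ⊗[ℂ] A) (T : Module.End ℂ A)
    (hT : ∀ x, T x = sliceRight (f ∘ₗ LinearMap.mulLeft ℂ x) t) :
    LinearMap.trace ℂ A T = f (LinearMap.mul' ℂ A t) := by
  let F : A ⊗[ℂ] A →ₗ[ℂ] Module.End ℂ A :=
    TensorProduct.lift ((LinearMap.smulRightₗ (R := ℂ) (M := A) (M₂ := A)).flip.compl₂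
      ((LinearMap.mul ℂ A).flip.compr₂ f))
  have hF : ∀ t x, F t x = sliceRight (f ∘ₗ LinearMap.mulLeft ℂ x) t := fun t x => by
    induction t with
    | zero => simp
    | add a b ha hb => simp only [map_add, LinearMap.add_apply, ha, hb]
    | tmul a b => simp [F]
  have hTF : T = F t := LinearMap.ext fun x => by rw [hT, hF]
  rw [hTF]
  clear hTF hT
  induction t with
  | zero => simp
  | add a b ha hb => simp only [map_add, ha, hb]
  | tmul a b =>
    have : F (a ⊗ₜ[ℂ] b) = (f ∘ₗ LinearMap.mulRight ℂ b).smulRight a :=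
      LinearMap.ext fun x => by simp [hF]
    rw [this, LinearMap.trace_smulRight]
    simp

/-- The map f ↦ (id ⊗ f)(λ) is injective: if the slice vanishes, the trace formula gives f(1) = 0,
and the same applies to all translates of f. So 1 is the slice by a unique functional t, and the
trace formula for left multiplication by a identifies t(a) with the regular trace of a. -/
theorem IsSymmSeparabilityIdempotent.sliceRight_regTrace (h : IsSymmSeparabilityIdempotent lam) :
    sliceRight (regTrace A) lam = 1 := by
  let θ : Module.Dual ℂ A →ₗ[ℂ] A := sliceRight.flip lam
  have hθ : ∀ f, θ f = sliceRight f lam := fun f => rfl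
  have h1 : ∀ f, θ f = 0 → f 1 = 0 := fun f hf => by
    have := trace_sliceRight_mulLeft f lam 0 (fun x => by
      rw [h.sliceRight_mulLeft, ← hθ, hf, zero_mul, LinearMap.zero_apply])
    rw [h.mul_eq_one, map_zero] at this
    exact this.symm
  have hinj : Function.Injective θ := by
    rw [injective_iff_map_eq_zero]
    intro f hf
    ext x
    have := h1 (f ∘ₗ LinearMap.mulLeft ℂ x) (by rw [hθ, h.sliceRight_mulLeft, ← hθ, hf, zero_mul])
    simpa using this
  obtain ⟨t, ht⟩ :=
    (LinearMap.injective_iff_surjective_of_finrank_eq_finrank Subspace.dual_finrank_eq).1 hinj 1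
  have : regTrace A = t := by
    ext a
    have := trace_sliceRight_mulLeft t ((LinearMap.mulLeft ℂ a).rTensor A lam)
      (LinearMap.mul ℂ A a) (fun x => by
        rw [sliceRight_rTensor, h.sliceRight_mulLeft, ← hθ, ht]; simp)
    rw [regTrace, LinearMap.comp_apply, this]
    have h2 : ∀ s : A ⊗[ℂ] A, LinearMap.mul' ℂ A ((LinearMap.mulLeft ℂ a).rTensor A s) =
        a * LinearMap.mul' ℂ A s := fun s => by
      induction s with
      | zero => simp
      | add c d hc hd => simp only [map_add, mul_add, hc, hd]
      | tmul c d => simp [mul_assoc]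
    rw [h2, h.mul_eq_one, mul_one]
  rw [this, ← hθ, ht]

theorem IsSymmSeparabilityIdempotent.sliceRight_regTrace_mulRight
    (h : IsSymmSeparabilityIdempotent lam) (x : A) :
    sliceRight (regTrace A ∘ₗ LinearMap.mulRight ℂ x) lam = x := by
  rw [h.sliceRight_mulRight, h.sliceRight_regTrace, mul_one]

theorem IsSymmSeparabilityIdempotent.regTrace_nondeg (h : IsSymmSeparabilityIdempotent lam) (x : A)
    (hx : ∀ y, regTrace A (y * x) = 0) : x = 0 := by
  rw [← h.sliceRight_regTrace_mulRight x]
  have : regTrace A ∘ₗ LinearMap.mulRight ℂ x = 0 := LinearMap.ext fun y => hx y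
  simp [this]

/-- The regular trace is a Frobenius form; to check an identity on a leg in A it is enough to pair
with τ(· y). -/
theorem IsSymmSeparabilityIdempotent.exists_regTrace_eq (h : IsSymmSeparabilityIdempotent lam)
    (f : Module.Dual ℂ A) : ∃ z, f = regTrace A ∘ₗ LinearMap.mulRight ℂ z := by
  let Φ : A →ₗ[ℂ] Module.Dual ℂ A := (LinearMap.mul ℂ A).flip.compr₂ (regTrace A)
  have hΦ : Function.Injective Φ := by
    rw [injective_iff_map_eq_zero]
    exact fun a ha => h.regTrace_nondeg a fun y => LinearMap.congr_fun ha y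
  obtain ⟨z, hz⟩ := (LinearMap.injective_iff_surjective_of_finrank_eq_finrank
    Subspace.dual_finrank_eq.symm).1 hΦ f
  exact ⟨z, hz.symm⟩

end Separability

/-! ### Coinvariance of λ and uniqueness of the invariant trace -/

section Invariance

open Coalgebra HopfAlgebra

variable {H A : Type*} [Ring H] [HopfAlgebra ℂ H] [Ring A] [Algebra ℂ A]
  [FiniteDimensional ℂ H] [FiniteDimensional ℂ A] (β : RightComoduleAlgebra H A)
  {lam : A ⊗[ℂ] A}

/-- `∑ τ(x⁽⁰⁾ y) x⁽¹⁾ = ∑ τ(x y⁽⁰⁾) S(y⁽¹⁾)` for the regular trace `τ`. -/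
theorem sliceLeft_regTrace (hS : ∀ x : H, antipode ℂ (antipode ℂ x) = x) (x y : A) :
    sliceLeft (regTrace A ∘ₗ LinearMap.mulRight ℂ y) (β.coact x) =
      antipode ℂ (sliceLeft (regTrace A ∘ₗ LinearMap.mulLeft ℂ x) (β.coact y)) := by
  let b := Module.finBasis ℂ H
  have hy := sum_sliceRight_tmul b (β.coact y)
  have h1 := congrArg (sliceLeft (regTrace A)) (sum_coact_mul_antipode β x y _ _ _ hy)
  have h2 : ∀ a : A, sliceLeft (regTrace A) (β.coact a) = regTrace A a • 1 := fun a => by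
    rw [← sub_eq_zero, ← Module.forall_dual_apply_eq_zero_iff ℂ]
    intro ψ
    have h3 : ψ (sliceLeft (regTrace A) (β.coact a)) = regTrace A (TbarPlus β ψ a) := by
      rw [TbarPlus_apply]
      induction β.coact a with
      | zero => simp
      | add c d hc hd => simp only [map_add, hc, hd]
      | tmul c d => simp [mul_comm]
    rw [map_sub, h3, regTrace_TbarPlus β hS]
    simp [mul_comm]
  have h4 : ∀ (a : A) (w : H), sliceLeft (regTrace A) (β.coact a * (1 ⊗ₜ[ℂ] w)) =
      regTrace A a • w := fun a w => by
    have : sliceLeft (regTrace A) (β.coact a * (1 ⊗ₜ[ℂ] w)) =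
        sliceLeft (regTrace A) (β.coact a) * w := by
      induction β.coact a with
      | zero => simp
      | add c d hc hd => simp only [map_add, add_mul, hc, hd]
      | tmul c d => simp
    rw [this, h2]; simp
  have h5 : sliceLeft (regTrace A) (β.coact x * (y ⊗ₜ[ℂ] 1)) =
      sliceLeft (regTrace A ∘ₗ LinearMap.mulRight ℂ y) (β.coact x) := by
    induction β.coact x with
    | zero => simp
    | add c d hc hd => simp only [map_add, add_mul, hc, hd]
    | tmul c d => simp
  rw [h5, map_sum] at h1
  simp only [h4] at h1
  rw [← h1, sliceLeft_eq_sum b, map_sum]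
  simp

/-- Moving the coaction through a symmetric separability idempotent:
`∑ λ⟨1⟩⁽⁰⁾ ⊗ λ⟨1⟩⁽¹⁾ ⊗ λ⟨2⟩ = ∑ λ⟨1⟩ ⊗ S(λ⟨2⟩⁽¹⁾) ⊗ λ⟨2⟩⁽⁰⁾`. -/
theorem IsSymmSeparabilityIdempotent.rTensor_coact (h : IsSymmSeparabilityIdempotent lam)
    (hS : ∀ x : H, antipode ℂ (antipode ℂ x) = x) :
    β.coact.toLinearMap.rTensor A lam =
      (TensorProduct.assoc ℂ A H A).symm (((TensorProduct.comm ℂ A H).toLinearMap ∘ₗ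
        (antipode ℂ).lTensor A ∘ₗ β.coact.toLinearMap).lTensor A lam) := by
  refine eq_of_sliceRight_eq fun f => ?_
  -- Pairing the last leg with τ(· y) turns the left side into β(y), as λ is the dual basis of τ. On
  -- the right side, `sliceLeft_regTrace` brings the coaction onto y, and S² = 1 cancels the
  -- antipodes.
  obtain ⟨y, rfl⟩ := h.exists_regTrace_eq f
  rw [sliceRight_rTensor, h.sliceRight_regTrace_mulRight]
  have h1 : ∀ t : A ⊗[ℂ] A, sliceRight (regTrace A ∘ₗ LinearMap.mulRight ℂ y)
      ((TensorProduct.assoc ℂ A H A).symm (((TensorProduct.comm ℂ A H).toLinearMap ∘ₗ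
        (antipode ℂ).lTensor A ∘ₗ β.coact.toLinearMap).lTensor A t)) =
      (LinearMap.lTensor A (antipode ℂ)) ((LinearMap.lTensor A ((sliceLeft (regTrace A ∘ₗ
        LinearMap.mulRight ℂ y)) ∘ₗ β.coact.toLinearMap)) t) := fun t => by
    induction t with
    | zero => simp
    | add c d hc hd => simp only [map_add, hc, hd]
    | tmul c d =>
      simp only [LinearMap.lTensor_tmul, LinearMap.comp_apply, AlgHom.toLinearMap_apply,
        LinearEquiv.coe_coe]
      induction β.coact d with
      | zero => simp
      | add e f he hf => simp only [map_add, TensorProduct.tmul_add, he, hf]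
      | tmul e f => simp [TensorProduct.smul_tmul]
  have h2 : ∀ t : A ⊗[ℂ] A, (LinearMap.lTensor A (antipode ℂ)) ((LinearMap.lTensor A
      ((sliceLeft (regTrace A ∘ₗ LinearMap.mulRight ℂ y)) ∘ₗ β.coact.toLinearMap)) t) =
      LinearMap.rTensor H (sliceRight.flip t) (LinearMap.rTensor H
        ((LinearMap.mul ℂ A).flip.compr₂ (regTrace A)) (β.coact y)) := fun t => by
    induction t with
    | zero => simp
    | add c d hc hd => simp only [map_add, LinearMap.rTensor_add, LinearMap.add_apply, hc, hd]
    | tmul c d =>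
      simp only [LinearMap.lTensor_tmul, LinearMap.comp_apply, AlgHom.toLinearMap_apply]
      rw [sliceLeft_regTrace β hS, hS]
      induction β.coact y with
      | zero => simp
      | add e f he hf => simp only [map_add, TensorProduct.tmul_add, he, hf]
      | tmul e f =>
        simp only [sliceLeft_tmul, LinearMap.rTensor_tmul, LinearMap.flip_apply, sliceRight_tmul,
          TensorProduct.tmul_smul, TensorProduct.smul_tmul']
        rfl
  have h3 : sliceRight.flip lam ∘ₗ ((LinearMap.mul ℂ A).flip.compr₂ (regTrace A)) =
      LinearMap.id := LinearMap.ext fun z => h.sliceRight_regTrace_mulRight z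
  rw [AlgHom.toLinearMap_apply, h1, h2, ← LinearMap.comp_apply, ← LinearMap.rTensor_comp, h3]
  simp

/-- An invariant trace functional on an indecomposable comodule algebra with a symmetric
separability idempotent is a multiple of the regular trace. -/
theorem IsHIndecomposable.eq_smul_regTrace [Nontrivial A] {β : RightComoduleAlgebra H A}
    (hβ : IsHIndecomposable β)
    (h : IsSymmSeparabilityIdempotent lam) (hS : ∀ x : H, antipode ℂ (antipode ℂ x) = x)
    (G : Module.Dual ℂ A) (hG : ∀ a b, G (a * b) = G (b * a))
    (hinv : ∀ ψ a, G (TbarPlus β ψ a) = ψ 1 * G a) : ∃ c : ℂ, G = c • regTrace A := by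
  obtain ⟨z, rfl⟩ := h.exists_regTrace_eq G
  simp only [LinearMap.comp_apply, LinearMap.mulRight_apply] at hG hinv
  -- With G = τ(· z), the trace property of G says that z is central, and the invariance of G says
  -- that z is coinvariant.
  have hz : ∀ x, z * x = x * z := fun x => by
    rw [← sub_eq_zero]
    refine h.regTrace_nondeg _ fun y => ?_
    rw [mul_sub, map_sub, sub_eq_zero, ← mul_assoc, regTrace_mul_comm, ← mul_assoc, hG,
      ← mul_assoc]
  have hzc : β.coact z = z ⊗ₜ[ℂ] 1 := by
    apply (TensorProduct.comm ℂ A H).injective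
    refine eq_of_sliceRight_eq fun f => ?_
    obtain ⟨y, rfl⟩ := h.exists_regTrace_eq f
    have h1 : ∀ (g : Module.Dual ℂ A) (t : A ⊗[ℂ] H),
        sliceRight g (TensorProduct.comm ℂ A H t) = sliceLeft g t := fun g t => by
      induction t with
      | zero => simp
      | add c d hc hd => simp only [map_add, hc, hd]
      | tmul c d => simp
    rw [h1, h1, sliceLeft_regTrace β hS]
    have h2 : sliceLeft (regTrace A ∘ₗ LinearMap.mulLeft ℂ z) (β.coact y) =
        regTrace A (y * z) • 1 := by
      rw [← sub_eq_zero, ← Module.forall_dual_apply_eq_zero_iff ℂ]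
      intro ψ
      have h3 : ψ (sliceLeft (regTrace A ∘ₗ LinearMap.mulLeft ℂ z) (β.coact y)) =
          regTrace A (TbarPlus β ψ y * z) := by
        rw [TbarPlus_apply]
        induction β.coact y with
        | zero => simp
        | add c d hc hd => simp only [map_add, add_mul, hc, hd]
        | tmul c d => simp [mul_comm, hz]
      rw [map_sub, h3, hinv]
      simp [mul_comm]
    rw [h2]
    simp [hz, antipode_one]
  -- The aim is z = μ, for an eigenvalue μ of multiplication by z.
  obtain ⟨μ, hμ⟩ := Module.End.exists_eigenvalue (LinearMap.mul ℂ A z)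
  refine ⟨μ, ?_⟩
  set w := z - algebraMap ℂ A μ with hw
  have hwc : ∀ x, w * x = x * w := fun x => by
    rw [hw, sub_mul, mul_sub, hz, Algebra.commutes]
  have hwβ : β.coact w = w ⊗ₜ[ℂ] 1 := by
    rw [hw, map_sub, hzc, AlgHom.commutes, TensorProduct.sub_tmul]; rfl
  obtain ⟨v, hv⟩ := hμ.exists_hasEigenvector
  have hwv : w * v = 0 := by
    have := hv.apply_eq_smul
    rw [LinearMap.mul_apply'] at this
    rw [hw, sub_mul, this, Algebra.algebraMap_eq_smul_one, smul_mul_assoc, one_mul, sub_self]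
  -- Fitting decomposition: for large n, the kernel and the range of multiplication by wⁿ are
  -- complementary. They are ideals and subcomodules because w is central and coinvariant.
  obtain ⟨N, hN⟩ := Filter.eventually_atTop.1
    ((LinearMap.mul ℂ A w).eventually_isCompl_ker_pow_range_pow)
  have hcompl := hN (N + 1) (Nat.le_succ N)
  have hpow : ∀ n x, ((LinearMap.mul ℂ A w) ^ n) x = w ^ n * x := fun n => by
    induction n with
    | zero => simp
    | succ n ih => intro x; rw [pow_succ, Module.End.mul_apply, ih, pow_succ]; simp [mul_assoc]
  set u := w ^ (N + 1) with hu
  have huc : ∀ x, u * x = x * u := fun x =>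
    ((show Commute w x from hwc x).pow_left (N + 1)).eq
  have huβ : β.coact u = u ⊗ₜ[ℂ] 1 := by
    rw [hu, map_pow, hwβ, Algebra.TensorProduct.tmul_pow, one_pow]
  have huT : ∀ ψ x, TbarPlus β ψ (u * x) = u * TbarPlus β ψ x := fun ψ x => by
    rw [TbarPlus_apply, TbarPlus_apply, map_mul, huβ]
    induction β.coact x with
    | zero => simp
    | add c d hc hd => simp only [map_add, mul_add, hc, hd]
    | tmul c d => simp
  have hmem : ∀ (I : Submodule ℂ A) (x : A), (∀ ψ, TbarPlus β ψ x ∈ I) →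
      β.coact x ∈ LinearMap.range (I.subtype.rTensor H) := fun I x hI => by
    let b := Module.finBasis ℂ H
    rw [← sum_sliceRight_tmul b (β.coact x)]
    exact Submodule.sum_mem _ fun k _ => ⟨⟨_, hI (b.coord k)⟩ ⊗ₜ[ℂ] b k, by simp [TbarPlus_apply]⟩
  have hker : ∀ x, x ∈ LinearMap.ker ((LinearMap.mul ℂ A w) ^ (N + 1)) ↔ u * x = 0 := fun x => by
    rw [LinearMap.mem_ker, hpow]
  have hran : ∀ x, x ∈ LinearMap.range ((LinearMap.mul ℂ A w) ^ (N + 1)) ↔ ∃ y, u * y = x :=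
    fun x => by simp only [LinearMap.mem_range, hpow, hu]
  have hI : IsHIdeal β (LinearMap.ker ((LinearMap.mul ℂ A w) ^ (N + 1))) := by
    refine ⟨fun a x hx => ?_, fun a x hx => ?_, fun x hx => hmem _ x fun ψ => ?_⟩ <;>
      rw [hker] at hx ⊢
    · rw [← mul_assoc, huc, mul_assoc, hx, mul_zero]
    · rw [← mul_assoc, hx, zero_mul]
    · rw [← huT, hx, map_zero]
  have hJ : IsHIdeal β (LinearMap.range ((LinearMap.mul ℂ A w) ^ (N + 1))) := by
    refine ⟨fun a x hx => ?_, fun a x hx => ?_, fun x hx => hmem _ x fun ψ => ?_⟩ <;>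
      rw [hran] at hx ⊢ <;> obtain ⟨y, rfl⟩ := hx
    · exact ⟨a * y, by rw [← mul_assoc, huc, mul_assoc]⟩
    · exact ⟨y * a, by rw [mul_assoc]⟩
    · exact ⟨_, (huT ψ y).symm⟩
  -- The kernel contains the eigenvector v, so indecomposability kills the range.
  have hu0 : u = 0 := by
    rcases hβ _ _ hI hJ hcompl with h0 | h0
    · exfalso
      have : v ∈ LinearMap.ker ((LinearMap.mul ℂ A w) ^ (N + 1)) := by
        rw [hker, hu, pow_succ, mul_assoc, hwv, mul_zero]
      rw [h0] at this
      exact hv.2 ((Submodule.mem_bot ℂ).1 this)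
    · have : u ∈ LinearMap.range ((LinearMap.mul ℂ A w) ^ (N + 1)) := (hran u).2 ⟨1, mul_one u⟩
      rw [h0] at this
      exact (Submodule.mem_bot ℂ).1 this
  -- Each yw is nilpotent, hence has trace zero, and the trace form is nondegenerate.
  have hw0 : w = 0 := by
    refine h.regTrace_nondeg _ fun y => ?_
    have hnil : IsNilpotent (LinearMap.mul ℂ A (y * w)) := by
      refine ⟨N + 1, LinearMap.ext fun x => ?_⟩
      have hp : ∀ n x, ((LinearMap.mul ℂ A (y * w)) ^ n) x = (y * w) ^ n * x := fun n => by
        induction n with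
        | zero => simp
        | succ n ih => intro x; rw [pow_succ, Module.End.mul_apply, ih, pow_succ]; simp [mul_assoc]
      have hc : Commute y w := (hwc y).symm
      rw [hp, hc.mul_pow, ← hu, hu0, mul_zero, zero_mul, LinearMap.zero_apply]
    exact (LinearMap.isNilpotent_trace_of_isNilpotent hnil).eq_zero
  have hz' : z = algebraMap ℂ A μ := sub_eq_zero.1 hw0
  ext x
  simp [hz', Algebra.algebraMap_eq_smul_one]

end Invariance

/-! ### Sweedler sums around faces as products in E ⊗ H -/

section SliceRing

open Coalgebra HopfAlgebra WithConv

variable {E H : Type*} [Ring E] [Algebra ℂ E] [Ring H] [HopfAlgebra ℂ H]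

@[simp] theorem sliceRight_tmul_one_mul (z : E) (φ : Module.Dual ℂ H) (t : E ⊗[ℂ] H) :
    sliceRight φ (z ⊗ₜ[ℂ] 1 * t) = z * sliceRight φ t := by
  induction t with
  | zero => simp
  | add a b ha hb => simp only [mul_add, map_add, ha, hb]
  | tmul a b => simp

@[simp] theorem sliceRight_mul_tmul_one (z : E) (φ : Module.Dual ℂ H) (t : E ⊗[ℂ] H) :
    sliceRight φ (t * z ⊗ₜ[ℂ] 1) = sliceRight φ t * z := by
  induction t with
  | zero => simp
  | add a b ha hb => simp only [add_mul, map_add, ha, hb]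
  | tmul a b => simp

theorem sliceRight_one (φ : Module.Dual ℂ H) : sliceRight φ (1 : E ⊗[ℂ] H) = φ 1 • 1 := by
  rw [Algebra.TensorProduct.one_def, sliceRight_tmul]

variable [FiniteDimensional ℂ H]

theorem commute_tmul_one_iff {z : E} {t : E ⊗[ℂ] H} :
    Commute (z ⊗ₜ[ℂ] 1) t ↔ ∀ φ, Commute z (sliceRight φ t) := by
  refine ⟨fun h φ => ?_, fun h => eq_of_sliceRight_eq fun φ => ?_⟩
  · have := congrArg (sliceRight φ) h.eq
    rwa [sliceRight_tmul_one_mul, sliceRight_mul_tmul_one] at this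
  · rw [sliceRight_tmul_one_mul, sliceRight_mul_tmul_one, (h φ).eq]

theorem sliceRight_mul_eq_sum {ι : Type*} [Fintype ι] (b : Module.Basis ι ℂ H)
    (φ : Module.Dual ℂ H) (s t : E ⊗[ℂ] H) : sliceRight φ (s * t) =
      ∑ i, ∑ j, φ (b i * b j) • (sliceRight (b.coord i) s * sliceRight (b.coord j) t) := by
  conv_lhs => rw [← sum_sliceRight_tmul b s, ← sum_sliceRight_tmul b t]
  simp only [Finset.sum_mul_sum, Algebra.TensorProduct.tmul_mul_tmul, map_sum, sliceRight_tmul]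

/-- All slices of `s` commute with all slices of `t`. -/
def SlicesCommute (s t : E ⊗[ℂ] H) : Prop :=
  ∀ φ ψ : Module.Dual ℂ H, Commute (sliceRight φ s) (sliceRight ψ t)

theorem SlicesCommute.symm {s t : E ⊗[ℂ] H} (h : SlicesCommute s t) : SlicesCommute t s :=
  fun φ ψ => (h ψ φ).symm

theorem slicesCommute_iff {s t : E ⊗[ℂ] H} :
    SlicesCommute s t ↔ ∀ φ, Commute (sliceRight φ s ⊗ₜ[ℂ] 1) t := by
  simp only [SlicesCommute, commute_tmul_one_iff]

theorem SlicesCommute.list_prod_right {s : E ⊗[ℂ] H} {l : List (E ⊗[ℂ] H)}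
    (h : ∀ t ∈ l, SlicesCommute s t) : SlicesCommute s l.prod :=
  slicesCommute_iff.2 fun φ => Commute.list_prod_right _ _ fun t ht =>
    slicesCommute_iff.1 (h t ht) φ

theorem SlicesCommute.list_prod {l l' : List (E ⊗[ℂ] H)}
    (h : ∀ s ∈ l, ∀ t ∈ l', SlicesCommute s t) : SlicesCommute l.prod l'.prod :=
  list_prod_right fun t ht => (list_prod_right fun s hs => (h s hs t ht).symm).symm

/-- The factors in E commute by assumption, and those in H may be exchanged under a trace. This is
what makes face operators independent of the starting site. -/
theorem SlicesCommute.sliceRight_mul_comm {s t : E ⊗[ℂ] H} (h : SlicesCommute s t)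
    {φ : Module.Dual ℂ H} (hφ : ∀ x y, φ (x * y) = φ (y * x)) :
    sliceRight φ (s * t) = sliceRight φ (t * s) := by
  let b := Module.finBasis ℂ H
  rw [sliceRight_mul_eq_sum b, sliceRight_mul_eq_sum b, Finset.sum_comm]
  refine Finset.sum_congr rfl fun i _ => Finset.sum_congr rfl fun j _ => ?_
  rw [hφ, (h _ _).eq]

/-- The slices of `t` form a representation of the dual Hopf algebra. -/
structure IsCorep (t : E ⊗[ℂ] H) : Prop where
  counit : sliceRight (Coalgebra.counit (R := ℂ)) t = 1
  dualMul : ∀ φ ψ : Module.Dual ℂ H,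
    sliceRight (dualMul φ ψ) t = sliceRight φ t * sliceRight ψ t

/-- The corepresentation identity (id ⊗ Δ)(t) = t₁₂ t₁₃ written in a basis. Every functional on H ⊗
H is a combination of products of coordinates, so the module property for products of functionals
suffices. -/
theorem IsCorep.lTensor_comul {t : E ⊗[ℂ] H} (h : IsCorep t) {ι : Type*} [Fintype ι]
    (b : Module.Basis ι ℂ H) : comul.lTensor E t =
      ∑ i, ∑ j, (sliceRight (b.coord i) t * sliceRight (b.coord j) t) ⊗ₜ[ℂ] (b i ⊗ₜ[ℂ] b j) := by
  refine eq_of_sliceRight_eq fun f => ?_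
  have h1 : f ∘ₗ comul = ∑ i, ∑ j, f (b i ⊗ₜ[ℂ] b j) • HopfDisk.dualMul (b.coord i) (b.coord j) := by
    have : f = ∑ i, ∑ j, f (b i ⊗ₜ[ℂ] b j) • (LinearMap.mul' ℂ ℂ ∘ₗ
        TensorProduct.map (b.coord i) (b.coord j)) := by
      refine (b.tensorProduct b).ext fun ⟨k, l⟩ => ?_
      simp only [Module.Basis.tensorProduct_apply, LinearMap.sum_apply, LinearMap.smul_apply,
        LinearMap.comp_apply, TensorProduct.map_tmul, LinearMap.mul'_apply,
        Module.Basis.coord_apply, Module.Basis.repr_self, Finsupp.single_apply, smul_eq_mul]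
      classical
      rw [Finset.sum_eq_single k, Finset.sum_eq_single l] <;> simp +contextual
    conv_lhs => rw [this]
    ext x
    simp [HopfDisk.dualMul]
  rw [sliceRight_lTensor, h1]
  simp only [map_sum, map_smul, LinearMap.sum_apply, LinearMap.smul_apply, h.dualMul,
    sliceRight_tmul]

theorem sliceRight_dualMul (φ ψ : Module.Dual ℂ H) (t : E ⊗[ℂ] H) :
    sliceRight (dualMul φ ψ) t =
      sliceRight (LinearMap.mul' ℂ ℂ ∘ₗ TensorProduct.map φ ψ) (comul.lTensor E t) := by
  rw [sliceRight_lTensor]; rfl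

theorem IsCorep.one : IsCorep (1 : E ⊗[ℂ] H) :=
  ⟨by simp [sliceRight_one], fun φ ψ => by
    simp [sliceRight_one, HopfDisk.dualMul, Bialgebra.comul_one, Algebra.TensorProduct.one_def,
      smul_smul, mul_comm]⟩

/-- As Δ is multiplicative, the Δ of st is the product of those of s and t; the slices have to be
reordered, which is why they must commute. -/
theorem IsCorep.mul {s t : E ⊗[ℂ] H} (hs : IsCorep s) (ht : IsCorep t) (h : SlicesCommute s t) :
    IsCorep (s * t) := by
  let b := Module.finBasis ℂ H
  refine ⟨?_, fun φ ψ => ?_⟩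
  · have h1 := congrArg₂ (· * ·) hs.counit ht.counit
    simp only [sliceRight_eq_sum b Coalgebra.counit, mul_one, Finset.sum_mul_sum,
      smul_mul_smul_comm] at h1
    rw [sliceRight_mul_eq_sum b, ← h1]
    simp only [Bialgebra.counit_mul]
  · have h1 : comul.lTensor E (s * t) = comul.lTensor E s * comul.lTensor E t :=
      map_mul (Algebra.TensorProduct.map (AlgHom.id ℂ E) (Bialgebra.comulAlgHom ℂ H)) s t
    rw [sliceRight_dualMul, h1, hs.lTensor_comul b, ht.lTensor_comul b, sliceRight_mul_eq_sum b,
      sliceRight_mul_eq_sum b]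
    simp only [Finset.sum_mul_sum, Algebra.TensorProduct.tmul_mul_tmul, map_sum,
      sliceRight_tmul, smul_mul_smul_comm, LinearMap.comp_apply, TensorProduct.map_tmul,
      LinearMap.mul'_apply]
    have hc : ∀ i j k l, sliceRight (b.coord i) s * sliceRight (b.coord j) s *
        (sliceRight (b.coord k) t * sliceRight (b.coord l) t) =
        sliceRight (b.coord i) s * sliceRight (b.coord k) t *
        (sliceRight (b.coord j) s * sliceRight (b.coord l) t) := fun i j k l => by
      simp only [mul_assoc]
      rw [← mul_assoc (sliceRight (b.coord j) s), (h (b.coord j) (b.coord k)).eq, mul_assoc]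
    simp only [hc]
    exact Finset.sum_congr rfl fun i _ => Finset.sum_comm

theorem IsCorep.list_prod {l : List (E ⊗[ℂ] H)} (h : ∀ t ∈ l, IsCorep t)
    (hc : l.Pairwise SlicesCommute) : IsCorep l.prod := by
  induction l with
  | nil => exact .one
  | cons t l ih =>
    rw [List.pairwise_cons] at hc
    rw [List.prod_cons]
    exact (h t (by simp)).mul (ih (fun s hs => h s (by simp [hs])) hc.2)
      (.list_prod_right hc.1)

/-- The tensor whose slices are the values of a linear map on the dual. -/
def toTensor (f : Module.Dual ℂ H →ₗ[ℂ] E) : E ⊗[ℂ] H :=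
  ∑ k, f ((Module.finBasis ℂ H).coord k) ⊗ₜ[ℂ] Module.finBasis ℂ H k

@[simp] theorem sliceRight_toTensor (f : Module.Dual ℂ H →ₗ[ℂ] E) (φ : Module.Dual ℂ H) :
    sliceRight φ (toTensor f) = f φ := by
  simp only [toTensor, map_sum, sliceRight_tmul, ← map_smul]
  rw [← map_sum]
  congr 1
  refine (Module.finBasis ℂ H).ext fun i => ?_
  simp [Finsupp.single_apply]

/-- The comultiplication of the dual is the transpose of the product of H. Splitting φ over two
factors is thus the same as multiplying two tensors and slicing once. -/
theorem sliceRight_mul_eq_dualComul (s t : E ⊗[ℂ] H) (φ : Module.Dual ℂ H) :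
    LinearMap.mul' ℂ E (TensorProduct.map (sliceRight.flip s) (sliceRight.flip t)
      (dualComul H φ)) = sliceRight φ (s * t) := by
  let b := Module.finBasis ℂ H
  have h1 : ∀ D : Module.Dual ℂ H ⊗[ℂ] Module.Dual ℂ H, LinearMap.mul' ℂ E (TensorProduct.map
      (sliceRight.flip s) (sliceRight.flip t) D) =
      ∑ i, ∑ j, TensorProduct.dualDistribEquiv ℂ H H D (b i ⊗ₜ[ℂ] b j) •
        (sliceRight (b.coord i) s * sliceRight (b.coord j) t) := fun D => by
    induction D with
    | zero => simp
    | add x y hx hy =>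
      simp only [map_add, hx, hy, LinearMap.add_apply, add_smul, Finset.sum_add_distrib]
    | tmul φ ψ =>
      have : TensorProduct.dualDistribEquiv ℂ H H (φ ⊗ₜ[ℂ] ψ) =
        TensorProduct.dualDistrib ℂ H H (φ ⊗ₜ[ℂ] ψ) := rfl
      rw [TensorProduct.map_tmul, LinearMap.mul'_apply, LinearMap.flip_apply,
        LinearMap.flip_apply, sliceRight_eq_sum b φ, sliceRight_eq_sum b ψ]
      simp only [this, TensorProduct.dualDistrib_apply, Finset.sum_mul_sum, smul_mul_smul_comm]
  rw [h1, sliceRight_mul_eq_sum b]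
  have h2 : TensorProduct.dualDistribEquiv ℂ H H (dualComul H φ) = φ ∘ₗ LinearMap.mul' ℂ H :=
    LinearEquiv.apply_symm_apply _ _
  simp only [h2, LinearMap.comp_apply, LinearMap.mul'_apply]

theorem sweedlerProd_dual_eq {V : Type*} [AddCommGroup V] [Module ℂ V]
    (l : List (Module.Dual ℂ H →ₗ[ℂ] Module.End ℂ V)) (φ : Module.Dual ℂ H) :
    sweedlerProd (dualComul H) (dualCounit H) l φ = sliceRight φ (l.map toTensor).prod := by
  induction l generalizing φ with
  | nil =>
    rw [List.map_nil, List.prod_nil, sliceRight_one]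
    simp [sweedlerProd, dualCounit, Algebra.algebraMap_eq_smul_one]
  | cons f l ih =>
    rw [List.map_cons, List.prod_cons, ← sliceRight_mul_eq_dualComul]
    have h1 : sweedlerProd (dualComul H) (dualCounit H) l =
      sliceRight.flip (l.map toTensor).prod := LinearMap.ext ih
    have h2 : f = sliceRight.flip (toTensor f) := LinearMap.ext fun φ => by simp
    rw [sweedlerProd, h1, LinearMap.comp_apply, LinearMap.comp_apply]
    conv_lhs => rw [h2]

end SliceRing

/-! ### Sweedler sums around vertices as products in a convolution ring -/

section Convolution

open Coalgebra HopfAlgebra WithConv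

variable {H : Type*} [Ring H] [HopfAlgebra ℂ H]

theorem sweedlerProd_eq_convMul {V : Type*} [AddCommGroup V] [Module ℂ V]
    (l : List (H →ₗ[ℂ] Module.End ℂ V)) :
    toConv (sweedlerProd comul counit l) = (l.map toConv).prod := by
  induction l with
  | nil => rfl
  | cons f l ih => rw [List.map_cons, List.prod_cons, ← ih]; rfl

variable {R : Type*} [Ring R] [Algebra ℂ R]

/-- A ring element as a constant in the convolution ring. -/
def constConv (H : Type*) [Ring H] [HopfAlgebra ℂ H] (t : R) : WithConv (H →ₗ[ℂ] R) :=
  toConv ((counit (R := ℂ)).smulRight t)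

theorem constConv_mul_apply (t : R) (f : WithConv (H →ₗ[ℂ] R)) (x : H) :
    (constConv H t * f) x = t * f x := by
  let r := Repr.arbitrary ℂ x
  rw [r.convMul_apply]
  conv_rhs => rw [← sum_counit_smul r, map_sum, Finset.mul_sum]
  simp [constConv]

theorem sum_smul_counit {x : H} {ι : Type*} (r : Repr ℂ x ι) :
    ∑ i ∈ r.index, counit (R := ℂ) (r.right i) • r.left i = x := by
  have := congrArg (TensorProduct.rid ℂ H) (sum_tmul_counit_eq r)
  simpa only [map_sum, TensorProduct.rid_tmul, one_smul] using this

theorem mul_constConv_apply (t : R) (f : WithConv (H →ₗ[ℂ] R)) (x : H) :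
    (f * constConv H t) x = f x * t := by
  let r := Repr.arbitrary ℂ x
  rw [r.convMul_apply]
  conv_rhs => rw [← sum_smul_counit r, map_sum, Finset.sum_mul]
  simp [constConv]

theorem constConv_mul (s t : R) : constConv H (s * t) = constConv H s * constConv H t := by
  ext x
  rw [constConv_mul_apply]
  simp [constConv]

theorem constConv_one : constConv H (1 : R) = 1 := by
  ext x
  simp [constConv, Algebra.algebraMap_eq_smul_one]

/-- Allows face tensors, as constants, to be commuted past whole vertex products inside one ring. -/
theorem commute_constConv_iff {t : R} {f : WithConv (H →ₗ[ℂ] R)} :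
    Commute (constConv H t) f ↔ ∀ x, Commute t (f x) := by
  refine ⟨fun h x => ?_, fun h => ?_⟩
  · have := congrArg (fun g : WithConv (H →ₗ[ℂ] R) => g x) h.eq
    rwa [constConv_mul_apply, mul_constConv_apply] at this
  · ext x
    rw [constConv_mul_apply, mul_constConv_apply, (h x).eq]

end Convolution

/-! ### Abstract relations between a face and the product around a vertex -/

section AroundVertex

variable {C D : Type*} [Ring C] {T l : D → C} {X : C} {f : D → D} {ds : List D}

/-- Two consecutive edges of a face meeting at a vertex commute with the product around the
vertex. -/
theorem commute_pair_prod (hf : ∀ d, f (f d) = d) (hnd : ds.Nodup) (hnf : ∀ d ∈ ds, f d ∉ ds)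
    (h₁ : ∀ d ∈ ds, T d * l d = l d * X * T d) (h₂ : ∀ d ∈ ds, l d * T (f d) = T (f d) * X * l d)
    (hc : ∀ d ∈ ds, ∀ x, x ≠ d → x ≠ f d → Commute (T x) (l d)) {u v : List D} {d e : D}
    (hds : ds = u ++ d :: e :: v) : Commute (T (f e) * T d) (ds.map l).prod := by
  subst hds
  have hfd : ∀ x y, x ∈ u ++ d :: e :: v → y ∈ u ++ d :: e :: v → x ≠ f y := fun x y hx hy h =>
    hnf y hy (h ▸ hx)
  have hff : ∀ x y, f x = f y → x = y := fun x y h => by rw [← hf x, h, hf]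
  simp only [List.nodup_append, List.nodup_cons, List.mem_cons, not_or] at hnd
  obtain ⟨-, ⟨⟨hde, hdv⟩, hev, -⟩, hu⟩ := hnd
  have hu' : Commute (T (f e) * T d) (u.map l).prod := by
    refine Commute.list_prod_right _ _ fun y hy => ?_
    obtain ⟨x, hx, rfl⟩ := List.mem_map.1 hy
    refine .mul_left (hc x (by simp [hx]) _ (fun h => hfd x e (by simp [hx]) (by simp) h.symm)
      fun h => ?_) (hc x (by simp [hx]) _ (fun h => hu x hx d (by simp) h.symm)
      (hfd _ _ (by simp) (by simp [hx])))
    exact hu x hx e (by simp) (hff _ _ h).symm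
  have hv' : Commute (T (f e) * T d) (v.map l).prod := by
    refine Commute.list_prod_right _ _ fun y hy => ?_
    obtain ⟨x, hx, rfl⟩ := List.mem_map.1 hy
    refine .mul_left (hc x (by simp [hx]) _ (fun h => hfd x e (by simp [hx]) (by simp) h.symm)
      fun h => ?_) (hc x (by simp [hx]) _ (fun h => hdv (h ▸ hx))
      (hfd _ _ (by simp) (by simp [hx])))
    exact hev ((hff _ _ h) ▸ hx)
  have hm : Commute (T (f e) * T d) (l d * l e) := by
    have h3 : Commute (T d) (l e) := hc e (by simp) d hde (hfd _ _ (by simp) (by simp))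
    have h4 : Commute (T (f e)) (l d) := hc d (by simp) (f e)
      (fun h => hfd d e (by simp) (by simp) h.symm) (fun h => hde (hff _ _ h).symm)
    -- Moving T d past l d creates a twist X, which is exactly what T (f e) needs in order to pass l
    -- e.
    calc T (f e) * T d * (l d * l e) = T (f e) * (T d * l d) * l e := by noncomm_ring
      _ = (T (f e) * l d) * X * (T d * l e) := by rw [h₁ d (by simp)]; noncomm_ring
      _ = l d * (T (f e) * X * l e) * T d := by rw [h4.eq, h3.eq]; noncomm_ring
      _ = l d * l e * (T (f e) * T d) := by rw [← h₂ e (by simp)]; noncomm_ring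
  rw [List.map_append, List.prod_append, List.map_cons, List.map_cons, List.prod_cons,
    List.prod_cons, ← mul_assoc (l d)]
  exact hu'.mul_right (hm.mul_right hv')

/-- At the first dart there is no earlier factor to supply the twist, so it stays in the formula.
The next lemma is the counterpart for the last dart. -/
theorem flip_head_mul_prod (hf : ∀ d, f (f d) = d) {d : D} {v : List D}
    (hds : ds = d :: v) (hnd : ds.Nodup) (hnf : ∀ d ∈ ds, f d ∉ ds)
    (h₂ : ∀ d ∈ ds, l d * T (f d) = T (f d) * X * l d)
    (hc : ∀ d ∈ ds, ∀ x, x ≠ d → x ≠ f d → Commute (T x) (l d)) :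
    T (f d) * X * (ds.map l).prod = (ds.map l).prod * T (f d) := by
  subst hds
  have hv : Commute (T (f d)) (v.map l).prod := by
    refine Commute.list_prod_right _ _ fun y hy => ?_
    obtain ⟨x, hx, rfl⟩ := List.mem_map.1 hy
    refine hc x (by simp [hx]) _ (fun h => hnf d (by simp) (h ▸ by simp [hx])) fun h => ?_
    have : d = x := by rw [← hf d, h, hf]
    exact (List.nodup_cons.1 hnd).1 (this ▸ hx)
  rw [List.map_cons, List.prod_cons, mul_assoc (l d), ← hv.eq, ← mul_assoc, ← mul_assoc,
    ← h₂ d (by simp)]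

theorem last_mul_prod {d : D} {u : List D} (hds : ds = u ++ [d]) (hnd : ds.Nodup)
    (hnf : ∀ d ∈ ds, f d ∉ ds) (h₁ : ∀ d ∈ ds, T d * l d = l d * X * T d)
    (hc : ∀ d ∈ ds, ∀ x, x ≠ d → x ≠ f d → Commute (T x) (l d)) :
    T d * (ds.map l).prod = (ds.map l).prod * X * T d := by
  subst hds
  have hu : Commute (T d) (u.map l).prod := by
    refine Commute.list_prod_right _ _ fun y hy => ?_
    obtain ⟨x, hx, rfl⟩ := List.mem_map.1 hy
    refine hc x (by simp [hx]) _ (fun h => ?_) fun h => hnf x (by simp [hx]) (h ▸ by simp)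
    subst h
    simp only [List.nodup_append] at hnd
    exact hnd.2.2 _ hx d (by simp) rfl
  rw [List.map_append, List.prod_append, List.map_singleton, List.prod_singleton, ← mul_assoc,
    hu.eq, mul_assoc, h₁ d (by simp)]
  noncomm_ring

end AroundVertex

/-! ### Products built from the coaction -/

section CoactConv

open Coalgebra HopfAlgebra WithConv

variable {H A R : Type*} [Ring H] [HopfAlgebra ℂ H] [Ring A] [Algebra ℂ A] [Ring R] [Algebra ℂ R]
  (β : RightComoduleAlgebra H A)

/-- `a ↦ ∑ f(a⁽⁰⁾) g(a⁽¹⁾)`. -/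
def coactConv (f : A →ₗ[ℂ] R) (g : WithConv (H →ₗ[ℂ] R)) : A →ₗ[ℂ] R :=
  LinearMap.mul' ℂ R ∘ₗ TensorProduct.map f g.ofConv ∘ₗ β.coact.toLinearMap

/-- Coassociativity of the coaction: A-valued Sweedler sums form a right module over the convolution
ring. -/
theorem coactConv_coactConv (f : A →ₗ[ℂ] R) (g k : WithConv (H →ₗ[ℂ] R)) :
    coactConv β (coactConv β f g) k = coactConv β f (g * k) := by
  ext a
  have h := congrArg (LinearMap.mul' ℂ R ∘ₗ TensorProduct.map f (LinearMap.mul' ℂ R ∘ₗ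
    TensorProduct.map g.ofConv k.ofConv)) (LinearMap.congr_fun β.coassoc a)
  simp only [LinearMap.comp_apply, LinearEquiv.coe_coe, AlgHom.toLinearMap_apply] at h
  simp only [coactConv, LinearMap.comp_apply, AlgHom.toLinearMap_apply]
  have h1 : ∀ t : A ⊗[ℂ] H, LinearMap.mul' ℂ R (TensorProduct.map f (g * k).ofConv t) =
      LinearMap.mul' ℂ R (TensorProduct.map f (LinearMap.mul' ℂ R ∘ₗ
        TensorProduct.map g.ofConv k.ofConv) (comul.lTensor A t)) := fun t => by
    induction t with
    | zero => simp
    | add a b ha hb => simp only [map_add, ha, hb]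
    | tmul a b => simp [LinearMap.convMul_apply]
  rw [h1, ← h]
  induction β.coact a with
  | zero => simp
  | add a b ha hb => simp only [map_add, ha, hb]
  | tmul a b =>
    simp only [TensorProduct.map_tmul, LinearMap.mul'_apply, LinearMap.rTensor_tmul,
      AlgHom.toLinearMap_apply, LinearMap.comp_apply]
    induction β.coact a with
    | zero => simp
    | add c d hc hd => simp only [map_add, add_mul, TensorProduct.add_tmul, hc, hd]
    | tmul c d => simp [mul_assoc]

theorem mul_coactConv (t : R) (f : A →ₗ[ℂ] R) (g : WithConv (H →ₗ[ℂ] R)) :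
    LinearMap.mulLeft ℂ t ∘ₗ coactConv β f g = coactConv β (LinearMap.mulLeft ℂ t ∘ₗ f) g := by
  ext a
  simp only [coactConv, LinearMap.comp_apply]
  induction β.coact.toLinearMap a with
  | zero => simp
  | add a b ha hb => simp only [map_add, ha, hb]
  | tmul a b => simp [mul_assoc]

theorem coactConv_mul_constConv (t : R) (f : A →ₗ[ℂ] R) (g : WithConv (H →ₗ[ℂ] R)) :
    coactConv β f (g * constConv H t) = LinearMap.mulRight ℂ t ∘ₗ coactConv β f g := by
  ext a
  simp only [coactConv, LinearMap.comp_apply]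
  induction β.coact.toLinearMap a with
  | zero => simp
  | add a b ha hb => simp only [map_add, ha, hb]
  | tmul a b =>
    rw [TensorProduct.map_tmul, TensorProduct.map_tmul, LinearMap.mul'_apply, LinearMap.mul'_apply,
      mul_constConv_apply, LinearMap.mulRight_apply, mul_assoc]

theorem coactConv_constConv_mul (t : R) (f : A →ₗ[ℂ] R) (g : WithConv (H →ₗ[ℂ] R)) :
    coactConv β f (constConv H t * g) = coactConv β (LinearMap.mulRight ℂ t ∘ₗ f) g := by
  ext a
  simp only [coactConv, LinearMap.comp_apply]
  induction β.coact.toLinearMap a with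
  | zero => simp
  | add a b ha hb => simp only [map_add, ha, hb]
  | tmul a b =>
    rw [TensorProduct.map_tmul, TensorProduct.map_tmul, LinearMap.mul'_apply, LinearMap.mul'_apply,
      constConv_mul_apply, LinearMap.comp_apply, LinearMap.mulRight_apply, mul_assoc]

theorem coactConv_one (f : A →ₗ[ℂ] R) : coactConv β f (1 : WithConv (H →ₗ[ℂ] R)) = f := by
  ext a
  have := congrArg f (LinearMap.congr_fun β.counit_coact a)
  simp only [LinearMap.comp_apply, LinearEquiv.coe_coe, LinearMap.id_apply] at this
  rw [← this]
  simp only [coactConv, LinearMap.comp_apply]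
  induction β.coact.toLinearMap a with
  | zero => simp
  | add a b ha hb => simp only [map_add, ha, hb]
  | tmul a b => simp [Algebra.algebraMap_eq_smul_one]

theorem coactProd_eq_coactConv {V : Type*} [AddCommGroup V] [Module ℂ V]
    (g : A →ₗ[ℂ] Module.End ℂ V) (l : List (H →ₗ[ℂ] Module.End ℂ V)) :
    coactProd β g l = coactConv β g (l.map toConv).prod := by
  rw [← sweedlerProd_eq_convMul]; rfl

end CoactConv

/-! ### Identities on a single edge -/

section EdgeIdentities

open Coalgebra HopfAlgebra

variable {H : Type*} [Ring H] [HopfAlgebra ℂ H] [FiniteDimensional ℂ H]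

theorem sliceRight_tmul_mul {E : Type*} [Ring E] [Algebra ℂ E] (φ : Module.Dual ℂ H) (a : E) (x : H)
    (t : E ⊗[ℂ] H) :
    sliceRight φ (a ⊗ₜ[ℂ] x * t) = a * sliceRight (φ ∘ₗ LinearMap.mulLeft ℂ x) t := by
  induction t with
  | zero => simp
  | add c d hc hd => simp only [mul_add, map_add, hc, hd]
  | tmul c d => simp

theorem sliceRight_mul_tmul {E : Type*} [Ring E] [Algebra ℂ E] (φ : Module.Dual ℂ H) (a : E) (x : H)
    (t : E ⊗[ℂ] H) :
    sliceRight φ (t * a ⊗ₜ[ℂ] x) = sliceRight (φ ∘ₗ LinearMap.mulRight ℂ x) t * a := by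
  induction t with
  | zero => simp
  | add c d hc hd => simp only [add_mul, map_add, hc, hd]
  | tmul c d => simp

theorem Tplus_apply_mul (φ : Module.Dual ℂ H) (x : H) {g : H} {ι : Type*} (r : Repr ℂ g ι) :
    Tplus H φ (g * x) = ∑ i ∈ r.index, r.left i * Tplus H (φ ∘ₗ LinearMap.mulLeft ℂ (r.right i)) x := by
  simp only [Tplus, LinearMap.comp_apply, LinearMap.lcomp_apply, Bialgebra.comul_mul, ← r.eq,
    Finset.sum_mul, map_sum]
  refine Finset.sum_congr rfl fun i _ => ?_
  induction comul (R := ℂ) x with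
  | zero => simp
  | add c d hc hd => simp only [mul_add, map_add, hc, hd]
  | tmul c d => simp

theorem TbarPlus_apply_mul_tmul {A : Type*} [Ring A] [Algebra ℂ A] (β : RightComoduleAlgebra H A)
    (φ : Module.Dual ℂ H) (a x : A) {ι : Type*} (s : Finset ι) (l : ι → A) (r : ι → H)
    (h : ∑ i ∈ s, l i ⊗ₜ[ℂ] r i = β.coact a) :
    TbarPlus β φ (a * x) = ∑ i ∈ s, l i * TbarPlus β (φ ∘ₗ LinearMap.mulLeft ℂ (r i)) x := by
  simp only [TbarPlus_apply, map_mul, ← h, Finset.sum_mul, map_sum]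
  refine Finset.sum_congr rfl fun i _ => ?_
  induction β.coact x with
  | zero => simp
  | add c d hc hd => simp only [mul_add, map_add, hc, hd]
  | tmul c d => simp

theorem TbarPlus_apply_tmul_mul {A : Type*} [Ring A] [Algebra ℂ A] (β : RightComoduleAlgebra H A)
    (φ : Module.Dual ℂ H) (x b : A) {ι : Type*} (s : Finset ι) (l : ι → A) (r : ι → H)
    (h : ∑ i ∈ s, l i ⊗ₜ[ℂ] r i = β.coact b) :
    TbarPlus β φ (x * b) = ∑ i ∈ s, TbarPlus β (φ ∘ₗ LinearMap.mulRight ℂ (r i)) x * l i := by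
  simp only [TbarPlus_apply, map_mul, ← h, Finset.mul_sum, map_sum]
  refine Finset.sum_congr rfl fun i _ => ?_
  induction β.coact x with
  | zero => simp
  | add c d hc hd => simp only [add_mul, map_add, hc, hd]
  | tmul c d => simp

/-- `t₊ (L₊ᵍ ⊗ 1) = ∑ (L₊^{g⁽¹⁾} ⊗ g⁽²⁾) t₊`. -/
theorem toTensor_Tplus_mul_Lplus (g : H) :
    toTensor (Tplus H) * Lplus H g ⊗ₜ[ℂ] 1 =
      (Lplus H).rTensor H (comul g) * toTensor (Tplus H) := by
  let r := Repr.arbitrary ℂ g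
  refine eq_of_sliceRight_eq fun φ => LinearMap.ext fun x => ?_
  rw [sliceRight_mul_tmul_one, ← r.eq]
  simp only [map_sum, Finset.sum_mul, LinearMap.rTensor_tmul, sliceRight_tmul_mul,
    sliceRight_toTensor, LinearMap.sum_apply, Module.End.mul_apply]
  exact Tplus_apply_mul φ x r

/-- Conjugation of an operator by the antipode. -/
def antipodeConj (H : Type*) [Ring H] [HopfAlgebra ℂ H] : Module.End ℂ H →ₗ[ℂ] Module.End ℂ H :=
  LinearMap.mulLeft ℂ (antipode ℂ : Module.End ℂ H) ∘ₗ LinearMap.mulRight ℂ (antipode ℂ)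

theorem antipodeConj_apply (f : Module.End ℂ H) (x : H) :
    antipodeConj H f x = antipode ℂ (f (antipode ℂ x)) := rfl

variable (hS : ∀ x : H, antipode ℂ (antipode ℂ x) = x)
include hS

theorem antipodeConj_mul (f g : Module.End ℂ H) :
    antipodeConj H (f * g) = antipodeConj H f * antipodeConj H g := by
  ext x; simp [antipodeConj_apply, hS]

theorem antipodeConj_one : antipodeConj H 1 = 1 := by
  ext x; simp [antipodeConj_apply, hS]

theorem antipodeConj_antipodeConj (f : Module.End ℂ H) :
    antipodeConj H (antipodeConj H f) = f := by
  ext x; simp [antipodeConj_apply, hS]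

theorem antipodeConj_Lplus (g : H) : antipodeConj H (Lplus H g) = Lminus H g := by
  ext x; simp [antipodeConj_apply, Lplus, Lminus, antipode_mul_antidistrib, hS]

theorem antipodeConj_Tplus (φ : Module.Dual ℂ H) : antipodeConj H (Tplus H φ) = Tminus H φ := by
  ext x
  rw [antipodeConj_apply, Tminus_apply_repr φ (Repr.arbitrary ℂ x), Tplus, LinearMap.comp_apply,
    LinearMap.lcomp_apply, comul_antipode, ← (Repr.arbitrary ℂ x).eq]
  simp [hS]

theorem commute_Lplus_antipodeConj (g k : H) : Commute (Lplus H g) (antipodeConj H (Lplus H k)) := by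
  rw [antipodeConj_Lplus hS]
  ext x; simp [Lplus, Lminus, mul_assoc]

theorem commute_Tplus_antipodeConj (φ ψ : Module.Dual ℂ H) :
    Commute (Tplus H φ) (antipodeConj H (Tplus H ψ)) := by
  rw [antipodeConj_Tplus hS]
  ext x
  have h := congrArg (TensorProduct.lift ((LinearMap.lsmul ℂ H ∘ₗ ψ ∘ₗ antipode ℂ).compl₂
    (sliceRight φ))) (coassoc_apply (R := ℂ) x)
  have h1 : (Tplus H φ * Tminus H ψ) x = TensorProduct.lift ((LinearMap.lsmul ℂ H ∘ₗ ψ ∘ₗ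
      antipode ℂ).compl₂ (sliceRight φ)) (comul.lTensor H (comul x)) := by
    simp only [Tplus, Tminus, LinearMap.comp_apply, Module.End.mul_apply, LinearMap.lcomp_apply]
    induction comul (R := ℂ) x with
    | zero => simp
    | add a b ha hb => simp only [map_add, ha, hb]
    | tmul a b => simp
  have h2 : (Tminus H ψ * Tplus H φ) x = TensorProduct.lift ((LinearMap.lsmul ℂ H ∘ₗ ψ ∘ₗ
      antipode ℂ).compl₂ (sliceRight φ)) (TensorProduct.assoc ℂ H H H
        (comul.rTensor H (comul x))) := by
    simp only [Tplus, Tminus, LinearMap.comp_apply, Module.End.mul_apply, LinearMap.lcomp_apply]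
    induction comul (R := ℂ) x with
    | zero => simp
    | add a b ha hb => simp only [map_add, ha, hb]
    | tmul a b =>
      simp only [sliceRight_tmul, map_smul, LinearMap.rTensor_tmul]
      induction comul (R := ℂ) a with
      | zero => simp
      | add c d hc hd => simp only [map_add, smul_add, TensorProduct.add_tmul, hc, hd]
      | tmul c d => simp [smul_smul, mul_comm]
  rw [h1, h2, h]

end EdgeIdentities

/-! ### Identities for the projection of an edge to the Haar integral -/

section PinIdentities

open Coalgebra HopfAlgebra

variable {H : Type*} [Ring H] [HopfAlgebra ℂ H] [StarRing H] [StarModule ℂ H]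
  [FiniteDimensional ℂ H] (hH : IsCStarHopfAlgebra H)

/-- The operator `x ↦ ∑ χ(x⁽²⁾ y) x⁽¹⁾` for the dual Haar integral `χ`. -/
def haarTplus (H : Type*) [Ring H] [HopfAlgebra ℂ H] (y : H) : Module.End ℂ H :=
  Tplus H (dualHaarIntegral H ∘ₗ LinearMap.mulRight ℂ y)

include hH

theorem IsCStarHopfAlgebra.Lplus_haarIntegral_apply (x : H) :
    Lplus H (haarIntegral H) x = counit (R := ℂ) x • haarIntegral H :=
  hH.isHaarIntegral.2.1 x

/-- The invariance of χ moves the comultiplication from x to y. In this form the operator depends on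
x only through the functional χ(x ·), so compositions with the rank-one pin can be computed. -/
theorem IsCStarHopfAlgebra.haarTplus_apply (x : H) {y : H} {ι : Type*} (q : Repr ℂ y ι) :
    haarTplus H y x = ∑ i ∈ q.index, dualHaarIntegral H (x * q.right i) • antipode ℂ (q.left i) := by
  let r := Repr.arbitrary ℂ x
  have h := congrArg (antipode ℂ)
    (sum_integral_mul_right hH.isDualHaarIntegral.1 r q)
  simp only [map_sum, map_smul, hH.antipode_antipode] at h
  rw [← h, haarTplus, Tplus_apply_repr _ r]
  rfl

theorem IsCStarHopfAlgebra.haarTplus_haarIntegral (y : H) :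
    haarTplus H y (haarIntegral H) =
      dualHaarIntegral H (haarIntegral H) • antipode ℂ y := by
  let q := Repr.arbitrary ℂ y
  rw [hH.haarTplus_apply _ q]
  simp only [hH.isHaarIntegral.2.1, map_smul, smul_eq_mul]
  conv_rhs => rw [← sum_smul_counit q, map_sum, Finset.smul_sum]
  refine Finset.sum_congr rfl fun i _ => ?_
  rw [map_smul, smul_smul, mul_comm]

theorem IsCStarHopfAlgebra.counit_haarTplus (x y : H) :
    counit (R := ℂ) (haarTplus H y x) = dualHaarIntegral H (x * y) := by
  let q := Repr.arbitrary ℂ y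
  rw [hH.haarTplus_apply _ q]
  conv_rhs => rw [← sum_counit_smul q, Finset.mul_sum, map_sum]
  simp [counit_antipode, mul_comm]

/-- The right factor followed by ε produces χ(x y⁽²⁾), and the left factor applied to h produces
χ(h) S(y⁽¹⁾). This is the single-edge source of B P B = χ(h) B. -/
theorem IsCStarHopfAlgebra.sum_haarTplus_mul_pin_mul {y : H} {ι : Type*} (q : Repr ℂ y ι) :
    ∑ i ∈ q.index, haarTplus H (q.left i) * Lplus H (haarIntegral H) * haarTplus H (q.right i) =
      dualHaarIntegral H (haarIntegral H) • haarTplus H y := by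
  ext x
  rw [LinearMap.smul_apply, hH.haarTplus_apply x q]
  simp only [LinearMap.sum_apply, Module.End.mul_apply, hH.Lplus_haarIntegral_apply, map_smul,
    hH.counit_haarTplus, hH.haarTplus_haarIntegral, Finset.smul_sum]
  exact Finset.sum_congr rfl fun i _ => smul_comm _ _ _

/-- A rank-one computation, using χ(hy) = ε(y) χ(h); the single-edge source of P B P = χ(h) P. -/
theorem IsCStarHopfAlgebra.pin_mul_haarTplus_mul_pin (y : H) :
    Lplus H (haarIntegral H) * haarTplus H y * Lplus H (haarIntegral H) =
      (dualHaarIntegral H (haarIntegral H) * counit (R := ℂ) y) • Lplus H (haarIntegral H) := by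
  ext x
  simp only [Module.End.mul_apply, hH.Lplus_haarIntegral_apply, map_smul, hH.counit_haarTplus,
    hH.isHaarIntegral.2.1, LinearMap.smul_apply, smul_smul, smul_eq_mul]
  congr 1
  ring

theorem IsCStarHopfAlgebra.Tminus_antipode (φ : Module.Dual ℂ H) {y : H} {ι : Type*}
    (q : Repr ℂ y ι) :
    antipodeConj H (Tplus H φ) (antipode ℂ y) =
      ∑ i ∈ q.index, φ (q.right i) • antipode ℂ (q.left i) := by
  rw [antipodeConj_apply, hH.antipode_antipode, Tplus_apply_repr φ q]
  simp

/-- After the pin, the label is a multiple of S(y), on which the opposite side of the edge reads off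
y⁽²⁾. That letter is what the rest of the face contributes, so the edge can be replaced by the path
along its other side. -/
theorem IsCStarHopfAlgebra.Tminus_mul_haarTplus_mul_pin (φ : Module.Dual ℂ H) {y : H} {ι : Type*}
    (q : Repr ℂ y ι) :
    antipodeConj H (Tplus H φ) * haarTplus H y * Lplus H (haarIntegral H) =
      ∑ i ∈ q.index, φ (q.right i) • (haarTplus H (q.left i) * Lplus H (haarIntegral H)) := by
  ext x
  simp only [Module.End.mul_apply, hH.Lplus_haarIntegral_apply, map_smul,
    hH.haarTplus_haarIntegral, hH.Tminus_antipode φ q, LinearMap.sum_apply, LinearMap.smul_apply,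
    Finset.smul_sum]
  exact Finset.sum_congr rfl fun i _ => by simp only [smul_smul]; congr 1; ring

theorem IsCStarHopfAlgebra.sum_comul_haarIntegral_mul_antipode {ι : Type*}
    (r : Repr ℂ (haarIntegral H) ι) :
    ∑ i ∈ r.index, comul (R := ℂ) (r.right i) * (1 ⊗ₜ[ℂ] antipode ℂ (r.left i)) =
      haarIntegral H ⊗ₜ[ℂ] 1 := by
  let r' : Repr ℂ (haarIntegral H) ι := ⟨r.index, r.right, r.left, by
    conv_rhs => rw [← hH.comm_comul_haarIntegral, ← r.eq]
    simp⟩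
  simpa using sum_comul_mul_antipode (1 : H) r'

/-- On the label h the letters of the two sides are h⁽²⁾ and S(h⁽¹⁾) up to rotation of the legs; by
cocommutativity they become adjacent and cancel. It serves to remove a dart followed by its reverse.
-/
theorem IsCStarHopfAlgebra.Tplus_mul_Tminus_mul_pin :
    toTensor (Tplus H) * (antipodeConj H).rTensor H (toTensor (Tplus H)) *
      (Lplus H (haarIntegral H)) ⊗ₜ[ℂ] 1 = (Lplus H (haarIntegral H)) ⊗ₜ[ℂ] 1 := by
  have h1 : ∀ (x : H) (u : Module.End ℂ H ⊗[ℂ] H),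
      (LinearMap.applyₗ x).rTensor H (toTensor (Tplus H) * u) =
      (LinearMap.mul' ℂ (H ⊗[ℂ] H) ∘ₗ TensorProduct.map comul
        (TensorProduct.mk ℂ H H 1)) ((LinearMap.applyₗ x).rTensor H u) := fun x u => by
    induction u with
    | zero => simp
    | add a b ha hb => simp only [mul_add, map_add, ha, hb]
    | tmul a b =>
      refine eq_of_sliceRight_eq fun φ => ?_
      rw [sliceRight_rTensor, sliceRight_mul_tmul, sliceRight_toTensor]
      simp only [LinearMap.applyₗ_apply_apply, Module.End.mul_apply, Tplus, LinearMap.comp_apply,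
        LinearMap.lcomp_apply, LinearMap.rTensor_tmul, TensorProduct.map_tmul,
        TensorProduct.mk_apply, LinearMap.mul'_apply]
      induction comul (R := ℂ) (a x) with
      | zero => simp
      | add c d hc hd => simp only [add_mul, map_add, hc, hd]
      | tmul c d => simp
  have h2 : (LinearMap.applyₗ (haarIntegral H)).rTensor H
      ((antipodeConj H).rTensor H (toTensor (Tplus H))) =
      TensorProduct.comm ℂ H H ((antipode ℂ).rTensor H (comul (R := ℂ) (haarIntegral H))) := by
    refine eq_of_sliceRight_eq fun φ => ?_
    rw [sliceRight_rTensor, sliceRight_rTensor, sliceRight_toTensor, LinearMap.applyₗ_apply_apply,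
      antipodeConj_Tplus hH.antipode_antipode]
    let r := Repr.arbitrary ℂ (haarIntegral H)
    rw [Tminus_apply_repr φ r, ← r.eq]
    simp
  refine eq_of_sliceRight_eq fun φ => LinearMap.ext fun x => ?_
  rw [sliceRight_mul_tmul_one, sliceRight_tmul, Module.End.mul_apply, LinearMap.smul_apply,
    hH.Lplus_haarIntegral_apply, map_smul, smul_comm]
  congr 1
  have h3 := congrArg (sliceRight φ) (h1 (haarIntegral H)
    ((antipodeConj H).rTensor H (toTensor (Tplus H))))
  rw [sliceRight_rTensor, h2, LinearMap.applyₗ_apply_apply] at h3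
  let r := Repr.arbitrary ℂ (haarIntegral H)
  rw [h3, ← r.eq]
  have h4 := congrArg (sliceRight φ) (hH.sum_comul_haarIntegral_mul_antipode r)
  simpa using h4

end PinIdentities

/-! ## Operators on the edges of a lattice -/

theorem DiskLattice.not_isOuter_flip {D : Type*} (L : DiskLattice D) {d : D} (h : L.IsOuter d) :
    ¬ L.IsOuter (L.flip d) := fun h' =>
  (L.pos_flip d).1 (L.outer_pos _ h') (L.outer_pos _ h)

/-- Commuting representations of the operators on `H` for the bulk darts and of the operators on `A`
for the boundary edges. Reversing a dart corresponds to conjugation by the antipode. -/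
structure EdgeSystem {D : Type*} (L : DiskLattice D) (H A V : Type*) [Ring H] [HopfAlgebra ℂ H]
    [Ring A] [Algebra ℂ A] [AddCommGroup V] [Module ℂ V] where
  bulk : D → Module.End ℂ H →ₗ[ℂ] Module.End ℂ V
  bdry : D → Module.End ℂ A →ₗ[ℂ] Module.End ℂ V
  bulk_mul : ∀ d f g, bulk d (f * g) = bulk d f * bulk d g
  bulk_one : ∀ d, ¬ L.IsOuter d → ¬ L.IsOuter (L.flip d) → bulk d 1 = 1
  bulk_flip : ∀ d f, bulk (L.flip d) f = bulk d (antipodeConj H f)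
  bulk_comm : ∀ d d', d' ≠ d → d' ≠ L.flip d → ∀ f g, Commute (bulk d f) (bulk d' g)
  bdry_mul : ∀ o f g, bdry o (f * g) = bdry o f * bdry o g
  bdry_one : ∀ o, L.IsOuter o → bdry o 1 = 1
  bdry_comm : ∀ o o', o ≠ o' → ∀ f g, Commute (bdry o f) (bdry o' g)
  bulk_bdry_comm : ∀ d o f g, Commute (bulk d f) (bdry o g)

theorem rTensor_mul_of_mul {B C H : Type*} [Ring B] [Algebra ℂ B] [Ring C] [Algebra ℂ C] [Ring H]
    [Algebra ℂ H] {κ : B →ₗ[ℂ] C} (h : ∀ x y, κ (x * y) = κ x * κ y) (s t : B ⊗[ℂ] H) :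
    κ.rTensor H (s * t) = κ.rTensor H s * κ.rTensor H t := by
  induction s with
  | zero => simp
  | add a b ha hb => simp only [add_mul, map_add, ha, hb]
  | tmul a b =>
    induction t with
    | zero => simp
    | add c d hc hd => simp only [mul_add, map_add, hc, hd]
    | tmul c d => simp [h]

/-- The convolution ring of linear maps from `H` to an algebra. -/
abbrev ConvRing (H R : Type*) [Ring H] [HopfAlgebra ℂ H] [Ring R] [Algebra ℂ R] : Type _ :=
  WithConv (H →ₗ[ℂ] R)

/-- The inclusion of `H` in the convolution ring of maps into `E ⊗ H`. -/
def inclConv (E H : Type*) [Ring E] [Algebra ℂ E] [Ring H] [HopfAlgebra ℂ H] :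
    ConvRing H (E ⊗[ℂ] H) :=
  .toConv (Algebra.TensorProduct.includeRight (R := ℂ)).toLinearMap

namespace EdgeSystem

open Coalgebra HopfAlgebra WithConv

variable {D : Type*} {L : DiskLattice D} {H A V : Type*} [Ring H] [HopfAlgebra ℂ H]
    [FiniteDimensional ℂ H]
    [Ring A] [Algebra ℂ A] [AddCommGroup V] [Module ℂ V] (M : EdgeSystem L H A V)
    (β : RightComoduleAlgebra H A)

open scoped Classical in
/-- The tensor whose slices are the operators of the dart on the face to its left. -/
def T (d : D) : Module.End ℂ V ⊗[ℂ] H :=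
  if L.IsOuter (L.flip d) then (M.bdry (L.flip d)).rTensor H (toTensor (TbarPlus β))
  else (M.bulk d).rTensor H (toTensor (Tplus H))

/-- The operators of a dart on the vertex it starts from. -/
def l (d : D) : H →ₗ[ℂ] Module.End ℂ V := M.bulk d ∘ₗ Lplus H

theorem T_of_isOuter {o : D} (h : L.IsOuter o) :
    M.T β (L.flip o) = (M.bdry o).rTensor H (toTensor (TbarPlus β)) := by
  rw [T, L.flip_flip, if_pos h]

theorem T_of_not_isOuter {d : D} (h : ¬ L.IsOuter (L.flip d)) :
    M.T β d = (M.bulk d).rTensor H (toTensor (Tplus H)) := by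
  rw [T, if_neg h]

theorem sliceRight_T_of_not_isOuter {d : D} (h : ¬ L.IsOuter (L.flip d)) (φ : Module.Dual ℂ H) :
    sliceRight φ (M.T β d) = M.bulk d (Tplus H φ) := by
  rw [T_of_not_isOuter M β h, sliceRight_rTensor, sliceRight_toTensor]

theorem sliceRight_T_of_isOuter {o : D} (h : L.IsOuter o) (φ : Module.Dual ℂ H) :
    sliceRight φ (M.T β (L.flip o)) = M.bdry o (TbarPlus β φ) := by
  rw [T_of_isOuter M β h, sliceRight_rTensor, sliceRight_toTensor]

theorem isCorep_T {d : D} (hd : ¬ L.IsOuter d) : IsCorep (M.T β d) := by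
  by_cases h : L.IsOuter (L.flip d)
  · rw [← L.flip_flip d]
    exact ⟨by rw [sliceRight_T_of_isOuter M β h, TbarPlus_counit, M.bdry_one _ h],
      fun φ ψ => by simp only [sliceRight_T_of_isOuter M β h, TbarPlus_dualMul, M.bdry_mul]⟩
  · exact ⟨by rw [sliceRight_T_of_not_isOuter M β h, Tplus_counit, M.bulk_one _ hd h],
      fun φ ψ => by simp only [sliceRight_T_of_not_isOuter M β h, Tplus_dualMul, M.bulk_mul]⟩

theorem commute_bulk_T {d x : D} (h : x ≠ d) (h' : x ≠ L.flip d) (f : Module.End ℂ H)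
    (φ : Module.Dual ℂ H) : Commute (M.bulk d f) (sliceRight φ (M.T β x)) := by
  by_cases hx : L.IsOuter (L.flip x)
  · rw [← L.flip_flip x, sliceRight_T_of_isOuter M β hx]
    exact M.bulk_bdry_comm _ _ _ _
  · rw [sliceRight_T_of_not_isOuter M β hx]
    exact M.bulk_comm _ _ h h' _ _

theorem commute_bdry_T {o x : D} (h : x ≠ L.flip o) (f : Module.End ℂ A)
    (φ : Module.Dual ℂ H) : Commute (M.bdry o f) (sliceRight φ (M.T β x)) := by
  by_cases hx : L.IsOuter (L.flip x)
  · rw [← L.flip_flip x, sliceRight_T_of_isOuter M β hx]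
    exact M.bdry_comm _ _ (fun h' => h (by rw [h', L.flip_flip])) _ _
  · rw [sliceRight_T_of_not_isOuter M β hx]
    exact (M.bulk_bdry_comm _ _ _ _).symm

theorem slicesCommute_T (hS : ∀ x : H, antipode ℂ (antipode ℂ x) = x) {d x : D} (h : d ≠ x) :
    SlicesCommute (M.T β d) (M.T β x) := by
  intro φ ψ
  by_cases hd : L.IsOuter (L.flip d)
  · rw [← L.flip_flip d, sliceRight_T_of_isOuter M β hd]
    exact M.commute_bdry_T β (by rw [L.flip_flip]; exact h.symm) _ _
  · rw [sliceRight_T_of_not_isOuter M β hd]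
    by_cases hx : x = L.flip d
    · subst hx
      by_cases hd' : L.IsOuter d
      · rw [sliceRight_T_of_isOuter M β hd']
        exact M.bulk_bdry_comm _ _ _ _
      · rw [sliceRight_T_of_not_isOuter M β (by rwa [L.flip_flip]), M.bulk_flip, Commute,
          SemiconjBy, ← M.bulk_mul, ← M.bulk_mul, (commute_Tplus_antipodeConj hS φ ψ).eq]
    · exact M.commute_bulk_T β h.symm hx _ _

theorem commute_l (hS : ∀ x : H, antipode ℂ (antipode ℂ x) = x) {d x : D} (h : d ≠ x) (g k : H) :
    Commute (M.l d g) (M.l x k) := by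
  by_cases hx : x = L.flip d
  · subst hx
    simp only [l, LinearMap.comp_apply, M.bulk_flip, Commute, SemiconjBy]
    rw [← M.bulk_mul, ← M.bulk_mul, (commute_Lplus_antipodeConj hS g k).eq]
  · exact M.bulk_comm _ _ h.symm hx _ _

theorem l_mul (d : D) (g k : H) : M.l d (g * k) = M.l d g * M.l d k := by
  rw [l, LinearMap.comp_apply, LinearMap.comp_apply, LinearMap.comp_apply, ← M.bulk_mul]
  congr 1
  ext x; simp [Lplus, mul_assoc]

/-- The operators `l` in the convolution ring of maps into `End V ⊗ H`. -/
def lConv (d : D) : ConvRing H (Module.End ℂ V ⊗[ℂ] H) :=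
  toConv ((Algebra.TensorProduct.includeLeft (R := ℂ) (S := ℂ)).toLinearMap ∘ₗ M.l d)

/-- The comultiplication is multiplicative, so left multiplication by g passes the dual action at
the cost of a letter g⁽²⁾ in the word of the face. This letter is the twist `inclConv`. -/
theorem constConv_T_mul_lConv {d : D} (hd : ¬ L.IsOuter (L.flip d)) :
    constConv H (M.T β d) * M.lConv d =
      M.lConv d * inclConv _ H * constConv H (M.T β d) := by
  ext g
  rw [constConv_mul_apply, mul_constConv_apply]
  have h1 : (M.lConv d * inclConv (Module.End ℂ V) H) g =
      (M.bulk d).rTensor H ((Lplus H).rTensor H (comul g)) := by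
    rw [LinearMap.convMul_apply]
    induction comul (R := ℂ) g with
    | zero => simp
    | add a b ha hb => simp only [map_add, ha, hb]
    | tmul a b => simp [lConv, inclConv, l]
  have h2 : M.lConv d g = (M.bulk d).rTensor H (Lplus H g ⊗ₜ[ℂ] 1) := rfl
  rw [h1, h2, T_of_not_isOuter M β hd, ← rTensor_mul_of_mul (M.bulk_mul d),
    ← rTensor_mul_of_mul (M.bulk_mul d), toTensor_Tplus_mul_Lplus]

/-- Read on the reversed dart, l is right multiplication by S(g). The letter that compensates it
comes from g⁽¹⁾, hence the twist stands to the left of l. -/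
theorem lConv_mul_constConv_T (hS : ∀ x : H, antipode ℂ (antipode ℂ x) = x) {d : D}
    (hd : ¬ L.IsOuter d) :
    M.lConv d * constConv H (M.T β (L.flip d)) =
      constConv H (M.T β (L.flip d)) * inclConv _ H * M.lConv d := by
  have key : ∀ (g : H) (φ : Module.Dual ℂ H) (r : Repr ℂ g (H × H)), Lminus H g * Tplus H φ =
      ∑ i ∈ r.index, Tplus H (φ ∘ₗ LinearMap.mulRight ℂ (r.left i)) * Lminus H (r.right i) :=
    fun g φ r => LinearMap.ext fun x => by
      let q : Repr ℂ (antipode ℂ g) (H × H) := ⟨r.index, fun i => antipode ℂ (r.right i),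
        fun i => antipode ℂ (r.left i), by rw [comul_antipode, ← r.eq]; simp⟩
      have h1 := congrArg (sliceRight φ) (sum_comul_mul_antipode x q)
      rw [map_sum] at h1
      simp only [q, hS] at h1
      simp only [LinearMap.sum_apply, Module.End.mul_apply, Tplus, LinearMap.comp_apply,
        LinearMap.lcomp_apply, Lminus, LinearMap.flip_apply, LinearMap.mul_apply']
      have h2 : ∀ (u : H ⊗[ℂ] H) (z : H), sliceRight φ (u * (1 ⊗ₜ[ℂ] z)) =
          sliceRight (φ ∘ₗ LinearMap.mulRight ℂ z) u := fun u z => by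
        rw [sliceRight_mul_tmul, mul_one]
      simp only [h2] at h1
      rw [h1, sliceRight_mul_tmul_one]
  ext g
  rw [mul_constConv_apply, mul_assoc, constConv_mul_apply]
  have h0 : ∀ k, M.l d k = M.bulk (L.flip d) (Lminus H k) := fun k => by
    rw [M.bulk_flip, ← antipodeConj_Lplus hS, antipodeConj_antipodeConj hS]; rfl
  have h2 : M.lConv d g = (M.bulk (L.flip d)).rTensor H (Lminus H g ⊗ₜ[ℂ] 1) := by
    rw [LinearMap.rTensor_tmul, ← h0]; rfl
  let r := Repr.arbitrary ℂ g
  have h1 : (inclConv (Module.End ℂ V) H * M.lConv d) g = (M.bulk (L.flip d)).rTensor H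
      (∑ i ∈ r.index, Lminus H (r.right i) ⊗ₜ[ℂ] r.left i) := by
    rw [r.convMul_apply, map_sum]
    simp [lConv, inclConv, h0]
  rw [h1, h2, T_of_not_isOuter M β (by rwa [L.flip_flip]),
    ← rTensor_mul_of_mul (M.bulk_mul (L.flip d)), ← rTensor_mul_of_mul (M.bulk_mul (L.flip d))]
  congr 1
  refine eq_of_sliceRight_eq fun φ => ?_
  rw [sliceRight_tmul_one_mul, sliceRight_toTensor, key g φ r, Finset.mul_sum, map_sum]
  simp only [sliceRight_mul_tmul, sliceRight_toTensor]

end EdgeSystem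

/-! ### Words of darts and their face operators -/

section CorepSums

open Coalgebra

variable {E H : Type*} [Ring E] [Algebra ℂ E] [Ring H] [HopfAlgebra ℂ H] [FiniteDimensional ℂ H]

theorem sliceRight_mul_eq_sum_right {ι : Type*} [Fintype ι] (b : Module.Basis ι ℂ H)
    (φ : Module.Dual ℂ H) (s t : E ⊗[ℂ] H) : sliceRight φ (s * t) =
      ∑ j, sliceRight (φ ∘ₗ LinearMap.mulRight ℂ (b j)) s * sliceRight (b.coord j) t := by
  conv_lhs => rw [← sum_sliceRight_tmul b t]
  simp only [Finset.mul_sum, map_sum, sliceRight_mul_tmul]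

/-- The corepresentation identity, contracted with F. It turns a product of two slices along the
same path into a single slice, which is how the rest of a face is handled in the merging lemmas. -/
theorem IsCorep.sum_mul {t : E ⊗[ℂ] H} (h : IsCorep t) {ι : Type*} [Fintype ι]
    (b : Module.Basis ι ℂ H) (F : H ⊗[ℂ] H →ₗ[ℂ] E) :
    ∑ i, ∑ j, F (b i ⊗ₜ[ℂ] b j) * (sliceRight (b.coord i) t * sliceRight (b.coord j) t) =
      ∑ k, F (comul (b k)) * sliceRight (b.coord k) t := by
  have h1 := congrArg (TensorProduct.lift ((LinearMap.mul ℂ E).flip.compl₂ F)) (h.lTensor_comul b)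
  conv at h1 => enter [1, 2, 2]; rw [← sum_sliceRight_tmul b t]
  simpa using h1.symm

theorem IsDualHaarIntegral.sliceRight_mul {t : E ⊗[ℂ] H} {χ : Module.Dual ℂ H}
    (hχ : IsDualHaarIntegral H χ) (ht : IsCorep t) (φ : Module.Dual ℂ H) :
    sliceRight φ t * sliceRight χ t = φ 1 • sliceRight χ t := by
  rw [← ht.dualMul, hχ.1, map_smul, LinearMap.smul_apply]

end CorepSums

namespace EdgeSystem

open Coalgebra HopfAlgebra WithConv

variable {D : Type*} {L : DiskLattice D} {H A V : Type*} [Ring H] [HopfAlgebra ℂ H]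
  [FiniteDimensional ℂ H] [Ring A] [Algebra ℂ A] [AddCommGroup V] [Module ℂ V]
  (M : EdgeSystem L H A V) (β : RightComoduleAlgebra H A)

/-- The projection of the edge of a bulk dart to the Haar integral. -/
def pin (d : D) : Module.End ℂ V := M.bulk d (Lplus H (haarIntegral H))

/-- The tensor of a word of darts. -/
def word (w : List D) : Module.End ℂ V ⊗[ℂ] H := (w.map (M.T β)).prod

/-- The face operator of a word of darts. -/
def B (w : List D) : Module.End ℂ V := sliceRight (dualHaarIntegral H) (M.word β w)

@[simp] theorem word_cons (d : D) (w : List D) : M.word β (d :: w) = M.T β d * M.word β w := by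
  simp [word]

@[simp] theorem word_append (u w : List D) : M.word β (u ++ w) = M.word β u * M.word β w := by
  simp [word]

theorem commute_word {z : Module.End ℂ V} {w : List D}
    (h : ∀ d ∈ w, ∀ φ, Commute z (sliceRight φ (M.T β d))) (φ : Module.Dual ℂ H) :
    Commute z (sliceRight φ (M.word β w)) := by
  refine commute_tmul_one_iff.1 (Commute.list_prod_right _ _ fun t ht => ?_) φ
  obtain ⟨d, hd, rfl⟩ := List.mem_map.1 ht
  exact commute_tmul_one_iff.2 (h d hd)

theorem commute_bulk_word {d : D} {w : List D} (h : d ∉ w) (h' : L.flip d ∉ w)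
    (f : Module.End ℂ H) (φ : Module.Dual ℂ H) :
    Commute (M.bulk d f) (sliceRight φ (M.word β w)) :=
  M.commute_word β (fun _ hx => M.commute_bulk_T β (ne_of_mem_of_not_mem hx h)
    (ne_of_mem_of_not_mem hx h') f) φ

variable [StarRing H] [StarModule ℂ H] (hH : IsCStarHopfAlgebra H)
include hH

theorem slicesCommute_word {u w : List D} (h : u.Disjoint w) :
    SlicesCommute (M.word β u) (M.word β w) := by
  refine SlicesCommute.list_prod fun s hs t ht => ?_
  obtain ⟨d, hd, rfl⟩ := List.mem_map.1 hs
  obtain ⟨x, hx, rfl⟩ := List.mem_map.1 ht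
  exact M.slicesCommute_T β hH.antipode_antipode fun h' => h hd (h' ▸ hx)

theorem isCorep_word {w : List D} (hw : w.Nodup) (hi : ∀ d ∈ w, ¬ L.IsOuter d) :
    IsCorep (M.word β w) := by
  refine IsCorep.list_prod (fun t ht => ?_) ?_
  · obtain ⟨d, hd, rfl⟩ := List.mem_map.1 ht
    exact M.isCorep_T β (hi d hd)
  · rw [List.pairwise_map]
    exact hw.imp fun h => M.slicesCommute_T β hH.antipode_antipode h

theorem commute_B {u w : List D} (h : u.Disjoint w) : Commute (M.B β u) (M.B β w) :=
  M.slicesCommute_word β hH h _ _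

theorem sliceRight_word_mul_B {w : List D} (hw : w.Nodup) (hi : ∀ d ∈ w, ¬ L.IsOuter d)
    (φ : Module.Dual ℂ H) : sliceRight φ (M.word β w) * M.B β w = φ 1 • M.B β w :=
  hH.isDualHaarIntegral.sliceRight_mul (M.isCorep_word β hH hw hi) φ

theorem B_mul_B {w : List D} (hw : w.Nodup) (hi : ∀ d ∈ w, ¬ L.IsOuter d) :
    M.B β w * M.B β w = M.B β w := by
  have := M.sliceRight_word_mul_B β hH hw hi (dualHaarIntegral H)
  rwa [hH.isDualHaarIntegral.2.2, one_smul] at this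

theorem B_append_comm {u w : List D} (h : u.Disjoint w) : M.B β (u ++ w) = M.B β (w ++ u) := by
  rw [B, B, word_append, word_append]
  exact (M.slicesCommute_word β hH h).sliceRight_mul_comm hH.dualHaarIntegral_mul_comm

/-- Rotations exchange an initial and a final segment, and χ is a trace. -/
theorem B_of_isRotated {u w : List D} (hu : u.Nodup) (h : u ~r w) : M.B β u = M.B β w := by
  obtain ⟨n, rfl⟩ := h
  rw [← List.rotate_mod, List.rotate_eq_drop_append_take_mod, Nat.mod_mod]
  conv_lhs => rw [← List.take_append_drop (n % u.length) u]
  exact M.B_append_comm β hH (List.disjoint_take_drop hu le_rfl)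

/-! ### Pinned edges -/

theorem pin_flip (d : D) : M.pin (L.flip d) = M.pin d := by
  rw [pin, M.bulk_flip, antipodeConj_Lplus hH.antipode_antipode]
  congr 1
  ext x
  simp [Lminus, Lplus, hH.antipode_haarIntegral, hH.isHaarIntegral.1, hH.isHaarIntegral.2.1]

theorem l_mul_pin (d : D) (g : H) : M.l d g * M.pin d = counit (R := ℂ) g • M.pin d := by
  have : M.pin d = M.l d (haarIntegral H) := rfl
  rw [this, ← l_mul, hH.isHaarIntegral.1, map_smul]

theorem pin_mul_l (d : D) (g : H) : M.pin d * M.l d g = counit (R := ℂ) g • M.pin d := by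
  have : M.pin d = M.l d (haarIntegral H) := rfl
  rw [this, ← l_mul, hH.isHaarIntegral.2.1, map_smul]

theorem pin_mul_pin (d : D) : M.pin d * M.pin d = M.pin d := by
  have := M.l_mul_pin hH d (haarIntegral H)
  rwa [hH.isHaarIntegral.2.2, one_smul] at this

theorem commute_pin_l (d x : D) (g : H) : Commute (M.pin d) (M.l x g) := by
  by_cases h : d = x
  · subst h
    rw [Commute, SemiconjBy, M.l_mul_pin hH, M.pin_mul_l hH]
  · exact M.commute_l hH.antipode_antipode h _ _

theorem commute_pin_pin (d x : D) : Commute (M.pin d) (M.pin x) := M.commute_pin_l hH d x _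

omit hH in
theorem commute_pin_B {d : D} {w : List D} (h : d ∉ w) (h' : L.flip d ∉ w) :
    Commute (M.pin d) (M.B β w) := M.commute_bulk_word β h h' _ _

theorem word_flip_mul_pin {d : D} (hd : ¬ L.IsOuter d) (hd' : ¬ L.IsOuter (L.flip d)) :
    M.T β (L.flip d) * M.T β d * M.pin d ⊗ₜ[ℂ] 1 = M.pin d ⊗ₜ[ℂ] 1 := by
  have h := congrArg ((M.bulk (L.flip d)).rTensor H) hH.Tplus_mul_Tminus_mul_pin
  rw [rTensor_mul_of_mul (M.bulk_mul (L.flip d)), rTensor_mul_of_mul (M.bulk_mul (L.flip d)),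
    LinearMap.rTensor_tmul, ← LinearMap.comp_apply, ← LinearMap.rTensor_comp] at h
  have h1 : M.bulk (L.flip d) ∘ₗ antipodeConj H = M.bulk d := LinearMap.ext fun f => by
    rw [LinearMap.comp_apply, ← M.bulk_flip, L.flip_flip]
  rw [h1, ← M.T_of_not_isOuter β hd', ← M.T_of_not_isOuter β (by rwa [L.flip_flip])] at h
  rwa [← M.pin_flip hH]

/-- A dart that is followed by its reverse can be removed from a word when its edge is pinned. -/
theorem B_flip_cons_cons_mul_pin {d : D} {w : List D} (hd : ¬ L.IsOuter d)
    (hd' : ¬ L.IsOuter (L.flip d)) (h : d ∉ w) (h' : L.flip d ∉ w) :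
    M.B β (L.flip d :: d :: w) * M.pin d = M.B β w * M.pin d := by
  have hc : Commute (M.pin d ⊗ₜ[ℂ] (1 : H)) (M.word β w) :=
    commute_tmul_one_iff.2 (M.commute_bulk_word β h h' _)
  rw [B, B, ← sliceRight_mul_tmul_one, ← sliceRight_mul_tmul_one, word_cons, word_cons]
  congr 1
  rw [mul_assoc, mul_assoc, ← hc.eq, ← mul_assoc, ← mul_assoc, M.word_flip_mul_pin β hH hd hd']

/-! ### Merging two faces along a pinned edge -/

omit [StarRing H] [StarModule ℂ H] hH in
theorem B_cons_eq_sum {ι : Type*} [Fintype ι] (b : Module.Basis ι ℂ H) {d : D}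
    (hd' : ¬ L.IsOuter (L.flip d)) (p : List D) :
    M.B β (d :: p) = ∑ j, M.bulk d (haarTplus H (b j)) * sliceRight (b.coord j) (M.word β p) := by
  rw [B, word_cons, sliceRight_mul_eq_sum_right b]
  simp only [M.sliceRight_T_of_not_isOuter β hd', haarTplus]

variable {d : D} {p : List D} (hd' : ¬ L.IsOuter (L.flip d)) (hp : p.Nodup)
  (hi : ∀ x ∈ p, ¬ L.IsOuter x) (h : d ∉ p) (h' : L.flip d ∉ p)
include hd' hp hi h h'

/-- The edge d enters through `haarTplus`, which the pins reduce to χ(h) ε. The counit slice of the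
corepresentation along p is 1. -/
theorem pin_mul_B_mul_pin : M.pin d * M.B β (d :: p) * M.pin d =
    dualHaarIntegral H (haarIntegral H) • M.pin d := by
  let b := Module.finBasis ℂ H
  have hc : ∀ φ, Commute (M.pin d) (sliceRight φ (M.word β p)) := M.commute_bulk_word β h h' _
  have h1 := (M.isCorep_word β hH hp hi).counit
  rw [sliceRight_eq_sum b] at h1
  rw [M.B_cons_eq_sum β b hd', Finset.mul_sum, Finset.sum_mul]
  conv_rhs => rw [← mul_one (M.pin d), ← h1, Finset.mul_sum, Finset.smul_sum]
  refine Finset.sum_congr rfl fun j _ => ?_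
  rw [mul_assoc, mul_assoc, ← (hc _).eq, ← mul_assoc, ← mul_assoc]
  have h2 : M.pin d * M.bulk d (haarTplus H (b j)) * M.pin d =
      (dualHaarIntegral H (haarIntegral H) * counit (R := ℂ) (b j)) • M.pin d := by
    rw [pin, ← M.bulk_mul, ← M.bulk_mul, hH.pin_mul_haarTplus_mul_pin, map_smul]
  rw [h2, smul_mul_assoc, mul_smul_comm, smul_smul]

/-- The two copies of the path p combine by the corepresentation identity, and the edge d then
undergoes the single-edge identity for `haarTplus`. -/
theorem B_mul_pin_mul_B : M.B β (d :: p) * M.pin d * M.B β (d :: p) =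
    dualHaarIntegral H (haarIntegral H) • M.B β (d :: p) := by
  let b := Module.finBasis ℂ H
  have hc : ∀ f φ, Commute (M.bulk d f) (sliceRight φ (M.word β p)) := M.commute_bulk_word β h h'
  let G : H →ₗ[ℂ] Module.End ℂ H :=
    Tplus H ∘ₗ (LinearMap.mul ℂ H).flip.compr₂ (dualHaarIntegral H)
  have hG : ∀ y, G y = haarTplus H y := fun y => rfl
  let F : H ⊗[ℂ] H →ₗ[ℂ] Module.End ℂ V := M.bulk d ∘ₗ LinearMap.mul' ℂ _ ∘ₗ
    TensorProduct.map (LinearMap.mulRight ℂ (Lplus H (haarIntegral H)) ∘ₗ G) G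
  have hF : ∀ y, F (comul y) =
      dualHaarIntegral H (haarIntegral H) • M.bulk d (haarTplus H y) := fun y => by
    let q := Repr.arbitrary ℂ y
    rw [← map_smul, ← hH.sum_haarTplus_mul_pin_mul q, ← q.eq]
    simp [F, hG]
  have h1 := (M.isCorep_word β hH hp hi).sum_mul b F
  simp only [hF, smul_mul_assoc, ← Finset.smul_sum, ← M.B_cons_eq_sum β b hd'] at h1
  rw [← h1, M.B_cons_eq_sum β b hd', Finset.sum_mul, Finset.sum_mul_sum]
  refine Finset.sum_congr rfl fun i _ => Finset.sum_congr rfl fun j _ => ?_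
  have h2 : F (b i ⊗ₜ[ℂ] b j) = M.bulk d (haarTplus H (b i)) * M.pin d *
      M.bulk d (haarTplus H (b j)) := by
    simp [F, hG, pin, M.bulk_mul]
  rw [h2]
  have h3 := (hc (Lplus H (haarIntegral H)) (b.coord i)).eq
  have h4 := (hc (haarTplus H (b j)) (b.coord i)).eq
  change M.pin d * _ = _ * M.pin d at h3
  simp only [mul_assoc]
  rw [← mul_assoc (sliceRight _ _) (M.pin d), ← h3, mul_assoc, ← mul_assoc (sliceRight _ _),
    ← h4, mul_assoc]

/-- Behind the face operator of d·p the face is flat, so the reverse of d transports in the same way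
as the path p. -/
theorem T_flip_mul_B_mul_pin (hd : ¬ L.IsOuter d) : M.T β (L.flip d) * (M.B β (d :: p) * M.pin d) ⊗ₜ[ℂ] 1 =
    (M.B β (d :: p) * M.pin d) ⊗ₜ[ℂ] 1 * M.word β p := by
  let b := Module.finBasis ℂ H
  have hc : ∀ φ, Commute (M.pin d) (sliceRight φ (M.word β p)) := M.commute_bulk_word β h h' _
  refine eq_of_sliceRight_eq fun φ => ?_
  rw [sliceRight_mul_tmul_one, sliceRight_tmul_one_mul]
  rw [M.sliceRight_T_of_not_isOuter β (by rwa [L.flip_flip]), M.bulk_flip]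
  let G : H →ₗ[ℂ] Module.End ℂ H :=
    Tplus H ∘ₗ (LinearMap.mul ℂ H).flip.compr₂ (dualHaarIntegral H)
  have hG : ∀ y, G y = haarTplus H y := fun y => rfl
  let F : H ⊗[ℂ] H →ₗ[ℂ] Module.End ℂ V := M.bulk d ∘ₗ
    LinearMap.mulRight ℂ (Lplus H (haarIntegral H)) ∘ₗ G ∘ₗ sliceRight φ
  have hF : ∀ y, F (comul y) = M.bulk d (antipodeConj H (Tplus H φ)) *
      M.bulk d (haarTplus H y) * M.pin d := fun y => by
    let q := Repr.arbitrary ℂ y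
    rw [pin, ← M.bulk_mul, ← M.bulk_mul, hH.Tminus_mul_haarTplus_mul_pin φ q, ← q.eq]
    simp [F, ← hG]
  have h1 := (M.isCorep_word β hH hp hi).sum_mul b F
  have hFt : ∀ i j, F (b i ⊗ₜ[ℂ] b j) =
      φ (b j) • (M.bulk d (haarTplus H (b i)) * M.pin d) := fun i j => by
    simp [F, ← hG, pin, M.bulk_mul]
  simp only [hF, hFt] at h1
  rw [M.B_cons_eq_sum β b hd', sliceRight_eq_sum b φ, Finset.sum_mul, Finset.mul_sum]
  trans ∑ j, M.bulk d (antipodeConj H (Tplus H φ)) * M.bulk d (haarTplus H (b j)) * M.pin d *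
    sliceRight (b.coord j) (M.word β p)
  · refine Finset.sum_congr rfl fun j _ => ?_
    simp only [mul_assoc, (hc _).eq]
  · rw [← h1, Finset.sum_mul_sum]
    refine Finset.sum_congr rfl fun i _ => Finset.sum_congr rfl fun j _ => ?_
    simp only [mul_assoc, smul_mul_assoc, mul_smul_comm]
    rw [← mul_assoc (M.pin d), (hc _).eq, mul_assoc]

/-- Two faces meeting along a pinned edge merge. -/
theorem B_flip_mul_B_mul_pin (hd : ¬ L.IsOuter d) {q : List D} (hq : d ∉ q) (hq' : L.flip d ∉ q)
    (hpq : p.Disjoint q) : M.B β (L.flip d :: q) * (M.B β (d :: p) * M.pin d) =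
      M.B β (d :: p) * M.pin d * M.B β (p ++ q) := by
  have hc : Commute ((M.B β (d :: p) * M.pin d) ⊗ₜ[ℂ] (1 : H)) (M.word β q) :=
    commute_tmul_one_iff.2 fun φ => .mul_left
      (M.slicesCommute_word β hH (List.disjoint_cons_left.2 ⟨hq, hpq⟩) _ _)
      (M.commute_bulk_word β hq hq' _ _)
  rw [B, ← sliceRight_mul_tmul_one, word_cons, mul_assoc, ← hc.eq, ← mul_assoc,
    M.T_flip_mul_B_mul_pin β hH hd' hp hi h h' hd, mul_assoc, sliceRight_tmul_one_mul,
    ← word_append, ← B]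

end EdgeSystem

/-! ### Vertex operators of lists of darts -/

section MultiplicativeConv

open Coalgebra WithConv

variable {H E : Type*} [Ring H] [HopfAlgebra ℂ H] [Ring E] [Algebra ℂ E]

theorem convMul_apply_mul {f g : ConvRing H E} (hf : ∀ x y, f (x * y) = f x * f y)
    (hg : ∀ x y, g (x * y) = g x * g y) (hfg : ∀ x y, Commute (f x) (g y)) (x y : H) :
    (f * g) (x * y) = (f * g) x * (f * g) y := by
  let r := Repr.arbitrary ℂ x
  let q := Repr.arbitrary ℂ y
  rw [r.convMul_apply, q.convMul_apply, LinearMap.convMul_apply, Bialgebra.comul_mul, ← r.eq,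
    ← q.eq, Finset.sum_mul_sum, Finset.sum_mul_sum]
  simp only [map_sum, Algebra.TensorProduct.tmul_mul_tmul, TensorProduct.map_tmul,
    LinearMap.mul'_apply, hf, hg]
  refine Finset.sum_congr rfl fun i _ => Finset.sum_congr rfl fun j _ => ?_
  simp only [mul_assoc]
  rw [← mul_assoc (g _), (hfg _ _).symm.eq, mul_assoc]

variable {V : Type*} [AddCommGroup V] [Module ℂ V]

theorem convMul_apply_of_right {f g : ConvRing H (Module.End ℂ V)} {ψ : V}
    (hg : ∀ x, g x ψ = counit (R := ℂ) x • ψ) (x : H) : (f * g) x ψ = f x ψ := by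
  let r := Repr.arbitrary ℂ x
  rw [r.convMul_apply]
  conv_rhs => rw [← sum_smul_counit r]
  simp [hg]

theorem convMul_apply_of_left {f g : ConvRing H (Module.End ℂ V)} {ψ : V}
    (hf : ∀ x y, f x (g y ψ) = counit (R := ℂ) x • g y ψ) (x : H) : (f * g) x ψ = g x ψ := by
  let r := Repr.arbitrary ℂ x
  rw [r.convMul_apply]
  conv_rhs => rw [← sum_counit_smul r]
  simp [hf]

end MultiplicativeConv

namespace EdgeSystem

open Coalgebra HopfAlgebra WithConv

variable {D : Type*} {L : DiskLattice D} {H A V : Type*} [Ring H] [HopfAlgebra ℂ H]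
  [FiniteDimensional ℂ H] [Ring A] [Algebra ℂ A] [AddCommGroup V] [Module ℂ V]
  (M : EdgeSystem L H A V) (β : RightComoduleAlgebra H A)

/-- The operators of a list of darts on the vertex they start from. -/
def vert (ds : List D) : ConvRing H (Module.End ℂ V) :=
  (ds.map fun d => (toConv (M.l d) : ConvRing H (Module.End ℂ V))).prod

@[simp] theorem vert_nil : M.vert [] = 1 := rfl

@[simp] theorem vert_cons (d : D) (ds : List D) :
    M.vert (d :: ds) = toConv (M.l d) * M.vert ds := by simp [vert]

@[simp] theorem vert_append (u w : List D) : M.vert (u ++ w) = M.vert u * M.vert w := by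
  simp [vert]

theorem commute_vert {z : Module.End ℂ V} {ds : List D}
    (h : ∀ d ∈ ds, ∀ g, Commute z (M.l d g)) (g : H) : Commute z (M.vert ds g) := by
  refine commute_constConv_iff.1 (Commute.list_prod_right _ _ fun f hf => ?_) g
  obtain ⟨d, hd, rfl⟩ := List.mem_map.1 hf
  exact commute_constConv_iff.2 (h d hd)

theorem vert_apply_of_forall {ds : List D} {ψ : V}
    (h : ∀ d ∈ ds, ∀ g, M.l d g ψ = counit (R := ℂ) g • ψ) (g : H) :
    M.vert ds g ψ = counit (R := ℂ) g • ψ := by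
  induction ds generalizing g with
  | nil => simp [Algebra.algebraMap_eq_smul_one]
  | cons d ds ih =>
    rw [vert_cons, convMul_apply_of_right (ih fun x hx => h x (by simp [hx]))]
    exact h d (by simp) g

variable (hS : ∀ x : H, antipode ℂ (antipode ℂ x) = x)
include hS

theorem commute_vert_vert {u w : List D} (h : u.Disjoint w) (g k : H) :
    Commute (M.vert u g) (M.vert w k) :=
  M.commute_vert (fun d hd y => (M.commute_vert (fun x hx y' =>
    M.commute_l hS (fun h' => h hx (by rwa [← h'])) _ _) g).symm) k

theorem vert_mul {ds : List D} (h : ds.Nodup) (g k : H) :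
    M.vert ds (g * k) = M.vert ds g * M.vert ds k := by
  induction ds generalizing g k with
  | nil => simp
  | cons d ds ih =>
    rw [List.nodup_cons] at h
    rw [vert_cons]
    refine convMul_apply_mul (M.l_mul d) (ih h.2) (fun x y => ?_) g k
    exact M.commute_vert (fun x hx _ => M.commute_l hS (fun h' => h.1 (by rw [h']; exact hx)) _ _) _

/-- Darts acting by the counit drop out of the iterated comultiplication. At a vertex with one edge
left, invariance under the vertex operator thus means that this edge is pinned. -/
theorem vert_apply_of_leaf {u w : List D} {d : D} {ψ : V} (hnd : (u ++ d :: w).Nodup)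
    (h : ∀ x ∈ u ++ w, ∀ g, M.l x g ψ = counit (R := ℂ) g • ψ) (g : H) :
    M.vert (u ++ d :: w) g ψ = M.l d g ψ := by
  have hw := M.vert_apply_of_forall (ds := w) (ψ := ψ) fun x hx => h x (by simp [hx])
  have hd : ∀ y, (toConv (M.l d) * M.vert w : ConvRing H (Module.End ℂ V)) y ψ = M.l d y ψ :=
    fun y => convMul_apply_of_right hw y
  rw [vert_append, vert_cons, convMul_apply_of_left (fun x y => ?_), hd]
  rw [hd]
  refine M.vert_apply_of_forall (fun z hz k => ?_) x
  have hzd : z ≠ d := fun h' => by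
    subst h'
    simp [List.nodup_append, hz] at hnd
    exact (hnd.2.2 _ hz).1 rfl
  rw [← Module.End.mul_apply, (M.commute_l hS hzd k y).eq, Module.End.mul_apply,
    h z (by simp [hz]), map_smul]

end EdgeSystem

/-! ### The corner at which a vertex product starts -/

section HaarRotation

open Coalgebra HopfAlgebra WithConv

variable {H E : Type*} [Ring H] [HopfAlgebra ℂ H] [StarRing H] [StarModule ℂ H]
  [FiniteDimensional ℂ H] [Ring E] [Algebra ℂ E] (hH : IsCStarHopfAlgebra H)

/-- Cyclic rotation of the factors of a threefold tensor product. -/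
def rotateThree (H : Type*) [AddCommGroup H] [Module ℂ H] : H ⊗[ℂ] (H ⊗[ℂ] H) →ₗ[ℂ] H ⊗[ℂ] (H ⊗[ℂ] H) :=
  (TensorProduct.assoc ℂ H H H).toLinearMap ∘ₗ (TensorProduct.comm ℂ H (H ⊗[ℂ] H)).toLinearMap

/-- The iterated comultiplication of the Haar integral is cyclically invariant. -/
theorem IsCStarHopfAlgebra.rotateThree_haarIntegral (hH : IsCStarHopfAlgebra H) :
    rotateThree H (comul.lTensor H (comul (haarIntegral H))) =
      comul.lTensor H (comul (haarIntegral H)) := by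
  have h1 : ∀ t : H ⊗[ℂ] H, TensorProduct.comm ℂ H (H ⊗[ℂ] H) (comul.lTensor H t) =
      comul.rTensor H (TensorProduct.comm ℂ H H t) := fun t => by
    induction t with
    | zero => simp
    | add a b ha hb => simp only [map_add, ha, hb]
    | tmul a b => simp
  rw [rotateThree, LinearMap.comp_apply, LinearEquiv.coe_coe, LinearEquiv.coe_coe, h1,
    hH.comm_comul_haarIntegral, coassoc_apply]

include hH in
/-- A tensor that commutes with the operators `f` up to a twist has a slice that commutes with the
value of `f` at the Haar integral. -/
theorem IsCStarHopfAlgebra.commute_of_twisted {f : ConvRing H E} {m : E ⊗[ℂ] H}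
    {F : ConvRing H (E ⊗[ℂ] H)} (hF : ∀ x, F x = f x ⊗ₜ[ℂ] 1)
    (h : constConv H m * inclConv E H * F = F * inclConv E H * constConv H m) :
    Commute (f (haarIntegral H)) (sliceRight (dualHaarIntegral H) m) := by
  let χ := dualHaarIntegral H
  have hχ : ∀ x y, χ (x * y) = χ (y * x) := hH.dualHaarIntegral_mul_comm
  -- The twisted relation is multiplied by S in the convolution ring, evaluated at h and sliced with
  -- χ; both sides become contractions of the threefold coproduct of h.
  let Sc : ConvRing H (E ⊗[ℂ] H) := toConv
    ((Algebra.TensorProduct.includeRight (R := ℂ) (A := E)).toLinearMap ∘ₗ antipode ℂ)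
  have hSc : ∀ x, Sc x = (1 : E) ⊗ₜ[ℂ] antipode ℂ x := fun x => rfl
  have hX : ∀ x, inclConv E H x = (1 : E) ⊗ₜ[ℂ] x := fun x => rfl
  let P : H ⊗[ℂ] (H ⊗[ℂ] H) →ₗ[ℂ] E := LinearMap.mul' ℂ E ∘ₗ TensorProduct.map f.ofConv
    (sliceRight.flip m ∘ₗ (LinearMap.mul ℂ H).compr₂ χ ∘ₗ LinearMap.mul' ℂ H ∘ₗ
      (antipode ℂ).rTensor H ∘ₗ (TensorProduct.comm ℂ H H).toLinearMap)
  have hP : ∀ a b c, P (a ⊗ₜ[ℂ] (b ⊗ₜ[ℂ] c)) =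
      f a * sliceRight (χ ∘ₗ LinearMap.mulLeft ℂ (antipode ℂ c * b)) m := fun a b c => rfl
  let Q : H ⊗[ℂ] (H ⊗[ℂ] H) →ₗ[ℂ] E := LinearMap.mul' ℂ E ∘ₗ TensorProduct.map
    (sliceRight.flip m ∘ₗ (LinearMap.mul ℂ H).flip.compr₂ χ ∘ₗ LinearMap.mul' ℂ H ∘ₗ
      (antipode ℂ).lTensor H) f.ofConv ∘ₗ (TensorProduct.assoc ℂ H H H).symm.toLinearMap ∘ₗ
      (TensorProduct.comm ℂ H H).toLinearMap.lTensor H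
  have hQ : ∀ a b c, Q (a ⊗ₜ[ℂ] (b ⊗ₜ[ℂ] c)) =
      sliceRight (χ ∘ₗ LinearMap.mulRight ℂ (a * antipode ℂ c)) m * f b := fun a b c => rfl
  let r := Repr.arbitrary ℂ (haarIntegral H)
  have ht : comul.lTensor H (comul (haarIntegral H)) =
      ∑ i ∈ r.index, ∑ j ∈ (Repr.arbitrary ℂ (r.right i)).index, r.left i ⊗ₜ[ℂ]
        ((Repr.arbitrary ℂ (r.right i)).left j ⊗ₜ[ℂ] (Repr.arbitrary ℂ (r.right i)).right j) := by
    rw [← r.eq, map_sum]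
    refine Finset.sum_congr rfl fun i _ => ?_
    rw [LinearMap.lTensor_tmul, ← (Repr.arbitrary ℂ (r.right i)).eq, TensorProduct.tmul_sum]
  have ht' : comul.lTensor H (comul (haarIntegral H)) =
      ∑ i ∈ r.index, ∑ j ∈ (Repr.arbitrary ℂ (r.left i)).index,
        (Repr.arbitrary ℂ (r.left i)).left j ⊗ₜ[ℂ]
          ((Repr.arbitrary ℂ (r.left i)).right j ⊗ₜ[ℂ] r.right i) := by
    rw [← coassoc_apply]
    conv_lhs => rw [← r.eq, map_sum, map_sum]
    refine Finset.sum_congr rfl fun i _ => ?_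
    rw [LinearMap.rTensor_tmul, ← (Repr.arbitrary ℂ (r.left i)).eq, TensorProduct.sum_tmul, map_sum]
    rfl
  -- In this order, S(h⁽³⁾) h⁽²⁾ is a factor and collapses by the skew antipode identity.
  have hPt : P (comul.lTensor H (comul (haarIntegral H))) =
      f (haarIntegral H) * sliceRight χ m := by
    have h1 : ∀ x : H, ∑ j ∈ (Repr.arbitrary ℂ x).index, antipode ℂ ((Repr.arbitrary ℂ x).right j) *
        (Repr.arbitrary ℂ x).left j = counit (R := ℂ) x • 1 := fun x => by
      have := congrArg (antipode ℂ) (sum_antipode_mul_eq_smul (Repr.arbitrary ℂ x))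
      simpa only [map_sum, antipode_mul_antidistrib, hH.antipode_antipode, map_smul, antipode_one]
        using this
    rw [ht]
    conv_rhs => rw [← sum_smul_counit r]
    simp only [map_sum, hP, ← Finset.mul_sum, Finset.sum_mul]
    refine Finset.sum_congr rfl fun i _ => ?_
    have h2 : ∀ x : H, sliceRight (χ ∘ₗ LinearMap.mulLeft ℂ x) m =
      (sliceRight.flip m ∘ₗ (LinearMap.mul ℂ H).compr₂ χ) x := fun _ => rfl
    simp only [h2]
    rw [← map_sum, h1, map_smul, map_smul, mul_smul_comm, smul_mul_assoc, ← h2]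
    congr 3
    ext x; simp
  have hQt : Q (comul.lTensor H (comul (haarIntegral H))) =
      sliceRight χ m * f (haarIntegral H) := by
    -- Here the legs to be contracted are h⁽¹⁾ and h⁽³⁾; the cyclic invariance of the coproduct of h
    -- makes them neighbours.
    rw [← hH.rotateThree_haarIntegral, ht']
    conv_rhs => rw [← sum_counit_smul r]
    have hrot : ∀ a b c : H, rotateThree H (a ⊗ₜ[ℂ] (b ⊗ₜ[ℂ] c)) = b ⊗ₜ[ℂ] (c ⊗ₜ[ℂ] a) :=
      fun _ _ _ => rfl
    simp only [map_sum, hrot, hQ, ← Finset.sum_mul, Finset.mul_sum]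
    refine Finset.sum_congr rfl fun i _ => ?_
    have h2 : ∀ x : H, sliceRight (χ ∘ₗ LinearMap.mulRight ℂ x) m =
      (sliceRight.flip m ∘ₗ (LinearMap.mul ℂ H).flip.compr₂ χ) x := fun _ => rfl
    simp only [h2]
    rw [← map_sum, sum_right_mul_antipode hH.antipode_antipode, map_smul, map_smul, mul_smul_comm,
      smul_mul_assoc, ← h2]
    congr 3
    ext x; simp
  have h3 := congrArg (fun G : ConvRing H (E ⊗[ℂ] H) =>
    sliceRight χ ((G * Sc) (haarIntegral H))) h
  simp only [mul_assoc] at h3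
  have hl : sliceRight χ ((F * (inclConv E H * (constConv H m * Sc))) (haarIntegral H)) =
      P (comul.lTensor H (comul (haarIntegral H))) := by
    rw [r.convMul_apply, ht]
    simp only [map_sum]
    refine Finset.sum_congr rfl fun i _ => ?_
    rw [(Repr.arbitrary ℂ (r.right i)).convMul_apply, Finset.mul_sum, map_sum]
    refine Finset.sum_congr rfl fun j _ => ?_
    rw [hP, constConv_mul_apply, hF, hX, hSc, sliceRight_tmul_one_mul, sliceRight_tmul_mul, one_mul,
      sliceRight_mul_tmul, mul_one]
    congr 2
    refine congrArg sliceRight (LinearMap.ext fun x => ?_)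
    simp only [LinearMap.comp_apply, LinearMap.mulLeft_apply, LinearMap.mulRight_apply, mul_assoc]
    rw [← mul_assoc, hχ]
  have hr : sliceRight χ ((constConv H m * (inclConv E H * (F * Sc))) (haarIntegral H)) =
      Q (comul.lTensor H (comul (haarIntegral H))) := by
    rw [constConv_mul_apply, r.convMul_apply, ht, Finset.mul_sum]
    simp only [map_sum]
    refine Finset.sum_congr rfl fun i _ => ?_
    rw [(Repr.arbitrary ℂ (r.right i)).convMul_apply, Finset.mul_sum, Finset.mul_sum, map_sum]
    refine Finset.sum_congr rfl fun j _ => ?_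
    rw [hQ, hF, hX, hSc]
    simp only [Algebra.TensorProduct.tmul_mul_tmul, one_mul, mul_one]
    rw [sliceRight_mul_tmul]
  rw [hl, hr, hPt, hQt] at h3
  exact h3.symm

end HaarRotation

/-! ## Cycles of permutations -/

section CycleList

variable {D : Type*} (p : Equiv.Perm D)

theorem coe_cycleList (x : D) : (cycleList p x : Cycle D) = Function.periodicOrbit p x := by
  simp only [cycleList, Function.periodicOrbit, Equiv.Perm.iterate_eq_pow]

theorem nodup_cycleList (x : D) : (cycleList p x).Nodup := by
  rw [← Cycle.nodup_coe_iff, coe_cycleList]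
  exact Function.nodup_periodicOrbit

variable [Finite D]

theorem mem_periodicPts (x : D) : x ∈ Function.periodicPts p := by
  obtain ⟨n, hn, h⟩ := isOfFinOrder_of_finite p |>.exists_pow_eq_one
  exact ⟨n, hn, by rw [Function.IsPeriodicPt, Equiv.Perm.iterate_eq_pow, h]; rfl⟩

theorem chain_cycleList (x : D) : (cycleList p x : Cycle D).Chain fun a b => p a = b := by
  rw [coe_cycleList, Function.periodicOrbit_chain' _ (mem_periodicPts p x)]
  intro n
  rw [Function.iterate_succ_apply']

theorem mem_cycleList {x y : D} : y ∈ cycleList p x ↔ p.SameCycle x y := by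
  rw [← Cycle.mem_coe_iff, coe_cycleList, Function.mem_periodicOrbit_iff (mem_periodicPts p x)]
  constructor
  · rintro ⟨n, rfl⟩
    exact ⟨n, by rw [Equiv.Perm.iterate_eq_pow]; rfl⟩
  · intro h
    obtain ⟨n, -, h⟩ := h.exists_pow_eq'
    exact ⟨n, by rw [Equiv.Perm.iterate_eq_pow, h]⟩

theorem isRotated_cycleList {x y : D} (h : p.SameCycle x y) : cycleList p x ~r cycleList p y := by
  rw [← Cycle.coe_eq_coe, coe_cycleList, coe_cycleList]
  obtain ⟨n, -, rfl⟩ := h.exists_pow_eq'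
  rw [← Equiv.Perm.iterate_eq_pow,
    Function.periodicOrbit_apply_iterate_eq (mem_periodicPts p x)]

theorem cycleList_eq_cons (x : D) : ∃ l, cycleList p x = x :: l := by
  have h := Function.minimalPeriod_pos_of_mem_periodicPts (mem_periodicPts p x)
  obtain ⟨n, hn⟩ := Nat.exists_eq_succ_of_ne_zero h.ne'
  rw [cycleList, hn, List.range_succ_eq_map]
  exact ⟨_, rfl⟩

end CycleList

section Words

variable {D : Type*}

theorem exists_isRotated_cons {w : List D} {x : D} (h : x ∈ w) : ∃ u, w ~r x :: u := by
  obtain ⟨a, b, rfl⟩ := List.append_of_mem h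
  exact ⟨b ++ a, List.isRotated_append⟩

theorem chain_congr {r : D → D → Prop} {w w' : List D} (h : w ~r w') :
    (w : Cycle D).Chain r ↔ (w' : Cycle D).Chain r := by
  rw [Cycle.coe_eq_coe.2 h]

theorem chain_isRotated {r : D → D → Prop} {w w' : List D} (hw : (w : Cycle D).Chain r)
    (h : w ~r w') : (w' : Cycle D).Chain r := (chain_congr h).1 hw

end Words

/-! ### From corners to whole faces -/

section ChainCommute

variable {C D : Type*} [Ring C] {T : D → C} {Z : C} {p P : D → Prop} {f n : D → D}

/-- If a product of the operators of two consecutive darts through a vertex commutes with `Z`, then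
so does the word of a face. -/
theorem commute_prod_of_isChain (hf : ∀ x, p x → ¬ p (f x)) (hn : ∀ x, p (n x) ↔ p (f x))
    (h₁ : ∀ x, P x → ¬ p x → ¬ p (f x) → Commute (T x) Z)
    (h₂ : ∀ x, P x → P (n x) → p (f x) → Commute (T x * T (n x)) Z) :
    ∀ w : List D, w.IsChain (fun a b => n a = b) → (∀ x ∈ w, P x) → (∀ x ∈ w.head?, ¬ p x) →
      (∀ x ∈ w.getLast?, ¬ p (f x)) → Commute (w.map T).prod Z
  | [], _, _, _, _ => by simp
  | [x], _, hP, hh, hl => by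
    simpa using h₁ x (hP x (by simp)) (hh x (by simp)) (hl x (by simp))
  | x :: y :: w, hc, hP, hh, hl => by
    rw [List.isChain_cons_cons] at hc
    obtain ⟨rfl, hc⟩ := hc
    -- A dart ending at the vertex is treated together with its successor, which starts there; the
    -- other darts are treated singly.
    by_cases hx : p (f x)
    · have ih := commute_prod_of_isChain hf hn h₁ h₂ w hc.tail (fun z hz => hP z (by simp [hz]))
        (fun z hz => by
          have := hc.rel_head? hz
          rw [← this, hn]
          exact hf _ ((hn x).2 hx)) (fun z hz => hl z (by
            cases w with
            | nil => simp at hz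
            | cons a w => simpa using hz))
      rw [List.map_cons, List.map_cons, List.prod_cons, List.prod_cons, ← mul_assoc]
      exact (h₂ x (hP x (by simp)) (hP _ (by simp)) hx).mul_left ih
    · have ih := commute_prod_of_isChain hf hn h₁ h₂ (n x :: w) hc
        (fun z hz => hP z (List.mem_cons_of_mem _ hz))
        (fun z hz => by
          simp only [List.head?_cons, Option.mem_def, Option.some.injEq] at hz
          rw [← hz, hn]; exact hx) (fun z hz => hl z (by simpa using hz))
      rw [List.map_cons, List.prod_cons]
      exact (h₁ x (hP x (by simp)) (hh x (by simp)) hx).mul_left ih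

end ChainCommute

namespace DiskLattice

variable {D : Type*} (L : DiskLattice D)

theorem next_apply (d : D) : L.next d = L.rot⁻¹ (L.flip d) := rfl

theorem rot_next (d : D) : L.rot (L.next d) = L.flip d := by simp [next_apply]

theorem sameCycle_next_iff {v d : D} :
    L.rot.SameCycle v (L.next d) ↔ L.rot.SameCycle v (L.flip d) := by
  rw [← L.rot_next, Equiv.Perm.sameCycle_apply_right]

theorem isOuter_next_iff {d : D} : L.IsOuter (L.next d) ↔ L.IsOuter d :=
  Equiv.Perm.sameCycle_apply_right

theorem not_sameCycle_flip {v d : D} (h : L.rot.SameCycle v d) :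
    ¬ L.rot.SameCycle v (L.flip d) := fun h' => L.no_loop d (h.symm.trans h')

theorem origin_eq_iff {d d' : D} : L.origin d = L.origin d' ↔ L.rot.SameCycle d d' :=
  Quotient.eq (r := Equiv.Perm.SameCycle.setoid L.rot)

theorem not_isOuter_of_origin {d : D} (h : ¬ L.IsBdryVertex (L.origin d)) : ¬ L.IsOuter d :=
  fun h' => h ⟨d, h', rfl⟩

theorem not_isOuter_flip_of_origin {d : D} (h : ¬ L.IsBdryVertex (L.origin d)) :
    ¬ L.IsOuter (L.flip d) := fun h' => h ⟨L.next (L.flip d), L.isOuter_next_iff.2 h',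
  L.origin_eq_iff.2 (by
    rw [Equiv.Perm.sameCycle_comm, L.sameCycle_next_iff, L.flip_flip])⟩

end DiskLattice

/-! ### Bulk vertex operators commute with face operators -/

namespace EdgeSystem

open Coalgebra HopfAlgebra WithConv

variable {D : Type*} {L : DiskLattice D} {H A V : Type*} [Ring H] [HopfAlgebra ℂ H]
  [FiniteDimensional ℂ H] [Ring A] [Algebra ℂ A] [AddCommGroup V] [Module ℂ V]
  (M : EdgeSystem L H A V) (β : RightComoduleAlgebra H A)

theorem lConv_prod_apply (ds : List D) (g : H) :
    (ds.map M.lConv).prod g = M.vert ds g ⊗ₜ[ℂ] (1 : H) := by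
  have h : ∀ ds : List D, (ds.map M.lConv).prod =
      (toConv ((Algebra.TensorProduct.includeLeft (R := ℂ) (S := ℂ) (B := H)).toLinearMap ∘ₗ
        (M.vert ds).ofConv) : ConvRing H (Module.End ℂ V ⊗[ℂ] H)) := fun ds => by
    induction ds with
    | nil =>
      ext x
      simp [Algebra.algebraMap_eq_smul_one, Algebra.TensorProduct.one_def,
        TensorProduct.smul_tmul']
    | cons d ds ih =>
      rw [List.map_cons, List.prod_cons, ih, vert_cons]
      exact congrArg toConv (LinearMap.algHom_comp_convMul_distrib
        (Algebra.TensorProduct.includeLeft (R := ℂ) (S := ℂ) (B := H)) (toConv (M.l d))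
        (M.vert ds)).symm
  rw [h]; rfl

theorem constConv_word (w : List D) :
    constConv H (M.word β w) = (w.map fun x => constConv H (M.T β x)).prod := by
  induction w with
  | nil => exact constConv_one
  | cons d w ih => rw [word_cons, constConv_mul, ih, List.map_cons, List.prod_cons]

theorem commute_constConv_T_lConv {x d : D} (h : x ≠ d) (h' : x ≠ L.flip d) :
    Commute (constConv H (M.T β x)) (M.lConv d) :=
  commute_constConv_iff.2 fun _ => (commute_tmul_one_iff.2 (M.commute_bulk_T β h h' _)).symm

variable [StarRing H] [StarModule ℂ H] (hH : IsCStarHopfAlgebra H) [Finite D]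
include hH

/-- Vertex operators commute with face operators. -/
theorem commute_vert_B {v : D} (hv : ¬ L.IsBdryVertex (L.origin v)) {w : List D} (hw : w.Nodup)
    (hi : ∀ x ∈ w, ¬ L.IsOuter x) (hc : (w : Cycle D).Chain fun a b => L.next a = b) :
    Commute (M.vert (cycleList L.rot v) (haarIntegral H)) (M.B β w) := by
  classical
  have hf := L.flip_flip
  set ds := cycleList L.rot v with hds
  have hmem : ∀ d, d ∈ ds ↔ L.rot.SameCycle v d := fun d => mem_cycleList L.rot
  have hnd : ds.Nodup := nodup_cycleList _ _
  have hout : ∀ d ∈ ds, ¬ L.IsOuter d ∧ ¬ L.IsOuter (L.flip d) := fun d hd => by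
    have : L.origin d = L.origin v := (L.origin_eq_iff.2 ((hmem d).1 hd)).symm
    rw [← this] at hv
    exact ⟨L.not_isOuter_of_origin hv, L.not_isOuter_flip_of_origin hv⟩
  have hnf : ∀ d ∈ ds, L.flip d ∉ ds := fun d hd hd' =>
    L.not_sameCycle_flip ((hmem d).1 hd) ((hmem _).1 hd')
  have h₁ : ∀ d ∈ ds, constConv H (M.T β d) * M.lConv d =
      M.lConv d * inclConv _ H * constConv H (M.T β d) := fun d hd =>
    M.constConv_T_mul_lConv β (hout d hd).2
  have h₂ : ∀ d ∈ ds, M.lConv d * constConv H (M.T β (L.flip d)) =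
      constConv H (M.T β (L.flip d)) * inclConv _ H * M.lConv d := fun d hd =>
    M.lConv_mul_constConv_T β hH.antipode_antipode (hout d hd).1
  have hcom : ∀ d ∈ ds, ∀ x, x ≠ d → x ≠ L.flip d →
      Commute (constConv H (M.T β x)) (M.lConv d) := fun d _ x => M.commute_constConv_T_lConv β
  obtain ⟨ds', hds'⟩ := cycleList_eq_cons L.rot v
  have hch := chain_cycleList L.rot v
  rw [hds', Cycle.chain_coe_cons] at hch
  rw [← hds] at hds'
  -- At a corner that is not the start of the list around the vertex, the two darts are neighbours
  -- in this list.
  have hpair : ∀ x, L.rot.SameCycle v (L.flip x) → L.flip x ≠ v →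
      Commute (constConv H (M.T β x) * constConv H (M.T β (L.next x)))
        (ds.map M.lConv).prod := fun x hx hxv => by
    obtain ⟨a, b, hab⟩ := List.append_of_mem ((hmem _).2 hx)
    obtain rfl | ⟨a, y, rfl⟩ := List.eq_nil_or_concat' a
    · rw [hds'] at hab
      exact absurd (List.cons_eq_cons.1 hab).1.symm hxv
    have hy : y = L.next x := by
      have h0 : (v :: (ds' ++ [v])) = a ++ y :: L.flip x :: (b ++ [v]) := by
        rw [← List.cons_append, ← hds', hab]; simp
      rw [h0, List.isChain_append_cons_cons] at hch
      rw [L.next_apply, ← hch.2.1]; simp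
    subst hy
    have := commute_pair_prod (T := fun x => constConv H (M.T β x)) (l := M.lConv) hf hnd hnf h₁ h₂
      hcom (u := a) (v := b) (d := L.next x) (e := L.flip x) (by rw [hab]; simp)
    rwa [hf] at this
  have hp : ∀ x, L.rot.SameCycle v x → ¬ L.rot.SameCycle v (L.flip x) :=
    fun x h => L.not_sameCycle_flip h
  have hfree : ∀ x, ¬ L.rot.SameCycle v x → ¬ L.rot.SameCycle v (L.flip x) →
      Commute (constConv H (M.T β x)) (ds.map M.lConv).prod := fun x hx hx' =>
    Commute.list_prod_right _ _ fun y hy => by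
      obtain ⟨d, hd, rfl⟩ := List.mem_map.1 hy
      exact hcom d hd x (fun h => hx (h ▸ (hmem d).1 hd))
        fun h => hx' (by rw [h, hf]; exact (hmem d).1 hd)
  -- The exceptional case: the face contains the corner between the last and the first dart of the
  -- list at the vertex.
  by_cases hwrap : ∃ x ∈ w, L.flip x = v
  · obtain ⟨x, hxw, hxv⟩ := hwrap
    obtain ⟨u', hu'⟩ := exists_isRotated_cons hxw
    have hc' := chain_isRotated hc hu'
    have hx : ¬ L.rot.SameCycle v x := fun h => hp x h (by rw [hxv])
    cases u' with
    | nil =>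
      rw [Cycle.chain_singleton] at hc'
      exact absurd (L.sameCycle_next_iff.2 (by rw [hxv] : L.rot.SameCycle v (L.flip x)))
        (by rw [hc']; exact hx)
    | cons y u =>
      rw [Cycle.chain_coe_cons, List.cons_append, List.isChain_cons_cons] at hc'
      obtain ⟨rfl, hc'⟩ := hc'
      -- The word is rotated so that the exceptional corner is spread over its two ends. The
      -- interior commutes with the vertex product, and each end contributes the twist required by
      -- `commute_of_twisted`.
      have hrot : w ~r L.next x :: u ++ [x] := hu'.trans (List.isRotated_append (l := [x]))
      rw [M.B_of_isRotated β hH hw hrot]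
      have hu : Commute (u.map fun z => constConv H (M.T β z)).prod (ds.map M.lConv).prod := by
        have hc'' := (List.isChain_append.1 hc'.tail)
        have hnx : ∀ z ∈ u, L.flip z ≠ v := fun z hz h => by
          have h1 : z = x := by rw [← hf z, h, ← hxv, hf]
          subst h1
          exact (List.nodup_cons.1 (hu'.nodup_iff.1 hw)).1 (by simp [hz])
        refine commute_prod_of_isChain (P := fun z => L.flip z ≠ v) hp
          (fun z => L.sameCycle_next_iff) (fun z _ => hfree z) (fun z hz _ hz' => hpair z hz' hz)
          u hc''.1 hnx (fun z hz => ?_) (fun z hz => ?_)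
        · have h1 := hc'.rel_head? (y := z) (by
            cases u with
            | nil => simp at hz
            | cons a u => simpa using hz)
          rw [← h1, L.sameCycle_next_iff]
          exact hp _ (L.sameCycle_next_iff.2 (by rw [hxv]))
        · have h1 := hc''.2.2 z hz x (by simp)
          rw [← L.sameCycle_next_iff, h1]
          exact hx
      refine hH.commute_of_twisted (F := (ds.map M.lConv).prod) (M.lConv_prod_apply ds) ?_
      have hfirst := flip_head_mul_prod (T := fun x => constConv H (M.T β x)) hf hds' hnd hnf h₂ hcom
      have hlast : constConv H (M.T β (L.next x)) * (ds.map M.lConv).prod =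
          (ds.map M.lConv).prod * inclConv _ H * constConv H (M.T β (L.next x)) := by
        obtain h0 | ⟨a, z, haz⟩ := List.eq_nil_or_concat' ds
        · rw [h0] at hds'; simp at hds'
        have hz : z = L.next x := by
          rw [← List.cons_append, ← hds', haz, List.append_assoc] at hch
          have := (List.isChain_append_cons_cons.1 hch).2.1
          rw [L.next_apply, hxv, ← this]; simp
        subst hz
        exact last_mul_prod (T := fun x => constConv H (M.T β x)) haz hnd hnf h₁ hcom
      rw [← hxv, hf] at hfirst
      rw [constConv_word, List.map_append, List.prod_append, List.map_cons, List.prod_cons,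
        List.map_singleton, List.prod_singleton]
      simp only [mul_assoc] at hfirst hlast ⊢
      rw [hfirst, ← mul_assoc _ (ds.map M.lConv).prod, hu.eq, mul_assoc, ← mul_assoc, hlast]
      simp only [mul_assoc]
  · push Not at hwrap
    have key : ∀ w, Commute (constConv H (M.word β w)) (ds.map M.lConv).prod →
        Commute (M.vert ds (haarIntegral H)) (M.B β w) := fun w h => by
      have := commute_constConv_iff.1 h (haarIntegral H)
      rw [lConv_prod_apply] at this
      exact commute_tmul_one_iff.1 this.symm _
    obtain rfl | hne := w.eq_nil_or_concat'
    · exact key _ (by rw [constConv_word]; simp)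
    -- A face has a dart not starting at the vertex since there are no loops. Rotated to start
    -- there, the word never begins or ends in the middle of a corner.
    obtain ⟨x, hxw, hx⟩ : ∃ x ∈ w, ¬ L.rot.SameCycle v x := by
      obtain ⟨a, x, rfl⟩ := hne
      by_contra! hall
      have h1 := hall x (by simp)
      have hc' := chain_isRotated hc (List.isRotated_append (l := a) (l' := [x]))
      cases a with
      | nil =>
        rw [List.append_nil, Cycle.chain_singleton] at hc'
        exact hp x h1 (L.sameCycle_next_iff.1 (by rwa [hc']))
      | cons y a =>
        rw [List.singleton_append, Cycle.chain_coe_cons, List.cons_append,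
          List.isChain_cons_cons] at hc'
        exact hp x h1 (L.sameCycle_next_iff.1 (by rw [hc'.1]; exact hall y (by simp)))
    obtain ⟨u, hu⟩ := exists_isRotated_cons hxw
    rw [M.B_of_isRotated β hH hw hu]
    have hc' := chain_isRotated hc hu
    rw [Cycle.chain_coe_cons, ← List.cons_append] at hc'
    have hc'' := List.isChain_append.1 hc'
    refine key _ ?_
    rw [constConv_word]
    refine commute_prod_of_isChain (P := fun z => L.flip z ≠ v) hp
        (fun z => L.sameCycle_next_iff) (fun z _ => hfree z) (fun z hz _ hz' => hpair z hz' hz)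
        (x :: u) hc''.1 (fun z hz => hwrap z (hu.mem_iff.2 hz)) (fun z hz => ?_) (fun z hz => ?_)
    · simp only [List.head?_cons, Option.mem_def, Option.some.injEq] at hz
      exact hz ▸ hx
    · have h1 := hc''.2.2 z hz x (by simp)
      rw [← L.sameCycle_next_iff, h1]
      exact hx

end EdgeSystem

namespace DiskLattice

variable {D : Type*} (L : DiskLattice D)

theorem eq_of_isOuter_of_sameCycle {o d : D} (ho : L.IsOuter o) (hd : L.IsOuter d)
    (h : L.rot.SameCycle o d) : d = o := (L.outer_simple o d ho hd h).symm

theorem rot_ne_of_isOuter {o : D} (ho : L.IsOuter o) : L.rot o ≠ o := fun h =>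
  L.not_isOuter_flip (L.isOuter_flip_rot ho) (by rwa [L.flip_flip, h])

variable [Finite D]

theorem cycleList_rot_outer (o : L.BdryEdge) :
    cycleList L.rot o.1 = o.1 :: L.rot o.1 :: L.bulkDartsAt o := by
  have h0 := Function.minimalPeriod_pos_of_mem_periodicPts (mem_periodicPts L.rot o.1)
  have h1 : Function.minimalPeriod L.rot o.1 ≠ 1 := fun h =>
    L.rot_ne_of_isOuter o.2 (Function.minimalPeriod_eq_one_iff_isFixedPt.1 h)
  obtain ⟨n, hn⟩ : ∃ n, Function.minimalPeriod L.rot o.1 = n + 2 :=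
    ⟨Function.minimalPeriod L.rot o.1 - 2, by omega⟩
  rw [cycleList, bulkDartsAt, hn, List.range_succ_eq_map, List.range_succ_eq_map]
  simp [Function.comp_def]

theorem nodup_bulkDartsAt (o : L.BdryEdge) :
    (o.1 :: L.rot o.1 :: L.bulkDartsAt o).Nodup := by
  rw [← cycleList_rot_outer]; exact nodup_cycleList _ _

theorem sameCycle_outer_iff (o : L.BdryEdge) {d : D} :
    L.rot.SameCycle o.1 d ↔ d = o.1 ∨ d = L.rot o.1 ∨ d ∈ L.bulkDartsAt o := by
  rw [← mem_cycleList, cycleList_rot_outer]; simp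

theorem chain_bulkDartsAt (o : L.BdryEdge) :
    (L.rot o.1 :: (L.bulkDartsAt o ++ [o.1])).IsChain fun a b => L.rot a = b := by
  have := chain_cycleList L.rot o.1
  rw [cycleList_rot_outer, Cycle.chain_coe_cons] at this
  exact this.tail

variable {L} in
theorem not_isOuter_of_mem_bulkDartsAt {o : L.BdryEdge} {d : D} (hd : d ∈ L.bulkDartsAt o) :
    ¬ L.IsOuter d ∧ ¬ L.IsOuter (L.flip d) := by
  have hs := (L.sameCycle_outer_iff o).2 (Or.inr (Or.inr hd))
  have hnd := L.nodup_bulkDartsAt o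
  simp only [List.nodup_cons, List.mem_cons, not_or] at hnd
  refine ⟨fun h => ?_, fun h => ?_⟩
  · have := L.eq_of_isOuter_of_sameCycle o.2 h hs
    exact hnd.1.2 (this ▸ hd)
  · have h1 := L.isOuter_next_iff.2 h
    have h2 := L.eq_of_isOuter_of_sameCycle o.2 h1
      (L.sameCycle_next_iff.2 (by rwa [L.flip_flip]))
    rw [L.next_apply, L.flip_flip, Equiv.Perm.inv_eq_iff_eq] at h2
    exact hnd.2.1 (h2 ▸ hd)

end DiskLattice

/-! ### Coinvariance of λ under the coaction -/

section CoactLemmas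

open Coalgebra HopfAlgebra WithConv

variable {H A E : Type*} [Ring H] [HopfAlgebra ℂ H] [Ring A] [Algebra ℂ A] [Ring E] [Algebra ℂ E]
  (β : RightComoduleAlgebra H A)

theorem commute_coactConv {z : E} {f : A →ₗ[ℂ] E} {g : ConvRing H E} (hf : ∀ a, Commute z (f a))
    (hg : ∀ x, Commute z (g x)) (a : A) : Commute z (coactConv β f g a) := by
  simp only [coactConv, LinearMap.comp_apply]
  induction β.coact.toLinearMap a with
  | zero => simp
  | add a b ha hb => simp only [map_add]; exact ha.add_right hb
  | tmul a b => exact (hf a).mul_right (hg b)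

theorem coactConv_mul {f : A →ₗ[ℂ] E} {g : ConvRing H E} (hf : ∀ a b, f (a * b) = f a * f b)
    (hg : ∀ x y, g (x * y) = g x * g y) (hfg : ∀ a x, Commute (g x) (f a)) (a b : A) :
    coactConv β f g (a * b) = coactConv β f g a * coactConv β f g b := by
  simp only [coactConv, LinearMap.comp_apply, AlgHom.toLinearMap_apply, map_mul]
  induction β.coact a with
  | zero => simp
  | add c d hc hd => simp only [map_add, add_mul, hc, hd]
  | tmul c d =>
    induction β.coact b with
    | zero => simp
    | add c d hc hd => simp only [map_add, mul_add, hc, hd]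
    | tmul e k =>
      simp only [Algebra.TensorProduct.tmul_mul_tmul, TensorProduct.map_tmul,
        LinearMap.mul'_apply, hf, hg]
      simp only [mul_assoc]
      rw [← mul_assoc (f e), ← (hfg e d).eq, mul_assoc]

theorem algHom_comp_coactConv {R : Type*} [Ring R] [Algebra ℂ R] (i : E →ₐ[ℂ] R) (f : A →ₗ[ℂ] E)
    (g : ConvRing H E) : i.toLinearMap ∘ₗ coactConv β f g =
      coactConv β (i.toLinearMap ∘ₗ f) (toConv (i.toLinearMap ∘ₗ g.ofConv) : ConvRing H R) := by
  ext a
  simp only [coactConv, LinearMap.comp_apply]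
  induction β.coact.toLinearMap a with
  | zero => simp
  | add a b ha hb => simp only [map_add, ha, hb]
  | tmul a b => simp

/-- `(a ⊗ g) ⊗ (b ⊗ k) ↦ (a ⊗ b) ⊗ k g`. -/
def collectCoact (H A : Type*) [Ring H] [HopfAlgebra ℂ H] [Ring A] [Algebra ℂ A] :
    (A ⊗[ℂ] H) ⊗[ℂ] (A ⊗[ℂ] H) →ₗ[ℂ] (A ⊗[ℂ] A) ⊗[ℂ] H :=
  (LinearMap.mul' ℂ H ∘ₗ (TensorProduct.comm ℂ H H).toLinearMap).lTensor (A ⊗[ℂ] A) ∘ₗ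
    (TensorProduct.tensorTensorTensorComm ℂ A H A H).toLinearMap

theorem collectCoact_tmul (a b : A) (g k : H) :
    collectCoact H A ((a ⊗ₜ g) ⊗ₜ (b ⊗ₜ k)) = (a ⊗ₜ b) ⊗ₜ (k * g) := rfl

/-- The symmetric separability idempotent is invariant under the coaction. -/
theorem IsSymmSeparabilityIdempotent.collectCoact_coact [FiniteDimensional ℂ H]
    [FiniteDimensional ℂ A] {lam : A ⊗[ℂ] A}
    (h : IsSymmSeparabilityIdempotent lam) (hS : ∀ x : H, antipode ℂ (antipode ℂ x) = x) :
    collectCoact H A (TensorProduct.map β.coact.toLinearMap β.coact.toLinearMap lam) =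
      lam ⊗ₜ[ℂ] 1 := by
  have h1 : TensorProduct.map β.coact.toLinearMap β.coact.toLinearMap lam =
      β.coact.toLinearMap.lTensor (A ⊗[ℂ] H) (β.coact.toLinearMap.rTensor A lam) := by
    rw [← LinearMap.comp_apply, LinearMap.lTensor_comp_rTensor]
  -- Once the coaction of the first factor has been moved to the second, the two coaction letters of
  -- the second factor cancel by the antipode axiom.
  rw [h1, h.rTensor_coact β hS]
  generalize lam = t
  induction t with
  | zero => simp
  | add x y hx hy => simp only [map_add, TensorProduct.add_tmul, hx, hy]
  | tmul a b =>
    let bs := Module.finBasis ℂ H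
    have hb := sum_sliceRight_tmul bs (β.coact b)
    let φ : A ⊗[ℂ] H →ₗ[ℂ] (A ⊗[ℂ] A) ⊗[ℂ] H := (TensorProduct.mk ℂ A A a).rTensor H
    have h2 := congrArg φ (sum_coact_mul_antipode β 1 b _ _ _ hb)
    simp only [one_mul, map_one] at h2
    have h3 : φ (b ⊗ₜ[ℂ] 1) = (a ⊗ₜ b) ⊗ₜ 1 := rfl
    rw [← h3, ← h2, LinearMap.lTensor_tmul, LinearMap.comp_apply, LinearMap.comp_apply,
      AlgHom.toLinearMap_apply]
    conv_lhs => rw [← hb]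
    simp only [map_sum, LinearMap.lTensor_tmul, LinearEquiv.coe_coe, TensorProduct.comm_tmul,
      TensorProduct.tmul_sum, TensorProduct.assoc_symm_tmul, AlgHom.toLinearMap_apply]
    refine Finset.sum_congr rfl fun i _ => ?_
    induction β.coact (sliceRight (bs.coord i) (β.coact b)) with
    | zero => simp
    | add x y hx hy => simp only [map_add, TensorProduct.tmul_add, add_mul, hx, hy]
    | tmul x y => simp [collectCoact_tmul, φ]

end CoactLemmas

section CoactLemmas

open WithConv

variable {H A R : Type*} [Ring H] [HopfAlgebra ℂ H] [Ring A] [Algebra ℂ A] [Ring R] [Algebra ℂ R]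
  (β : RightComoduleAlgebra H A)

/-- The abstract form of the corner next to the incoming boundary edge: y collects a coaction letter
from f, and F x-commutes precisely up to this letter. -/
theorem commute_mul_coactConv {x y : R} {f : A →ₗ[ℂ] R} {X F : ConvRing H R}
    (hy : ∀ a, y * f a = coactConv β f X a * y) (hx : ∀ a, Commute x (f a))
    (hF : constConv H x * X * constConv H y * F = F * constConv H (x * y)) (a : A) :
    Commute (x * y) (coactConv β f F a) := by
  have hy' : LinearMap.mulLeft ℂ y ∘ₗ f = LinearMap.mulRight ℂ y ∘ₗ coactConv β f X :=
    LinearMap.ext hy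
  have hx' : LinearMap.mulLeft ℂ x ∘ₗ f = LinearMap.mulRight ℂ x ∘ₗ f :=
    LinearMap.ext fun a => (hx a).eq
  have key : LinearMap.mulLeft ℂ (x * y) ∘ₗ coactConv β f F =
      LinearMap.mulRight ℂ (x * y) ∘ₗ coactConv β f F := by
    rw [mul_coactConv, LinearMap.mulLeft_mul, LinearMap.comp_assoc, hy', ← coactConv_mul_constConv,
      mul_coactConv, hx', ← coactConv_constConv_mul, coactConv_coactConv,
      ← coactConv_mul_constConv, ← hF, ← mul_assoc]
  exact LinearMap.congr_fun key a

end CoactLemmas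

namespace DiskLattice

variable {D : Type*} (L : DiskLattice D)

theorem not_mem_bulkDartsAt [Finite D] (o : L.BdryEdge) : (∀ d ∈ L.bulkDartsAt o, L.flip d ∉ L.bulkDartsAt o) ∧
    (L.bulkDartsAt o).Nodup ∧ o.1 ∉ L.bulkDartsAt o ∧ L.rot o.1 ∉ L.bulkDartsAt o := by
  have hnd := L.nodup_bulkDartsAt o
  simp only [List.nodup_cons, List.mem_cons, not_or] at hnd
  have hmem : ∀ {d}, d ∈ L.bulkDartsAt o → L.rot.SameCycle o.1 d := fun hd =>
    (L.sameCycle_outer_iff o).2 (Or.inr (Or.inr hd))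
  exact ⟨fun d hd hd' => L.not_sameCycle_flip (hmem hd) (hmem hd'), hnd.2.2, hnd.1.2, hnd.2.1⟩

end DiskLattice

/-! ### Boundary vertex operators commute with face operators -/

namespace EdgeSystem

open Coalgebra HopfAlgebra WithConv

variable {D : Type*} {L : DiskLattice D} {H A V : Type*} [Ring H] [HopfAlgebra ℂ H]
  [FiniteDimensional ℂ H] [Ring A] [Algebra ℂ A] [AddCommGroup V] [Module ℂ V]
  (M : EdgeSystem L H A V) (β : RightComoduleAlgebra H A)

/-- Left multiplication on a boundary edge. -/
def bdryLeft (o : D) : A →ₗ[ℂ] Module.End ℂ V := M.bdry o ∘ₗ LinearMap.mul ℂ A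

/-- Right multiplication on a boundary edge. -/
def bdryRight (o : D) : A →ₗ[ℂ] Module.End ℂ V := M.bdry o ∘ₗ (LinearMap.mul ℂ A).flip

/-- The action of `A` at a boundary vertex, through the incoming boundary edge and the bulk darts. -/
def K (o : L.BdryEdge) : A →ₗ[ℂ] Module.End ℂ V :=
  coactConv β (M.bdryLeft (L.incoming o).1) (M.vert (L.bulkDartsAt o))

/-- The vertex operators of a boundary vertex. -/
def bdryVert (o : L.BdryEdge) : A ⊗[ℂ] A →ₗ[ℂ] Module.End ℂ V :=
  LinearMap.mul' ℂ _ ∘ₗ TensorProduct.map (M.K β o) (M.bdryRight o.1)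

@[simp] theorem bdryVert_tmul (o : L.BdryEdge) (a b : A) :
    M.bdryVert β o (a ⊗ₜ b) = M.K β o a * M.bdryRight o.1 b := rfl

theorem bdryLeft_mul (o : D) (a b : A) :
    M.bdryLeft o (a * b) = M.bdryLeft o a * M.bdryLeft o b := by
  rw [bdryLeft, LinearMap.comp_apply, LinearMap.comp_apply, LinearMap.comp_apply, ← M.bdry_mul]
  congr 1
  ext x; simp [mul_assoc]

theorem bdryRight_mul (o : D) (a b : A) :
    M.bdryRight o (a * b) = M.bdryRight o b * M.bdryRight o a := by
  rw [bdryRight, LinearMap.comp_apply, LinearMap.comp_apply, LinearMap.comp_apply, ← M.bdry_mul]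
  congr 1
  ext x; simp [mul_assoc]

theorem commute_bdryLeft_bdryRight (o o' : D) (a b : A) :
    Commute (M.bdryLeft o a) (M.bdryRight o' b) := by
  by_cases h : o = o'
  · subst h
    simp only [bdryLeft, bdryRight, LinearMap.comp_apply, Commute, SemiconjBy, ← M.bdry_mul]
    congr 1
    ext x; simp [mul_assoc]
  · exact M.bdry_comm _ _ h _ _

theorem commute_K {z : Module.End ℂ V} {o : L.BdryEdge}
    (h : ∀ a, Commute z (M.bdryLeft (L.incoming o).1 a))
    (h' : ∀ d ∈ L.bulkDartsAt o, ∀ g, Commute z (M.l d g)) (a : A) : Commute z (M.K β o a) :=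
  commute_coactConv β h (M.commute_vert h') a

theorem commute_bdryVert {z : Module.End ℂ V} {o : L.BdryEdge} (h : ∀ a, Commute z (M.K β o a))
    (h' : ∀ b, Commute z (M.bdryRight o.1 b)) (t : A ⊗[ℂ] A) : Commute z (M.bdryVert β o t) := by
  induction t with
  | zero => simp
  | add s t hs ht => rw [map_add]; exact hs.add_right ht
  | tmul a b => exact (h a).mul_right (h' b)

theorem commute_l_bdryLeft (d o : D) (g : H) (a : A) :
    Commute (M.l d g) (M.bdryLeft o a) := M.bulk_bdry_comm _ _ _ _

theorem commute_l_bdryRight (d o : D) (g : H) (a : A) :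
    Commute (M.l d g) (M.bdryRight o a) := M.bulk_bdry_comm _ _ _ _

theorem commute_bdryRight_K (o o' : L.BdryEdge) (a b : A) :
    Commute (M.bdryRight o'.1 b) (M.K β o a) :=
  M.commute_K β (fun a => (M.commute_bdryLeft_bdryRight _ _ a b).symm)
    (fun d _ g => (M.commute_l_bdryRight d _ g b).symm) a

theorem commute_l_bdryVert {d : D} {o : L.BdryEdge} (g : H)
    (h : ∀ x ∈ L.bulkDartsAt o, ∀ k, Commute (M.l d g) (M.l x k)) (t : A ⊗[ℂ] A) :
    Commute (M.l d g) (M.bdryVert β o t) :=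
  M.commute_bdryVert β (M.commute_K β (M.commute_l_bdryLeft d _ g) h)
    (M.commute_l_bdryRight d _ g) t

section Relations

theorem T_flip_mul_bdryLeft {o : D} (ho : L.IsOuter o) :
    LinearMap.mulLeft ℂ (M.T β (L.flip o)) ∘ₗ
        ((Algebra.TensorProduct.includeLeft (R := ℂ) (S := ℂ) (B := H)).toLinearMap ∘ₗ
          M.bdryLeft o) =
      LinearMap.mulRight ℂ (M.T β (L.flip o)) ∘ₗ coactConv β
        ((Algebra.TensorProduct.includeLeft (R := ℂ) (S := ℂ) (B := H)).toLinearMap ∘ₗ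
          M.bdryLeft o) (inclConv (Module.End ℂ V) H) := by
  ext1 a
  refine eq_of_sliceRight_eq fun φ => ?_
  let bs := Module.finBasis ℂ H
  have ha := sum_sliceRight_tmul bs (β.coact a)
  simp only [coactConv, LinearMap.comp_apply, AlgHom.toLinearMap_apply, LinearMap.mulLeft_apply,
    Algebra.TensorProduct.includeLeft_apply, sliceRight_mul_tmul_one, LinearMap.mulRight_apply,
    M.sliceRight_T_of_isOuter β ho]
  conv_rhs => rw [← ha]
  simp only [map_sum, Finset.sum_mul, TensorProduct.map_tmul, LinearMap.mul'_apply]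
  trans ∑ k, M.bdryLeft o (sliceRight (bs.coord k) (β.coact a)) *
      M.bdry o (TbarPlus β (φ ∘ₗ LinearMap.mulLeft ℂ (bs k)))
  · simp only [bdryLeft, LinearMap.comp_apply, ← M.bdry_mul, ← map_sum]
    congr 1
    ext x
    simp only [Module.End.mul_apply, LinearMap.sum_apply, LinearMap.mul_apply']
    exact TbarPlus_apply_mul_tmul β φ a x _ _ _ ha
  · refine Finset.sum_congr rfl fun k _ => ?_
    simp only [inclConv, LinearMap.comp_apply, AlgHom.toLinearMap_apply,
      Algebra.TensorProduct.includeLeft_apply, Algebra.TensorProduct.includeRight_apply,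
      Algebra.TensorProduct.tmul_mul_tmul, one_mul, mul_one]
    rw [sliceRight_tmul_mul, M.sliceRight_T_of_isOuter β ho]

theorem T_flip_mul_bdryRight {o : D} (ho : L.IsOuter o) (b : A) :
    M.T β (L.flip o) * (M.bdryRight o b) ⊗ₜ[ℂ] 1 =
      LinearMap.mul' ℂ _ (TensorProduct.map (LinearMap.mulRight ℂ (M.T β (L.flip o)) ∘ₗ
        (Algebra.TensorProduct.includeLeft (R := ℂ) (S := ℂ) (B := H)).toLinearMap ∘ₗ
          M.bdryRight o) (inclConv (Module.End ℂ V) H).ofConv (β.coact b)) := by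
  refine eq_of_sliceRight_eq fun φ => ?_
  let bs := Module.finBasis ℂ H
  have hb := sum_sliceRight_tmul bs (β.coact b)
  rw [sliceRight_mul_tmul_one, M.sliceRight_T_of_isOuter β ho]
  conv_rhs => rw [← hb]
  simp only [map_sum, TensorProduct.map_tmul, LinearMap.mul'_apply]
  trans ∑ k, M.bdryRight o (sliceRight (bs.coord k) (β.coact b)) *
      M.bdry o (TbarPlus β (φ ∘ₗ LinearMap.mulRight ℂ (bs k)))
  · simp only [bdryRight, LinearMap.comp_apply, ← M.bdry_mul, ← map_sum]
    congr 1
    ext x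
    simp only [Module.End.mul_apply, LinearMap.sum_apply, LinearMap.flip_apply,
      LinearMap.mul_apply']
    exact TbarPlus_apply_tmul_mul β φ x b _ _ _ hb
  · refine Finset.sum_congr rfl fun k _ => ?_
    simp only [inclConv, LinearMap.comp_apply, AlgHom.toLinearMap_apply,
      Algebra.TensorProduct.includeLeft_apply, Algebra.TensorProduct.includeRight_apply,
      LinearMap.mulRight_apply]
    rw [sliceRight_mul_tmul, mul_one, sliceRight_tmul_one_mul, M.sliceRight_T_of_isOuter β ho]

end Relations

/-- The inclusion of the operators in the ring of operators with a leg in `H`. -/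
def incl (E H : Type*) [Ring E] [Algebra ℂ E] [Ring H] [Algebra ℂ H] : E →ₐ[ℂ] E ⊗[ℂ] H :=
  Algebra.TensorProduct.includeLeft (R := ℂ) (S := ℂ) (B := H)

theorem incl_comp_K (o : L.BdryEdge) : (incl (Module.End ℂ V) H).toLinearMap ∘ₗ M.K β o =
    coactConv β ((incl (Module.End ℂ V) H).toLinearMap ∘ₗ M.bdryLeft (L.incoming o).1)
      ((L.bulkDartsAt o).map M.lConv).prod := by
  have h : (((L.bulkDartsAt o).map M.lConv).prod : ConvRing H (Module.End ℂ V ⊗[ℂ] H)) =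
      toConv ((incl (Module.End ℂ V) H).toLinearMap ∘ₗ (M.vert (L.bulkDartsAt o)).ofConv) := by
    ext1; ext1 g
    exact M.lConv_prod_apply _ g
  rw [h]
  exact algHom_comp_coactConv β _ _ _

theorem commute_incl_K {z : Module.End ℂ V ⊗[ℂ] H} {o : L.BdryEdge}
    (h : ∀ a, Commute z (incl _ H (M.bdryLeft (L.incoming o).1 a)))
    (h' : Commute (constConv H z) ((L.bulkDartsAt o).map M.lConv).prod) (a : A) :
    Commute z (incl _ H (M.K β o a)) := by
  have h1 := LinearMap.congr_fun (M.incl_comp_K β o) a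
  simp only [LinearMap.comp_apply, AlgHom.toLinearMap_apply] at h1
  rw [h1]
  exact commute_coactConv β h (commute_constConv_iff.1 h') a

theorem commute_incl_bdryVert {z : Module.End ℂ V ⊗[ℂ] H} {o : L.BdryEdge}
    (h : ∀ a, Commute z (incl _ H (M.K β o a))) (h' : ∀ b, Commute z (incl _ H (M.bdryRight o.1 b)))
    (t : A ⊗[ℂ] A) : Commute z (incl _ H (M.bdryVert β o t)) := by
  induction t with
  | zero => simp
  | add s t hs ht => rw [map_add, map_add]; exact hs.add_right ht
  | tmul a b => rw [bdryVert_tmul, map_mul]; exact (h a).mul_right (h' b)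

/-- The corner next to the outgoing boundary edge. Passing y leaves the coaction letter of a and
passing x that of b; both land between x and y, where they multiply to the letter of the coaction on
λ, which is 1. -/
theorem T_mul_T_mul_incl_bdryVert {o : L.BdryEdge} {x y : Module.End ℂ V ⊗[ℂ] H}
    (hy : ∀ a, y * incl _ H (M.K β o a) =
      coactConv β ((incl _ H).toLinearMap ∘ₗ M.K β o) (inclConv _ H) a * y)
    (hyr : ∀ b, Commute y (incl _ H (M.bdryRight o.1 b)))
    (hxK : ∀ a, Commute x (incl _ H (M.K β o a)))
    (hxr : ∀ b, x * incl _ H (M.bdryRight o.1 b) = LinearMap.mul' ℂ _ (TensorProduct.map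
      (LinearMap.mulRight ℂ x ∘ₗ (incl _ H).toLinearMap ∘ₗ M.bdryRight o.1)
      (inclConv (Module.End ℂ V) H).ofConv (β.coact b))) {lam : A ⊗[ℂ] A}
    (hlam : collectCoact H A (TensorProduct.map β.coact.toLinearMap β.coact.toLinearMap lam) =
      lam ⊗ₜ[ℂ] 1) : Commute (x * y) (incl _ H (M.bdryVert β o lam)) := by
  let Φ : (A ⊗[ℂ] A) ⊗[ℂ] H →ₗ[ℂ] Module.End ℂ V ⊗[ℂ] H := LinearMap.mulRight ℂ y ∘ₗ
    LinearMap.mul' ℂ _ ∘ₗ TensorProduct.map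
      (LinearMap.mulRight ℂ x ∘ₗ (incl _ H).toLinearMap ∘ₗ M.bdryVert β o)
      (inclConv (Module.End ℂ V) H).ofConv
  have hΦ : ∀ t g, Φ (t ⊗ₜ g) = incl _ H (M.bdryVert β o t) * x * (1 ⊗ₜ g) * y := fun t g => rfl
  have hX : ∀ (z : Module.End ℂ V) (g : H), Commute ((1 : Module.End ℂ V) ⊗ₜ[ℂ] g)
      (incl (Module.End ℂ V) H z) := fun z g => by
    simp [incl, Commute, SemiconjBy]
  suffices h : ∀ t, x * y * incl _ H (M.bdryVert β o t) =
      Φ (collectCoact H A (TensorProduct.map β.coact.toLinearMap β.coact.toLinearMap t)) by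
    rw [Commute, SemiconjBy, h, hlam, hΦ, ← Algebra.TensorProduct.one_def, mul_one, mul_assoc]
  intro t
  induction t with
  | zero => simp
  | add s t hs ht => simp only [map_add, mul_add, hs, ht]
  | tmul a b =>
    rw [bdryVert_tmul, map_mul, mul_assoc, ← mul_assoc y, hy, mul_assoc, (hyr b).eq,
      TensorProduct.map_tmul]
    simp only [AlgHom.toLinearMap_apply, coactConv, LinearMap.comp_apply]
    induction β.coact a with
    | zero => simp
    | add c d hc hd => simp only [map_add, add_mul, mul_add, TensorProduct.add_tmul, hc, hd]
    | tmul c g =>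
      have h1 : x * (incl _ H (M.K β o c) * (1 ⊗ₜ g) * (incl _ H (M.bdryRight o.1 b) * y)) =
          incl _ H (M.K β o c) * (x * incl _ H (M.bdryRight o.1 b)) * (1 ⊗ₜ g) * y := by
        rw [mul_assoc (incl _ H (M.K β o c)), ← mul_assoc (1 ⊗ₜ g), (hX _ g).eq, ← mul_assoc,
          (hxK c).eq]
        simp only [mul_assoc]
      refine h1.trans ?_
      rw [hxr]
      induction β.coact b with
      | zero => simp
      | add c d hc hd => simp only [map_add, add_mul, mul_add, TensorProduct.tmul_add, hc, hd]
      | tmul e k =>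
        rw [collectCoact_tmul, hΦ, bdryVert_tmul, map_mul]
        have h2 : (1 : Module.End ℂ V) ⊗ₜ[ℂ] (k * g) = (1 ⊗ₜ k) * (1 ⊗ₜ g) := by simp
        rw [h2]
        simp only [TensorProduct.map_tmul, LinearMap.mul'_apply, LinearMap.comp_apply,
          LinearMap.mulRight_apply, AlgHom.toLinearMap_apply, inclConv,
          Algebra.TensorProduct.includeRight_apply, mul_assoc]


theorem commute_T_bdryLeft {o : L.BdryEdge} {x : D} (hx : x ≠ L.rot o.1) (a : A) :
    Commute (M.T β x) (incl _ H (M.bdryLeft (L.incoming o).1 a)) :=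
  (commute_tmul_one_iff.2 (M.commute_bdry_T β (by
    rw [show L.flip (L.incoming o).1 = L.rot o.1 from L.flip_flip _]; exact hx) _)).symm

theorem commute_T_bdryRight {o : L.BdryEdge} {x : D} (hx : x ≠ L.flip o.1) (b : A) :
    Commute (M.T β x) (incl _ H (M.bdryRight o.1 b)) :=
  (commute_tmul_one_iff.2 (M.commute_bdry_T β hx _)).symm

theorem T_rot_mul_bdryLeft (o : L.BdryEdge) :
    LinearMap.mulLeft ℂ (M.T β (L.rot o.1)) ∘ₗ
        ((incl _ H).toLinearMap ∘ₗ M.bdryLeft (L.incoming o).1) =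
      LinearMap.mulRight ℂ (M.T β (L.rot o.1)) ∘ₗ coactConv β
        ((incl _ H).toLinearMap ∘ₗ M.bdryLeft (L.incoming o).1)
          (inclConv (Module.End ℂ V) H) := by
  have := M.T_flip_mul_bdryLeft β (L.incoming o).2
  rwa [show L.flip (L.incoming o).1 = L.rot o.1 from L.flip_flip _] at this

variable [StarRing H] [StarModule ℂ H] (hH : IsCStarHopfAlgebra H) [Finite D]
include hH

section Around

variable {o : L.BdryEdge}

/-- The darts at a boundary vertex satisfy the relations of the abstract vertex products. -/
theorem bulkDartsAt_relations :
    (∀ d ∈ L.bulkDartsAt o, constConv H (M.T β d) * M.lConv d =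
      M.lConv d * inclConv _ H * constConv H (M.T β d)) ∧
    (∀ d ∈ L.bulkDartsAt o, M.lConv d * constConv H (M.T β (L.flip d)) =
      constConv H (M.T β (L.flip d)) * inclConv _ H * M.lConv d) ∧
    (∀ d ∈ L.bulkDartsAt o, ∀ x, x ≠ d → x ≠ L.flip d →
      Commute (constConv H (M.T β x)) (M.lConv d)) :=
  ⟨fun _ hd => M.constConv_T_mul_lConv β (L.not_isOuter_of_mem_bulkDartsAt hd).2,
   fun _ hd => M.lConv_mul_constConv_T β hH.antipode_antipode (L.not_isOuter_of_mem_bulkDartsAt hd).1,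
   fun _ _ _ => M.commute_constConv_T_lConv β⟩

/-- The dart before the outgoing boundary edge carries the last letter of the iterated coaction. It
is the last bulk dart, or the reverse of the incoming boundary edge if there are no bulk edges at
the vertex. -/
theorem T_mul_incl_K_of_rot_eq {y : D} (hy : L.rot y = o.1) (a : A) :
    M.T β y * incl _ H (M.K β o a) =
      coactConv β ((incl _ H).toLinearMap ∘ₗ M.K β o) (inclConv _ H) a * M.T β y := by
  obtain ⟨hnf, hnd, -, hrd⟩ := L.not_mem_bulkDartsAt o
  obtain ⟨h₁, h₂, hc⟩ := M.bulkDartsAt_relations β hH (o := o)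
  have hch := L.chain_bulkDartsAt o
  have key : LinearMap.mulLeft ℂ (M.T β y) ∘ₗ ((incl _ H).toLinearMap ∘ₗ M.K β o) =
      LinearMap.mulRight ℂ (M.T β y) ∘ₗ
        coactConv β ((incl _ H).toLinearMap ∘ₗ M.K β o) (inclConv _ H) := by
    have hK := M.incl_comp_K β o
    obtain h0 | ⟨u, d, hu⟩ := List.eq_nil_or_concat' (L.bulkDartsAt o)
    · rw [h0, List.map_nil, List.prod_nil, coactConv_one] at hK
      rw [h0] at hch
      obtain rfl : y = L.rot o.1 := by
        apply L.rot.injective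
        rw [hy]
        exact (List.isChain_cons_cons.1 hch).1.symm
      rw [hK]
      exact M.T_rot_mul_bdryLeft β o
    · obtain rfl : y = d := by
        apply L.rot.injective
        rw [hu, List.append_assoc, ← List.cons_append] at hch
        rw [hy, ((List.isChain_append_cons_cons (l₁ := L.rot o.1 :: u)).1 hch).2.1]
      have hyd : y ∈ L.bulkDartsAt o := by rw [hu]; simp
      have hcl : LinearMap.mulLeft ℂ (M.T β y) ∘ₗ
          ((incl _ H).toLinearMap ∘ₗ M.bdryLeft (L.incoming o).1) =
          LinearMap.mulRight ℂ (M.T β y) ∘ₗ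
          ((incl _ H).toLinearMap ∘ₗ M.bdryLeft (L.incoming o).1) := by
        ext1 a
        exact (M.commute_T_bdryLeft β (fun h => hrd (h ▸ hyd)) a).eq
      have hlast := last_mul_prod (T := fun x => constConv H (M.T β x)) hu hnd hnf h₁ hc
      rw [hK]
      refine (mul_coactConv β _ _ _).trans ?_
      rw [hcl]
      refine (coactConv_constConv_mul β _ _ _).symm.trans ?_
      rw [hlast]
      refine (coactConv_mul_constConv β _ _ _).trans ?_
      rw [coactConv_coactConv]
  exact LinearMap.congr_fun key a

end Around

variable [FiniteDimensional ℂ A] {lam : A ⊗[ℂ] A} (hlam : IsSymmSeparabilityIdempotent lam)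
include hlam

theorem commute_T_mul_T_bdryVert (o : L.BdryEdge) {x : D} (hx : ¬ L.IsOuter x)
    (hxp : L.rot.SameCycle o.1 (L.flip x)) :
    Commute (M.T β x * M.T β (L.next x)) (incl _ H (M.bdryVert β o lam)) := by
  have hf := L.flip_flip
  obtain ⟨hnf, hnd, hod, hrd⟩ := L.not_mem_bulkDartsAt o
  obtain ⟨h₁, h₂, hc⟩ := M.bulkDartsAt_relations β hH (o := o)
  have hch := L.chain_bulkDartsAt o
  have hxn : ¬ L.rot.SameCycle o.1 x := fun h => L.not_sameCycle_flip h hxp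
  have hyp : L.rot.SameCycle o.1 (L.next x) := L.sameCycle_next_iff.2 hxp
  have hpr : L.rot.SameCycle o.1 (L.rot o.1) := (L.sameCycle_outer_iff o).2 (Or.inr (Or.inl rfl))
  have hmem : ∀ {d}, d ∈ L.bulkDartsAt o → L.rot.SameCycle o.1 d := fun hd =>
    (L.sameCycle_outer_iff o).2 (Or.inr (Or.inr hd))
  have hxr : x ≠ L.rot o.1 := fun h => hxn (h ▸ hpr)
  have hyf : ∀ {d}, L.rot.SameCycle o.1 d → L.next x ≠ L.flip d := fun hd h =>
    L.not_sameCycle_flip hd (h ▸ hyp)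
  have hyr := M.commute_T_bdryRight β (o := o) (hyf (.refl _ _))
  obtain h | h | h := (L.sameCycle_outer_iff o).1 hxp
  -- The corner next to the outgoing boundary edge.
  · have hxo : x = L.flip o.1 := by rw [← h, hf]
    refine M.T_mul_T_mul_incl_bdryVert β (M.T_mul_incl_K_of_rot_eq β hH (by rw [L.rot_next, h]))
      hyr (M.commute_incl_K β (M.commute_T_bdryLeft β hxr) ?_) (fun b => ?_)
      (hlam.collectCoact_coact β hH.antipode_antipode)
    · refine Commute.list_prod_right _ _ fun y hy => ?_
      obtain ⟨d, hd, rfl⟩ := List.mem_map.1 hy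
      refine hc d hd x (fun h => hxn (h ▸ hmem hd)) fun h' => hod ?_
      rwa [← h, h', hf]
    · rw [hxo]
      exact M.T_flip_mul_bdryRight β o.2 b
  -- Otherwise x would be the incoming boundary edge itself, seen from the outer face.
  · refine absurd ?_ hx
    rw [← hf x, h]
    exact L.isOuter_flip_rot o.2
  · have hxo : x ≠ L.flip o.1 := fun h' => hod (by rwa [h', hf] at h)
    refine M.commute_incl_bdryVert β ?_
      (fun b => (M.commute_T_bdryRight β hxo b).mul_left (hyr b)) _
    obtain ⟨a, b, hab⟩ := List.append_of_mem h
    rw [hab, List.append_assoc, List.cons_append] at hch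
    obtain rfl | ⟨a, y, rfl⟩ := List.eq_nil_or_concat' a
    -- The corner between the incoming boundary edge and the first bulk dart.
    · have hy : L.next x = L.rot o.1 := by
        rw [L.next_apply, Equiv.Perm.inv_eq_iff_eq]
        simpa using (List.isChain_cons_cons.1 hch).1.symm
      have hhead := flip_head_mul_prod (T := fun x => constConv H (M.T β x)) (X := inclConv _ H)
        hf hab hnd hnf h₂ hc
      rw [hf] at hhead
      have hcy : Commute (constConv H (M.T β (L.rot o.1)))
          ((L.bulkDartsAt o).map M.lConv).prod := by
        refine Commute.list_prod_right _ _ fun y hy' => ?_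
        obtain ⟨d, hd, rfl⟩ := List.mem_map.1 hy'
        exact hc d hd _ (fun h => hrd (h ▸ hd)) (hy ▸ hyf (hmem hd))
      intro a
      have h1 := LinearMap.congr_fun (M.incl_comp_K β o) a
      simp only [LinearMap.comp_apply, AlgHom.toLinearMap_apply] at h1
      rw [hy, h1]
      refine commute_mul_coactConv β (X := inclConv _ H)
        (LinearMap.congr_fun (M.T_rot_mul_bdryLeft β o)) (M.commute_T_bdryLeft β hxr) ?_ a
      rw [mul_assoc, hcy.eq, ← mul_assoc, hhead, mul_assoc, constConv_mul]
    -- A corner between two bulk darts, as at a bulk vertex.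
    · have hy : y = L.next x := by
        rw [L.next_apply, Equiv.Perm.eq_inv_iff_eq]
        have h0 : L.rot o.1 :: (a ++ [y] ++ (L.flip x :: (b ++ [o.1]))) =
          (L.rot o.1 :: a) ++ y :: L.flip x :: (b ++ [o.1]) := by simp
        rw [h0, List.isChain_append_cons_cons] at hch
        exact hch.2.1
      subst hy
      have hyd : L.next x ∈ L.bulkDartsAt o := by rw [hab]; simp
      have hyr' : L.next x ≠ L.rot o.1 := fun h => hrd (h ▸ hyd)
      refine M.commute_incl_K β (fun c => (M.commute_T_bdryLeft β hxr c).mul_left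
        (M.commute_T_bdryLeft β hyr' c)) ?_
      have := commute_pair_prod (T := fun x => constConv H (M.T β x)) (l := M.lConv) hf hnd hnf h₁
        h₂ hc (u := a) (v := b) (d := L.next x) (e := L.flip x) (by rw [hab]; simp)
      rwa [hf, ← constConv_mul] at this

/-- Boundary vertex operators commute with face operators. -/
theorem commute_bdryVert_B (o : L.BdryEdge) {w : List D} (hw : w.Nodup)
    (hi : ∀ x ∈ w, ¬ L.IsOuter x) (hc : (w : Cycle D).Chain fun a b => L.next a = b) :
    Commute (M.bdryVert β o lam) (M.B β w) := by
  have hf := L.flip_flip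
  have hpr : L.rot.SameCycle o.1 (L.rot o.1) := (L.sameCycle_outer_iff o).2 (Or.inr (Or.inl rfl))
  have hmem : ∀ {d}, d ∈ L.bulkDartsAt o → L.rot.SameCycle o.1 d := fun hd =>
    (L.sameCycle_outer_iff o).2 (Or.inr (Or.inr hd))
  have hp : ∀ x, L.rot.SameCycle o.1 x → ¬ L.rot.SameCycle o.1 (L.flip x) :=
    fun x h => L.not_sameCycle_flip h
  have hfree : ∀ x, ¬ L.rot.SameCycle o.1 x → ¬ L.rot.SameCycle o.1 (L.flip x) →
      Commute (M.T β x) (incl _ H (M.bdryVert β o lam)) := fun x hx hx' => by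
    refine M.commute_incl_bdryVert β (M.commute_incl_K β (M.commute_T_bdryLeft β
      fun h : x = L.rot o.1 => hx (h ▸ hpr)) ?_) (M.commute_T_bdryRight β fun h => hx' (by rw [h, hf])) _
    refine Commute.list_prod_right _ _ fun y hy => ?_
    obtain ⟨d, hd, rfl⟩ := List.mem_map.1 hy
    exact M.commute_constConv_T_lConv β (fun h => hx (h ▸ hmem hd))
      fun h => hx' (by rw [h, hf]; exact hmem hd)
  have key : ∀ w, Commute (M.word β w) (incl _ H (M.bdryVert β o lam)) →
      Commute (M.bdryVert β o lam) (M.B β w) := fun w h => commute_tmul_one_iff.1 h.symm _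
  obtain rfl | hne := w.eq_nil_or_concat'
  · exact key _ (by simp [word])
  obtain ⟨x, hxw, hx⟩ : ∃ x ∈ w, ¬ L.rot.SameCycle o.1 x := by
    obtain ⟨a, x, rfl⟩ := hne
    by_contra! hall
    have h1 := hall x (by simp)
    have hc' := chain_isRotated hc (List.isRotated_append (l := a) (l' := [x]))
    cases a with
    | nil =>
      rw [List.append_nil, Cycle.chain_singleton] at hc'
      exact hp x h1 (L.sameCycle_next_iff.1 (by rwa [hc']))
    | cons y a =>
      rw [List.singleton_append, Cycle.chain_coe_cons, List.cons_append,
        List.isChain_cons_cons] at hc'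
      exact hp x h1 (L.sameCycle_next_iff.1 (by rw [hc'.1]; exact hall y (by simp)))
  obtain ⟨u, hu⟩ := exists_isRotated_cons hxw
  rw [M.B_of_isRotated β hH hw hu]
  have hc' := chain_isRotated hc hu
  rw [Cycle.chain_coe_cons, ← List.cons_append] at hc'
  have hc'' := List.isChain_append.1 hc'
  refine key _ ?_
  refine commute_prod_of_isChain (T := M.T β) (P := fun z => ¬ L.IsOuter z) (f := L.flip) (n := L.next) hp
      (fun z => L.sameCycle_next_iff) (fun z _ => hfree z)
      (fun z hz _ hz' => M.commute_T_mul_T_bdryVert β hH hlam o hz hz')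
      (x :: u) hc''.1 (fun z hz => hi z (hu.mem_iff.2 hz)) (fun z hz => ?_) (fun z hz => ?_)
  · simp only [List.head?_cons, Option.mem_def, Option.some.injEq] at hz
    exact hz ▸ hx
  · have h1 := hc''.2.2 z hz x (by simp)
    rw [← L.sameCycle_next_iff, h1]
    exact hx

end EdgeSystem

/-! ### The operators on the total space form an edge system -/

section PiUpdate

variable {ι M : Type*} [DecidableEq ι] [AddCommGroup M] [Module ℂ M]

/-- An operator acting on one factor of a tensor power. -/
def onFactor (i : ι) : Module.End ℂ M →ₗ[ℂ] Module.End ℂ (⨂[ℂ] _ : ι, M) :=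
  (PiTensorProduct.mapMultilinear ℂ (fun _ : ι => M) (fun _ => M)).toLinearMap
      (fun _ => LinearMap.id) i

theorem onFactor_tprod (i : ι) (f : Module.End ℂ M) (x : ι → M) :
    onFactor i f (⨂ₜ[ℂ] j, x j) = ⨂ₜ[ℂ] j, Function.update x i (f (x i)) j := by
  rw [onFactor, MultilinearMap.toLinearMap_apply, PiTensorProduct.mapMultilinear_apply,
    PiTensorProduct.map_tprod]
  congr 1
  ext j
  by_cases h : j = i
  · subst h; simp
  · simp [h]

theorem onFactor_mul (i : ι) (f g : Module.End ℂ M) :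
    onFactor i (f * g) = onFactor i f * onFactor i g := by
  ext x
  simp [onFactor_tprod]

theorem onFactor_one (i : ι) : onFactor i (1 : Module.End ℂ M) = 1 := by
  ext x
  simp [onFactor_tprod]

theorem commute_onFactor {i j : ι} (h : i ≠ j) (f g : Module.End ℂ M) :
    Commute (onFactor i f) (onFactor j g) := by
  rw [Commute, SemiconjBy]
  ext x
  simp [onFactor_tprod, h, h.symm, Function.update_comm h]

end PiUpdate

namespace EdgeSystem

open Coalgebra HopfAlgebra WithConv

variable {D : Type*} (L : DiskLattice D) (H A : Type*) [Ring H] [HopfAlgebra ℂ H]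
  [FiniteDimensional ℂ H] [Ring A] [Algebra ℂ A]

section Single

variable {L H A}

open scoped Classical in
theorem onBulkEdge_apply (e : L.BulkEdge) (f : Module.End ℂ H) :
    onBulkEdge L H A e f = (onFactor e f).rTensor _ := rfl

open scoped Classical in
theorem onBdryEdge_apply (e : L.BdryEdge) (f : Module.End ℂ A) :
    onBdryEdge L H A e f = (onFactor e f).lTensor _ := rfl

theorem onBulkEdge_mul (e : L.BulkEdge) (f g : Module.End ℂ H) :
    onBulkEdge L H A e (f * g) = onBulkEdge L H A e f * onBulkEdge L H A e g := by
  classical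
  simp only [onBulkEdge_apply, onFactor_mul, LinearMap.rTensor_mul]

theorem onBulkEdge_one (e : L.BulkEdge) : onBulkEdge L H A e 1 = 1 := by
  classical
  rw [onBulkEdge_apply, onFactor_one]; exact LinearMap.rTensor_id _ _

theorem commute_onBulkEdge {e e' : L.BulkEdge} (h : e ≠ e') (f g : Module.End ℂ H) :
    Commute (onBulkEdge L H A e f) (onBulkEdge L H A e' g) := by
  classical
  simp only [onBulkEdge_apply, Commute, SemiconjBy]
  rw [← LinearMap.rTensor_mul, ← LinearMap.rTensor_mul, (commute_onFactor h f g).eq]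

theorem onBdryEdge_mul (e : L.BdryEdge) (f g : Module.End ℂ A) :
    onBdryEdge L H A e (f * g) = onBdryEdge L H A e f * onBdryEdge L H A e g := by
  classical
  simp only [onBdryEdge_apply, onFactor_mul, LinearMap.lTensor_mul]

theorem onBdryEdge_one (e : L.BdryEdge) : onBdryEdge L H A e 1 = 1 := by
  classical
  rw [onBdryEdge_apply, onFactor_one]; exact LinearMap.lTensor_id _ _

theorem commute_onBdryEdge {e e' : L.BdryEdge} (h : e ≠ e') (f g : Module.End ℂ A) :
    Commute (onBdryEdge L H A e f) (onBdryEdge L H A e' g) := by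
  classical
  simp only [onBdryEdge_apply, Commute, SemiconjBy]
  rw [← LinearMap.lTensor_mul, ← LinearMap.lTensor_mul, (commute_onFactor h f g).eq]

theorem commute_onBulkEdge_onBdryEdge (e : L.BulkEdge) (o : L.BdryEdge) (f : Module.End ℂ H)
    (g : Module.End ℂ A) : Commute (onBulkEdge L H A e f) (onBdryEdge L H A o g) := by
  classical
  simp only [onBulkEdge_apply, onBdryEdge_apply, Commute, SemiconjBy, Module.End.mul_eq_comp]
  rw [LinearMap.rTensor_comp_lTensor, LinearMap.lTensor_comp_rTensor]

end Single

open scoped Classical in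
/-- The operators on `H` at the edge of a bulk dart, conjugated by the antipode if the dart has the
direction of the edge. -/
def onDart (d : D) : Module.End ℂ H →ₗ[ℂ] Module.End ℂ (TotalSpace L H A) :=
  if h : L.pos d ∧ ¬ L.IsOuter d then onBulkEdge L H A ⟨d, h⟩ ∘ₗ antipodeConj H
  else if h : L.pos (L.flip d) ∧ ¬ L.IsOuter (L.flip d) then onBulkEdge L H A ⟨L.flip d, h⟩
  else 0

variable {L} in
theorem onDart_pos {d : D} (h : L.pos d ∧ ¬ L.IsOuter d) :
    onDart L H A d = onBulkEdge L H A ⟨d, h⟩ ∘ₗ antipodeConj H := dif_pos h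

variable {L} in
theorem onDart_flip {d : D} (h : L.pos d ∧ ¬ L.IsOuter d) :
    onDart L H A (L.flip d) = onBulkEdge L H A ⟨d, h⟩ := by
  have h1 : ¬ (L.pos (L.flip d) ∧ ¬ L.IsOuter (L.flip d)) := fun h' => (L.pos_flip d).1 h'.1 h.1
  rw [onDart, dif_neg h1, dif_pos (by rwa [L.flip_flip])]
  simp only [L.flip_flip]

variable {L} in
theorem onDart_cases (d : D) : (∃ e : L.BulkEdge, d = e.1 ∧
      onDart L H A d = onBulkEdge L H A e ∘ₗ antipodeConj H) ∨
    (∃ e : L.BulkEdge, d = L.flip e.1 ∧ onDart L H A d = onBulkEdge L H A e) ∨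
    (onDart L H A d = 0 ∧ onDart L H A (L.flip d) = 0 ∧ (L.IsOuter d ∨ L.IsOuter (L.flip d))) := by
  by_cases h : L.pos d ∧ ¬ L.IsOuter d
  · exact Or.inl ⟨⟨d, h⟩, rfl, onDart_pos H A h⟩
  · by_cases h' : L.pos (L.flip d) ∧ ¬ L.IsOuter (L.flip d)
    · exact Or.inr (Or.inl ⟨⟨L.flip d, h'⟩, (L.flip_flip d).symm, by
        rw [← onDart_flip H A h', L.flip_flip]⟩)
    · refine Or.inr (Or.inr ⟨by rw [onDart, dif_neg h, dif_neg h'], by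
        rw [onDart, dif_neg h', dif_neg (by rwa [L.flip_flip])], ?_⟩)
      by_contra! hc
      exact h ⟨by_contra fun hp => h' ⟨(L.pos_flip d).2 hp, hc.2⟩, hc.1⟩

variable {L} in
theorem commute_onDart_onBdryEdge (d : D) (o : L.BdryEdge) (f : Module.End ℂ H)
    (g : Module.End ℂ A) : Commute (onDart L H A d f) (onBdryEdge L H A o g) := by
  obtain ⟨e, rfl, h⟩ | ⟨e, rfl, h⟩ | ⟨h, -⟩ := onDart_cases (L := L) H A d
  · rw [h, LinearMap.comp_apply]; exact commute_onBulkEdge_onBdryEdge e o _ g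
  · rw [h]; exact commute_onBulkEdge_onBdryEdge e o f g
  · rw [h]; exact Commute.zero_left _

variable {L} in
theorem commute_onDart {d d' : D} (h₁ : d' ≠ d) (h₂ : d' ≠ L.flip d) (f g : Module.End ℂ H) :
    Commute (onDart L H A d f) (onDart L H A d' g) := by
  have key : ∀ d, onDart L H A d = 0 ∨ ∃ e : L.BulkEdge, (d = e.1 ∨ d = L.flip e.1) ∧
      ∀ f, ∃ f', onDart L H A d f = onBulkEdge L H A e f' := fun d => by
    obtain ⟨e, he, h⟩ | ⟨e, he, h⟩ | ⟨h, -⟩ := onDart_cases (L := L) H A d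
    · exact Or.inr ⟨e, Or.inl he, fun f => ⟨antipodeConj H f, by rw [h]; rfl⟩⟩
    · exact Or.inr ⟨e, Or.inr he, fun f => ⟨f, by rw [h]⟩⟩
    · exact Or.inl h
  obtain h | ⟨e, he, h⟩ := key d
  · rw [h]; exact Commute.zero_left _
  obtain h' | ⟨e', he', h'⟩ := key d'
  · rw [h']; exact Commute.zero_right _
  obtain ⟨f', hf⟩ := h f
  obtain ⟨g', hg⟩ := h' g
  rw [hf, hg]
  refine commute_onBulkEdge (fun hee => ?_) _ _
  subst hee
  have hf := L.flip_flip
  grind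

open scoped Classical in
/-- The operators on the edges of the total space. -/
def total (hS : ∀ x : H, antipode ℂ (antipode ℂ x) = x) : EdgeSystem L H A (TotalSpace L H A) where
  bulk := onDart L H A
  bdry o := if h : L.IsOuter o then onBdryEdge L H A ⟨o, h⟩ else 0
  bulk_mul d f g := by
    obtain ⟨e, rfl, h⟩ | ⟨e, rfl, h⟩ | ⟨h, -⟩ := onDart_cases (L := L) H A d
    · simp only [h, LinearMap.comp_apply, antipodeConj_mul hS, onBulkEdge_mul]
    · simp only [h, onBulkEdge_mul]
    · simp [h]
  bulk_one d hd hd' := by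
    obtain ⟨e, rfl, h⟩ | ⟨e, rfl, h⟩ | ⟨-, -, h⟩ := onDart_cases (L := L) H A d
    · simp only [h, LinearMap.comp_apply, antipodeConj_one hS, onBulkEdge_one]
    · simp only [h, onBulkEdge_one]
    · exact absurd h (by tauto)
  bulk_flip d f := by
    obtain ⟨e, rfl, h⟩ | ⟨e, rfl, h⟩ | ⟨h, h', -⟩ := onDart_cases (L := L) H A d
    · rw [h, onDart_flip H A e.2, LinearMap.comp_apply, antipodeConj_antipodeConj hS]
    · rw [h, L.flip_flip, onDart_pos H A e.2]; rfl
    · rw [h, h']; rfl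
  bulk_comm _ _ h₁ h₂ f g := commute_onDart H A h₁ h₂ f g
  bdry_mul o f g := by
    by_cases h : L.IsOuter o
    · rw [dif_pos h, onBdryEdge_mul]
    · rw [dif_neg h]; simp
  bdry_one o h := by rw [dif_pos h, onBdryEdge_one]
  bdry_comm o o' hne f g := by
    by_cases h : L.IsOuter o
    · by_cases h' : L.IsOuter o'
      · rw [dif_pos h, dif_pos h']
        exact commute_onBdryEdge (fun h => hne (congrArg Subtype.val h)) _ _
      · rw [dif_neg h']
        exact Commute.zero_right _
    · rw [dif_neg h]
      exact Commute.zero_left _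
  bulk_bdry_comm d o f g := by
    by_cases h : L.IsOuter o
    · rw [dif_pos h]
      exact commute_onDart_onBdryEdge H A _ _ _ _
    · rw [dif_neg h]
      exact Commute.zero_right _

variable {L H A} (hS : ∀ x : H, antipode ℂ (antipode ℂ x) = x) (β : RightComoduleAlgebra H A)

theorem total_bdry (o : L.BdryEdge) : (total L H A hS).bdry o.1 = onBdryEdge L H A o :=
  dif_pos o.2

theorem dartL_eq (d : D) : dartL L H A d = (total L H A hS).l d := by
  have : (total L H A hS).bulk = onDart L H A := rfl
  rw [l, this, dartL, onDart]
  split_ifs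
  · ext1 g
    simp only [LinearMap.comp_apply, antipodeConj_Lplus hS]
  · rfl
  · rfl

theorem toTensor_eq_of_sliceRight_eq {V : Type*} [AddCommGroup V]
    [Module ℂ V] {f : Module.Dual ℂ H →ₗ[ℂ] Module.End ℂ V} {t : Module.End ℂ V ⊗[ℂ] H}
    (h : ∀ φ, f φ = sliceRight φ t) : toTensor (E := Module.End ℂ V) f = t :=
  eq_of_sliceRight_eq fun φ => by rw [sliceRight_toTensor, h]

theorem toTensor_dartT (d : D) : toTensor (E := Module.End ℂ (TotalSpace L H A)) (dartT L β d) = (total L H A hS).T β d := by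
  refine toTensor_eq_of_sliceRight_eq fun φ => ?_
  by_cases h : L.IsOuter (L.flip d)
  · conv_rhs => rw [← L.flip_flip d]
    rw [sliceRight_T_of_isOuter _ _ h, dartT, dif_pos h]
    rw [total_bdry hS ⟨_, h⟩]; rfl
  · have : (total L H A hS).bulk = onDart L H A := rfl
    rw [sliceRight_T_of_not_isOuter _ _ h, this, dartT, dif_neg h, onDart]
    split_ifs
    · simp only [LinearMap.comp_apply, antipodeConj_Tplus hS]
    · rfl
    · rfl

theorem faceOp_eq (d : D) (φ : Module.Dual ℂ H) : faceOp L β d φ =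
    sliceRight φ ((total L H A hS).word β (cycleList L.next d)) := by
  rw [faceOp, sweedlerProd_dual_eq, word, List.map_map]
  exact congrArg (fun l => sliceRight φ (List.prod l))
    (List.map_congr_left fun d _ => toTensor_dartT hS β d)

theorem vertexOp_eq (d : D) (g : H) : vertexOp L H A d g =
    (total L H A hS).vert (cycleList L.rot (L.rot d)) g := by
  have h := congrArg (fun f : ConvRing H (Module.End ℂ (TotalSpace L H A)) => f g)
    (sweedlerProd_eq_convMul ((cycleList L.rot (L.rot d)).map (dartL L H A)))
  rw [List.map_map] at h
  rw [vert]
  refine h.trans (congrArg (fun l : List (ConvRing H (Module.End ℂ (TotalSpace L H A))) =>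
    l.prod g) (List.map_congr_left fun d _ => ?_))
  rw [Function.comp_apply, dartL_eq hS]

end EdgeSystem

/-! ### Independence of the boundary vertex operator of the site -/

section CoactLemmas

open Coalgebra HopfAlgebra WithConv

variable {H A R : Type*} [Ring H] [HopfAlgebra ℂ H] [Ring A] [Algebra ℂ A] [Ring R] [Algebra ℂ R]
  (β : RightComoduleAlgebra H A)

/-- Moving the coaction from the first to the second factor of the separability idempotent. -/
theorem IsSymmSeparabilityIdempotent.coactConv_coactConv_antipode [FiniteDimensional ℂ H]
    [FiniteDimensional ℂ A]
    {lam : A ⊗[ℂ] A} (h : IsSymmSeparabilityIdempotent lam)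
    (hS : ∀ x : H, antipode ℂ (antipode ℂ x) = x) (f r : A →ₗ[ℂ] R) (F : ConvRing H R)
    (hFr : ∀ g a, Commute (F g) (r a)) :
    LinearMap.mul' ℂ R (TensorProduct.map (coactConv β f F) r lam) =
      LinearMap.mul' ℂ R (TensorProduct.map f
        (coactConv β r (toConv (F.ofConv ∘ₗ antipode ℂ) : ConvRing H R)) lam) := by
  let G : (A ⊗[ℂ] H) ⊗[ℂ] A →ₗ[ℂ] R := LinearMap.mul' ℂ R ∘ₗ
    TensorProduct.map (LinearMap.mul' ℂ R ∘ₗ TensorProduct.map f F.ofConv) r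
  have h1 := congrArg G (h.rTensor_coact β hS)
  have h2 : ∀ t : A ⊗[ℂ] A, LinearMap.mul' ℂ R (TensorProduct.map (coactConv β f F) r t) =
      G (β.coact.toLinearMap.rTensor A t) := fun t => by
    induction t with
    | zero => simp
    | add x y hx hy => simp only [map_add, hx, hy]
    | tmul a b => rfl
  rw [h2, h1]
  generalize lam = t
  induction t with
  | zero => simp
  | add x y hx hy => simp only [map_add, hx, hy]
  | tmul a b =>
    simp only [LinearMap.lTensor_tmul, TensorProduct.map_tmul, LinearMap.comp_apply, coactConv]
    induction β.coact.toLinearMap b with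
    | zero => simp
    | add x y hx hy => simp only [map_add, TensorProduct.tmul_add, mul_add, hx, hy]
    | tmul b g => simp [G, mul_assoc, (hFr _ _).eq]

end CoactLemmas

namespace EdgeSystem

open Coalgebra HopfAlgebra WithConv

variable {D : Type*} {L : DiskLattice D} {H A V : Type*} [Ring H] [HopfAlgebra ℂ H]
  [FiniteDimensional ℂ H] [Ring A] [Algebra ℂ A] [AddCommGroup V] [Module ℂ V]
  (M : EdgeSystem L H A V) (β : RightComoduleAlgebra H A)
  (hS : ∀ x : H, antipode ℂ (antipode ℂ x) = x)
include hS

/-- S reverses the order of the coproduct, and operators at different darts commute. -/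
theorem vert_reverse_antipode {ds : List D} (hnd : ds.Nodup) :
    (ds.reverse.map fun d =>
      (toConv (M.l d ∘ₗ antipode ℂ) : ConvRing H (Module.End ℂ V))).prod =
      toConv ((M.vert ds).ofConv ∘ₗ antipode ℂ) := by
  induction ds with
  | nil => ext g; simp [counit_antipode]
  | cons d ds ih =>
    rw [List.nodup_cons] at hnd
    rw [List.reverse_cons, List.map_append, List.prod_append, ih hnd.2, vert_cons]
    ext1; ext1 g
    let r := Repr.arbitrary ℂ g
    let q : Repr ℂ (antipode ℂ g) (H × H) := ⟨r.index, fun i => antipode ℂ (r.right i),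
        fun i => antipode ℂ (r.left i), by rw [comul_antipode, ← r.eq]; simp⟩
    have h1 : ((toConv (M.l d) * M.vert ds : ConvRing H (Module.End ℂ V)) (antipode ℂ g)) =
      ∑ i ∈ r.index, M.l d (antipode ℂ (r.right i)) * M.vert ds (antipode ℂ (r.left i)) :=
        q.convMul_apply _ _
    refine Eq.trans ?_ h1.symm
    rw [List.map_singleton, List.prod_singleton]
    refine (r.convMul_apply _ _).trans (Finset.sum_congr rfl fun i _ => ?_)
    exact (M.commute_vert (fun x hx _ =>
      M.commute_l hS (fun h' : d = x => hnd.1 (h' ▸ hx)) _ _) _).symm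

end EdgeSystem

namespace EdgeSystem

open Coalgebra HopfAlgebra WithConv

variable {D : Type*} {L : DiskLattice D} {H A : Type*} [Ring H] [HopfAlgebra ℂ H]
  [FiniteDimensional ℂ H] [Ring A] [Algebra ℂ A] [FiniteDimensional ℂ A] [Finite D]
  (β : RightComoduleAlgebra H A)
  (hS : ∀ x : H, antipode ℂ (antipode ℂ x) = x) {lam : A ⊗[ℂ] A}

include hS

/-- The bulk edges on the far side of the site are acted on through S of the second factor of λ;
moving the coaction back to the first factor removes S and joins the two groups of edges. The site
thus plays no role for λ. -/
theorem bdryVertexOp_eq_of {M : EdgeSystem L H A (TotalSpace L H A)}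
    (hb : ∀ o : L.BdryEdge, M.bdry o.1 = onBdryEdge L H A o) (hl : ∀ d, dartL L H A d = M.l d)
    (hlam : IsSymmSeparabilityIdempotent lam) (s : L.BdrySite) :
    bdryVertexOp L β s lam = M.bdryVert β s.1 lam := by
  have hnd : (L.bulkDartsAt s.1).Nodup := (L.not_mem_bulkDartsAt s.1).2.1
  have huw := List.take_append_drop s.2 (L.bulkDartsAt s.1)
  have h1 : coactProd β (onBdryEdge L H A (L.incoming s.1) ∘ₗ LinearMap.mul ℂ A)
      (((L.bulkDartsAt s.1).take s.2).map (dartL L H A)) =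
      coactConv β (M.bdryLeft (L.incoming s.1).1) (M.vert ((L.bulkDartsAt s.1).take s.2)) := by
    rw [coactProd_eq_coactConv, bdryLeft, hb, vert, List.map_map]
    exact congrArg (fun l => coactConv β _ (List.prod l))
      (List.map_congr_left fun d _ => congrArg toConv (hl d))
  have h2 : coactProd β (onBdryEdge L H A s.1 ∘ₗ (LinearMap.mul ℂ A).flip)
      (((L.bulkDartsAt s.1).drop s.2).reverse.map fun d => dartL L H A d ∘ₗ antipode ℂ) =
      coactConv β (M.bdryRight s.1.1)
        (toConv ((M.vert ((L.bulkDartsAt s.1).drop s.2)).ofConv ∘ₗ antipode ℂ)) := by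
    rw [coactProd_eq_coactConv, bdryRight, hb, ← M.vert_reverse_antipode hS
      (by rw [← huw] at hnd; exact hnd.of_append_right), List.map_map]
    exact congrArg (fun l => coactConv β _ (List.prod l))
      (List.map_congr_left fun d _ => congrArg (fun f => toConv (f ∘ₗ antipode ℂ)) (hl d))
  have h3 := hlam.coactConv_coactConv_antipode β hS
    (coactConv β (M.bdryLeft (L.incoming s.1).1) (M.vert ((L.bulkDartsAt s.1).take s.2)))
    (M.bdryRight s.1.1) (M.vert ((L.bulkDartsAt s.1).drop s.2))
    fun g a => (M.commute_vert (fun d _ g => (M.commute_l_bdryRight d _ g a).symm) g).symm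
  rw [coactConv_coactConv, ← vert_append, huw, ← h1, ← h2] at h3
  exact h3.symm

theorem bdryVertexOp_eq (hlam : IsSymmSeparabilityIdempotent lam) (s : L.BdrySite) :
    bdryVertexOp L β s lam = (total L H A hS).bdryVert β s.1 lam :=
  bdryVertexOp_eq_of β hS (total_bdry hS) (dartL_eq hS) hlam s

end EdgeSystem


/-! ### Idempotency and commutation of the vertex operators -/

namespace EdgeSystem

open Coalgebra HopfAlgebra WithConv

variable {D : Type*} {L : DiskLattice D} {H A V : Type*} [Ring H] [HopfAlgebra ℂ H]
  [FiniteDimensional ℂ H] [Ring A] [Algebra ℂ A] [AddCommGroup V] [Module ℂ V]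
  (M : EdgeSystem L H A V) (β : RightComoduleAlgebra H A)

section

variable (hS : ∀ x : H, antipode ℂ (antipode ℂ x) = x) [Finite D]
include hS

theorem K_mul (o : L.BdryEdge) (a b : A) : M.K β o (a * b) = M.K β o a * M.K β o b :=
  coactConv_mul β (M.bdryLeft_mul _) (M.vert_mul hS (L.not_mem_bulkDartsAt o).2.1)
    (fun a _ => (M.commute_vert (fun d _ k => (M.commute_l_bdryLeft d _ k a).symm) _).symm) a b

/-- The boundary vertex operators represent A ⊗ Aᵒᵖ, in which multiplying λ by t only depends on the
product of the factors of t, by centrality; for t = λ this product is 1. -/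
theorem bdryVert_mul_self {lam : A ⊗[ℂ] A} (hlam : IsSymmSeparabilityIdempotent lam)
    (o : L.BdryEdge) : M.bdryVert β o lam * M.bdryVert β o lam = M.bdryVert β o lam := by
  have h1 : ∀ (a b : A) (s : A ⊗[ℂ] A), M.bdryVert β o (a ⊗ₜ b) * M.bdryVert β o s =
      M.bdryVert β o (TensorProduct.map (LinearMap.mulLeft ℂ a) (LinearMap.mulRight ℂ b) s) := by
    intro a b s
    induction s with
    | zero => simp
    | add x y hx hy => simp only [map_add, mul_add, hx, hy]
    | tmul c d =>
      simp only [bdryVert_tmul, TensorProduct.map_tmul, LinearMap.mulLeft_apply,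
        LinearMap.mulRight_apply, K_mul M β hS, M.bdryRight_mul, mul_assoc]
      rw [← mul_assoc (M.bdryRight o.1 b), (M.commute_bdryRight_K β o o c b).eq, mul_assoc]
  have h2 : ∀ t : A ⊗[ℂ] A, M.bdryVert β o t * M.bdryVert β o lam =
      M.bdryVert β o ((LinearMap.mulRight ℂ (LinearMap.mul' ℂ A t)).lTensor A lam) := by
    intro t
    induction t with
    | zero => simp
    | add x y hx hy =>
      simp only [map_add, add_mul, hx, hy]
      rw [← map_add, ← LinearMap.add_apply, ← LinearMap.lTensor_add]
      congr 3
      ext z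
      simp [mul_add]
    | tmul a b =>
      rw [h1, ← LinearMap.lTensor_comp_rTensor, LinearMap.comp_apply, hlam.central,
        LinearMap.mul'_apply, LinearMap.mulRight_mul, LinearMap.lTensor_comp, LinearMap.comp_apply]
  rw [h2, hlam.mul_eq_one]
  simp

theorem commute_bdryVert_bdryVert (o o' : L.BdryEdge) (h : o ≠ o') (s t : A ⊗[ℂ] A) :
    Commute (M.bdryVert β o s) (M.bdryVert β o' t) := by
  have hds : ∀ {o o' : L.BdryEdge}, o ≠ o' → ∀ {d}, d ∈ L.bulkDartsAt o → d ∉ L.bulkDartsAt o' :=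
    fun {o o'} h d hd hd' => h <| Subtype.ext <| L.outer_simple _ _ o.2 o'.2
      (((L.sameCycle_outer_iff o).2 (Or.inr (Or.inr hd))).trans
        ((L.sameCycle_outer_iff o').2 (Or.inr (Or.inr hd'))).symm)
  have hinc : (L.incoming o).1 ≠ (L.incoming o').1 := fun h' =>
    h (Subtype.ext (L.rot.injective (L.flip.injective h')))
  refine M.commute_bdryVert β (fun a => .symm ?_) (fun a => .symm ?_) t
  · refine M.commute_bdryVert β (fun b => ?_) (fun b => (M.commute_bdryRight_K β _ _ _ _).symm) s
    refine M.commute_K β (fun b => .symm ?_) (fun d hd g => .symm ?_) b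
    · exact M.commute_K β (fun a => M.bdry_comm _ _ hinc _ _)
        (fun d _ g => (M.commute_l_bdryLeft _ _ _ _).symm) a
    · exact M.commute_K β (fun a => M.commute_l_bdryLeft _ _ _ _)
        (fun d' hd' g' => M.commute_l hS (fun h'' : d = d' => hds h hd (h'' ▸ hd')) _ _) a
  · refine M.commute_bdryVert β (M.commute_bdryRight_K β _ _ · a) (fun b => ?_) s
    exact (M.bdry_comm _ _ (fun h' => h (Subtype.ext h')) _ _).symm

theorem commute_vert_bdryVert {ds : List D} (o : L.BdryEdge)
    (h : ∀ d ∈ ds, d ∉ L.bulkDartsAt o) (g : H) (t : A ⊗[ℂ] A) :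
    Commute (M.vert ds g) (M.bdryVert β o t) := by
  refine (M.commute_vert (fun d hd k => ?_) g).symm
  exact (M.commute_l_bdryVert β k
    (fun x hx k' => M.commute_l hS (fun h' : d = x => h d hd (h' ▸ hx)) _ _) t).symm

end

variable [StarRing H] [StarModule ℂ H] (hH : IsCStarHopfAlgebra H)
include hH

/-- Cocommutativity of h makes bulk vertex operators independent of the starting edge. -/
theorem vert_append_comm {u w : List D} (h : u.Disjoint w) :
    M.vert (u ++ w) (haarIntegral H) = M.vert (w ++ u) (haarIntegral H) := by
  let r := Repr.arbitrary ℂ (haarIntegral H)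
  let r' : Repr ℂ (haarIntegral H) (H × H) := ⟨r.index, r.right, r.left, by
    conv_rhs => rw [← hH.comm_comul_haarIntegral, ← r.eq]
    simp⟩
  rw [vert_append, vert_append, r.convMul_apply, r'.convMul_apply]
  exact Finset.sum_congr rfl fun i _ => (M.commute_vert_vert hH.antipode_antipode h _ _).eq

theorem vert_of_isRotated {u w : List D} (hu : u.Nodup) (h : u ~r w) :
    M.vert u (haarIntegral H) = M.vert w (haarIntegral H) := by
  obtain ⟨n, rfl⟩ := h
  rw [← List.rotate_mod, List.rotate_eq_drop_append_take_mod, Nat.mod_mod]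
  conv_lhs => rw [← List.take_append_drop (n % u.length) u]
  exact M.vert_append_comm hH (List.disjoint_take_drop hu le_rfl)

end EdgeSystem

/-! ### Ground states of a sum of commuting projections -/

section CommutingProjections

variable {V ι : Type*} [AddCommGroup V] [Module ℂ V]

/-- Eigenvalues of a sum of commuting idempotents. -/
theorem exists_nat_of_sum_apply_eq {Q : ι → Module.End ℂ V} (s : Finset ι)
    (hc : ∀ i ∈ s, ∀ j ∈ s, Commute (Q i) (Q j)) (hi : ∀ i ∈ s, Q i * Q i = Q i) {μ : ℂ} {ψ : V}
    (hψ : ψ ≠ 0) (h : (∑ i ∈ s, Q i) ψ = μ • ψ) :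
    ∃ n : ℕ, μ = n ∧ (n = 0 → ∀ i ∈ s, Q i ψ = 0) := by
  classical
  induction s using Finset.induction_on generalizing μ ψ with
  | empty => exact ⟨0, by
    simpa using (smul_eq_zero.1 (by simpa using h.symm)).resolve_right hψ, by simp⟩
  | insert a s ha ih =>
    have ih' := fun {μ : ℂ} {ψ : V} => @ih (fun i hi j hj => hc i (by simp [hi]) j (by simp [hj]))
      (fun j hj => hi j (by simp [hj])) μ ψ
    rw [Finset.sum_insert ha, LinearMap.add_apply] at h
    by_cases h0 : Q a ψ = 0
    · rw [h0, zero_add] at h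
      obtain ⟨n, hn, hs⟩ := ih' hψ h
      refine ⟨n, hn, fun hn0 i his => ?_⟩
      obtain rfl | his := Finset.mem_insert.1 his
      · exact h0
      · exact hs hn0 i his
    · have hcs : Commute (∑ i ∈ s, Q i) (Q a) :=
        Commute.sum_left _ _ _ fun i his => hc i (by simp [his]) a (by simp)
      have h1 := congrArg (Q a) h
      rw [map_add, ← Module.End.mul_apply, hi a (by simp), ← Module.End.mul_apply (Q a), ← hcs.eq,
        Module.End.mul_apply, map_smul] at h1
      -- The nonzero vector Q a ψ is an eigenvector of the remaining sum, with eigenvalue lowered by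
      -- 1.
      obtain ⟨n, hn, -⟩ := ih' (μ := μ - 1) h0 (by
        rw [sub_smul, one_smul, ← h1]; abel)
      exact ⟨n + 1, by push_cast; rw [← hn]; ring, by simp⟩

/-- The eigenvalues are natural numbers and 0 is attained, so the ground energy is 0; a vector of
energy 0 is annihilated by each summand. -/
theorem isGroundState_iff [Fintype ι] {P : ι → Module.End ℂ V} (hc : ∀ i j, Commute (P i) (P j))
    (hi : ∀ i, P i * P i = P i) (h0 : ∃ ψ : V, ψ ≠ 0 ∧ ∀ i, P i ψ = ψ) (ψ : V) :
    IsGroundState (∑ i, (1 - P i)) ψ ↔ ψ ≠ 0 ∧ ∀ i, P i ψ = ψ := by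
  have hfix : ∀ ψ : V, (∀ i, P i ψ = ψ) → (∑ i, (1 - P i)) ψ = 0 := fun ψ h => by
    simp [LinearMap.sum_apply, h]
  have hnat := fun {μ : ℂ} {ψ : V} => exists_nat_of_sum_apply_eq (Q := fun i => 1 - P i)
    Finset.univ (fun i _ j _ => ((Commute.one_left _).sub_left
      ((Commute.one_right _).sub_right (hc i j)))) (fun i _ => by
        simp [mul_sub, sub_mul, hi]) (μ := μ) (ψ := ψ)
  obtain ⟨ψ₀, hψ₀, hP⟩ := h0
  have hev : (∑ i, (1 - P i)).HasEigenvalue ((0 : ℝ) : ℂ) :=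
    Module.End.hasEigenvalue_of_hasEigenvector ⟨Module.End.mem_eigenspace_iff.2 (by
      rw [hfix _ hP]; simp), hψ₀⟩
  constructor
  · rintro ⟨hψ, E, ⟨-, hE⟩, h⟩
    obtain ⟨n, hn, hs⟩ := hnat hψ h
    obtain ⟨r, hr, hle⟩ := hE _ hev
    have hr0 : r = 0 := by exact_mod_cast hr.symm
    have hn' : E = n := by exact_mod_cast hn
    have : n = 0 := by
      have : (n : ℝ) ≤ 0 := by rw [← hn', ← hr0]; exact hle
      exact_mod_cast this.antisymm (Nat.cast_nonneg n)
    refine ⟨hψ, fun i => ?_⟩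
    have := hs this i (Finset.mem_univ _)
    rw [LinearMap.sub_apply, sub_eq_zero] at this
    exact this.symm
  · rintro ⟨hψ, h⟩
    refine ⟨hψ, 0, ⟨hev, fun μ hμ => ?_⟩, by rw [hfix _ h]; simp⟩
    obtain ⟨φ, hφ⟩ := hμ.exists_hasEigenvector
    obtain ⟨n, hn, -⟩ := hnat hφ.2 hφ.apply_eq_smul
    exact ⟨n, by simpa using hn, Nat.cast_nonneg n⟩

end CommutingProjections

section Cycles

variable {D : Type*} [Finite D] (p : Equiv.Perm D)

theorem disjoint_cycleList {x y : D} (h : ¬ p.SameCycle x y) :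
    (cycleList p x).Disjoint (cycleList p y) := fun z hx hy =>
  h (((mem_cycleList p).1 hx).trans ((mem_cycleList p).1 hy).symm)

end Cycles

namespace DiskLattice

variable {D : Type*} (L : DiskLattice D)

theorem isOuter_of_sameCycle {d x : D} (h : L.next.SameCycle d x) (hx : L.IsOuter x) :
    L.IsOuter d := Equiv.Perm.SameCycle.trans hx h.symm

theorem leftFace_eq_iff {d d' : D} : L.leftFace d = L.leftFace d' ↔ L.next.SameCycle d d' :=
  Quotient.eq (r := Equiv.Perm.SameCycle.setoid L.next)

theorem origin_out (v : L.Vertex) : L.origin v.out = v := Quotient.out_eq v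

theorem leftFace_out (f : L.Face) : L.leftFace f.out = f := Quotient.out_eq f

variable {L} in
theorem not_isOuter_out (f : L.InnerFace) : ¬ L.IsOuter f.1.out := fun h => f.2 <| by
  rw [← L.leftFace_out f.1]; exact (L.leftFace_eq_iff.2 h).symm

theorem not_isOuter_of_mem_cycleList [Finite D] {d : D} (hd : ¬ L.IsOuter d) :
    ∀ x ∈ cycleList L.next d, ¬ L.IsOuter x := fun _ hx h =>
  hd (L.isOuter_of_sameCycle ((mem_cycleList L.next).1 hx) h)

end DiskLattice

namespace EdgeSystem

open Coalgebra HopfAlgebra WithConv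

variable {D : Type*} {L : DiskLattice D} {H A V : Type*} [Ring H] [HopfAlgebra ℂ H]
  [FiniteDimensional ℂ H] [Ring A] [Algebra ℂ A] [AddCommGroup V] [Module ℂ V]
  (M : EdgeSystem L H A V) (β : RightComoduleAlgebra H A) (lam : A ⊗[ℂ] A)

/-- The vector is fixed by the Haar operators of all faces and vertices. -/
structure IsInvariant (ψ : V) : Prop where
  face : ∀ d, ¬ L.IsOuter d → M.B β (cycleList L.next d) ψ = ψ
  vertex : ∀ d, ¬ L.IsBdryVertex (L.origin d) → M.vert (cycleList L.rot d) (haarIntegral H) ψ = ψ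
  bdryVertex : ∀ o, M.bdryVert β o lam ψ = ψ

/-- The Haar operators of faces and vertices. -/
inductive HaarOperator : Module.End ℂ V → Prop
  | face {d : D} (hd : ¬ L.IsOuter d) : HaarOperator (M.B β (cycleList L.next d))
  | vertex {d : D} (hd : ¬ L.IsBdryVertex (L.origin d)) :
      HaarOperator (M.vert (cycleList L.rot d) (haarIntegral H))
  | bdryVertex (o : L.BdryEdge) : HaarOperator (M.bdryVert β o lam)

variable {lam} [StarRing H] [StarModule ℂ H] (hH : IsCStarHopfAlgebra H) [Finite D]
  [FiniteDimensional ℂ A] (hlam : IsSymmSeparabilityIdempotent lam)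

include hH hlam in
theorem HaarOperator.mul_self {P : Module.End ℂ V} (h : M.HaarOperator β lam P) : P * P = P := by
  cases h with
  | face hd =>
    exact M.B_mul_B β hH (nodup_cycleList _ _) (L.not_isOuter_of_mem_cycleList hd)
  | vertex hd =>
    rw [← M.vert_mul hH.antipode_antipode (nodup_cycleList _ _), hH.isHaarIntegral.1,
      hH.isHaarIntegral.2.2, one_smul]
  | bdryVertex o => exact M.bdryVert_mul_self β hH.antipode_antipode hlam o

include hH in
theorem commute_vert_bdryVert_of_bulk {d : D} (hd : ¬ L.IsBdryVertex (L.origin d)) (o : L.BdryEdge)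
    (t : A ⊗[ℂ] A) (g : H) :
    Commute (M.vert (cycleList L.rot d) g) (M.bdryVert β o t) :=
  M.commute_vert_bdryVert β hH.antipode_antipode o (fun x hx hx' => hd
    ⟨o.1, o.2, (L.origin_eq_iff.2 (((mem_cycleList L.rot).1 hx).trans
      ((L.sameCycle_outer_iff o).2 (Or.inr (Or.inr hx'))).symm)).symm⟩) g t

include hH hlam in
theorem HaarOperator.commute {P Q : Module.End ℂ V} (hP : M.HaarOperator β lam P)
    (hQ : M.HaarOperator β lam Q) : Commute P Q := by
  cases hP with
  | @face d hd =>
    have hn := nodup_cycleList L.next d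
    have hi := L.not_isOuter_of_mem_cycleList hd
    have hch := chain_cycleList L.next d
    cases hQ with
    | @face d' hd' =>
      by_cases h : L.next.SameCycle d d'
      · rw [M.B_of_isRotated β hH hn (isRotated_cycleList _ h)]
      · exact M.commute_B β hH (disjoint_cycleList _ h)
    | vertex hd' => exact (M.commute_vert_B β hH hd' hn hi hch).symm
    | bdryVertex o => exact (M.commute_bdryVert_B β hH hlam o hn hi hch).symm
  | @vertex d hd =>
    cases hQ with
    | @face d' hd' =>
      exact M.commute_vert_B β hH hd (nodup_cycleList _ _) (L.not_isOuter_of_mem_cycleList hd')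
        (chain_cycleList L.next d')
    | @vertex d' hd' =>
      by_cases h : L.rot.SameCycle d d'
      · rw [M.vert_of_isRotated hH (nodup_cycleList _ _) (isRotated_cycleList _ h)]
      · exact M.commute_vert_vert hH.antipode_antipode (disjoint_cycleList _ h) _ _
    | bdryVertex o => exact M.commute_vert_bdryVert_of_bulk β hH hd o _ _
  | bdryVertex o =>
    cases hQ with
    | @face d' hd' =>
      exact M.commute_bdryVert_B β hH hlam o (nodup_cycleList _ _)
        (L.not_isOuter_of_mem_cycleList hd') (chain_cycleList L.next d')
    | vertex hd' => exact (M.commute_vert_bdryVert_of_bulk β hH hd' o _ _).symm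
    | bdryVertex o' =>
      by_cases h : o = o'
      · rw [h]
      · exact M.commute_bdryVert_bdryVert β hH.antipode_antipode o o' h _ _

end EdgeSystem

/-! ### Ground states are the nonzero invariant vectors -/

section Hamiltonian

open EdgeSystem

variable {D : Type*} {L : DiskLattice D} {H A : Type*} [Ring H] [HopfAlgebra ℂ H]
  [FiniteDimensional ℂ H] [Ring A] [Algebra ℂ A] (β : RightComoduleAlgebra H A)
  [StarRing H] [StarModule ℂ H] (hH : IsCStarHopfAlgebra H)

include hH in
theorem vertexOp_out_eq [Finite D] (d : D) : vertexOp L H A d (haarIntegral H) =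
    (total L H A hH.antipode_antipode).vert (cycleList L.rot d) (haarIntegral H) := by
  rw [vertexOp_eq hH.antipode_antipode]
  exact vert_of_isRotated _ hH (nodup_cycleList _ _)
    (isRotated_cycleList _ (Equiv.Perm.sameCycle_apply_left.2 (.refl _ _)))

/-- The exponent stays between 1 and the degree of the vertex minus 1, so the dart differs from the
outgoing boundary edge, the only outer dart there. -/
theorem DiskLattice.not_isOuter_bdrySite [Finite D] (s : L.BdrySite) :
    ¬ L.IsOuter ((L.rot ^ (s.2.1 + 1)) s.1.1) := fun h => by
  have h1 := L.eq_of_isOuter_of_sameCycle s.1.2 h ⟨(s.2.1 + 1 : ℕ), by rw [zpow_natCast]⟩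
  have h2 := s.2.2
  rw [← Equiv.Perm.iterate_eq_pow] at h1
  have := Function.IsPeriodicPt.minimalPeriod_le (f := L.rot) (x := s.1.1) (Nat.succ_pos s.2.1) h1
  omega

variable [FiniteDimensional ℂ A] {lam : A ⊗[ℂ] A} (hlam : IsSymmSeparabilityIdempotent lam)
  [Fintype D]

include hlam in
theorem isGroundState_hamiltonian_iff
    (h0 : ∃ ψ, ψ ≠ 0 ∧ (total L H A hH.antipode_antipode).IsInvariant β lam ψ)
    (ψ : TotalSpace L H A) : IsGroundState (hamiltonian L β lam) ψ ↔
      ψ ≠ 0 ∧ (total L H A hH.antipode_antipode).IsInvariant β lam ψ := by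
  classical
  have hS := hH.antipode_antipode
  let P : ({v : L.Vertex // ¬ L.IsBdryVertex v} ⊕ {f : L.InnerFace // ¬ L.IsBdryFace f}) ⊕
      (L.BdrySite ⊕ L.BdrySite) → Module.End ℂ (TotalSpace L H A) :=
    Sum.elim (Sum.elim (fun v => vertexOp L H A v.1.out (haarIntegral H))
      (fun f => faceOp L β f.1.1.out (dualHaarIntegral H)))
      (Sum.elim (fun s => bdryVertexOp L β s lam) (fun s => bdryFaceOp L β s (dualHaarIntegral H)))
  have hham : hamiltonian L β lam = ∑ i, (1 - P i) := by
    rw [Fintype.sum_sum_type, Fintype.sum_sum_type, Fintype.sum_sum_type, hamiltonian, ← add_assoc]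
    simp only [P, Sum.elim_inl, Sum.elim_inr]
  have hP : ∀ i, HaarOperator (total L H A hS) β lam (P i) := by
    rintro ((v | f) | (s | s))
    · change HaarOperator _ β lam (vertexOp L H A v.1.out (haarIntegral H))
      rw [vertexOp_out_eq hH]
      exact .vertex (by rw [L.origin_out]; exact v.2)
    · change HaarOperator _ β lam (faceOp L β f.1.1.out (dualHaarIntegral H))
      rw [faceOp_eq hS]
      exact .face (DiskLattice.not_isOuter_out f.1)
    · change HaarOperator _ β lam (bdryVertexOp L β s lam)
      rw [bdryVertexOp_eq β hS hlam]
      exact .bdryVertex s.1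
    · change HaarOperator _ β lam (faceOp L β _ (dualHaarIntegral H))
      rw [faceOp_eq hS]
      exact .face (L.not_isOuter_bdrySite s)
  have hinv : ∀ ψ, (∀ i, P i ψ = ψ) ↔ (total L H A hS).IsInvariant β lam ψ := fun ψ => by
    constructor
    · intro h
      have hpos : ∀ o : L.BdryEdge, 0 < Function.minimalPeriod L.rot o.1 - 1 := fun o => by
        have := congrArg List.length (L.cycleList_rot_outer o)
        simp only [cycleList, List.length_map, List.length_range, List.length_cons] at this
        omega
      refine ⟨fun d hd => ?_, fun d hd => ?_, fun o => ?_⟩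
      · by_cases hb : ∃ o, L.IsOuter o ∧ L.leftFace (L.flip o) = L.leftFace d
        · obtain ⟨o, ho, hod⟩ := hb
          have h1 : L.IsOuter (L.next o) := L.isOuter_next_iff.2 ho
          -- A face with a boundary edge o is not among the bulk faces; it occurs at the first
          -- corner of the end vertex of o, where the dart `flip o` starts.
          have h2 := h (Sum.inr (Sum.inr ⟨⟨L.next o, h1⟩, ⟨0, hpos _⟩⟩))
          change faceOp L β ((L.rot ^ (0 + 1)) (L.next o)) (dualHaarIntegral H) ψ = ψ at h2
          rw [faceOp_eq hS, zero_add, pow_one, L.rot_next] at h2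
          rw [B_of_isRotated _ β hH (nodup_cycleList _ _)
            (isRotated_cycleList _ (L.leftFace_eq_iff.1 hod).symm)]
          exact h2
        · have hf : L.leftFace d ≠ L.leftFace L.root := fun h' =>
            hd (L.leftFace_eq_iff.1 h'.symm)
          have h2 := h (Sum.inl (Sum.inr ⟨⟨L.leftFace d, hf⟩, hb⟩))
          change faceOp L β (L.leftFace d).out (dualHaarIntegral H) ψ = ψ at h2
          rw [faceOp_eq hS] at h2
          rw [B_of_isRotated _ β hH (nodup_cycleList _ _)
            (isRotated_cycleList _ (L.leftFace_eq_iff.1 (L.leftFace_out (L.leftFace d)).symm))]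
          exact h2
      · have h2 := h (Sum.inl (Sum.inl ⟨L.origin d, hd⟩))
        change vertexOp L H A (L.origin d).out (haarIntegral H) ψ = ψ at h2
        rw [vertexOp_out_eq hH] at h2
        rw [vert_of_isRotated _ hH (nodup_cycleList _ _)
          (isRotated_cycleList _ (L.origin_eq_iff.1 (L.origin_out (L.origin d)).symm))]
        exact h2
      · have h2 := h (Sum.inr (Sum.inl ⟨o, ⟨0, hpos o⟩⟩))
        change bdryVertexOp L β _ lam ψ = ψ at h2
        rwa [bdryVertexOp_eq β hS hlam] at h2
    · intro h i
      have key : ∀ Q, HaarOperator (total L H A hS) β lam Q → Q ψ = ψ := fun Q hQ => by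
        cases hQ with
        | face hd => exact h.face _ hd
        | vertex hd => exact h.vertex _ hd
        | bdryVertex o => exact h.bdryVertex o
      exact key _ (hP i)
  rw [hham, isGroundState_iff (fun i j => HaarOperator.commute _ β hH hlam (hP i) (hP j))
    (fun i => HaarOperator.mul_self _ β hH hlam (hP i))
    (by obtain ⟨ψ, h, h'⟩ := h0; exact ⟨ψ, h, (hinv ψ).2 h'⟩), hinv]

end Hamiltonian

namespace DiskLattice

/-! ## Removing edges -/

variable {D : Type*} (L : DiskLattice D)

/-- The dart `c'` follows `c` on the boundary of a face when the darts in `S` are removed. -/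
def Follows (S : Finset D) (c c' : D) : Prop :=
  ∃ k : ℕ, c' = (L.rot⁻¹ ^ (k + 1)) (L.flip c) ∧ ∀ j < k, (L.rot⁻¹ ^ (j + 1)) (L.flip c) ∈ S

variable {L} {S : Finset D}

theorem Follows.mono {S' : Finset D} (hS : S ⊆ S') {c c' : D} (h : L.Follows S c c') :
    L.Follows S' c c' := by
  obtain ⟨k, h, h'⟩ := h
  exact ⟨k, h, fun j hj => hS (h' j hj)⟩

theorem follows_next (c : D) : L.Follows S c (L.next c) := ⟨0, by simp [next_apply], by simp⟩

theorem Follows.sameCycle {c c' : D} (h : L.Follows S c c') : L.rot.SameCycle (L.flip c) c' := by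
  obtain ⟨k, rfl, -⟩ := h
  exact ⟨-(k + 1 : ℕ), by rw [zpow_neg, zpow_natCast, inv_pow]⟩

/-- When e is removed, its predecessor is followed by whatever follows the reverse of e. -/
theorem Follows.trans {S' : Finset D} {a b e : D} (h₁ : L.Follows S a e)
    (h₂ : L.Follows S (L.flip e) b) (hS : S ⊆ S') (he : e ∈ S') : L.Follows S' a b := by
  obtain ⟨k, rfl, hk⟩ := h₁
  obtain ⟨k', rfl, hk'⟩ := h₂
  have hpow : ∀ m n z, (L.rot⁻¹ ^ m) ((L.rot⁻¹ ^ n) z) = (L.rot⁻¹ ^ (m + n)) z := fun m n z => by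
    rw [pow_add, Equiv.Perm.mul_apply]
  rw [L.flip_flip] at hk' ⊢
  simp only [hpow] at hk' ⊢
  refine ⟨k' + 1 + k, by rw [← add_assoc], fun j hj => ?_⟩
  obtain h | rfl | h := lt_trichotomy j k
  · exact hS (hk j h)
  · exact he
  · obtain ⟨i, rfl⟩ := Nat.exists_eq_add_of_lt h
    have := hk' i (by omega)
    rw [show i + 1 + (k + 1) = k + i + 1 + 1 by ring] at this
    exact hS this

/-- A boundary word of length one would be a loop. -/
theorem ne_nil_of_chain {d : D} {p : List D} (h : ((d :: p : List D) : Cycle D).Chain (L.Follows S)) :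
    p ≠ [] := by
  rintro rfl
  rw [Cycle.chain_singleton] at h
  exact L.no_loop d h.sameCycle.symm

/-- Only the two junctions between p and q need an argument: there the removed edge is skipped. -/
theorem chain_merge {S' : Finset D} {d : D} {p q : List D}
    (hp : ((d :: p : List D) : Cycle D).Chain (L.Follows S))
    (hq : ((L.flip d :: q : List D) : Cycle D).Chain (L.Follows S)) (hS : S ⊆ S') (hd : d ∈ S')
    (hd' : L.flip d ∈ S') : ((p ++ q : List D) : Cycle D).Chain (L.Follows S') := by
  have hp0 := ne_nil_of_chain hp
  have hq0 := ne_nil_of_chain hq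
  rw [Cycle.chain_coe_cons, List.isChain_cons, List.isChain_append] at hp hq
  obtain ⟨a, p, rfl⟩ := List.exists_cons_of_ne_nil hp0
  obtain ⟨b, q, rfl⟩ := List.exists_cons_of_ne_nil hq0
  simp only [List.cons_append, List.head?_cons, Option.mem_some_iff, forall_eq',
    List.isChain_singleton, true_and] at hp hq
  rw [List.cons_append, Cycle.chain_coe_cons]
  have h0 : a :: (p ++ b :: q ++ [a]) = (a :: p) ++ ((b :: q) ++ [a]) := by simp
  rw [h0, List.isChain_append, List.isChain_append]
  simp only [List.cons_append, List.head?_cons, Option.mem_some_iff, forall_eq',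
    List.isChain_singleton, true_and]
  refine ⟨hp.2.1.imp fun _ _ h => h.mono hS, ⟨hq.2.1.imp fun _ _ h => h.mono hS, fun x hx => ?_⟩,
    fun x hx => ?_⟩
  · exact (hq.2.2 x hx).trans (by rw [L.flip_flip]; exact hp.1) hS hd'
  · exact (hp.2.2 x hx).trans hq.1 hS hd

theorem chain_remove_leaf {S' : Finset D} {d : D} {u : List D}
    (h : ((L.flip d :: d :: u : List D) : Cycle D).Chain (L.Follows S)) (hS : S ⊆ S')
    (hd' : L.flip d ∈ S') : (u : Cycle D).Chain (L.Follows S') := by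
  cases u with
  | nil => simp
  | cons a u =>
    rw [Cycle.chain_coe_cons, List.cons_append, List.isChain_cons_cons, List.isChain_cons,
      List.isChain_append] at h
    simp only [List.cons_append, List.head?_cons, Option.mem_some_iff, forall_eq',
      List.isChain_singleton, true_and] at h
    rw [Cycle.chain_coe_cons, ← List.cons_append, List.isChain_append]
    simp only [List.head?_cons, Option.mem_some_iff, forall_eq', List.isChain_singleton, true_and]
    exact ⟨h.2.2.1.imp fun _ _ h => h.mono hS, fun x hx =>
      (h.2.2.2 x hx).trans (by rw [L.flip_flip]; exact h.2.1) hS hd'⟩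

/-- In a word, the reverse of the only remaining dart at a vertex is followed by that dart. -/
theorem exists_isRotated_of_leaf {d : D} {w : List D} (hw : (w : Cycle D).Chain (L.Follows S))
    (hwS : ∀ x ∈ w, x ∉ S) (hd : L.flip d ∈ w) (hleaf : ∀ y, L.rot.SameCycle d y → y ∉ S → y = d) :
    ∃ u, w ~r L.flip d :: d :: u := by
  obtain ⟨u, hu⟩ := exists_isRotated_cons hd
  have hc := chain_isRotated hw hu
  obtain ⟨b, u, rfl⟩ := List.exists_cons_of_ne_nil (ne_nil_of_chain hc)
  rw [Cycle.chain_coe_cons, List.cons_append, List.isChain_cons_cons] at hc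
  have h1 := hc.1.sameCycle
  rw [L.flip_flip] at h1
  obtain rfl := hleaf b h1 (hwS b (hu.mem_iff.2 (by simp)))
  exact ⟨u, hu⟩

/-- Functions invariant under reversal and under rotation at inner darts are constant. -/
theorem eq_of_invariant [Finite D] {α : Type*} {f : D → α} (hflip : ∀ x, f (L.flip x) = f x)
    (hrot : ∀ y, ¬ L.IsOuter y → f (L.rot y) = f y) (x y : D) : f x = f y := by
  have hrot' : ∀ y, f (L.rot y) = f y := fun y => by
    by_cases hy : L.IsOuter y
    · have h1 : ∀ z ∈ L.rot y :: L.bulkDartsAt ⟨y, hy⟩, f (L.rot z) = f z := fun z hz => by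
        refine hrot z fun hz' => ?_
        have := L.eq_of_isOuter_of_sameCycle hy hz'
          ((L.sameCycle_outer_iff ⟨y, hy⟩).2 (Or.inr (List.mem_cons.1 hz)))
        subst this
        exact (List.nodup_cons.1 (L.nodup_bulkDartsAt ⟨z, hy⟩)).1 hz
      have key : ∀ (l : List D) (a : D), (a :: (l ++ [y])).IsChain (fun a b => L.rot a = b) →
          (∀ z ∈ a :: l, f (L.rot z) = f z) → f y = f a := by
        intro l
        induction l with
        | nil =>
          intro a hc hl
          rw [← hl a (by simp), (List.isChain_cons_cons.1 hc).1]
        | cons b l ih =>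
          intro a hc hl
          rw [List.cons_append, List.isChain_cons_cons] at hc
          rw [ih b hc.2 fun z hz => hl z (List.mem_cons_of_mem _ hz), ← hc.1, hl a (by simp)]
      exact (key _ _ (L.chain_bulkDartsAt ⟨y, hy⟩) h1).symm
    · exact hrot y hy
  obtain ⟨g, hg, rfl⟩ := L.connected x y
  suffices h : ∀ x, f (g x) = f x from (h x).symm
  induction hg using Subgroup.closure_induction with
  | mem g hg =>
    obtain rfl | rfl := hg
    · exact hrot'
    · exact hflip
  | one => simp
  | mul a b _ _ ha hb => intro x; rw [Equiv.Perm.mul_apply, ha, hb]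
  | inv a _ ha => intro x; rw [← ha (a⁻¹ x)]; simp

/-! ### Merging faces -/

variable (L) in
/-- A stage in the process of merging faces by removing edges: `S` is the set of the removed darts
and `ws` is the list of the boundary words of the merged faces. -/
structure MergeStage (S : Finset D) (ws : List (List D)) : Prop where
  not_isOuter : ∀ d ∈ S, ¬ L.IsOuter d
  flip_mem : ∀ d ∈ S, L.flip d ∈ S
  nodup : ws.flatten.Nodup
  mem_iff : ∀ x, (∃ w ∈ ws, x ∈ w) ↔ ¬ L.IsOuter x ∧ x ∉ S
  ne_nil : [] ∉ ws
  chain : ∀ w ∈ ws, (w : Cycle D).Chain (L.Follows S)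
  vertex : ∀ x, ∃ y, L.rot.SameCycle x y ∧ y ∉ S
  label : ∃ cl : D → List D, (∀ x, ¬ L.IsOuter x → cl (L.next x) = cl x) ∧
    (∀ d ∈ S, cl (L.flip d) = cl d) ∧ ∀ x, ¬ L.IsOuter x → x ∉ S → x ∈ cl x ∧ cl x ∈ ws
  card : 2 * ws.length + S.card + 2 = 2 * Nat.card L.Face

theorem MergeStage.nodup_of_mem {ws : List (List D)} (h : L.MergeStage S ws) {w : List D}
    (hw : w ∈ ws) : w.Nodup := (List.nodup_flatten.1 h.nodup).1 w hw

theorem MergeStage.eq_of_mem {ws : List (List D)} (h : L.MergeStage S ws) {w w' : List D}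
    (hw : w ∈ ws) (hw' : w' ∈ ws) {x : D} (hx : x ∈ w) (hx' : x ∈ w') : w = w' := by
  by_contra hne
  haveI : Std.Symm (List.Disjoint (α := D)) := ⟨fun _ _ h => h.symm⟩
  exact ((List.nodup_flatten.1 h.nodup).2.forall hw hw' hne) hx hx'

/-- As long as there are two faces, there is an edge between two different faces. -/
theorem MergeStage.exists_merge [Finite D] {ws : List (List D)} (h : L.MergeStage S ws)
    (h2 : 2 ≤ ws.length) : ∃ d, ∃ w ∈ ws, ∃ w' ∈ ws, w ≠ w' ∧ d ∈ w ∧ L.flip d ∈ w' := by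
  classical
  obtain ⟨cl, h₁, h₂, h₃⟩ := h.label
  by_contra! hcon
  -- The merged face next to an edge. If no edge separated two merged faces, this function would be
  -- invariant under reversal and rotation, hence constant by connectedness of the surface,
  -- contradicting the presence of two words.
  let f : D → List D := fun x => if L.IsOuter x then cl (L.flip x) else cl x
  have hflip : ∀ x, f (L.flip x) = f x := fun x => by
    by_cases hx : L.IsOuter x
    · simp [f, hx, L.not_isOuter_flip hx]
    · by_cases hx' : L.IsOuter (L.flip x)
      · simp [f, hx, hx', L.flip_flip]
      · simp only [f, hx, hx', if_false]
        by_cases hS : x ∈ S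
        · exact h₂ x hS
        · have hS' : L.flip x ∉ S := fun h' => hS (by simpa [L.flip_flip] using h.flip_mem _ h')
          by_contra hne
          exact hcon x _ (h₃ x hx hS).2 _ (h₃ _ hx' hS').2 (Ne.symm hne) (h₃ x hx hS).1
            (h₃ _ hx' hS').1
  have hrot : ∀ y, ¬ L.IsOuter y → f (L.rot y) = f y := fun y hy => by
    obtain ⟨x, rfl⟩ := L.next.surjective y
    rw [L.rot_next, hflip]
    have hx : ¬ L.IsOuter x := fun h => hy (L.isOuter_next_iff.2 h)
    simp only [f, hx, hy, if_false, h₁ x hx]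
  have hconst := L.eq_of_invariant hflip hrot
  have hcl : ∀ w ∈ ws, ∃ x, f x = w := fun w hw => by
    obtain ⟨x, hx⟩ := List.exists_mem_of_ne_nil w fun h0 => h.ne_nil (h0 ▸ hw)
    have hx' := (h.mem_iff x).1 ⟨w, hw, hx⟩
    have := h₃ x hx'.1 hx'.2
    exact ⟨x, by simp only [f, hx'.1, if_false]; exact h.eq_of_mem this.2 hw this.1 hx⟩
  match ws, h2 with
  | w :: w' :: ws, _ =>
    obtain ⟨x, hx⟩ := hcl w (by simp)
    obtain ⟨x', hx'⟩ := hcl w' (by simp)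
    have hww : w = w' := by rw [← hx, ← hx', hconst x x']
    subst hww
    obtain ⟨y, hy⟩ := List.exists_mem_of_ne_nil w fun h0 => h.ne_nil (by simp [h0])
    have := h.nodup
    simp only [List.flatten_cons, List.nodup_append] at this
    exact this.2.2 y hy y (by simp [hy]) rfl


/-- One removed edge lowers the number of words by one and raises the number of removed darts by
two, which keeps the counting relation with the number of faces. -/
theorem MergeStage.merge [DecidableEq D] {ws : List (List D)} (h : L.MergeStage S ws)
    {w w' : List D} {d : D} (hw : w ∈ ws) (hw' : w' ∈ ws) (hne : w ≠ w') (hd : d ∈ w)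
    (hd' : L.flip d ∈ w') : ∃ p q rest, ws.Perm (w :: w' :: rest) ∧ w ~r d :: p ∧
      w' ~r L.flip d :: q ∧
      L.MergeStage (insert d (insert (L.flip d) S)) ((p ++ q) :: rest) := by
  obtain ⟨p, hp⟩ := exists_isRotated_cons hd
  obtain ⟨q, hq⟩ := exists_isRotated_cons hd'
  have hperm : ws.Perm (w :: w' :: (ws.erase w).erase w') :=
    (List.perm_cons_erase hw).trans
      ((List.perm_cons_erase ((List.mem_erase_of_ne hne.symm).2 hw')).cons w)
  set rest := (ws.erase w).erase w'
  have hff := L.flip_flip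
  have hpc := chain_isRotated (h.chain w hw) hp
  have hqc := chain_isRotated (h.chain w' hw') hq
  have hflat : ws.flatten.Perm (d :: p ++ (L.flip d :: q ++ rest.flatten)) :=
    hperm.flatten.trans (by
      simp only [List.flatten_cons]
      exact hp.perm.append (hq.perm.append_right _))
  have hnd := hflat.nodup_iff.1 h.nodup
  have hmem : ∀ x, (∃ w ∈ ws, x ∈ w) ↔ x = d ∨ x = L.flip d ∨ x ∈ p ++ q ∨ ∃ w ∈ rest, x ∈ w :=
    fun x => by
      rw [← List.mem_flatten, hflat.mem_iff]
      simp only [List.mem_append, List.mem_cons, List.mem_flatten]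
      tauto
  have hdS := (h.mem_iff d).1 ⟨w, hw, hd⟩
  have hdS' := (h.mem_iff _).1 ⟨w', hw', hd'⟩
  have hsub : S ⊆ insert d (insert (L.flip d) S) := fun x hx => by simp [hx]
  have hdd : d ≠ L.flip d := fun h' => L.no_loop d (h' ▸ .refl _ _)
  -- No vertex gets isolated: if e were the only dart left at its vertex, it would follow its
  -- reverse in the same word, and the two faces would coincide.
  have hvert : ∀ {e w w'}, w ∈ ws → w' ∈ ws → w ≠ w' → e ∈ w → L.flip e ∈ w' →
      ∃ y, L.rot.SameCycle e y ∧ y ∉ S ∧ y ≠ e := fun {e w w'} hw hw' hne he he' => by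
    by_contra! hcon
    obtain ⟨u, hu⟩ := exists_isRotated_of_leaf (h.chain w' hw')
      (fun x hx => ((h.mem_iff x).1 ⟨_, hw', hx⟩).2) he' hcon
    exact hne (h.eq_of_mem hw hw' he (hu.mem_iff.2 (by simp)))
  have hvert' : ∀ {e w w' x}, w ∈ ws → w' ∈ ws → w ≠ w' → e ∈ w → L.flip e ∈ w' →
      L.rot.SameCycle x e →
      ∃ y, L.rot.SameCycle x y ∧ y ∉ insert e (insert (L.flip e) S) := by
    intro e w w' x hw hw' hne he he' hx
    obtain ⟨y, hy, hyS, hye⟩ := hvert hw hw' hne he he'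
    refine ⟨y, hx.trans hy, fun h' => ?_⟩
    obtain h' | h' | h' := by simpa using h'
    · exact hye h'
    · exact L.no_loop e (h' ▸ hy)
    · exact hyS h'
  refine ⟨p, q, rest, hperm, hp, hq, ?_⟩
  constructor
  · simp only [Finset.mem_insert]
    rintro x (rfl | rfl | hx)
    · exact hdS.1
    · exact hdS'.1
    · exact h.not_isOuter x hx
  · simp only [Finset.mem_insert]
    rintro x (rfl | rfl | hx)
    · simp
    · simp [hff]
    · exact Or.inr (Or.inr (h.flip_mem x hx))
  · rw [List.flatten_cons, List.append_assoc]
    refine List.Nodup.sublist ?_ hnd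
    exact (List.sublist_cons_self d p).append
      ((List.sublist_cons_self (L.flip d) q).append (List.Sublist.refl _))
  · intro x
    have h1 := hmem x
    rw [h.mem_iff] at h1
    have h2 : (∃ w ∈ (p ++ q) :: rest, x ∈ w) ↔ x ∈ p ++ q ∨ ∃ w ∈ rest, x ∈ w := by simp
    rw [h2]
    have h3 : x ∈ p ++ q ∨ (∃ w ∈ rest, x ∈ w) → x ≠ d ∧ x ≠ L.flip d := by
      rw [← List.mem_flatten, ← List.mem_append, List.append_assoc]
      have h4 := (List.nodup_cons.1 hnd).1
      have h5 := (List.nodup_cons.1 ((List.perm_middle (l₁ := d :: p)).nodup_iff.1 hnd)).1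
      refine fun h' => ⟨fun hxd => h4 ?_, fun hxd => h5 ?_⟩
      · rw [← hxd]
        obtain h' | h' := List.mem_append.1 h'
        · exact List.mem_append_left _ h'
        · exact List.mem_append_right _ (List.mem_cons_of_mem _ h')
      · rw [← hxd]
        exact List.mem_cons_of_mem _ h'
    rw [Finset.mem_insert, Finset.mem_insert, not_or, not_or]
    constructor
    · intro h'
      have h4 := h1.2 (Or.inr (Or.inr h'))
      exact ⟨h4.1, (h3 h').1, (h3 h').2, h4.2⟩
    · rintro ⟨h4, h5, h6, h7⟩
      exact ((h1.1 ⟨h4, h7⟩).resolve_left h5).resolve_left h6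
  · simp only [List.mem_cons, not_or]
    refine ⟨fun h' => ne_nil_of_chain hpc (List.append_eq_nil_iff.1 h'.symm).1, fun h' => h.ne_nil ?_⟩
    exact hperm.mem_iff.2 (by simp [h'])
  · intro x hx
    obtain rfl | hx := List.mem_cons.1 hx
    · exact chain_merge hpc hqc hsub (by simp) (by simp)
    · exact (h.chain x (hperm.mem_iff.2 (by simp [hx]))).imp fun _ _ h => h.mono hsub
  · intro x
    obtain ⟨y, hy, hyS⟩ := h.vertex x
    by_cases h1 : y = d
    · exact hvert' hw hw' hne hd hd' (h1 ▸ hy)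
    by_cases h2 : y = L.flip d
    · have := hvert' hw' hw hne.symm hd' (by rwa [hff]) (h2 ▸ hy)
      rwa [hff, Finset.insert_comm] at this
    · exact ⟨y, hy, by simp [h1, h2, hyS]⟩
  · obtain ⟨cl, h₁, h₂, h₃⟩ := h.label
    have hcd := h₃ d hdS.1 hdS.2
    have hcd' := h₃ _ hdS'.1 hdS'.2
    have hcd1 : cl d = w := h.eq_of_mem hcd.2 hw hcd.1 hd
    have hcd2 : cl (L.flip d) = w' := h.eq_of_mem hcd'.2 hw' hcd'.1 hd'
    refine ⟨fun x => if cl x = w ∨ cl x = w' then p ++ q else cl x, fun x hx => ?_, ?_, ?_⟩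
    · simp only [h₁ x hx]
    · simp only [Finset.mem_insert]
      rintro x (rfl | rfl | hx)
      · simp [hcd1, hcd2]
      · simp [hcd1, hcd2, hff]
      · simp only [h₂ x hx]
    · intro x hx hxS
      simp only [Finset.mem_insert, not_or] at hxS
      obtain ⟨h4, h5⟩ := h₃ x hx hxS.2.2
      dsimp only
      split_ifs with hc
      · refine ⟨?_, by simp⟩
        rw [List.mem_append]
        obtain hc | hc := hc
        · rw [hc] at h4
          exact Or.inl ((List.mem_cons.1 (hp.mem_iff.1 h4)).resolve_left hxS.1)
        · rw [hc] at h4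
          exact Or.inr ((List.mem_cons.1 (hq.mem_iff.1 h4)).resolve_left hxS.2.1)
      · have h6 := hperm.mem_iff.1 h5
        simp only [List.mem_cons] at h6 ⊢
        exact ⟨h4, Or.inr (by tauto)⟩
  · have h1 := h.card
    have h2 := hperm.length_eq
    rw [Finset.card_insert_of_notMem (by simp [hdd, hdS.2]),
      Finset.card_insert_of_notMem hdS'.2]
    simp only [List.length_cons] at h2 ⊢
    omega

/-- The faces of the disk. -/
theorem mergeStage_faces [Fintype D] [DecidableEq D] [Fintype L.InnerFace] :
    L.MergeStage ∅ ((Finset.univ : Finset L.InnerFace).toList.map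
      fun f => cycleList L.next f.1.out) := by
  have hsame : ∀ (f : L.InnerFace) (x : D), x ∈ cycleList L.next f.1.out ↔ L.leftFace x = f.1 :=
    fun f x => by
      rw [mem_cycleList, ← L.leftFace_eq_iff, L.leftFace_out, eq_comm]
  have hin : ∀ x, ¬ L.IsOuter x ↔ L.leftFace x ≠ L.leftFace L.root := fun x => by
    rw [Ne, L.leftFace_eq_iff, Equiv.Perm.sameCycle_comm]; rfl
  constructor
  · simp
  · simp
  · rw [List.nodup_flatten]
    refine ⟨fun l hl => ?_, ?_⟩
    · obtain ⟨f, -, rfl⟩ := List.mem_map.1 hl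
      exact nodup_cycleList _ _
    · rw [List.pairwise_map]
      refine (Finset.nodup_toList _).imp fun {f g} hfg x hx hx' => hfg ?_
      rw [hsame] at hx hx'
      exact Subtype.ext (hx.symm.trans hx')
  · intro x
    rw [hin]
    simp only [List.mem_map, Finset.mem_toList, Finset.mem_univ, true_and, exists_exists_eq_and,
      hsame, Finset.notMem_empty, not_false_iff, and_true]
    exact ⟨fun ⟨f, hf⟩ => hf ▸ f.2, fun h => ⟨⟨_, h⟩, rfl⟩⟩
  · intro h
    obtain ⟨f, -, hf⟩ := List.mem_map.1 h
    obtain ⟨l, hl⟩ := cycleList_eq_cons L.next f.1.out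
    simp [hl] at hf
  · intro w hw
    obtain ⟨f, -, rfl⟩ := List.mem_map.1 hw
    exact (chain_cycleList L.next _).imp fun a b (h : L.next a = b) => h ▸ follows_next a
  · exact fun x => ⟨x, .refl _ _, by simp⟩
  · refine ⟨fun x => cycleList L.next (L.leftFace x).out, fun x _ => ?_, by simp, fun x hx _ => ?_⟩
    · exact congrArg (fun f : L.Face => cycleList L.next f.out)
        (L.leftFace_eq_iff.2 (Equiv.Perm.sameCycle_apply_left.2 (.refl _ _)))
    · have hx' := (hin x).1 hx
      refine ⟨(hsame ⟨_, hx'⟩ x).2 rfl, List.mem_map.2 ⟨⟨_, hx'⟩, by simp, rfl⟩⟩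
  · have h1 : Fintype.card L.InnerFace = Nat.card L.Face - 1 := by
      classical
      rw [Nat.card_eq_fintype_card, ← Set.card_ne_eq (L.leftFace L.root)]
      exact Fintype.card_congr (Equiv.refl _)
    have h2 : 0 < Nat.card L.Face := Nat.card_pos_iff.2 ⟨⟨L.leftFace L.root⟩, inferInstance⟩
    rw [List.length_map, Finset.length_toList, Finset.card_univ, h1, Finset.card_empty]
    omega

end DiskLattice

section Cycles

variable {D : Type*} (p : Equiv.Perm D)

theorem eq_map_range_of_isChain {x : D} {l : List D}
    (h : (x :: l).IsChain fun a b => p a = b) :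
    x :: l = (List.range (l.length + 1)).map fun i => (p ^ i) x := by
  induction l generalizing x with
  | nil => simp
  | cons a l ih =>
    rw [List.isChain_cons_cons] at h
    obtain ⟨rfl, h⟩ := h
    have h1 := ih h
    rw [List.length_cons, List.range_succ_eq_map (n := l.length + 1), List.map_cons, List.map_map,
      h1]
    simp [Function.comp_def, pow_succ]

theorem isRotated_cycleList_of_chain {w : List D} {x : D} (hn : w.Nodup)
    (hc : (w : Cycle D).Chain fun a b => p a = b) (hx : x ∈ w) : w ~r cycleList p x := by
  obtain ⟨u, hu⟩ := exists_isRotated_cons hx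
  refine hu.trans ?_
  have hc' := chain_isRotated hc hu
  have hn' := hu.nodup_iff.1 hn
  rw [Cycle.chain_coe_cons] at hc'
  have h1 := eq_map_range_of_isChain p hc'
  rw [List.length_append, List.length_singleton, List.range_succ, List.map_append,
    ← List.cons_append] at h1
  obtain ⟨h2, h3⟩ := List.append_inj' h1 rfl
  have hper : Function.IsPeriodicPt p (u.length + 1) x := by
    rw [Function.IsPeriodicPt, Equiv.Perm.iterate_eq_pow]
    exact (by simpa using h3.symm : (p ^ (u.length + 1)) x = x)
  have hle := hper.minimalPeriod_le (Nat.succ_pos _)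
  have hpos := hper.minimalPeriod_pos (Nat.succ_pos _)
  -- A smaller period would repeat x within a word without repetitions.
  have heq : Function.minimalPeriod p x = u.length + 1 := by
    by_contra hne
    rw [h2] at hn'
    have := (List.nodup_map_iff_inj_on List.nodup_range).1 hn' _
      (List.mem_range.2 (lt_of_le_of_ne hle hne)) 0 (List.mem_range.2 (Nat.succ_pos _)) (by
        rw [← Equiv.Perm.iterate_eq_pow, Function.iterate_minimalPeriod]; simp)
    omega
  rw [cycleList, heq, h2]

theorem forall_of_cycleChain {r : D → D → Prop} {Q : D → Prop} {w : List D}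
    (hc : (w : Cycle D).Chain r) (hQ : ∀ a ∈ w, ∀ b ∈ w, r a b → Q a → Q b) {d : D} (hd : d ∈ w)
    (h : Q d) : ∀ x ∈ w, Q x := by
  obtain ⟨u, hu⟩ := exists_isRotated_cons hd
  have hc' := chain_isRotated hc hu
  rw [Cycle.chain_coe_cons, ← List.cons_append] at hc'
  have key : ∀ (l : List D) (a : D), (∀ x ∈ a :: l, x ∈ w) → (a :: l).IsChain r → Q a →
      ∀ x ∈ a :: l, Q x := by
    intro l
    induction l with
    | nil => intro a _ _ ha; simpa using ha
    | cons b l ih =>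
      intro a hw hc ha
      rw [List.isChain_cons_cons] at hc
      have := ih b (fun x hx => hw x (List.mem_cons_of_mem _ hx)) hc.2
        (hQ a (hw a (by simp)) b (hw b (by simp)) hc.1 ha)
      exact List.forall_mem_cons.2 ⟨ha, this⟩
  exact fun x hx => key u d (fun x hx => hu.mem_iff.2 hx) (List.isChain_append.1 hc').1 h x
    (hu.mem_iff.1 hx)

end Cycles

namespace DiskLattice

/-! ### Removing leaves -/

variable {D : Type*} (L : DiskLattice D) [Fintype D]

open scoped Classical in
/-- The bulk darts that are not removed. -/
def remaining (S : Finset D) : Finset D :=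
  Finset.univ.filter fun d => ¬ L.IsOuter d ∧ ¬ L.IsOuter (L.flip d) ∧ d ∉ S

open scoped Classical in
/-- The darts at bulk vertices that are not removed. -/
def remainingInner (S : Finset D) : Finset D :=
  Finset.univ.filter fun d => ¬ L.IsBdryVertex (L.origin d) ∧ d ∉ S

open scoped Classical in
/-- The bulk vertices that are not isolated. -/
def activeVertices (S : Finset D) : Finset L.Vertex := (L.remainingInner S).image L.origin

variable {S : Finset D} {d : D}

theorem mem_remaining :
    d ∈ L.remaining S ↔ ¬ L.IsOuter d ∧ ¬ L.IsOuter (L.flip d) ∧ d ∉ S := by simp [remaining]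

theorem mem_remainingInner :
    d ∈ L.remainingInner S ↔ ¬ L.IsBdryVertex (L.origin d) ∧ d ∉ S := by simp [remainingInner]

theorem mem_activeVertices {v : L.Vertex} :
    v ∈ L.activeVertices S ↔ ∃ d, (¬ L.IsBdryVertex (L.origin d) ∧ d ∉ S) ∧ L.origin d = v := by
  simp [activeVertices, mem_remainingInner]

theorem remainingInner_subset : L.remainingInner S ⊆ L.remaining S := fun d hd => by
  rw [mem_remainingInner] at hd
  exact L.mem_remaining.2
    ⟨L.not_isOuter_of_origin hd.1, L.not_isOuter_flip_of_origin hd.1, hd.2⟩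

/-- A stage in the process of removing the edges that end at a vertex of degree one: `S` is the set
of the removed darts and `w` is the boundary word of the only face. -/
structure LeafStage (S : Finset D) (w : List D) : Prop where
  not_isOuter : ∀ d ∈ S, ¬ L.IsOuter d
  flip_mem : ∀ d ∈ S, L.flip d ∈ S
  nodup : w.Nodup
  mem_iff : ∀ x, x ∈ w ↔ ¬ L.IsOuter x ∧ x ∉ S
  chain : (w : Cycle D).Chain (L.Follows S)
  card_le : (L.remaining S).card ≤ 2 * (L.activeVertices S).card

variable {L} {w : List D}

theorem isOuter_root : L.IsOuter L.root := Equiv.Perm.SameCycle.refl _ _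

theorem LeafStage.flip_root_mem (h : L.LeafStage S w) : L.flip L.root ∈ w :=
  (h.mem_iff _).2 ⟨L.not_isOuter_flip isOuter_root, fun h' =>
    h.not_isOuter _ (h.flip_mem _ h') (by rw [L.flip_flip]; exact isOuter_root)⟩

/-- Without a leaf, every active bulk vertex would carry at least two darts, and the counting bound
would leave no dart for boundary vertices. The remaining bulk edges would then be separated from the
boundary, although the single word runs through both. -/
theorem LeafStage.exists_leaf (h : L.LeafStage S w) (hne : (L.remaining S).Nonempty) :
    ∃ d, ¬ L.IsBdryVertex (L.origin d) ∧ d ∉ S ∧ ∀ y, L.rot.SameCycle d y → y ∉ S → y = d := by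
  classical
  by_contra! hcon
  have h1 : (L.activeVertices S).card * 2 ≤ (L.remainingInner S).card := by
    rw [Finset.card_eq_sum_card_fiberwise (f := L.origin) (t := L.activeVertices S)
      (fun d hd => Finset.mem_image_of_mem _ hd), ← smul_eq_mul]
    refine Finset.card_nsmul_le_sum _ _ _ fun v hv => ?_
    obtain ⟨d, hd, rfl⟩ := L.mem_activeVertices.1 hv
    obtain ⟨y, hy, hyS, hyd⟩ := hcon d hd.1 hd.2
    have hyo : L.origin y = L.origin d := L.origin_eq_iff.2 hy.symm
    rw [Nat.succ_le_iff, Finset.one_lt_card]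
    exact ⟨y, by simp [mem_remainingInner, hyo, hd.1, hyS], d,
      by simp [mem_remainingInner, hd.1, hd.2], hyd⟩
  have h2 := Finset.eq_of_subset_of_card_le (L.remainingInner_subset (S := S))
    (h.card_le.trans (by omega))
  obtain ⟨d, hd⟩ := hne
  -- The word cannot pass from a bulk edge to a boundary edge, as it would have to do so at a
  -- boundary vertex. Yet it contains the reverse of the root.
  have hall := forall_of_cycleChain (Q := fun x => ¬ L.IsOuter (L.flip x)) h.chain
    (fun a ha b hb hab hQ => by
      have ha' := (h.mem_iff a).1 ha
      have h3 : L.flip a ∈ L.remaining S := L.mem_remaining.2 ⟨hQ, by rw [L.flip_flip]; exact ha'.1,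
        fun h' => ha'.2 (by simpa [L.flip_flip] using h.flip_mem _ h')⟩
      rw [← h2, mem_remainingInner, L.origin_eq_iff.2 hab.sameCycle] at h3
      exact L.not_isOuter_flip_of_origin h3.1)
    ((h.mem_iff d).2 ⟨(L.mem_remaining.1 hd).1, (L.mem_remaining.1 hd).2.2⟩)
    (L.mem_remaining.1 hd).2.1
  exact hall _ h.flip_root_mem (by rw [L.flip_flip]; exact isOuter_root)

-- Two darts disappear, and at most one vertex becomes inactive, so the counting bound persists.
open scoped Classical in
theorem LeafStage.remove (h : L.LeafStage S w)
    (hv : ¬ L.IsBdryVertex (L.origin d)) (hdS : d ∉ S)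
    (hleaf : ∀ y, L.rot.SameCycle d y → y ∉ S → y = d) :
    ∃ u, w ~r L.flip d :: d :: u ∧ L.LeafStage (insert d (insert (L.flip d) S)) u ∧
      (L.remaining (insert d (insert (L.flip d) S))).card < (L.remaining S).card := by
  have hff := L.flip_flip
  have hdo := L.not_isOuter_of_origin hv
  have hdo' := L.not_isOuter_flip_of_origin hv
  have hdS' : L.flip d ∉ S := fun h' => hdS (by simpa [hff] using h.flip_mem _ h')
  have hdd : d ≠ L.flip d := fun h' => L.no_loop d (h' ▸ .refl _ _)
  obtain ⟨u, hu⟩ := exists_isRotated_of_leaf h.chain (fun x hx => ((h.mem_iff x).1 hx).2)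
    ((h.mem_iff _).2 ⟨hdo', hdS'⟩) hleaf
  have hnd := hu.nodup_iff.1 h.nodup
  have hsub : S ⊆ insert d (insert (L.flip d) S) := fun x hx => by simp [hx]
  have hc := chain_isRotated h.chain hu
  have hmem : ∀ x, x ∈ u ↔ ¬ L.IsOuter x ∧ x ∉ insert d (insert (L.flip d) S) := fun x => by
    have h1 := h.mem_iff x
    rw [hu.mem_iff, List.mem_cons, List.mem_cons] at h1
    have h2 : x ∈ u → x ≠ d ∧ x ≠ L.flip d := fun hx => by
      simp only [List.nodup_cons, List.mem_cons, not_or] at hnd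
      exact ⟨fun h' => hnd.2.1 (h' ▸ hx), fun h' => hnd.1.2 (h' ▸ hx)⟩
    rw [Finset.mem_insert, Finset.mem_insert, not_or, not_or]
    constructor
    · intro hx
      have h3 := h1.1 (Or.inr (Or.inr hx))
      exact ⟨h3.1, (h2 hx).1, (h2 hx).2, h3.2⟩
    · rintro ⟨h3, h4, h5, h6⟩
      exact ((h1.2 ⟨h3, h6⟩).resolve_left h5).resolve_left h4
  have hroot : L.flip L.root ∈ u := by
    have h1 := hu.mem_iff.1 h.flip_root_mem
    rw [List.mem_cons, List.mem_cons] at h1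
    refine (h1.resolve_left fun h' => hdo ?_).resolve_left fun h' => hdo' ?_
    · rw [← L.flip.injective h']; exact isOuter_root
    · rw [← h', hff]; exact isOuter_root
  have hrem : (L.remaining (insert d (insert (L.flip d) S))).card + 2 = (L.remaining S).card := by
    have h1 : L.remaining S = insert d (insert (L.flip d)
        (L.remaining (insert d (insert (L.flip d) S)))) := by
      ext x
      simp only [mem_remaining, Finset.mem_insert, not_or]
      constructor
      · intro hx
        by_cases h1 : x = d
        · exact Or.inl h1
        by_cases h2 : x = L.flip d
        · exact Or.inr (Or.inl h2)
        exact Or.inr (Or.inr ⟨hx.1, hx.2.1, h1, h2, hx.2.2⟩)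
      · rintro (rfl | rfl | hx)
        · exact ⟨hdo, hdo', hdS⟩
        · exact ⟨hdo', by rwa [hff], hdS'⟩
        · exact ⟨hx.1, hx.2.1, hx.2.2.2.2⟩
    rw [h1, Finset.card_insert_of_notMem, Finset.card_insert_of_notMem]
    · simp [mem_remaining]
    · simp [mem_remaining, hdd]
  refine ⟨u, hu, ?_, by omega⟩
  constructor
  · simp only [Finset.mem_insert]
    rintro x (rfl | rfl | hx)
    · exact hdo
    · exact hdo'
    · exact h.not_isOuter x hx
  · simp only [Finset.mem_insert]
    rintro x (rfl | rfl | hx)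
    · simp
    · simp [hff]
    · exact Or.inr (Or.inr (h.flip_mem x hx))
  · exact (List.nodup_cons.1 (List.nodup_cons.1 hnd).2).2
  · exact hmem
  · exact chain_remove_leaf hc hsub (by simp)
  -- Only the leaf itself can become inactive: the word continues from the other end of the edge
  -- with a dart that is still present.
  · have hU : L.activeVertices S ⊆
        insert (L.origin d) (L.activeVertices (insert d (insert (L.flip d) S))) := by
      intro v hv'
      obtain ⟨y, ⟨hy, hyS⟩, rfl⟩ := L.mem_activeVertices.1 hv'
      rw [Finset.mem_insert]
      by_cases h1 : y = d
      · exact Or.inl (by rw [h1])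
      refine Or.inr (L.mem_activeVertices.2 ?_)
      by_cases h2 : y = L.flip d
      · subst h2
        obtain ⟨a, u, rfl⟩ := List.exists_cons_of_ne_nil (List.ne_nil_of_mem hroot)
        rw [Cycle.chain_coe_cons, List.cons_append, List.cons_append, List.isChain_cons_cons,
          List.isChain_cons_cons] at hc
        have h3 := L.origin_eq_iff.2 hc.2.1.sameCycle
        exact ⟨a, ⟨by rwa [← h3], ((hmem a).1 (by simp)).2⟩, h3.symm⟩
      · exact ⟨y, ⟨hy, by simp [h1, h2, hyS]⟩, rfl⟩
    have h1 := (Finset.card_le_card hU).trans (Finset.card_insert_le _ _)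
    have h2 := h.card_le
    omega

variable (L) in
open scoped Classical in
/-- The outer darts. -/
def outerDarts : Finset D := Finset.univ.filter L.IsOuter

theorem mem_outerDarts : d ∈ L.outerDarts ↔ L.IsOuter d := by simp [outerDarts]

/-- A count with Euler's formula. The darts are the remaining and the removed ones and both sides of
the boundary edges; the vertices are the active ones and one per boundary edge, as the boundary is
simple. With one word left, the number of remaining bulk darts comes out as twice the number of
active vertices, as for a forest attached to the boundary. -/
theorem MergeStage.leafStage (h : L.MergeStage S [w]) : L.LeafStage S w := by
  classical
  have hff := L.flip_flip
  refine ⟨h.not_isOuter, h.flip_mem, h.nodup_of_mem (by simp), fun x => by simpa using h.mem_iff x,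
    h.chain w (by simp), ?_⟩
  have hD : (L.remaining S).card + S.card + L.outerDarts.card + L.outerDarts.card =
      Fintype.card D := by
    have h1 : (Finset.univ : Finset D) =
        ((L.remaining S ∪ S) ∪ L.outerDarts) ∪ L.outerDarts.map L.flip.toEmbedding := by
      ext x
      simp only [Finset.mem_univ, Finset.mem_union, mem_remaining, mem_outerDarts, Finset.mem_map,
        Equiv.coe_toEmbedding, true_iff]
      by_cases h1 : L.IsOuter x
      · tauto
      by_cases h2 : L.IsOuter (L.flip x)
      · exact Or.inr ⟨_, h2, hff x⟩
      tauto
    rw [← Finset.card_univ, h1, Finset.card_union_of_disjoint, Finset.card_union_of_disjoint,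
      Finset.card_union_of_disjoint, Finset.card_map]
    · rw [Finset.disjoint_left]
      exact fun x hx => (L.mem_remaining.1 hx).2.2
    · rw [Finset.disjoint_left]
      intro x hx hx'
      rw [Finset.mem_union] at hx
      exact hx.elim (fun hx => (L.mem_remaining.1 hx).1 (mem_outerDarts.1 hx'))
        fun hx => h.not_isOuter x hx (mem_outerDarts.1 hx')
    · rw [Finset.disjoint_left]
      intro x hx hx'
      obtain ⟨o, ho, rfl⟩ := Finset.mem_map.1 hx'
      rw [mem_outerDarts] at ho
      rw [Finset.mem_union, Finset.mem_union] at hx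
      obtain (hx | hx) | hx := hx
      · exact (L.mem_remaining.1 hx).2.1 (by simpa [hff] using ho)
      · exact h.not_isOuter _ (h.flip_mem _ hx) (by simpa [hff] using ho)
      · exact L.not_isOuter_flip ho (mem_outerDarts.1 hx)
  have hV : (L.activeVertices S).card + L.outerDarts.card = Nat.card L.Vertex := by
    letI := Fintype.ofFinite L.Vertex
    have h1 : (L.outerDarts.image L.origin).card = L.outerDarts.card :=
      Finset.card_image_of_injOn fun a ha b hb hab =>
        L.outer_simple a b (mem_outerDarts.1 ha) (mem_outerDarts.1 hb) (L.origin_eq_iff.1 hab)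
    have h2 : (Finset.univ : Finset L.Vertex) = L.activeVertices S ∪ L.outerDarts.image L.origin := by
      ext v
      simp only [Finset.mem_univ, Finset.mem_union, mem_activeVertices, Finset.mem_image,
        mem_outerDarts, true_iff]
      by_cases hv : L.IsBdryVertex v
      · exact Or.inr hv
      · obtain ⟨y, hy, hyS⟩ := h.vertex v.out
        have h3 : L.origin y = v := by rw [← L.origin_out v]; exact L.origin_eq_iff.2 hy.symm
        exact Or.inl ⟨y, ⟨by rwa [h3], hyS⟩, h3⟩
    rw [Nat.card_eq_fintype_card, ← Finset.card_univ, h2, Finset.card_union_of_disjoint, h1]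
    rw [Finset.disjoint_left]
    intro v hv hv'
    obtain ⟨y, ⟨hy, -⟩, rfl⟩ := L.mem_activeVertices.1 hv
    obtain ⟨o, ho, hoy⟩ := Finset.mem_image.1 hv'
    exact hy ⟨o, mem_outerDarts.1 ho, hoy⟩
  have h1 := h.card
  have h2 := L.euler
  have h3 : Nat.card L.Vertex = Nat.card (Quotient (Equiv.Perm.SameCycle.setoid L.rot)) := rfl
  have h4 : Nat.card L.Face = Nat.card (Quotient (Equiv.Perm.SameCycle.setoid (L.rot⁻¹ * L.flip))) :=
    rfl
  rw [← h3, ← h4, Nat.card_eq_fintype_card (α := D)] at h2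
  simp only [List.length_singleton] at h1
  omega

variable (L) in
/-- The inner darts of the boundary edges, in the order in which they follow each other after all
bulk edges are removed. -/
def bdryWord : List D := cycleList (L.rot * L.flip) (L.flip L.root)

/-- All darts of the word are now reverses of boundary edges. Of the darts at the next boundary
vertex, only one is of this kind, so the successor is forced. -/
theorem LeafStage.isRotated_bdryWord (h : L.LeafStage S w) (h0 : L.remaining S = ∅) :
    w ~r L.bdryWord := by
  have hff := L.flip_flip
  have hw : ∀ x ∈ w, L.IsOuter (L.flip x) := fun x hx => by
    by_contra hx'
    have h1 := (h.mem_iff x).1 hx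
    have : x ∈ L.remaining S := L.mem_remaining.2 ⟨h1.1, hx', h1.2⟩
    simp [h0] at this
  have hc := h.chain
  refine isRotated_cycleList_of_chain _ h.nodup ?_ h.flip_root_mem
  obtain ⟨u, hu⟩ := exists_isRotated_cons h.flip_root_mem
  rw [chain_congr hu] at hc ⊢
  have hmem : ∀ x ∈ L.flip L.root :: (u ++ [L.flip L.root]), x ∈ w := fun x hx =>
    hu.mem_iff.2 (by simp at hx ⊢; tauto)
  rw [Cycle.chain_coe_cons] at hc ⊢
  generalize L.flip L.root :: (u ++ [L.flip L.root]) = l at hc hmem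
  induction l with
  | nil => simp
  | cons a l ih =>
    cases l with
    | nil => simp
    | cons b l =>
      rw [List.isChain_cons_cons] at hc ⊢
      refine ⟨?_, ih hc.2 fun x hx => hmem x (List.mem_cons_of_mem _ hx)⟩
      have ha := hw a (hmem a (by simp))
      have hb := hw b (hmem b (by simp))
      have hs := hc.1.sameCycle
      obtain h1 | h1 | h1 := (L.sameCycle_outer_iff ⟨_, ha⟩).1 hs
      · rw [h1] at hb
        exact absurd hb (L.not_isOuter_flip ha)
      · exact h1.symm
      · exact absurd hb (L.not_isOuter_of_mem_bulkDartsAt h1).2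

end DiskLattice

/-! ### Detecting invariant vectors by one functional -/

namespace EdgeSystem

open Coalgebra HopfAlgebra WithConv

variable {D : Type*} {L : DiskLattice D} {H A V : Type*} [Ring H] [HopfAlgebra ℂ H]
  [FiniteDimensional ℂ H] [Ring A] [Algebra ℂ A] [AddCommGroup V] [Module ℂ V]
  (M : EdgeSystem L H A V) (β : RightComoduleAlgebra H A) (lam : A ⊗[ℂ] A)

/-- All bulk edges are pinned. -/
def IsPinned (ψ : V) : Prop := ∀ d, ¬ L.IsOuter d → ¬ L.IsOuter (L.flip d) → M.pin d ψ = ψ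

/-- The vector is fixed by the pins of the darts in `S`, by the Haar operators of the words `ws` and
by those of the vertices. -/
structure IsFixed (S : Finset D) (ws : List (List D)) (ψ : V) : Prop where
  pin : ∀ d ∈ S, M.pin d ψ = ψ
  face : ∀ w ∈ ws, M.B β w ψ = ψ
  vertex : ∀ d, ¬ L.IsBdryVertex (L.origin d) → M.vert (cycleList L.rot d) (haarIntegral H) ψ = ψ
  bdryVertex : ∀ o, M.bdryVert β o lam ψ = ψ

/-- The functional `F` is injective on the fixed vectors and detects the images of pinned vectors
under the Haar operators of the words. -/
def Detects (F : V →ₗ[ℂ] ℂ) (S : Finset D) (ws : List (List D)) : Prop :=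
  (∀ ψ, M.IsFixed β lam S ws ψ → F ψ = 0 → ψ = 0) ∧
    ∃ c : ℂ, c ≠ 0 ∧ ∀ χ, M.IsPinned χ → F ((ws.map (M.B β)).prod χ) = c * F χ

variable {lam} [StarRing H] [StarModule ℂ H] (hH : IsCStarHopfAlgebra H) {F : V →ₗ[ℂ] ℂ}
  (hF : ∀ d, ¬ L.IsOuter d → ¬ L.IsOuter (L.flip d) → ∀ ψ, F (M.pin d ψ) = F ψ)
  {S : Finset D} {ws : List (List D)}
include hH

theorem commute_pin_prod {d : D} (h : ∀ w ∈ ws, d ∉ w ∧ L.flip d ∉ w) :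
    Commute (M.pin d) (ws.map (M.B β)).prod :=
  Commute.list_prod_right _ _ fun x hx => by
    obtain ⟨w, hw, rfl⟩ := List.mem_map.1 hx
    exact M.commute_pin_B β (h w hw).1 (h w hw).2

theorem commute_pin_bdryVert (d : D) (o : L.BdryEdge) (t : A ⊗[ℂ] A) :
    Commute (M.pin d) (M.bdryVert β o t) :=
  M.commute_l_bdryVert β _ (fun x _ k => M.commute_pin_l hH d x k) t

-- Pinning d maps the fixed vectors of the two faces injectively to those of the merged face, and F
-- does not see the pin. This transports both halves of the detection property.
include hF in
theorem detects_of_merge [DecidableEq D] {d : D} {p q : List D} {w w' : List D}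
    {rest : List (List D)} (hw : w.Nodup) (hw' : w'.Nodup) (hp : w ~r d :: p)
    (hq : w' ~r L.flip d :: q) (hi : ∀ x ∈ w, ¬ L.IsOuter x) (hd' : ¬ L.IsOuter (L.flip d))
    (hdisj : w.Disjoint w') (hrest : ∀ x ∈ rest, d ∉ x ∧ L.flip d ∉ x)
    (h : M.Detects β lam F (insert d (insert (L.flip d) S)) ((p ++ q) :: rest)) :
    M.Detects β lam F S (w :: w' :: rest) := by
  obtain ⟨h₁, c, hc, h₂⟩ := h
  have hc0 := hH.dualHaarIntegral_haarIntegral_ne_zero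
  have hd : ¬ L.IsOuter d := hi d (hp.mem_iff.2 (by simp))
  have hnp := hp.nodup_iff.1 hw
  have hnq := hq.nodup_iff.1 hw'
  have hip : ∀ x ∈ p, ¬ L.IsOuter x := fun x hx => hi x (hp.mem_iff.2 (by simp [hx]))
  have hdp : d ∉ p := (List.nodup_cons.1 hnp).1
  have hdq' : L.flip d ∉ q := (List.nodup_cons.1 hnq).1
  have hdis : ∀ x, x ∈ d :: p → x ∈ L.flip d :: q → False := fun x hx hx' =>
    hdisj (hp.mem_iff.2 hx) (hq.mem_iff.2 hx')
  have hdp' : L.flip d ∉ p := fun h' => hdis _ (List.mem_cons_of_mem _ h') (by simp)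
  have hdq : d ∉ q := fun h' => hdis d (by simp) (List.mem_cons_of_mem _ h')
  have hpq : p.Disjoint q := fun x hx hx' =>
    hdis x (List.mem_cons_of_mem _ hx) (List.mem_cons_of_mem _ hx')
  have hpn := (List.nodup_cons.1 hnp).2
  have hmerge := M.B_flip_mul_B_mul_pin β hH hd' hpn hip hdp hdp' hd hdq hdq' hpq
  have hPBP := M.pin_mul_B_mul_pin β hH hd' hpn hip hdp hdp'
  have hBPB := M.B_mul_pin_mul_B β hH hd' hpn hip hdp hdp'
  have hcpq : Commute (M.pin d) (M.B β (p ++ q)) :=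
    M.commute_pin_B β (by simp [hdp, hdq]) (by simp [hdp', hdq'])
  have hBw := M.B_of_isRotated β hH hw hp
  have hBw' := M.B_of_isRotated β hH hw' hq
  refine ⟨fun ψ hψ hFψ => ?_, _, mul_ne_zero hc0 hc, fun χ hχ => ?_⟩
  · have hf := hψ.face w (by simp)
    have hg := hψ.face w' (by simp)
    rw [hBw] at hf
    rw [hBw'] at hg
    -- From B P B = χ(h) B: the vector can be recovered from its pinned version.
    have h3 : M.B β (d :: p) (M.pin d ψ) = dualHaarIntegral H (haarIntegral H) • ψ := by
      have := LinearMap.congr_fun hBPB ψ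
      simpa only [Module.End.mul_apply, LinearMap.smul_apply, hf] using this
    -- Apply the pin to the merging identity at ψ, use P B P = χ(h) P and cancel χ(h).
    have h4 : M.B β (p ++ q) (M.pin d ψ) = M.pin d ψ := by
      have h5 := congrArg (M.pin d) (LinearMap.congr_fun hmerge ψ)
      simp only [Module.End.mul_apply] at h5
      rw [h3, map_smul, hg] at h5
      have h6 := LinearMap.congr_fun hPBP (M.B β (p ++ q) ψ)
      simp only [Module.End.mul_apply, LinearMap.smul_apply] at h6
      rw [h6, map_smul] at h5
      have h7 := smul_right_injective V hc0 h5
      rw [← Module.End.mul_apply, ← hcpq.eq, Module.End.mul_apply]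
      exact h7.symm
    have h5 : M.IsFixed β lam (insert d (insert (L.flip d) S)) ((p ++ q) :: rest) (M.pin d ψ) := by
      refine ⟨fun x hx => ?_, fun x hx => ?_, fun x hx => ?_, fun o => ?_⟩
      · have hpp : ∀ y, M.pin y ψ = ψ → M.pin y (M.pin d ψ) = M.pin d ψ := fun y hy => by
          rw [← Module.End.mul_apply, (M.commute_pin_pin hH y d).eq, Module.End.mul_apply, hy]
        have hdd : M.pin d (M.pin d ψ) = M.pin d ψ := by
          rw [← Module.End.mul_apply, M.pin_mul_pin hH]
        simp only [Finset.mem_insert] at hx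
        obtain rfl | rfl | hx := hx
        · exact hdd
        · rw [M.pin_flip hH]; exact hdd
        · exact hpp x (hψ.pin x hx)
      · obtain rfl | hx := List.mem_cons.1 hx
        · exact h4
        · rw [← Module.End.mul_apply, ← (M.commute_pin_B β (hrest x hx).1 (hrest x hx).2).eq,
            Module.End.mul_apply, hψ.face x (by simp [hx])]
      · rw [← Module.End.mul_apply, ← (M.commute_vert (fun y _ k => M.commute_pin_l hH d y k) _).eq,
            Module.End.mul_apply, hψ.vertex x hx]
      · rw [← Module.End.mul_apply, ← (M.commute_pin_bdryVert β hH d o lam).eq,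
            Module.End.mul_apply, hψ.bdryVertex o]
    have h6 := h₁ _ h5 (by rw [hF d hd hd', hFψ])
    rw [h6, map_zero] at h3
    exact (smul_eq_zero.1 h3.symm).resolve_left hc0
  · have hdpin : M.pin d χ = χ := hχ d hd hd'
    have h3 : M.pin d ((rest.map (M.B β)).prod χ) = (rest.map (M.B β)).prod χ := by
      rw [← Module.End.mul_apply, (M.commute_pin_prod β hH hrest).eq, Module.End.mul_apply, hdpin]
    have h4 := h₂ χ hχ
    simp only [List.map_cons, List.prod_cons, Module.End.mul_apply] at h4 ⊢
    generalize (rest.map (M.B β)).prod χ = ξ at h3 h4 ⊢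
    have hcww := M.commute_B β hH hdisj
    rw [hBw, hBw'] at hcww ⊢
    rw [← Module.End.mul_apply, hcww.eq, Module.End.mul_apply]
    -- Merging brings the two face operators into the form B P B(p q). Since F absorbs a further P
    -- on the left, P B P = χ(h) P leaves the merged face operator with the factor χ(h).
    have h5 := LinearMap.congr_fun hmerge ξ
    simp only [Module.End.mul_apply, h3] at h5
    have h6 := LinearMap.congr_fun hPBP (M.B β (p ++ q) ξ)
    simp only [Module.End.mul_apply, LinearMap.smul_apply] at h6
    rw [h5, ← hF d hd hd', h6, map_smul, hF d hd hd', h4, smul_eq_mul, mul_assoc]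

/-- A leaf edge is pinned by the vertex operator at its free end, since all other edges there are
pinned already. On pinned vectors the leaf can be erased from the word, so neither the functional
nor the constant changes. -/
theorem detects_of_leaf [Finite D] [DecidableEq D] {d : D} {u w : List D} (hw : w.Nodup)
    (hu : w ~r L.flip d :: d :: u) (hv : ¬ L.IsBdryVertex (L.origin d))
    (hleaf : ∀ y, L.rot.SameCycle d y → y ∉ S → y = d)
    (h : M.Detects β lam F (insert d (insert (L.flip d) S)) [u]) : M.Detects β lam F S [w] := by
  obtain ⟨h₁, c, hc, h₂⟩ := h
  have hd := L.not_isOuter_of_origin hv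
  have hd' := L.not_isOuter_flip_of_origin hv
  have hn := hu.nodup_iff.1 hw
  simp only [List.nodup_cons, List.mem_cons, not_or] at hn
  have hB : ∀ ψ, M.pin d ψ = ψ → M.B β w ψ = M.B β u ψ := fun ψ hψ => by
    rw [M.B_of_isRotated β hH hw hu, ← hψ, ← Module.End.mul_apply,
      M.B_flip_cons_cons_mul_pin β hH hd hd' hn.2.1 hn.1.2, Module.End.mul_apply]
  refine ⟨fun ψ hψ hFψ => h₁ ψ ?_ hFψ, c, hc, fun χ hχ => ?_⟩
  · have hpin : M.pin d ψ = ψ := by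
      have h3 := hψ.vertex d hv
      obtain ⟨l, hl⟩ := cycleList_eq_cons L.rot d
      have hnl := nodup_cycleList L.rot d
      rw [hl] at h3 hnl
      have h4 := M.vert_apply_of_leaf hH.antipode_antipode (u := []) (w := l) (d := d) (ψ := ψ) hnl
        (fun x hx g => by
          have hxd : x ≠ d := fun h => (List.nodup_cons.1 hnl).1 (h ▸ hx)
          have hxS : x ∈ S := by
            by_contra hxS
            exact hxd (hleaf x ((mem_cycleList L.rot).1 (by rw [hl]; exact List.mem_cons_of_mem _ hx))
              hxS)
          have := LinearMap.congr_fun (M.l_mul_pin hH x g) ψ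
          simpa only [Module.End.mul_apply, LinearMap.smul_apply, hψ.pin x hxS] using this)
        (haarIntegral H)
      exact h4.symm.trans h3
    refine ⟨fun x hx => ?_, fun x hx => ?_, hψ.vertex, hψ.bdryVertex⟩
    · simp only [Finset.mem_insert] at hx
      obtain rfl | rfl | hx := hx
      · exact hpin
      · rw [M.pin_flip hH]; exact hpin
      · exact hψ.pin x hx
    · obtain rfl := List.mem_singleton.1 hx
      rw [← hB ψ hpin]
      exact hψ.face w (by simp)
  · have h3 := h₂ χ hχ
    simp only [List.map_cons, List.map_nil, List.prod_cons, List.prod_nil, mul_one] at h3 ⊢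
    rw [hB χ (hχ d hd hd'), h3]

variable [Fintype D]
  (hinj : ∀ ψ, M.IsPinned ψ → M.B β L.bdryWord ψ = ψ → (∀ o, M.bdryVert β o lam ψ = ψ) →
    F ψ = 0 → ψ = 0)
  (hB : ∀ χ, M.IsPinned χ → F (M.B β L.bdryWord χ) = F χ)
include hinj hB

theorem detects_of_leafStage {w : List D} (h : L.LeafStage S w) : M.Detects β lam F S [w] := by
  classical
  induction hn : (L.remaining S).card using Nat.strong_induction_on generalizing S w with
  | _ n ih =>
    by_cases h0 : L.remaining S = ∅
    · have hBw := M.B_of_isRotated β hH h.nodup (h.isRotated_bdryWord h0)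
      refine ⟨fun ψ hψ hFψ => hinj ψ (fun d hd hd' => hψ.pin d ?_) ?_ hψ.bdryVertex hFψ, 1,
        one_ne_zero, fun χ hχ => ?_⟩
      · by_contra hdS
        have := L.mem_remaining.2 ⟨hd, hd', hdS⟩
        simp [h0] at this
      · rw [← hBw]; exact hψ.face w (by simp)
      · simp only [List.map_cons, List.map_nil, List.prod_cons, List.prod_nil, mul_one, one_mul]
        rw [hBw, hB χ hχ]
    · obtain ⟨d, hv, hdS, hleaf⟩ := h.exists_leaf (Finset.nonempty_iff_ne_empty.2 h0)
      obtain ⟨u, hu, hst, hlt⟩ := h.remove hv hdS hleaf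
      exact M.detects_of_leaf β hH h.nodup hu hv hleaf (ih _ (hn ▸ hlt) hst rfl)

-- Induction on the number of faces: merge across an edge while two faces remain, then cut off the
-- leaves. The base case on the boundary circle is supplied by the hypotheses `hinj` and `hB`.
include hF in
theorem detects_of_mergeStage (h : L.MergeStage S ws) (hne : ws ≠ []) :
    M.Detects β lam F S ws := by
  classical
  induction hn : ws.length generalizing S ws with
  | zero => exact absurd (List.length_eq_zero_iff.1 hn) hne
  | succ n ih =>
    by_cases h2 : 2 ≤ ws.length
    · obtain ⟨d, w, hw, w', hw', hww, hd, hd'⟩ := h.exists_merge h2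
      obtain ⟨p, q, rest, hperm, hp, hq, hst⟩ := h.merge hw hw' hww hd hd'
      have hlen := hperm.length_eq
      simp only [List.length_cons] at hlen
      have hdet := ih hst (by simp) (by simp only [List.length_cons]; omega)
      have hnd : (w :: w' :: rest).flatten.Nodup := hperm.flatten.nodup_iff.1 h.nodup
      rw [List.nodup_flatten, List.pairwise_cons, List.pairwise_cons] at hnd
      have hmi : ∀ x ∈ ws, ∀ y ∈ x, ¬ L.IsOuter y := fun x hx y hy =>
        ((h.mem_iff y).1 ⟨x, hx, hy⟩).1
      have h3 := M.detects_of_merge β hH hF (h.nodup_of_mem hw) (h.nodup_of_mem hw') hp hq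
        (hmi w hw) (hmi w' hw' _ hd') (hnd.2.1 w' (by simp))
        (fun x hx => ⟨fun hdx => hnd.2.1 x (by simp [hx]) hd hdx,
          fun hdx => hnd.2.2.1 x hx hd' hdx⟩) hdet
      refine ⟨fun ψ hψ => h3.1 ψ ⟨hψ.pin, fun x hx => hψ.face x (hperm.mem_iff.2 hx), hψ.vertex,
        hψ.bdryVertex⟩, ?_⟩
      have h4 : (ws.map (M.B β)).prod = ((w :: w' :: rest).map (M.B β)).prod := by
        refine (hperm.map (M.B β)).prod_eq' ?_
        rw [List.pairwise_map]
        exact (List.nodup_flatten.1 h.nodup).2.imp fun hd => M.commute_B β hH hd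
      rw [h4]
      exact h3.2
    · have h1 : ws.length = 1 := by omega
      obtain ⟨w, rfl⟩ := List.length_eq_one_iff.1 h1
      exact M.detects_of_leafStage β hH hinj hB h.leafStage

end EdgeSystem

/-! ### The boundary circle -/

namespace DiskLattice

variable {D : Type*} (L : DiskLattice D)

theorem incoming_ne (o : L.BdryEdge) : o ≠ L.incoming o := fun h => by
  have h1 : o.1 = L.flip (L.rot o.1) := congrArg Subtype.val h
  have h2 : L.flip o.1 = L.rot o.1 := by rw [h1, L.flip_flip, ← h1]
  exact L.no_loop o.1 (h2 ▸ ⟨1, rfl⟩)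

variable [Finite D]

theorem mem_bdryWord {x : D} : x ∈ L.bdryWord ↔ L.IsOuter (L.flip x) := by
  have hf : L.flip⁻¹ = L.flip := by
    ext y
    rw [Equiv.Perm.inv_eq_iff_eq, L.flip_flip]
  -- The successor map on inner boundary darts is the inverse of `next` on the outer face,
  -- conjugated by reversal.
  have h1 : L.flip * L.next⁻¹ * L.flip⁻¹ = L.rot * L.flip := by
    ext y
    simp only [next, mul_inv_rev, hf, inv_inv, Equiv.Perm.mul_apply, L.flip_flip]
  rw [bdryWord, mem_cycleList, IsOuter, ← Equiv.Perm.sameCycle_inv (f := L.next), ← h1,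
    Equiv.Perm.sameCycle_conj, hf, L.flip_flip]

/-- The boundary edges, in the order opposite to their direction. -/
def bdryList : List L.BdryEdge :=
  L.bdryWord.pmap (fun x hx => ⟨L.flip x, hx⟩) fun _ hx => L.mem_bdryWord.1 hx

theorem map_bdryList : L.bdryList.map (fun o => L.flip o.1) = L.bdryWord := by
  simp [bdryList, List.map_pmap, L.flip_flip]

theorem nodup_bdryList : L.bdryList.Nodup :=
  List.Nodup.of_map (fun o => L.flip o.1) (by rw [map_bdryList]; exact nodup_cycleList _ _)

theorem mem_bdryList (o : L.BdryEdge) : o ∈ L.bdryList := by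
  have h : L.flip o.1 ∈ L.bdryWord := L.mem_bdryWord.2 (by rw [L.flip_flip]; exact o.2)
  exact List.mem_pmap.2 ⟨_, h, Subtype.ext (L.flip_flip _)⟩

theorem chain_bdryList : (L.bdryList : Cycle L.BdryEdge).Chain fun a b => L.incoming a = b := by
  have hc := chain_cycleList (L.rot * L.flip) (L.flip L.root)
  have hmap := L.map_bdryList
  rw [bdryWord] at hmap
  rw [← hmap] at hc
  cases h : L.bdryList with
  | nil => exact Cycle.Chain.nil _
  | cons o t =>
    rw [h, List.map_cons, Cycle.chain_coe_cons] at hc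
    rw [Cycle.chain_coe_cons]
    have h1 : L.flip o.1 :: (t.map (fun o => L.flip o.1) ++ [L.flip o.1]) =
      (o :: (t ++ [o])).map fun o => L.flip o.1 := by simp
    rw [h1, List.isChain_map] at hc
    refine hc.imp fun a b hab => Subtype.ext ?_
    rw [Equiv.Perm.mul_apply, L.flip_flip] at hab
    exact (congrArg L.flip hab).trans (L.flip_flip _)

theorem exists_isRotated_bdryList (o : L.BdryEdge) :
    ∃ l, L.bdryList ~r o :: L.incoming o :: l := by
  obtain ⟨t, ht⟩ := exists_isRotated_cons (L.mem_bdryList o)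
  have hc := chain_isRotated L.chain_bdryList ht
  cases t with
  | nil => exact absurd ((Cycle.chain_singleton _ _).1 hc).symm (L.incoming_ne o)
  | cons o' l =>
    rw [Cycle.chain_coe_cons, List.cons_append, List.isChain_cons_cons] at hc
    exact ⟨l, hc.1 ▸ ht⟩

theorem exists_bdryList_eq : ∃ o l o', L.bdryList = o :: (l ++ [o']) ∧ L.incoming o' = o ∧
    (L.bdryList).IsChain fun a b => L.incoming a = b := by
  have hc := L.chain_bdryList
  cases ht : L.bdryList with
  | nil =>
    have := L.mem_bdryList ⟨L.root, Equiv.Perm.SameCycle.refl _ _⟩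
    simp [ht] at this
  | cons o t =>
    rw [ht, Cycle.chain_coe_cons] at hc
    obtain rfl | ⟨l, o', rfl⟩ := t.eq_nil_or_concat'
    · simp only [List.nil_append, List.isChain_cons_cons] at hc
      exact absurd hc.1.symm (L.incoming_ne o)
    · refine ⟨o, l, o', rfl, ?_, ?_⟩
      · have h1 : o :: (l ++ [o'] ++ [o]) = (o :: l) ++ o' :: o :: [] := by simp
        rw [h1, List.isChain_append_cons_cons] at hc
        exact hc.2.1
      · rw [← List.cons_append] at hc
        exact (List.isChain_append.1 hc).1

end DiskLattice

theorem map_update_of_notMem {ι A : Type*} [DecidableEq ι] {l : List ι} {i : ι} (h : i ∉ l) (y : ι → A) (a : A) :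
    l.map (Function.update y i a) = l.map y :=
  List.map_congr_left fun j hj => Function.update_of_ne (by rintro rfl; exact h hj) _ _

/-! ### Functionals that can move factors along a circle -/

section ListProd

variable {ι A : Type*} [DecidableEq ι] [Ring A] [Algebra ℂ A]

/-- The product of the factors of a tensor in the order given by a list. -/
def listProd (l : List ι) (hn : l.Nodup) (hl : ∀ i, i ∈ l) : (⨂[ℂ] _ : ι, A) →ₗ[ℂ] A :=
  PiTensorProduct.lift ((MultilinearMap.mkPiAlgebraFin ℂ l.length A).domDomCongr
    (hn.getEquivOfForallMemList l hl))

theorem listProd_tprod (l : List ι) (hn : l.Nodup) (hl : ∀ i, i ∈ l) (y : ι → A) :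
    listProd l hn hl (⨂ₜ[ℂ] i, y i) = (l.map y).prod := by
  rw [listProd, PiTensorProduct.lift.tprod, MultilinearMap.domDomCongr_apply,
    MultilinearMap.mkPiAlgebraFin_apply]
  congr 1
  conv_rhs => rw [← List.ofFn_get l, List.map_ofFn]
  rfl

/-- If a functional on a tensor power can move factors along a list, then it depends only on the
product of the factors. -/
theorem apply_tprod_eq_of_move {R : ι → ι → Prop} (hR : ∀ i j, R i j → i ≠ j)
    {g : (⨂[ℂ] _ : ι, A) →ₗ[ℂ] ℂ}
    (hg : ∀ i j, R i j → ∀ y : ι → A, g (⨂ₜ[ℂ] k, y k) =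
      g (⨂ₜ[ℂ] k, Function.update (Function.update y j 1) i (y i * y j) k))
    {i : ι} {l : List ι} (hc : (i :: l).IsChain R) (hn : (i :: l).Nodup) (y : ι → A) :
    g (⨂ₜ[ℂ] k, y k) = g (⨂ₜ[ℂ] k, if k = i then ((i :: l).map y).prod else
      if k ∈ l then 1 else y k) := by
  induction l generalizing i with
  | nil =>
    congr 2; ext k
    by_cases h : k = i
    · subst h; simp
    · simp [h]
  | cons j l ih =>
    rw [List.isChain_cons_cons] at hc
    have hn' := List.nodup_cons.1 hn
    have hij : i ≠ j := fun h => hn'.1 (by simp [h])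
    rw [ih hc.2 hn'.2, hg i j hc.1]
    congr 2; ext k
    by_cases h : k = i
    · subst h
      have : k ∉ l := fun h => hn'.1 (by simp [h])
      simp [hij, this]
    · by_cases h' : k = j
      · subst h'; simp [h]
      · simp [h, h']

/-- A functional on a tensor power which can move factors along a cycle is a trace of the product
of the factors. -/
theorem exists_trace_of_move {R : ι → ι → Prop} (hR : ∀ i j, R i j → i ≠ j)
    {g : (⨂[ℂ] _ : ι, A) →ₗ[ℂ] ℂ}
    (hg : ∀ i j, R i j → ∀ y : ι → A, g (⨂ₜ[ℂ] k, y k) =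
      g (⨂ₜ[ℂ] k, Function.update (Function.update y j 1) i (y i * y j) k))
    {L : List ι} (hn : L.Nodup) (hL : ∀ i, i ∈ L) {i j : ι} {l : List ι} (hLl : L = i :: (l ++ [j]))
    (hji : R j i) (hc : L.IsChain R) :
    ∃ τ : A →ₗ[ℂ] ℂ, (∀ a b, τ (a * b) = τ (b * a)) ∧ g = τ ∘ₗ listProd L hn hL := by
  subst hLl
  have h1 : ∀ y : ι → A, g (⨂ₜ[ℂ] k, y k) = (g ∘ₗ (PiTensorProduct.tprod ℂ).toLinearMap 1 i)
      ((i :: (l ++ [j])).map y).prod := fun y => by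
    rw [apply_tprod_eq_of_move hR hg hc hn y, LinearMap.comp_apply, MultilinearMap.toLinearMap_apply]
    congr 2; ext k
    by_cases h : k = i
    · subst h; simp
    · have := (List.mem_cons.1 (hL k)).resolve_left h
      rw [if_neg h, if_pos this, Function.update_of_ne h, Pi.one_apply]
  refine ⟨g ∘ₗ (PiTensorProduct.tprod ℂ (s := fun _ : ι => A)).toLinearMap 1 i, fun a b => ?_, PiTensorProduct.ext (MultilinearMap.ext fun y => ?_)⟩
  · have hij := (hR j i hji).symm
    rw [List.nodup_cons, List.nodup_append] at hn
    have hjl : j ∉ l := fun h => hn.2.2.2 j h j (by simp) rfl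
    have hil : i ∉ l := fun h => hn.1 (by simp [h])
    have h2 : l.map (1 : ι → A) = List.replicate l.length 1 := by simp [List.eq_replicate_iff]
    -- The closing move of the circle joins the label a of the first place to the label b of the
    -- last one in the order b a, whereas the product along the list is a b.
    have h3 := hg j i hji (Function.update (Function.update 1 i a) j b)
    rw [h1, h1] at h3
    simpa [map_update_of_notMem hjl, map_update_of_notMem hil, hij, h2] using h3
  · simp only [LinearMap.compMultilinearMap_apply]
    rw [LinearMap.comp_apply, listProd_tprod]
    exact h1 y

omit [DecidableEq ι] [Algebra ℂ A] in
theorem trace_prod_of_isRotated {τ : A → ℂ} (hτ : ∀ a b, τ (a * b) = τ (b * a)) {l l' : List ι}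
    (h : l ~r l') (y : ι → A) : τ (l.map y).prod = τ (l'.map y).prod := by
  obtain ⟨n, rfl⟩ := h
  rw [List.rotate_eq_drop_append_take_mod, List.map_append, List.prod_append, hτ,
    ← List.prod_append, ← List.map_append, List.take_append_drop]

end ListProd

/-! ### Pinned vectors and the collapse to A -/

namespace EdgeSystem

open Coalgebra HopfAlgebra WithConv

section Pinned

variable {D : Type*} {L : DiskLattice D} {H A V : Type*} [Ring H] [HopfAlgebra ℂ H]
  [FiniteDimensional ℂ H] [Ring A] [Algebra ℂ A] [AddCommGroup V] [Module ℂ V]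
  (M : EdgeSystem L H A V) (β : RightComoduleAlgebra H A)

theorem IsPinned.bdry {M : EdgeSystem L H A V} {ψ : V} (h : M.IsPinned ψ) (o : D)
    (f : Module.End ℂ A) : M.IsPinned (M.bdry o f ψ) := fun d hd hd' => by
  rw [← Module.End.mul_apply, pin, (M.bulk_bdry_comm _ _ _ _).eq, Module.End.mul_apply]
  exact congrArg _ (h d hd hd')

/-- The action of `A ⊗ A` on the two boundary edges at a boundary vertex. -/
def bdryPair (o : L.BdryEdge) : A ⊗[ℂ] A →ₗ[ℂ] Module.End ℂ V :=
  LinearMap.mul' ℂ _ ∘ₗ TensorProduct.map (M.bdryLeft (L.incoming o).1) (M.bdryRight o.1)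

theorem bdryPair_tmul (o : L.BdryEdge) (a b : A) : M.bdryPair o (a ⊗ₜ b) =
    M.bdryLeft (L.incoming o).1 a * M.bdryRight o.1 b := rfl

/-- The action of the dual on a word of darts. -/
def wordOp (φ : Module.Dual ℂ H) (w : List D) : Module.End ℂ V := sliceRight φ (M.word β w)

theorem wordOp_nil (φ : Module.Dual ℂ H) : M.wordOp β φ [] = φ 1 • 1 := sliceRight_tmul φ 1 1

theorem wordOp_cons {ι : Type*} [Fintype ι] (bs : Module.Basis ι ℂ H) (φ : Module.Dual ℂ H)
    {o : D} (ho : L.IsOuter o) (w : List D) : M.wordOp β φ (L.flip o :: w) =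
      ∑ k, M.bdry o (TbarPlus β (bs.coord k)) * M.wordOp β (φ ∘ₗ LinearMap.mulLeft ℂ (bs k)) w := by
  rw [wordOp, word_cons, ← sum_sliceRight_tmul bs (M.T β (L.flip o)), Finset.sum_mul, map_sum]
  exact Finset.sum_congr rfl fun k _ => by
    rw [sliceRight_tmul_mul, M.sliceRight_T_of_isOuter β ho, wordOp]

theorem commute_bdry_wordOp {o : D} {w : List D} (h : L.flip o ∉ w) (f : Module.End ℂ A)
    (φ : Module.Dual ℂ H) : Commute (M.bdry o f) (M.wordOp β φ w) := by
  refine commute_tmul_one_iff.1 (Commute.list_prod_right _ _ fun y hy => ?_) φ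
  obtain ⟨x, hx, rfl⟩ := List.mem_map.1 hy
  exact commute_tmul_one_iff.2 (M.commute_bdry_T β (fun hxo => h (hxo ▸ hx)) f)

variable [StarRing H] [StarModule ℂ H] (hH : IsCStarHopfAlgebra H)
include hH

theorem IsPinned.l {M : EdgeSystem L H A V} {ψ : V} (h : M.IsPinned ψ) {d : D} (hd : ¬ L.IsOuter d)
    (hd' : ¬ L.IsOuter (L.flip d)) (g : H) : M.l d g ψ = counit (R := ℂ) g • ψ := by
  have := LinearMap.congr_fun (M.l_mul_pin hH d g) ψ
  simpa only [Module.End.mul_apply, LinearMap.smul_apply, h d hd hd'] using this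

/-- On pinned bulk edges the coaction letters act by the counit, so only the multiplications on the
two boundary edges survive. -/
theorem bdryVert_apply_of_isPinned [Finite D] {ψ : V} (hψ : M.IsPinned ψ) (o : L.BdryEdge)
    (t : A ⊗[ℂ] A) : M.bdryVert β o t ψ = M.bdryPair o t ψ := by
  induction t with
  | zero => simp
  | add s t hs ht => simp only [map_add, LinearMap.add_apply, hs, ht]
  | tmul a b =>
    rw [bdryVert_tmul, bdryPair_tmul, Module.End.mul_apply, Module.End.mul_apply]
    have hξ : M.IsPinned (M.bdryRight o.1 b ψ) := hψ.bdry o.1 _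
    generalize M.bdryRight o.1 b ψ = ξ at hξ
    have hv : ∀ g, M.vert (L.bulkDartsAt o) g ξ = counit (R := ℂ) g • ξ := M.vert_apply_of_forall
      fun d hd g => hξ.l hH (L.not_isOuter_of_mem_bulkDartsAt hd).1
        (L.not_isOuter_of_mem_bulkDartsAt hd).2 g
    let bs := Module.finBasis ℂ H
    have h1 := LinearMap.congr_fun (TbarPlus_counit β) a
    rw [TbarPlus_apply, Module.End.one_apply] at h1
    conv_rhs => rw [← h1]
    rw [← sum_sliceRight_tmul bs (β.coact a), K, coactConv]
    simp only [LinearMap.comp_apply, AlgHom.toLinearMap_apply]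
    conv_lhs => rw [← sum_sliceRight_tmul bs (β.coact a)]
    simp only [map_sum, LinearMap.sum_apply, TensorProduct.map_tmul, LinearMap.mul'_apply,
      Module.End.mul_apply, sliceRight_tmul, map_smul, LinearMap.smul_apply]
    refine Finset.sum_congr rfl fun k _ => ?_
    exact (congrArg _ (hv (bs k))).trans (map_smul _ _ _)

end Pinned

section TotalSpace

variable {D : Type*} {L : DiskLattice D} {H A : Type*} [Ring H] [HopfAlgebra ℂ H]
  [FiniteDimensional ℂ H] [Ring A] [Algebra ℂ A]

theorem totalSpace_ext {N : Type*} [AddCommGroup N] [Module ℂ N] {f g : TotalSpace L H A →ₗ[ℂ] N}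
    (h : ∀ (x : L.BulkEdge → H) (y : L.BdryEdge → A), f ((⨂ₜ[ℂ] e, x e) ⊗ₜ (⨂ₜ[ℂ] o, y o)) =
      g ((⨂ₜ[ℂ] e, x e) ⊗ₜ (⨂ₜ[ℂ] o, y o))) :
    f = g := by
  refine TensorProduct.ext (PiTensorProduct.ext (MultilinearMap.ext fun x =>
    PiTensorProduct.ext (MultilinearMap.ext fun y => h x y)))

theorem onBulkEdge_tmul [DecidableEq L.BulkEdge] (e : L.BulkEdge) (f : Module.End ℂ H)
    (x : L.BulkEdge → H) (Y : ⨂[ℂ] _ : L.BdryEdge, A) :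
    onBulkEdge L H A e f ((⨂ₜ[ℂ] e, x e) ⊗ₜ Y) =
      (⨂ₜ[ℂ] j, Function.update x e (f (x e)) j) ⊗ₜ Y := by
  rw [← onFactor_tprod e f x, onBulkEdge_apply, LinearMap.rTensor_tmul]
  congr!

theorem onBdryEdge_tmul [DecidableEq L.BdryEdge] (o : L.BdryEdge) (f : Module.End ℂ A)
    (X : ⨂[ℂ] _ : L.BulkEdge, H) (y : L.BdryEdge → A) :
    onBdryEdge L H A o f (X ⊗ₜ (⨂ₜ[ℂ] o, y o)) =
      X ⊗ₜ (⨂ₜ[ℂ] j, Function.update y o (f (y o)) j) := by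
  rw [← onFactor_tprod o f y, onBdryEdge_apply, LinearMap.lTensor_tmul]
  congr!

variable (L H A) in
/-- Evaluation of the counit on all bulk edges. -/
def counitAll [Fintype L.BulkEdge] : (⨂[ℂ] _ : L.BulkEdge, H) →ₗ[ℂ] ℂ :=
  PiTensorProduct.lift ((MultilinearMap.mkPiAlgebra ℂ L.BulkEdge ℂ).compLinearMap fun _ => counit)

theorem counitAll_tprod [Fintype L.BulkEdge] (x : L.BulkEdge → H) :
    counitAll L H (⨂ₜ[ℂ] e, x e) = ∏ e, counit (R := ℂ) (x e) := by
  simp [counitAll]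

/-- The edge operators are those of the total space. -/
structure IsTotal (M : EdgeSystem L H A (TotalSpace L H A)) : Prop where
  bulk (e : L.BulkEdge) : M.bulk e.1 = onBulkEdge L H A e ∘ₗ antipodeConj H
  bulk_flip (e : L.BulkEdge) : M.bulk (L.flip e.1) = onBulkEdge L H A e
  bdry (o : L.BdryEdge) : M.bdry o.1 = onBdryEdge L H A o

theorem isTotal_total (hS : ∀ x : H, antipode ℂ (antipode ℂ x) = x) : IsTotal (total L H A hS) :=
  ⟨fun e => onDart_pos H A e.2, fun e => onDart_flip H A e.2, total_bdry _⟩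

section Pin

variable [StarRing H] [StarModule ℂ H] (hH : IsCStarHopfAlgebra H)
  {M : EdgeSystem L H A (TotalSpace L H A)} (hM : IsTotal M)
include hH hM

theorem IsTotal.pin (e : L.BulkEdge) :
    M.pin e.1 = onBulkEdge L H A e (Lplus H (haarIntegral H)) := by
  rw [← M.pin_flip hH, EdgeSystem.pin, hM.bulk_flip]

theorem IsTotal.exists_pin_eq {d : D} (hd : ¬ L.IsOuter d) (hd' : ¬ L.IsOuter (L.flip d)) :
    ∃ e : L.BulkEdge, M.pin d = onBulkEdge L H A e (Lplus H (haarIntegral H)) := by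
  by_cases h : L.pos d
  · exact ⟨⟨d, h, hd⟩, hM.pin hH ⟨d, h, hd⟩⟩
  · refine ⟨⟨L.flip d, (L.pos_flip d).2 h, hd'⟩, ?_⟩
    rw [← hM.pin hH, M.pin_flip hH]

end Pin

variable [Fintype L.BulkEdge] [DecidableEq L.BdryEdge] [Finite D]

variable (L H A) in
/-- The counit on the bulk edges and the product of the labels of the boundary edges. -/
def collapse : TotalSpace L H A →ₗ[ℂ] A :=
  (TensorProduct.lid ℂ A).toLinearMap ∘ₗ TensorProduct.map (counitAll L H)
    (listProd L.bdryList L.nodup_bdryList L.mem_bdryList)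

theorem collapse_tmul (X : ⨂[ℂ] _ : L.BulkEdge, H) (Y : ⨂[ℂ] _ : L.BdryEdge, A) :
    collapse L H A (X ⊗ₜ Y) = counitAll L H X •
      listProd L.bdryList L.nodup_bdryList L.mem_bdryList Y := rfl

theorem collapse_tmul_tprod (X : ⨂[ℂ] _ : L.BulkEdge, H) (y : L.BdryEdge → A) :
    collapse L H A (X ⊗ₜ (⨂ₜ[ℂ] o, y o)) = counitAll L H X • (L.bdryList.map y).prod := by
  rw [collapse_tmul, listProd_tprod]

variable {M : EdgeSystem L H A (TotalSpace L H A)} (hM : IsTotal M) (β : RightComoduleAlgebra H A)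
include hM

theorem collapse_pin [StarRing H] [StarModule ℂ H] (hH : IsCStarHopfAlgebra H) {d : D}
    (hd : ¬ L.IsOuter d) (hd' : ¬ L.IsOuter (L.flip d)) (ψ : TotalSpace L H A) :
    collapse L H A (M.pin d ψ) = collapse L H A ψ := by
  classical
  obtain ⟨e, he⟩ := hM.exists_pin_eq hH hd hd'
  rw [he]
  refine LinearMap.congr_fun (f := collapse L H A ∘ₗ _) (g := collapse L H A)
    (totalSpace_ext fun x y => ?_) ψ
  rw [LinearMap.comp_apply, onBulkEdge_tmul, collapse_tmul_tprod, collapse_tmul_tprod,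
    counitAll_tprod, counitAll_tprod]
  congr 1
  refine Finset.prod_congr rfl fun j _ => ?_
  by_cases h : j = e
  · subst h
    simp [Lplus, hH.isHaarIntegral.2.2]
  · rw [Function.update_of_ne h]

/-- The boundary edges contribute their coaction letters in the order of the word, which is also the
order of the product of labels; multiplicativity of β combines them. The prefix u carries the part
of the boundary that has been passed. -/
theorem collapse_wordOp_tmul (X : ⨂[ℂ] _ : L.BulkEdge, H) (u l : List L.BdryEdge)
    (h : u ++ l = L.bdryList) (φ : Module.Dual ℂ H) (y : L.BdryEdge → A) :
    collapse L H A (M.wordOp β φ (l.map fun o => L.flip o.1) (X ⊗ₜ (⨂ₜ[ℂ] o, y o))) =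
      counitAll L H X •
        sliceRight φ (((u.map y).prod ⊗ₜ[ℂ] (1 : H)) * β.coact (l.map y).prod) := by
  induction l generalizing u φ y with
  | nil =>
    rw [List.append_nil] at h
    rw [List.map_nil, wordOp_nil, LinearMap.smul_apply, Module.End.one_apply, map_smul,
      collapse_tmul_tprod, List.map_nil, List.prod_nil, map_one β.coact, mul_one, sliceRight_tmul, h,
      smul_comm]
  | cons o l ih =>
    have hn := L.nodup_bdryList
    rw [← h, List.nodup_append, List.nodup_cons] at hn
    have hou : o ∉ u := fun h => hn.2.2 o h o (by simp) rfl
    have hol : L.flip o.1 ∉ l.map fun o => L.flip o.1 := fun h' => by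
      obtain ⟨o', ho', hoo⟩ := List.mem_map.1 h'
      exact hn.2.1.1 (Subtype.ext (L.flip.injective hoo) ▸ ho')
    let bs := Module.finBasis ℂ H
    have h3 : ∀ k, collapse L H A ((M.bdry o.1 (TbarPlus β (bs.coord k)) *
        M.wordOp β (φ ∘ₗ LinearMap.mulLeft ℂ (bs k)) (l.map fun o => L.flip o.1))
          (X ⊗ₜ (⨂ₜ[ℂ] o, y o))) = counitAll L H X •
        sliceRight φ ((u.map y).prod ⊗ₜ[ℂ] (1 : H) *
          (sliceRight (bs.coord k) (β.coact (y o)) ⊗ₜ[ℂ] bs k * β.coact (l.map y).prod)) :=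
        fun k => by
      rw [(M.commute_bdry_wordOp β hol _ _).eq, hM.bdry, Module.End.mul_apply, onBdryEdge_tmul,
        ih (u ++ [o]) (by simp [h]), List.map_append, map_update_of_notMem hou,
        map_update_of_notMem hn.2.1.1, List.map_singleton, Function.update_self, List.prod_append,
        List.prod_singleton, TbarPlus_apply]
      congr 1
      rw [sliceRight_tmul_one_mul, sliceRight_tmul_one_mul, sliceRight_tmul_mul, mul_assoc]
    rw [List.map_cons, M.wordOp_cons β bs φ o.2, LinearMap.sum_apply, map_sum,
      Finset.sum_congr rfl fun k _ => h3 k, ← Finset.smul_sum, ← map_sum, ← Finset.mul_sum,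
      ← Finset.sum_mul, sum_sliceRight_tmul, List.map_cons, List.prod_cons, map_mul β.coact]

theorem collapse_wordOp (φ : Module.Dual ℂ H) (ψ : TotalSpace L H A) :
    collapse L H A (M.wordOp β φ L.bdryWord ψ) = TbarPlus β φ (collapse L H A ψ) := by
  refine LinearMap.congr_fun (f := collapse L H A ∘ₗ _) (g := TbarPlus β φ ∘ₗ collapse L H A)
    (totalSpace_ext fun x y => ?_) ψ
  have := collapse_wordOp_tmul hM β (⨂ₜ[ℂ] e, x e) [] L.bdryList rfl φ y
  rw [L.map_bdryList, List.map_nil, List.prod_nil, ← Algebra.TensorProduct.one_def, one_mul] at this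
  rw [LinearMap.comp_apply, this, LinearMap.comp_apply, collapse_tmul_tprod, map_smul, TbarPlus_apply]

end TotalSpace

end EdgeSystem

theorem list_prod_mul_of_mem {R : Type*} [Monoid R] {l : List R} (h : ∀ x ∈ l, x * x = x)
    (hc : ∀ x ∈ l, ∀ y ∈ l, Commute x y) {x : R} (hx : x ∈ l) : l.prod * x = l.prod := by
  induction l with
  | nil => simp at hx
  | cons y l ih =>
    rw [List.prod_cons, mul_assoc]
    obtain rfl | hx := List.mem_cons.1 hx
    · have : Commute x l.prod := Commute.list_prod_right _ _ fun z hz =>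
        hc x (by simp) z (by simp [hz])
      rw [← this.eq, ← mul_assoc, h x (by simp)]
    · rw [ih (fun z hz => h z (by simp [hz])) (fun z hz w hw => hc z (by simp [hz]) w (by simp [hw])) hx]

/-! ### Averaging a trace over the dual -/

section Trace

open HopfAlgebra

variable {H A : Type*} [Ring H] [HopfAlgebra ℂ H] [Ring A] [Algebra ℂ A] [StarRing H]
  [StarModule ℂ H] [FiniteDimensional ℂ H] (hH : IsCStarHopfAlgebra H)
  (β : RightComoduleAlgebra H A)
include hH

theorem trace_TbarPlus_mul_comm {τ : A →ₗ[ℂ] ℂ} (hτ : ∀ a b, τ (a * b) = τ (b * a)) (a b : A) :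
    τ (TbarPlus β (dualHaarIntegral H) (a * b)) = τ (TbarPlus β (dualHaarIntegral H) (b * a)) := by
  have h : ∀ s t : A ⊗[ℂ] H, τ (sliceRight (dualHaarIntegral H) (s * t)) =
      τ (sliceRight (dualHaarIntegral H) (t * s)) := fun s t => by
    induction s with
    | zero => simp
    | add x y hx hy => simp only [add_mul, mul_add, map_add, hx, hy]
    | tmul x g =>
      induction t with
      | zero => simp
      | add x y hx hy => simp only [add_mul, mul_add, map_add, hx, hy]
      | tmul y k =>
        simp only [Algebra.TensorProduct.tmul_mul_tmul, sliceRight_tmul, map_smul]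
        rw [hτ, hH.dualHaarIntegral_mul_comm]
  rw [TbarPlus_apply, TbarPlus_apply, map_mul β.coact, map_mul β.coact, h]

/-- The averaged functional is invariant because χ absorbs the dual, and it is still a trace because
χ is one; uniqueness of the invariant trace applies. -/
theorem exists_trace_TbarPlus_eq [FiniteDimensional ℂ A] [Nontrivial A] {lam : A ⊗[ℂ] A} (hβ : IsHIndecomposable β)
    (hlam : IsSymmSeparabilityIdempotent lam) {τ : A →ₗ[ℂ] ℂ} (hτ : ∀ a b, τ (a * b) = τ (b * a)) :
    ∃ c : ℂ, ∀ a, τ (TbarPlus β (dualHaarIntegral H) a) = c * regTrace A a := by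
  obtain ⟨c, hc⟩ := hβ.eq_smul_regTrace hlam hH.antipode_antipode
    (τ ∘ₗ TbarPlus β (dualHaarIntegral H)) (trace_TbarPlus_mul_comm hH β hτ) fun ψ a => by
      rw [LinearMap.comp_apply, ← Module.End.mul_apply, ← TbarPlus_dualMul,
        hH.isDualHaarIntegral.2.1, map_smul, LinearMap.smul_apply, map_smul, smul_eq_mul,
        LinearMap.comp_apply]
  exact ⟨c, LinearMap.congr_fun hc⟩

end Trace

/-! ### Functionals invariant under the pins and the boundary vertices -/

namespace EdgeSystem

open Coalgebra HopfAlgebra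

variable {D : Type*} {L : DiskLattice D} {H A : Type*} [Ring H] [HopfAlgebra ℂ H]
  [FiniteDimensional ℂ H] [Ring A] [Algebra ℂ A]
  {M : EdgeSystem L H A (TotalSpace L H A)} (hM : IsTotal M) (β : RightComoduleAlgebra H A)
  {lam : A ⊗[ℂ] A} (hlam : IsSymmSeparabilityIdempotent lam)

variable (L H) in
/-- The Haar integral on all bulk edges. -/
def haarBulk : ⨂[ℂ] _ : L.BulkEdge, H := ⨂ₜ[ℂ] _, haarIntegral H

include hM in
theorem bdryPair_tmul_tprod [DecidableEq L.BdryEdge] (o : L.BdryEdge) (a b : A)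
    (X : ⨂[ℂ] _ : L.BulkEdge, H) (y : L.BdryEdge → A) :
    M.bdryPair o (a ⊗ₜ b) (X ⊗ₜ (⨂ₜ[ℂ] j, y j)) = X ⊗ₜ (⨂ₜ[ℂ] j,
      Function.update (Function.update y o (y o * b)) (L.incoming o) (a * y (L.incoming o)) j) := by
  rw [bdryPair_tmul, Module.End.mul_apply, bdryRight, bdryLeft, LinearMap.comp_apply,
    LinearMap.comp_apply, hM.bdry, hM.bdry, onBdryEdge_tmul, onBdryEdge_tmul]
  simp [(L.incoming_ne o).symm]

include hM in
theorem bdryPair_eq_bdryPair [DecidableEq L.BdryEdge] (o : L.BdryEdge) (t : A ⊗[ℂ] A)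
    (X : ⨂[ℂ] _ : L.BulkEdge, H) (y : L.BdryEdge → A) :
    M.bdryPair o t (X ⊗ₜ (⨂ₜ[ℂ] j, y j)) = M.bdryPair o
      (TensorProduct.map (LinearMap.mulRight ℂ (y (L.incoming o))) (LinearMap.mulLeft ℂ (y o)) t)
      (X ⊗ₜ (⨂ₜ[ℂ] j, Function.update (Function.update y o 1) (L.incoming o) 1 j)) := by
  induction t with
  | zero => simp
  | add s t hs ht => simp only [map_add, LinearMap.add_apply, hs, ht]
  | tmul a b =>
    rw [TensorProduct.map_tmul, bdryPair_tmul_tprod hM, bdryPair_tmul_tprod hM]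
    congr 3
    ext j
    have := L.incoming_ne o
    by_cases h : j = L.incoming o
    · subst h; simp
    · by_cases h' : j = o
      · subst h'; simp [this]
      · simp [h, h']

-- Rotate the circle so that the two edges at the vertex are adjacent. The factors of λ then meet
-- between their labels, in the exchanged order, and multiply to 1 by symmetry.
include hM in
theorem apply_bdryPair_tprod [Fintype L.BulkEdge] [DecidableEq L.BdryEdge] [Finite D]
    (hlam : IsSymmSeparabilityIdempotent lam) {τ : A →ₗ[ℂ] ℂ} (hτ : ∀ a b, τ (a * b) = τ (b * a))
    (o : L.BdryEdge) (ψ : TotalSpace L H A) :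
    τ (collapse L H A (M.bdryPair o lam ψ)) = τ (collapse L H A ψ) := by
  refine LinearMap.congr_fun (f := τ ∘ₗ collapse L H A ∘ₗ M.bdryPair o lam)
    (g := τ ∘ₗ collapse L H A) (totalSpace_ext fun x y => ?_) ψ
  simp only [LinearMap.comp_apply]
  obtain ⟨l, hl⟩ := L.exists_isRotated_bdryList o
  have hn := hl.nodup_iff.1 L.nodup_bdryList
  simp only [List.nodup_cons, List.mem_cons, not_or] at hn
  generalize (⨂ₜ[ℂ] e, x e) = X
  have h : ∀ t, τ (collapse L H A (M.bdryPair o t (X ⊗ₜ (⨂ₜ[ℂ] j, y j)))) = counitAll L H X *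
      τ (y o * (LinearMap.mul' ℂ A (TensorProduct.comm ℂ A A t) * (y (L.incoming o) * (l.map y).prod))) := by
    intro t
    induction t with
    | zero => simp
    | add s t hs ht => simp only [map_add, LinearMap.add_apply, hs, ht, mul_add, add_mul]
    | tmul a b =>
      rw [bdryPair_tmul_tprod hM, collapse_tmul_tprod, map_smul, trace_prod_of_isRotated hτ hl,
        List.map_cons, List.map_cons, map_update_of_notMem hn.2.1, map_update_of_notMem hn.1.2]
      simp [L.incoming_ne o, mul_assoc]
  rw [h, hlam.symm, hlam.mul_eq_one, one_mul, collapse_tmul_tprod, map_smul,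
    trace_prod_of_isRotated hτ hl, List.map_cons, List.map_cons, List.prod_cons, List.prod_cons,
    smul_eq_mul]

section Functional

variable [StarRing H] [StarModule ℂ H] (hH : IsCStarHopfAlgebra H) {G : TotalSpace L H A →ₗ[ℂ] ℂ}
include hM hH

theorem isPinned_haarBulk (Y : ⨂[ℂ] _ : L.BdryEdge, A) : M.IsPinned (haarBulk L H ⊗ₜ[ℂ] Y) :=
  fun d hd hd' => by
    classical
    obtain ⟨e, he⟩ := hM.exists_pin_eq hH hd hd'
    rw [he, haarBulk, onBulkEdge_tmul]
    congr 2
    ext j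
    by_cases h : j = e
    · subst h
      simp [Lplus, hH.isHaarIntegral.1, hH.isHaarIntegral.2.2]
    · rw [Function.update_of_ne h]

variable (hGp : ∀ e : L.BulkEdge, ∀ ψ, G (M.pin e.1 ψ) = G ψ)
include hGp

/-- The pins are inserted one edge at a time; each replaces the label x by ε(x) h. -/
theorem apply_tprod_tmul [Fintype L.BulkEdge] (x : L.BulkEdge → H) (Y : ⨂[ℂ] _ : L.BdryEdge, A) :
    G ((⨂ₜ[ℂ] e, x e) ⊗ₜ Y) = counitAll L H (⨂ₜ[ℂ] e, x e) * G (haarBulk L H ⊗ₜ Y) := by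
  classical
  have h : ∀ s : Finset L.BulkEdge, G ((⨂ₜ[ℂ] e, x e) ⊗ₜ Y) = (∏ e ∈ s, counit (R := ℂ) (x e)) *
      G ((⨂ₜ[ℂ] e, if e ∈ s then haarIntegral H else x e) ⊗ₜ Y) := by
    intro s
    induction s using Finset.induction_on with
    | empty => simp
    | insert e s hes ih =>
      rw [ih, ← hGp e, hM.pin hH, onBulkEdge_tmul, Finset.prod_insert hes, if_neg hes]
      have h1 : Lplus H (haarIntegral H) (x e) = counit (R := ℂ) (x e) • haarIntegral H :=
        hH.isHaarIntegral.2.1 (x e)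
      rw [h1, MultilinearMap.map_update_smul, ← TensorProduct.smul_tmul', map_smul, smul_eq_mul,
        mul_left_comm, ← mul_assoc]
      congr 4
      ext j
      by_cases h : j = e
      · subst h; simp
      · simp [h]
  rw [h Finset.univ, counitAll_tprod]
  simp [haarBulk]

variable (hGv : ∀ o ψ, G (M.bdryVert β o lam ψ) = G ψ)
include hGv hlam

/-- With λ inserted at the vertex, the identity λ⟨1⟩x ⊗ yλ⟨2⟩ = λ⟨1⟩ ⊗ yxλ⟨2⟩ shows that only the
product y x of the two labels matters. -/
theorem apply_haarBulk_tmul_move [DecidableEq L.BdryEdge] [Finite D] (o : L.BdryEdge)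
    (y : L.BdryEdge → A) : G (haarBulk L H ⊗ₜ (⨂ₜ[ℂ] j, y j)) = G (haarBulk L H ⊗ₜ (⨂ₜ[ℂ] j,
      Function.update (Function.update y (L.incoming o) 1) o (y o * y (L.incoming o)) j)) := by
  have h := L.incoming_ne o
  rw [← hGv o, M.bdryVert_apply_of_isPinned β hH (isPinned_haarBulk hM hH _),
    bdryPair_eq_bdryPair hM]
  conv_rhs => rw [← hGv o, M.bdryVert_apply_of_isPinned β hH (isPinned_haarBulk hM hH _),
    bdryPair_eq_bdryPair hM]
  have h1 : TensorProduct.map (LinearMap.mulRight ℂ (y (L.incoming o))) (LinearMap.mulLeft ℂ (y o))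
      lam = (LinearMap.mulLeft ℂ (y o * y (L.incoming o))).lTensor A lam := by
    rw [← LinearMap.lTensor_comp_rTensor, LinearMap.comp_apply, hlam.central',
      ← LinearMap.lTensor_comp_apply, ← LinearMap.mulLeft_mul]
  rw [h1]
  simp only [Function.update_self, Function.update_of_ne h.symm, LinearMap.mulRight_one]
  congr 5
  ext j
  by_cases h1 : j = L.incoming o
  · subst h1; simp
  · by_cases h' : j = o
    · subst h'; simp [h]
    · simp [h1, h']

/-- Pin invariance leaves only a functional of the boundary labels, and the moves at the boundary
vertices generate the cycle of `exists_trace_of_move`. -/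
theorem exists_trace_collapse [Fintype L.BulkEdge] [DecidableEq L.BdryEdge] [Finite D] :
    ∃ τ : A →ₗ[ℂ] ℂ, (∀ a b, τ (a * b) = τ (b * a)) ∧ G = τ ∘ₗ collapse L H A := by
  obtain ⟨o, l, o', hl, ho, hc⟩ := L.exists_bdryList_eq
  obtain ⟨τ, hτ, hg⟩ := exists_trace_of_move (R := fun a b => L.incoming a = b)
    (g := G ∘ₗ TensorProduct.mk ℂ _ _ (haarBulk L H))
    (fun a b hab => hab ▸ L.incoming_ne a)
    (fun a b hab y => by subst hab; exact apply_haarBulk_tmul_move hM β hlam hH hGp hGv a y)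
    L.nodup_bdryList L.mem_bdryList hl ho hc
  refine ⟨τ, hτ, totalSpace_ext fun x y => ?_⟩
  rw [apply_tprod_tmul hM hH hGp, LinearMap.comp_apply, collapse_tmul, map_smul, smul_eq_mul]
  exact congrArg _ (LinearMap.congr_fun hg _)

end Functional

end EdgeSystem

theorem mul_list_prod_of_mem {R : Type*} [Monoid R] {l : List R} (h : ∀ x ∈ l, x * x = x)
    (hc : ∀ x ∈ l, ∀ y ∈ l, Commute x y) {x : R} (hx : x ∈ l) : x * l.prod = l.prod := by
  rw [(Commute.list_prod_right _ _ fun z hz => hc x hx z hz : Commute x l.prod).eq,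
    list_prod_mul_of_mem h hc hx]

namespace DiskLattice

variable {D : Type*} (L : DiskLattice D)

/-- The words around the faces of the disk. -/
def faceWords [Fintype L.InnerFace] : List (List D) :=
  (Finset.univ : Finset L.InnerFace).toList.map fun f => cycleList L.next f.1.out

theorem mem_faceWords [Fintype L.InnerFace] {w : List D} :
    w ∈ L.faceWords ↔ ∃ f : L.InnerFace, cycleList L.next f.1.out = w := by simp [faceWords]

theorem not_isOuter_flip_root : ¬ L.IsOuter (L.flip L.root) := fun h =>
  (L.pos_flip _).1 (L.outer_pos _ h) (L.outer_pos _ (Equiv.Perm.SameCycle.refl _ _))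

theorem faceWords_ne_nil [Fintype L.InnerFace] : L.faceWords ≠ [] := fun h => by
  have h1 : L.leftFace (L.flip L.root) ≠ L.leftFace L.root := fun h =>
    L.not_isOuter_flip_root (L.leftFace_eq_iff.1 h.symm)
  have := L.mem_faceWords.2 ⟨⟨_, h1⟩, rfl⟩
  simp [h] at this

end DiskLattice

/-! ### Existence and uniqueness of invariant vectors -/

namespace EdgeSystem

open Coalgebra HopfAlgebra

section Abstract

variable {D : Type*} {L : DiskLattice D} {H A V : Type*} [Ring H] [HopfAlgebra ℂ H]
  [FiniteDimensional ℂ H] [Ring A] [Algebra ℂ A] [AddCommGroup V] [Module ℂ V]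
  (M : EdgeSystem L H A V) (β : RightComoduleAlgebra H A) {lam : A ⊗[ℂ] A}

theorem IsInvariant.isFixed [Fintype L.InnerFace] {ψ : V} (h : M.IsInvariant β lam ψ) :
    M.IsFixed β lam ∅ L.faceWords ψ :=
  ⟨by simp, fun w hw => by
    obtain ⟨f, rfl⟩ := L.mem_faceWords.1 hw
    exact h.face _ (DiskLattice.not_isOuter_out f), h.vertex, h.bdryVertex⟩

variable [StarRing H] [StarModule ℂ H] (hH : IsCStarHopfAlgebra H) [Finite D]
  [FiniteDimensional ℂ A] (hlam : IsSymmSeparabilityIdempotent lam)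
include hH hlam

/-- The Haar operators of the faces project a pinned vector onto an invariant one. -/
theorem isInvariant_prod_faceWords [Fintype L.InnerFace] {χ : V} (hχ : M.IsPinned χ)
    (hv : ∀ o, M.bdryVert β o lam χ = χ) :
    M.IsInvariant β lam ((L.faceWords.map (M.B β)).prod χ) := by
  have hop : ∀ x ∈ L.faceWords.map (M.B β), M.HaarOperator β lam x := fun x hx => by
    obtain ⟨w, hw, rfl⟩ := List.mem_map.1 hx
    obtain ⟨f, rfl⟩ := L.mem_faceWords.1 hw
    exact .face (DiskLattice.not_isOuter_out f)
  have hcomm : ∀ {P : Module.End ℂ V}, M.HaarOperator β lam P → P χ = χ →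
      P ((L.faceWords.map (M.B β)).prod χ) = (L.faceWords.map (M.B β)).prod χ := fun {P} hP h => by
    have : Commute P (L.faceWords.map (M.B β)).prod := Commute.list_prod_right _ _ fun x hx =>
      HaarOperator.commute M β hH hlam hP (hop x hx)
    rw [← Module.End.mul_apply, this.eq, Module.End.mul_apply, h]
  refine ⟨fun d hd => ?_, fun d hd => hcomm (.vertex hd) ?_, fun o => hcomm (.bdryVertex o) (hv o)⟩
  · have h1 : L.next.SameCycle d (L.leftFace d).out :=
      L.leftFace_eq_iff.1 (L.leftFace_out _).symm
    have hf : L.leftFace d ≠ L.leftFace L.root := fun h => hd (L.leftFace_eq_iff.1 h.symm)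
    rw [M.B_of_isRotated β hH (nodup_cycleList _ _) (isRotated_cycleList _ h1),
      ← Module.End.mul_apply, mul_list_prod_of_mem
        (fun x hx => HaarOperator.mul_self M β hH hlam (hop x hx))
        (fun x hx y hy => HaarOperator.commute M β hH hlam (hop x hx) (hop y hy))
        (List.mem_map_of_mem (L.mem_faceWords.2 ⟨⟨_, hf⟩, rfl⟩))]
  · rw [M.vert_apply_of_forall fun x hx g => ?_, hH.isHaarIntegral.2.2, one_smul]
    have hx' : L.origin d = L.origin x := L.origin_eq_iff.2 ((mem_cycleList L.rot).1 hx)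
    exact hχ.l hH (L.not_isOuter_of_origin (hx' ▸ hd)) (L.not_isOuter_flip_of_origin (hx' ▸ hd)) g

end Abstract

section Total

variable {D : Type*} {L : DiskLattice D} {H A : Type*} [Ring H] [HopfAlgebra ℂ H]
  [FiniteDimensional ℂ H] [Ring A] [Algebra ℂ A] [FiniteDimensional ℂ A] [Nontrivial A]
  {M : EdgeSystem L H A (TotalSpace L H A)} (hM : IsTotal M) (β : RightComoduleAlgebra H A)
  {lam : A ⊗[ℂ] A} (hlam : IsSymmSeparabilityIdempotent lam)
  [StarRing H] [StarModule ℂ H] (hH : IsCStarHopfAlgebra H)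
  [Fintype D] [Fintype L.BulkEdge] [Fintype L.BdryEdge] [DecidableEq L.BdryEdge]

variable (L H A) in
/-- The regular trace of the collapsed vector. -/
def collapseTrace : TotalSpace L H A →ₗ[ℂ] ℂ := regTrace A ∘ₗ collapse L H A

include hM hlam hH

theorem eq_zero_of_collapseTrace_eq_zero (hβ : IsHIndecomposable β) {ψ : TotalSpace L H A}
    (hψ : M.IsPinned ψ) (hB : M.B β L.bdryWord ψ = ψ) (hv : ∀ o, M.bdryVert β o lam ψ = ψ)
    (h0 : collapseTrace L H A ψ = 0) : ψ = 0 := by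
  have hS := hH.antipode_antipode
  refine (Module.forall_dual_apply_eq_zero_iff ℂ ψ).1 fun F => ?_
  -- Commuting idempotents that all fix ψ. Composing F with their product makes it invariant without
  -- changing its value at ψ.
  let ops : List (Module.End ℂ (TotalSpace L H A)) :=
    (Finset.univ : Finset L.BulkEdge).toList.map (fun e => M.pin e.1) ++
      (Finset.univ : Finset L.BdryEdge).toList.map fun o => M.bdryVert β o lam
  have hmem : ∀ x ∈ ops, (∃ e : L.BulkEdge, M.pin e.1 = x) ∨ ∃ o, M.bdryVert β o lam = x :=
    fun x hx => by simpa [ops] using hx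
  have hpin : ∀ e : L.BulkEdge, M.pin e.1 ∈ ops := fun e =>
    List.mem_append_left _ (List.mem_map_of_mem (f := fun e : L.BulkEdge => M.pin e.1) (by simp))
  have hvert : ∀ o, M.bdryVert β o lam ∈ ops := fun o =>
    List.mem_append_right _ (List.mem_map_of_mem (f := fun o => M.bdryVert β o lam) (by simp))
  have hflip : ∀ e : L.BulkEdge, ¬ L.IsOuter (L.flip e.1) := fun e h =>
    (L.pos_flip _).1 (L.outer_pos _ h) e.2.1
  have hid : ∀ x ∈ ops, x * x = x := fun x hx => by
    obtain ⟨e, rfl⟩ | ⟨o, rfl⟩ := hmem x hx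
    · exact M.pin_mul_pin hH _
    · exact M.bdryVert_mul_self β hS hlam o
  have hc : ∀ x ∈ ops, ∀ y ∈ ops, Commute x y := fun x hx y hy => by
    obtain ⟨e, rfl⟩ | ⟨o, rfl⟩ := hmem x hx <;> obtain ⟨e', rfl⟩ | ⟨o', rfl⟩ := hmem y hy
    · exact M.commute_pin_pin hH _ _
    · exact M.commute_pin_bdryVert β hH _ _ _
    · exact (M.commute_pin_bdryVert β hH _ _ _).symm
    · by_cases h : o = o'
      · rw [h]
      · exact M.commute_bdryVert_bdryVert β hS o o' h _ _
  have hfix : ∀ l : List (Module.End ℂ (TotalSpace L H A)), (∀ x ∈ l, x ψ = ψ) → l.prod ψ = ψ := by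
    intro l hl
    induction l with
    | nil => rfl
    | cons x l ih =>
      rw [List.prod_cons, Module.End.mul_apply, ih fun z hz => hl z (by simp [hz]),
        hl x (by simp)]
  have hψ' : ops.prod ψ = ψ := hfix ops fun x hx => by
    obtain ⟨e, rfl⟩ | ⟨o, rfl⟩ := hmem x hx
    · exact hψ _ e.2.2 (hflip e)
    · exact hv o
  obtain ⟨τ, hτ, hG⟩ := exists_trace_collapse hM β hlam hH (G := F ∘ₗ ops.prod)
    (fun e ξ => by
      rw [LinearMap.comp_apply, ← Module.End.mul_apply,
        list_prod_mul_of_mem hid hc (hpin e), LinearMap.comp_apply])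
    (fun o ξ => by
      rw [LinearMap.comp_apply, ← Module.End.mul_apply,
        list_prod_mul_of_mem hid hc (hvert o), LinearMap.comp_apply])
  obtain ⟨c, hc'⟩ := exists_trace_TbarPlus_eq hH β hβ hlam hτ
  -- F(ψ) becomes a trace of the average of the collapsed vector, hence a multiple of the regular
  -- trace, which vanishes.
  have h1 : F ψ = F (ops.prod (M.B β L.bdryWord ψ)) := by rw [hB, hψ']
  have h2 := LinearMap.congr_fun hG (M.B β L.bdryWord ψ)
  rw [LinearMap.comp_apply, LinearMap.comp_apply] at h2
  rw [h1, h2]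
  have h3 := collapse_wordOp hM β (dualHaarIntegral H) ψ
  rw [wordOp] at h3
  rw [B, h3, hc']
  have h4 : regTrace A (collapse L H A ψ) = 0 := h0
  rw [h4, mul_zero]

omit hlam [Nontrivial A] [Fintype L.BdryEdge] in
theorem collapseTrace_B (χ : TotalSpace L H A) :
    collapseTrace L H A (M.B β L.bdryWord χ) = collapseTrace L H A χ := by
  have h3 := collapse_wordOp hM β (dualHaarIntegral H) χ
  rw [wordOp] at h3
  rw [collapseTrace, LinearMap.comp_apply, B, h3, regTrace_TbarPlus β hH.antipode_antipode,
    hH.isDualHaarIntegral.2.2, one_mul, LinearMap.comp_apply]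

theorem detects_collapseTrace (hβ : IsHIndecomposable β) [Fintype L.InnerFace] :
    M.Detects β lam (collapseTrace L H A) ∅ L.faceWords := by
  classical
  exact M.detects_of_mergeStage β hH
    (fun d hd hd' ψ => congrArg (regTrace A) (collapse_pin hM hH hd hd' ψ))
    (fun ψ hψ hB hv => eq_zero_of_collapseTrace_eq_zero hM β hlam hH hβ hψ hB hv)
    (fun χ _ => collapseTrace_B hM β hH χ) L.mergeStage_faces L.faceWords_ne_nil

/-- A pinned vector fixed by the boundary vertex operators gives rise to a nonzero invariant vector
if its collapsed trace does not vanish. -/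
theorem prod_faceWords_ne_zero (hβ : IsHIndecomposable β) [Fintype L.InnerFace]
    {χ : TotalSpace L H A} (hχ : M.IsPinned χ) (h0 : collapseTrace L H A χ ≠ 0) :
    (L.faceWords.map (M.B β)).prod χ ≠ 0 := fun h => by
  obtain ⟨-, c, hc, h1⟩ := detects_collapseTrace hM β hlam hH hβ
  have := h1 χ hχ
  rw [h, map_zero] at this
  exact mul_ne_zero hc h0 this.symm

/-- The difference with the ratio of the values of `collapseTrace` as factor is fixed and has value
zero. -/
theorem exists_eq_smul_of_isInvariant (hβ : IsHIndecomposable β) {ψ ψ' : TotalSpace L H A}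
    (hψ : M.IsInvariant β lam ψ) (h0 : ψ ≠ 0) (hψ' : M.IsInvariant β lam ψ') :
    ∃ c : ℂ, ψ' = c • ψ := by
  classical
  obtain ⟨h1, -⟩ := detects_collapseTrace hM β hlam hH hβ
  have hF : collapseTrace L H A ψ ≠ 0 := fun h => h0 (h1 ψ hψ.isFixed h)
  refine ⟨collapseTrace L H A ψ' / collapseTrace L H A ψ, sub_eq_zero.1 (h1 _ ?_ ?_)⟩
  · have h := hψ.isFixed
    have h' := hψ'.isFixed
    exact ⟨by simp, fun w hw => by rw [map_sub, map_smul, h.face w hw, h'.face w hw],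
      fun d hd => by rw [map_sub, map_smul, h.vertex d hd, h'.vertex d hd],
      fun o => by rw [map_sub, map_smul, h.bdryVertex o, h'.bdryVertex o]⟩
  · rw [map_sub, map_smul, smul_eq_mul, div_mul_cancel₀ _ hF, sub_self]

omit hlam [FiniteDimensional ℂ A] [Nontrivial A] [Fintype L.BdryEdge] in
theorem collapse_haarBulk_tmul (y : L.BdryEdge → A) :
    collapse L H A (haarBulk L H ⊗ₜ (⨂ₜ[ℂ] o, y o)) = (L.bdryList.map y).prod := by
  rw [collapse_tmul_tprod, haarBulk, counitAll_tprod]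
  simp [hH.isHaarIntegral.2.2]

/-- Start from h on the bulk edges and 1 on the boundary and project with the boundary vertex
operators. These keep the bulk pinned and do not change `collapseTrace`, whose value is the
dimension of A. -/
theorem exists_isInvariant (hβ : IsHIndecomposable β) :
    ∃ ψ : TotalSpace L H A, ψ ≠ 0 ∧ M.IsInvariant β lam ψ := by
  classical
  have hS := hH.antipode_antipode
  let ops : List (Module.End ℂ (TotalSpace L H A)) :=
    (Finset.univ : Finset L.BdryEdge).toList.map fun o => M.bdryVert β o lam
  have hmem : ∀ x ∈ ops, ∃ o, M.bdryVert β o lam = x := fun x hx => by simpa [ops] using hx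
  have hvert : ∀ o, M.bdryVert β o lam ∈ ops := fun o =>
    List.mem_map_of_mem (f := fun o => M.bdryVert β o lam) (by simp)
  have hid : ∀ x ∈ ops, x * x = x := fun x hx => by
    obtain ⟨o, rfl⟩ := hmem x hx
    exact M.bdryVert_mul_self β hS hlam o
  have hc : ∀ x ∈ ops, ∀ y ∈ ops, Commute x y := fun x hx y hy => by
    obtain ⟨o, rfl⟩ := hmem x hx
    obtain ⟨o', rfl⟩ := hmem y hy
    by_cases h : o = o'
    · rw [h]
    · exact M.commute_bdryVert_bdryVert β hS o o' h _ _
  let χ : TotalSpace L H A := haarBulk L H ⊗ₜ (⨂ₜ[ℂ] _, 1)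
  have key : ∀ l : List (Module.End ℂ (TotalSpace L H A)),
      (∀ x ∈ l, ∃ o, M.bdryVert β o lam = x) →
        M.IsPinned (l.prod χ) ∧ collapseTrace L H A (l.prod χ) = collapseTrace L H A χ := by
    intro l hl
    induction l with
    | nil => exact ⟨isPinned_haarBulk hM hH _, rfl⟩
    | cons x l ih =>
      obtain ⟨h1, h2⟩ := ih fun z hz => hl z (by simp [hz])
      obtain ⟨o, rfl⟩ := hl x (by simp)
      rw [List.prod_cons, Module.End.mul_apply]
      refine ⟨fun d hd hd' => ?_, ?_⟩
      · rw [← Module.End.mul_apply, (M.commute_pin_bdryVert β hH d o lam).eq, Module.End.mul_apply,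
          h1 d hd hd']
      · rw [M.bdryVert_apply_of_isPinned β hH h1, ← h2]
        exact apply_bdryPair_tprod hM hlam regTrace_mul_comm o _
  obtain ⟨h1, h2⟩ := key ops hmem
  refine ⟨_, prod_faceWords_ne_zero hM β hlam hH hβ h1 ?_,
    M.isInvariant_prod_faceWords β hH hlam h1 fun o => ?_⟩
  · rw [h2, collapseTrace, LinearMap.comp_apply]
    have h3 := collapse_haarBulk_tmul hM hH (A := A) (L := L) fun _ => 1
    rw [h3]
    have h4 : regTrace A 1 = (Module.finrank ℂ A : ℂ) := by
      have : LinearMap.mul ℂ A 1 = LinearMap.id := by ext; simp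
      rw [regTrace, LinearMap.comp_apply, this, LinearMap.trace_id]
    have h5 : (L.bdryList.map fun _ => (1 : A)).prod = 1 := by simp
    rw [h5, h4]
    exact Nat.cast_ne_zero.2 Module.finrank_pos.ne'
  · rw [← Module.End.mul_apply, mul_list_prod_of_mem hid hc (hvert o)]

end Total

end EdgeSystem

/-! ### The tensor network as a product of face operators -/

section Expansion

variable {ι κ R E H : Type*} [DecidableEq ι] [Ring R] [Algebra ℂ R] [Ring E] [Algebra ℂ E] [Ring H]
  [Algebra ℂ H]

theorem exists_linearMap_list_prod {l : List ι} (hn : l.Nodup) {i : ι} (hi : i ∈ l) (X : ι → R) :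
    ∃ f : R →ₗ[ℂ] R, ∀ x, (l.map (Function.update X i x)).prod = f x := by
  obtain ⟨u, v, rfl⟩ := List.append_of_mem hi
  have hn' := List.nodup_middle.1 hn
  rw [List.nodup_cons, List.mem_append, not_or] at hn'
  refine ⟨LinearMap.mulLeft ℂ (u.map X).prod ∘ₗ LinearMap.mulRight ℂ (v.map X).prod, fun x => ?_⟩
  rw [List.map_append, List.map_cons, map_update_of_notMem hn'.1.1, map_update_of_notMem hn'.1.2]
  simp

/-- The product of the slices of the words `ws`, as a multilinear map. -/
def sliceProd (φ : Module.Dual ℂ H) {ws : List (List ι)} (hn : ws.flatten.Nodup)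
    (hm : ∀ i, i ∈ ws.flatten) : MultilinearMap ℂ (fun _ : ι => E ⊗[ℂ] H) E :=
  have key : ∀ [DecidableEq ι] (X : ι → E ⊗[ℂ] H) (i : ι), ∃ f : E ⊗[ℂ] H →ₗ[ℂ] E, ∀ x,
      (ws.map fun w => sliceRight φ (w.map (Function.update X i x)).prod).prod = f x := by
    intro _ X i
    obtain ⟨w, hw, hi⟩ := List.mem_flatten.1 (hm i)
    obtain ⟨u, v, rfl⟩ := List.append_of_mem hw
    rw [List.flatten_append, List.flatten_cons, List.nodup_append, List.nodup_append] at hn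
    obtain ⟨f, hf⟩ := exists_linearMap_list_prod hn.2.1.1 hi X
    have h1 : ∀ s : List (List ι), i ∉ s.flatten → ∀ x,
        (s.map fun w => sliceRight φ (w.map (Function.update X i x)).prod) =
          s.map fun w => sliceRight φ (w.map X).prod := fun s hs x =>
      List.map_congr_left fun w hw => by
        rw [map_update_of_notMem fun h => hs (List.mem_flatten.2 ⟨w, hw, h⟩)]
    refine ⟨LinearMap.mulLeft ℂ (u.map fun w => sliceRight φ (w.map X).prod).prod ∘ₗ
      LinearMap.mulRight ℂ (v.map fun w => sliceRight φ (w.map X).prod).prod ∘ₗ sliceRight φ ∘ₗ f,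
      fun x => ?_⟩
    rw [List.map_append, List.map_cons, h1 u (fun h => hn.2.2 i h i (by simp [hi]) rfl),
      h1 v (fun h => hn.2.1.2.2 i hi i h rfl), hf]
    simp
  { toFun := fun X => (ws.map fun w => sliceRight φ (w.map X).prod).prod
    map_update_add' := fun X i x y => by
      obtain ⟨f, hf⟩ := key X i
      rw [hf, hf, hf, map_add]
    map_update_smul' := fun X i c x => by
      obtain ⟨f, hf⟩ := key X i
      rw [hf, hf, map_smul] }

omit [DecidableEq ι] in
theorem prod_map_tmul (l : List ι) (t : ι → E) (b : ι → H) :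
    (l.map fun i => t i ⊗ₜ[ℂ] b i).prod = (l.map t).prod ⊗ₜ[ℂ] (l.map b).prod := by
  induction l with
  | nil => rfl
  | cons i l ih => simp only [List.map_cons, List.prod_cons, ih, Algebra.TensorProduct.tmul_mul_tmul]

omit [DecidableEq ι] in
theorem prod_map_smul (l : List ι) (c : ι → ℂ) (t : ι → E) :
    (l.map fun i => c i • t i).prod = (l.map c).prod • (l.map t).prod := by
  induction l with
  | nil => simp
  | cons i l ih => simp only [List.map_cons, List.prod_cons, ih, smul_mul_smul_comm]

/-- Each letter occurs exactly once in all the words together, so the product of the slices is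
multilinear in the letters and expands over all labellings. -/
theorem prod_sliceRight_eq_sum [Fintype ι] [Fintype κ] (φ : Module.Dual ℂ H) {ws : List (List ι)}
    (hn : ws.flatten.Nodup) (hm : ∀ i, i ∈ ws.flatten) (t : ι → κ → E) (b : κ → H) :
    (ws.map fun w => sliceRight φ (w.map fun i => ∑ k, t i k ⊗ₜ[ℂ] b k).prod).prod =
      ∑ k : ι → κ, (ws.map fun w => φ (w.map fun i => b (k i)).prod).prod •
        (ws.flatten.map fun i => t i (k i)).prod := by
  have h := (sliceProd (E := E) φ hn hm).map_sum (fun i k => t i k ⊗ₜ[ℂ] b k)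
  refine h.trans (Finset.sum_congr rfl fun k _ => ?_)
  change (ws.map fun w => sliceRight φ (w.map fun i => t i (k i) ⊗ₜ[ℂ] b (k i)).prod).prod = _
  simp only [prod_map_tmul, sliceRight_tmul, prod_map_smul]
  rw [List.map_flatten, List.prod_flatten, List.map_map]
  rfl

end Expansion

section Edge

open Coalgebra HopfAlgebra

variable {H : Type*} [Ring H] [HopfAlgebra ℂ H]

theorem sum_smul_sliceRight_coord {ι M N : Type*} [Fintype ι] [AddCommGroup M] [Module ℂ M]
    [AddCommGroup N] [Module ℂ N] (b : Module.Basis ι ℂ N) (g : Module.Dual ℂ N) (t : M ⊗[ℂ] N) :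
    ∑ k, g (b k) • sliceRight (b.coord k) t = sliceRight g t := by
  conv_rhs => rw [← sum_sliceRight_tmul b t]
  simp only [map_sum, sliceRight_tmul]

theorem Tplus_apply (φ : Module.Dual ℂ H) (x : H) : Tplus H φ x = sliceRight φ (comul x) := rfl

variable [FiniteDimensional ℂ H] [StarRing H] [StarModule ℂ H]

/-- The network splits h into the state leg and the letters of the two adjacent faces; by
cocommutativity and coassociativity this is the action of both sides of the edge on h. -/
theorem IsCStarHopfAlgebra.sum_repr_smul_sliceRight (hH : IsCStarHopfAlgebra H) {κ : Type*}
    [Fintype κ] (b : Module.Basis κ ℂ H) (c : κ × κ) :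
    ∑ k, (b.tensorProduct b).repr ((antipode ℂ (A := H)).lTensor H (comul (R := ℂ) (b k))) c •
      sliceRight (b.coord k) (comul (R := ℂ) (haarIntegral H)) =
    Tplus H (b.coord c.1) (Tminus H (b.coord c.2) (haarIntegral H)) := by
  have h1 : ∀ t : H ⊗[ℂ] H, (b.tensorProduct b).repr ((antipode ℂ (A := H)).lTensor H t) c =
      LinearMap.mul' ℂ ℂ (TensorProduct.map (b.coord c.1) (b.coord c.2 ∘ₗ antipode ℂ) t) := by
    intro t
    induction t with
    | zero => simp
    | add x y hx hy => simp only [map_add, Finsupp.add_apply, hx, hy]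
    | tmul x y =>
      obtain ⟨i, j⟩ := c
      simp [mul_comm]
  have h2 : Tminus H (b.coord c.2) (haarIntegral H) =
      Tplus H (b.coord c.2 ∘ₗ antipode ℂ) (haarIntegral H) := by
    have h3 : ∀ t : H ⊗[ℂ] H, sliceLeft (b.coord c.2 ∘ₗ antipode ℂ) t =
        sliceRight (b.coord c.2 ∘ₗ antipode ℂ) (TensorProduct.comm ℂ H H t) := fun t => by
      induction t with
      | zero => simp
      | add x y hx hy => simp only [map_add, hx, hy]
      | tmul x y => simp
    rw [Tplus_apply, ← hH.comm_comul_haarIntegral, ← h3]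
    rfl
  simp only [h1]
  rw [h2, ← Module.End.mul_apply, ← Tplus_dualMul, Tplus_apply,
    ← sum_smul_sliceRight_coord b]
  rfl

end Edge

namespace DiskLattice

variable {D : Type*} (L : DiskLattice D)

/-- The darts of the faces of the disk. -/
abbrev InnerDart : Type _ := {d : D // ¬ L.IsOuter d}

theorem not_isOuter_flip_of_pos {d : D} (h : L.pos d) : ¬ L.IsOuter (L.flip d) := fun h' =>
  (L.pos_flip d).1 (L.outer_pos _ h') h

/-- The inner dart of a bulk edge which has the direction of the edge. -/
def bulkDart (e : L.BulkEdge) : L.InnerDart := ⟨e.1, e.2.2⟩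

/-- The inner dart of a bulk edge which has the opposite direction. -/
def bulkFlip (e : L.BulkEdge) : L.InnerDart := ⟨L.flip e.1, L.not_isOuter_flip_of_pos e.2.1⟩

/-- The inner dart of a boundary edge. -/
def bdryFlip (o : L.BdryEdge) : L.InnerDart :=
  ⟨L.flip o.1, L.not_isOuter_flip_of_pos (L.outer_pos _ o.2)⟩

theorem innerDart_cases (d : L.InnerDart) :
    (∃ e, d = L.bulkDart e) ∨ (∃ e, d = L.bulkFlip e) ∨ ∃ o, d = L.bdryFlip o := by
  obtain ⟨d, hd⟩ := d
  by_cases h : L.pos d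
  · exact Or.inl ⟨⟨d, h, hd⟩, rfl⟩
  · have hf := L.flip_flip d
    by_cases ho : L.IsOuter (L.flip d)
    · exact Or.inr (Or.inr ⟨⟨_, ho⟩, Subtype.ext hf.symm⟩)
    · exact Or.inr (Or.inl ⟨⟨_, (L.pos_flip d).2 h, ho⟩, Subtype.ext hf.symm⟩)

theorem bulkDart_injective : Function.Injective L.bulkDart := fun _ _ h =>
  Subtype.ext (congrArg (fun d : L.InnerDart => d.1) h)

theorem bulkFlip_injective : Function.Injective L.bulkFlip := fun _ _ h =>
  Subtype.ext (L.flip.injective (congrArg Subtype.val h))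

theorem bdryFlip_injective : Function.Injective L.bdryFlip := fun _ _ h =>
  Subtype.ext (L.flip.injective (congrArg Subtype.val h))

theorem bulkFlip_ne_bulkDart (e e' : L.BulkEdge) : L.bulkFlip e ≠ L.bulkDart e' := fun h => by
  have h1 : L.flip e.1 = e'.1 := congrArg Subtype.val h
  exact (L.pos_flip e.1).1 (h1 ▸ e'.2.1) e.2.1

theorem bdryFlip_ne_bulkDart (o : L.BdryEdge) (e : L.BulkEdge) : L.bdryFlip o ≠ L.bulkDart e :=
  fun h => by
  have h1 : L.flip o.1 = e.1 := congrArg Subtype.val h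
  exact (L.pos_flip o.1).1 (h1 ▸ e.2.1) (L.outer_pos _ o.2)

theorem bdryFlip_ne_bulkFlip (o : L.BdryEdge) (e : L.BulkEdge) : L.bdryFlip o ≠ L.bulkFlip e :=
  fun h => e.2.2 ((L.flip.injective (congrArg Subtype.val h) : o.1 = e.1) ▸ o.2)

open scoped Classical in
/-- A label on the inner darts, as a pair of labels on every bulk edge and a label on every boundary
edge. -/
def innerLabel (κ : Type*) :
    ((L.BulkEdge → κ × κ) × (L.BdryEdge → κ)) ≃ (L.InnerDart → κ) where
  toFun c d := if h : L.IsOuter (L.flip d.1) then c.2 ⟨_, h⟩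
    else if h' : L.pos d.1 then (c.1 ⟨d.1, h', d.2⟩).2
    else (c.1 ⟨L.flip d.1, (L.pos_flip _).2 h', h⟩).1
  invFun k := ⟨fun e => (k (L.bulkFlip e), k (L.bulkDart e)), fun o => k (L.bdryFlip o)⟩
  left_inv c := by
    have hf := L.flip_flip
    refine Prod.ext (funext fun e => ?_) (funext fun o => ?_)
    · have h1 : ¬ L.IsOuter (L.flip e.1) := L.not_isOuter_flip_of_pos e.2.1
      have h2 : ¬ L.IsOuter (L.flip (L.flip e.1)) := by rw [hf]; exact e.2.2
      have h3 : ¬ L.pos (L.flip e.1) := fun h => (L.pos_flip e.1).1 h e.2.1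
      simp [bulkFlip, bulkDart, h1, h3, e.2.1, e.2.2, hf]
    · simp [bdryFlip, hf, o.2]
  right_inv k := by
    have hf := L.flip_flip
    funext d
    by_cases h : L.IsOuter (L.flip d.1)
    · simp [bdryFlip, hf, h]
    · by_cases h' : L.pos d.1
      · simp [h, h', bulkDart]
      · simp [h, h', bulkFlip, hf]

theorem innerLabel_bulkDart {κ : Type*} (c : (L.BulkEdge → κ × κ) × (L.BdryEdge → κ))
    (e : L.BulkEdge) : L.innerLabel κ c (L.bulkDart e) = (c.1 e).2 := by
  have := congrArg (fun c => (c.1 e).2) ((L.innerLabel κ).left_inv c)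
  exact this

theorem innerLabel_bulkFlip {κ : Type*} (c : (L.BulkEdge → κ × κ) × (L.BdryEdge → κ))
    (e : L.BulkEdge) : L.innerLabel κ c (L.bulkFlip e) = (c.1 e).1 := by
  have := congrArg (fun c => (c.1 e).1) ((L.innerLabel κ).left_inv c)
  exact this

theorem innerLabel_bdryFlip {κ : Type*} (c : (L.BulkEdge → κ × κ) × (L.BdryEdge → κ))
    (o : L.BdryEdge) : L.innerLabel κ c (L.bdryFlip o) = c.2 o := by
  have := congrArg (fun c => c.2 o) ((L.innerLabel κ).left_inv c)
  exact this

theorem dartLetter_eq {H κ : Type*} [Ring H] [HopfAlgebra ℂ H] (b : κ → H)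
    (c : (L.BulkEdge → κ × κ) × (L.BdryEdge → κ)) (d : L.InnerDart) :
    dartLetter L (fun e => b (c.1 e).1) (fun e => b (c.1 e).2) (fun o => b (c.2 o)) d.1 =
      b (L.innerLabel κ c d) := by
  have hf := L.flip_flip
  obtain ⟨e, rfl⟩ | ⟨e, rfl⟩ | ⟨o, rfl⟩ := L.innerDart_cases d
  · have h1 : ¬ L.IsOuter (L.flip e.1) := L.not_isOuter_flip_of_pos e.2.1
    rw [innerLabel_bulkDart]
    simp [dartLetter, bulkDart, h1, e.2.1, e.2.2]
  · have h3 : ¬ L.pos (L.flip e.1) := fun h => (L.pos_flip e.1).1 h e.2.1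
    rw [innerLabel_bulkFlip]
    simp [dartLetter, bulkFlip, h3, e.2.1, e.2.2, hf]
  · rw [innerLabel_bdryFlip]
    simp [dartLetter, bdryFlip, hf, o.2]

section Words

variable [Finite D] [Fintype L.InnerFace]

/-- The words around the faces of the disk, as lists of inner darts. -/
def innerFaceWords : List (List L.InnerDart) :=
  (Finset.univ : Finset L.InnerFace).toList.map fun f => (cycleList L.next f.1.out).attachWith
    (fun d => ¬ L.IsOuter d) (L.not_isOuter_of_mem_cycleList (not_isOuter_out f))

theorem map_innerFaceWords : L.innerFaceWords.map (List.map Subtype.val) = L.faceWords := by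
  rw [innerFaceWords, faceWords, List.map_map]
  exact List.map_congr_left fun f _ => by simp

theorem map_flatten_innerFaceWords :
    L.innerFaceWords.flatten.map Subtype.val = L.faceWords.flatten := by
  rw [List.map_flatten, map_innerFaceWords]

end Words

theorem nodup_flatten_innerFaceWords [Fintype D] [Fintype L.InnerFace] :
    L.innerFaceWords.flatten.Nodup := by
  classical
  refine List.Nodup.of_map Subtype.val ?_
  rw [L.map_flatten_innerFaceWords]
  exact L.mergeStage_faces.nodup

theorem mem_flatten_innerFaceWords [Fintype D] [Fintype L.InnerFace] (i : L.InnerDart) :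
    i ∈ L.innerFaceWords.flatten := by
  classical
  obtain ⟨w, hw, hi⟩ := (L.mergeStage_faces.mem_iff i.1).2 ⟨i.2, by simp⟩
  have h1 : i.1 ∈ L.faceWords.flatten := List.mem_flatten.2 ⟨w, hw, hi⟩
  rw [← L.map_flatten_innerFaceWords] at h1
  obtain ⟨j, hj, hji⟩ := List.mem_map.1 h1
  exact Subtype.ext hji ▸ hj

end DiskLattice

namespace EdgeSystem

open Coalgebra HopfAlgebra

section Slice

variable {D : Type*} {L : DiskLattice D} {H A V : Type*} [Ring H] [HopfAlgebra ℂ H]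
  [FiniteDimensional ℂ H] [Ring A] [Algebra ℂ A] [AddCommGroup V] [Module ℂ V]
  (M : EdgeSystem L H A V) (β : RightComoduleAlgebra H A)

/-- The action of the dual on a dart. -/
def slice (φ : Module.Dual ℂ H) (d : D) : Module.End ℂ V := sliceRight φ (M.T β d)

theorem prod_faceWords_eq_sum [Fintype D] [Fintype L.InnerFace]
    [Fintype L.InnerDart] [DecidableEq L.InnerDart] {κ : Type*} [Fintype κ]
    (b : Module.Basis κ ℂ H) : (L.faceWords.map (M.B β)).prod = ∑ k : L.InnerDart → κ,
      (L.innerFaceWords.map fun w => dualHaarIntegral H (w.map fun i => b (k i)).prod).prod •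
        (L.innerFaceWords.flatten.map fun i => M.slice β (b.coord (k i)) i.1).prod := by
  rw [← prod_sliceRight_eq_sum (dualHaarIntegral H)
    L.nodup_flatten_innerFaceWords L.mem_flatten_innerFaceWords
    (fun i k => M.slice β (b.coord k) i.1) b, ← L.map_innerFaceWords, List.map_map]
  congr 1
  refine List.map_congr_left fun w _ => ?_
  simp only [Function.comp_apply, slice, sum_sliceRight_tmul, B, word, List.map_map]
  rfl

end Slice

section Total

variable {D : Type*} {L : DiskLattice D} {H A : Type*} [Ring H] [HopfAlgebra ℂ H]
  [FiniteDimensional ℂ H] [Ring A] [Algebra ℂ A]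
  {M : EdgeSystem L H A (TotalSpace L H A)} (hM : IsTotal M) (β : RightComoduleAlgebra H A)
  (hS : ∀ x : H, antipode ℂ (antipode ℂ x) = x)
include hM

include hS in
theorem slice_bulkDart (φ : Module.Dual ℂ H) (e : L.BulkEdge) :
    M.slice β φ (L.bulkDart e).1 = onBulkEdge L H A e (Tminus H φ) := by
  have h : ¬ L.IsOuter (L.flip e.1) := L.not_isOuter_flip_of_pos e.2.1
  have h1 := M.sliceRight_T_of_not_isOuter β h φ
  rw [hM.bulk, LinearMap.comp_apply, antipodeConj_Tplus hS] at h1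
  exact h1

theorem slice_bulkFlip (φ : Module.Dual ℂ H) (e : L.BulkEdge) :
    M.slice β φ (L.bulkFlip e).1 = onBulkEdge L H A e (Tplus H φ) := by
  have h1 := M.sliceRight_T_of_not_isOuter β (d := L.flip e.1) (by rw [L.flip_flip]; exact e.2.2) φ
  rw [hM.bulk_flip] at h1
  exact h1

theorem slice_bdryFlip (φ : Module.Dual ℂ H) (o : L.BdryEdge) :
    M.slice β φ (L.bdryFlip o).1 = onBdryEdge L H A o (TbarPlus β φ) := by
  have h1 := M.sliceRight_T_of_isOuter β o.2 φ
  rw [hM.bdry] at h1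
  exact h1

-- Each edge is touched by at most one dart per side and the two sides commute, so the result does
-- not depend on the order of the list.
include hS in
theorem prod_slice_tprod [DecidableEq L.InnerDart] (φ : L.InnerDart → Module.Dual ℂ H)
    {l : List L.InnerDart} (hn : l.Nodup) (x : L.BulkEdge → H) (y : L.BdryEdge → A) :
    (l.map fun d => M.slice β (φ d) d.1).prod ((⨂ₜ[ℂ] e, x e) ⊗ₜ (⨂ₜ[ℂ] o, y o)) =
      (⨂ₜ[ℂ] e, (if L.bulkFlip e ∈ l then Tplus H (φ (L.bulkFlip e)) else 1)
        ((if L.bulkDart e ∈ l then Tminus H (φ (L.bulkDart e)) else 1) (x e))) ⊗ₜ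
      (⨂ₜ[ℂ] o, (if L.bdryFlip o ∈ l then TbarPlus β (φ (L.bdryFlip o)) else 1) (y o)) := by
  classical
  induction l with
  | nil => simp
  | cons d l ih =>
    rw [List.nodup_cons] at hn
    rw [List.map_cons, List.prod_cons, Module.End.mul_apply, ih hn.2]
    obtain ⟨e, rfl⟩ | ⟨e, rfl⟩ | ⟨o, rfl⟩ := L.innerDart_cases d
    · rw [slice_bulkDart hM β hS, onBulkEdge_tmul]
      have h2 : ∀ o, L.bdryFlip o ≠ L.bulkDart e := fun o => L.bdryFlip_ne_bulkDart o e
      have h3 : ∀ e', L.bulkFlip e' ≠ L.bulkDart e := fun e' => L.bulkFlip_ne_bulkDart e' e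
      congr 2
      · ext e'
        by_cases h : e' = e
        · subst h
          simp only [Function.update_self, List.mem_cons, true_or, if_true, if_neg hn.1, h3,
            false_or, Module.End.one_apply]
          split_ifs
          · have := commute_Tplus_antipodeConj hS (φ (L.bulkFlip e')) (φ (L.bulkDart e'))
            rw [antipodeConj_Tplus hS] at this
            exact (LinearMap.congr_fun this.eq (x e')).symm
          · rfl
        · have h1 : L.bulkDart e' ≠ L.bulkDart e := fun h' => h (L.bulkDart_injective h')
          rw [Function.update_of_ne h]
          simp only [List.mem_cons, h1, h3, false_or]; congr!
      · ext o
        simp only [List.mem_cons, h2, false_or]; congr!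
    · rw [slice_bulkFlip hM β, onBulkEdge_tmul]
      have h2 : ∀ o, L.bdryFlip o ≠ L.bulkFlip e := fun o => L.bdryFlip_ne_bulkFlip o e
      have h3 : ∀ e', L.bulkDart e' ≠ L.bulkFlip e := fun e' => (L.bulkFlip_ne_bulkDart e e').symm
      congr 2
      · ext e'
        by_cases h : e' = e
        · subst h
          simp only [Function.update_self, List.mem_cons, true_or, if_true, if_neg hn.1, h3,
            false_or, Module.End.one_apply]
          congr!
        · have h1 : L.bulkFlip e' ≠ L.bulkFlip e := fun h' => h (L.bulkFlip_injective h')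
          rw [Function.update_of_ne h]
          simp only [List.mem_cons, h1, h3, false_or]; congr!
      · ext o
        simp only [List.mem_cons, h2, false_or]; congr!
    · rw [slice_bdryFlip hM β, onBdryEdge_tmul]
      have h2 : ∀ e, L.bulkDart e ≠ L.bdryFlip o := fun e => (L.bdryFlip_ne_bulkDart o e).symm
      have h3 : ∀ e, L.bulkFlip e ≠ L.bdryFlip o := fun e => (L.bdryFlip_ne_bulkFlip o e).symm
      congr 2
      · ext e
        simp only [List.mem_cons, h2, h3, false_or]; congr!
      · ext o'
        by_cases h : o' = o
        · subst h
          simp only [Function.update_self, List.mem_cons, true_or, if_true, if_neg hn.1,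
            Module.End.one_apply]
        · have h1 : L.bdryFlip o' ≠ L.bdryFlip o := fun h' => h (L.bdryFlip_injective h')
          rw [Function.update_of_ne h]
          simp only [List.mem_cons, h1, false_or]; congr!

end Total

end EdgeSystem

theorem sum_sum_smul_tprod {ι ι' κ κ' γ M N : Type*} [Fintype ι] [DecidableEq ι] [Fintype κ]
    [Fintype γ] [Fintype ι'] [DecidableEq ι'] [Fintype κ']
    [AddCommGroup M] [Module ℂ M] [AddCommGroup N] [Module ℂ N] (R : κ → γ → ℂ)
    (F : (ι → γ) → (ι' → κ') → ℂ) (v : κ → M) (w : κ' → N) :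
    ∑ k : ι → κ, ∑ l : ι' → κ', (∑ c : ι → γ, (∏ e, R (k e) (c e)) * F c l) •
      ((⨂ₜ[ℂ] e, v (k e)) ⊗ₜ[ℂ] (⨂ₜ[ℂ] o, w (l o))) =
    ∑ c : ι → γ, ∑ l : ι' → κ', F c l •
      ((⨂ₜ[ℂ] e, ∑ j, R j (c e) • v j) ⊗ₜ[ℂ] (⨂ₜ[ℂ] o, w (l o))) := by
  have h : ∀ c : ι → γ, (⨂ₜ[ℂ] e, ∑ j, R j (c e) • v j) =
      ∑ k : ι → κ, (∏ e, R (k e) (c e)) • (⨂ₜ[ℂ] e, v (k e)) := fun c => by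
    rw [MultilinearMap.map_sum (PiTensorProduct.tprod ℂ) fun e j => R j (c e) • v j]
    simp only [MultilinearMap.map_smul_univ]
  simp only [h, TensorProduct.sum_tmul, Finset.smul_sum, Finset.sum_smul, mul_smul,
    TensorProduct.smul_tmul']
  rw [Finset.sum_comm]
  conv_rhs => rw [Finset.sum_comm]
  refine Finset.sum_congr rfl fun l _ => ?_
  rw [Finset.sum_comm]
  refine Finset.sum_congr rfl fun c _ => Finset.sum_congr rfl fun k _ => ?_
  rw [← TensorProduct.smul_tmul', ← TensorProduct.smul_tmul', ← TensorProduct.smul_tmul', smul_comm]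
  exact congrArg _ (TensorProduct.smul_tmul' _ _ _)

section Network

open EdgeSystem Coalgebra HopfAlgebra

variable {D : Type*} {L : DiskLattice D} {H A : Type*} [Ring H] [HopfAlgebra ℂ H]
  [FiniteDimensional ℂ H] [Ring A] [Algebra ℂ A]
  {M : EdgeSystem L H A (TotalSpace L H A)} (hM : IsTotal M) (β : RightComoduleAlgebra H A)
  [StarRing H] [StarModule ℂ H] (hH : IsCStarHopfAlgebra H) [Fintype D]

omit [StarRing H] [StarModule ℂ H] [FiniteDimensional ℂ H] in
open scoped Classical in
theorem faceEvaluation_eq {κ : Type*} (φ : Module.Dual ℂ H) (b : κ → H)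
    (c : (L.BulkEdge → κ × κ) × (L.BdryEdge → κ)) :
    faceEvaluation L (fun _ => φ) (fun e => b (c.1 e).1) (fun e => b (c.1 e).2)
      (fun o => b (c.2 o)) = (L.innerFaceWords.map fun w =>
        φ (w.map fun i => b (L.innerLabel κ c i)).prod).prod := by
  rw [faceEvaluation, ← Finset.prod_map_toList, DiskLattice.innerFaceWords, List.map_map]
  congr 1
  refine List.map_congr_left fun f _ => ?_
  rw [Function.comp_apply]
  simp only [← L.dartLetter_eq]
  congr 2
  rw [List.attachWith_map_val]

open scoped Classical in
include hM hH in
theorem prod_faceWords_tprod {κ : Type*} [Fintype κ] (b : Module.Basis κ ℂ H) (a : A) :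
    (L.faceWords.map (M.B β)).prod (haarBulk L H ⊗ₜ (⨂ₜ[ℂ] _, a)) =
      ∑ c : L.BulkEdge → κ × κ, ∑ l : L.BdryEdge → κ,
        faceEvaluation L (fun _ => dualHaarIntegral H) (fun e => b (c e).1) (fun e => b (c e).2)
          (fun o => b (l o)) •
        ((⨂ₜ[ℂ] e, Tplus H (b.coord (c e).1) (Tminus H (b.coord (c e).2) (haarIntegral H))) ⊗ₜ[ℂ]
          (⨂ₜ[ℂ] o, TbarPlus β (b.coord (l o)) a)) := by
  rw [M.prod_faceWords_eq_sum β b, LinearMap.sum_apply, ← (L.innerLabel κ).sum_comp,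
    Fintype.sum_prod_type]
  refine Finset.sum_congr rfl fun c _ => Finset.sum_congr rfl fun l _ => ?_
  rw [LinearMap.smul_apply, haarBulk, prod_slice_tprod hM β hH.antipode_antipode _
    L.nodup_flatten_innerFaceWords, faceEvaluation_eq (dualHaarIntegral H) b (c, l)]
  simp only [L.mem_flatten_innerFaceWords, if_true, L.innerLabel_bulkDart,
    L.innerLabel_bulkFlip, L.innerLabel_bdryFlip]

-- Both sides are expanded over labels of the darts. On the network side, the sums over the labels
-- of the bulk edges are carried out first, edge by edge.
open scoped Classical in
include hM hH in
theorem tensorNetworkState_eq (a : A) :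
    tensorNetworkState L β (fun _ => haarIntegral H) (fun _ => dualHaarIntegral H) (fun _ => a) =
      (L.faceWords.map (M.B β)).prod (haarBulk L H ⊗ₜ (⨂ₜ[ℂ] _, a)) := by
  let b := Module.finBasis ℂ H
  have h := sum_sum_smul_tprod (ι := L.BulkEdge) (ι' := L.BdryEdge)
    (fun k c => (b.tensorProduct b).repr
      ((antipode ℂ (A := H)).lTensor H (comul (R := ℂ) (b k))) c)
    (fun c l => faceEvaluation L (fun _ => dualHaarIntegral H) (fun e => b (c e).1)
      (fun e => b (c e).2) (fun o => b (l o)))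
    (fun k => sliceRight (b.coord k) (comul (R := ℂ) (haarIntegral H)))
    (fun l => sliceRight (b.coord l) (β.coact a))
  simp only [hH.sum_repr_smul_sliceRight b] at h
  rw [prod_faceWords_tprod hM β hH b]
  refine Eq.trans ?_ (h.trans ?_)
  · delta tensorNetworkState hopfTrace
    dsimp only
  · exact Finset.sum_congr rfl fun c _ => Finset.sum_congr rfl fun l _ => rfl

end Network

/-! ### The integral of an augmented algebra -/

section Augmentation

variable {A : Type*} [Ring A] [Algebra ℂ A] {lam : A ⊗[ℂ] A} (ε : A →ₐ[ℂ] ℂ)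

theorem augmentedIntegral_eq : augmentedIntegral lam ε = sliceRight ε.toLinearMap lam := rfl

theorem sliceRight_rTensor_apply (f : A →ₗ[ℂ] A) (φ : Module.Dual ℂ A) (t : A ⊗[ℂ] A) :
    sliceRight φ (f.rTensor A t) = f (sliceRight φ t) := by
  induction t with
  | zero => simp
  | add x y hx hy => simp only [map_add, hx, hy]
  | tmul x y => simp

theorem sliceRight_lTensor_apply (f : A →ₗ[ℂ] A) (φ : Module.Dual ℂ A) (t : A ⊗[ℂ] A) :
    sliceRight φ (f.lTensor A t) = sliceRight (φ ∘ₗ f) t := by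
  induction t with
  | zero => simp
  | add x y hx hy => simp only [map_add, hx, hy]
  | tmul x y => simp

variable (hlam : IsSymmSeparabilityIdempotent lam)
include hlam

theorem IsSymmSeparabilityIdempotent.mul_augmentedIntegral (a : A) :
    a * augmentedIntegral lam ε = ε a • augmentedIntegral lam ε := by
  have h := congrArg (sliceRight ε.toLinearMap) (hlam.central a)
  rw [sliceRight_rTensor_apply, sliceRight_lTensor_apply] at h
  have h1 : ε.toLinearMap ∘ₗ LinearMap.mulRight ℂ a = ε a • ε.toLinearMap := by
    ext x; simp [mul_comm]
  rw [h1, map_smul, LinearMap.smul_apply] at h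
  exact h

theorem IsSymmSeparabilityIdempotent.augmentedIntegral_mul (a : A) :
    augmentedIntegral lam ε * a = ε a • augmentedIntegral lam ε := by
  have h := congrArg (sliceRight ε.toLinearMap) (hlam.central' a)
  rw [sliceRight_rTensor_apply, sliceRight_lTensor_apply] at h
  have h1 : ε.toLinearMap ∘ₗ LinearMap.mulLeft ℂ a = ε a • ε.toLinearMap := by
    ext x; simp
  rw [h1, map_smul, LinearMap.smul_apply] at h
  exact h

theorem IsSymmSeparabilityIdempotent.augmentation_augmentedIntegral :
    ε (augmentedIntegral lam ε) = 1 := by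
  have h : ∀ t : A ⊗[ℂ] A, ε (augmentedIntegral t ε) = ε (LinearMap.mul' ℂ A t) := fun t => by
    rw [augmentedIntegral_eq]
    induction t with
    | zero => simp
    | add x y hx hy => simp only [map_add, hx, hy]
    | tmul x y => simp [mul_comm]
  rw [h, hlam.mul_eq_one, map_one]

theorem IsSymmSeparabilityIdempotent.regTrace_augmentedIntegral [FiniteDimensional ℂ A] :
    regTrace A (augmentedIntegral lam ε) = 1 := by
  have h : ∀ t : A ⊗[ℂ] A, regTrace A (augmentedIntegral t ε) =
      ε (sliceRight (regTrace A) (TensorProduct.comm ℂ A A t)) := fun t => by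
    rw [augmentedIntegral_eq]
    induction t with
    | zero => simp
    | add x y hx hy => simp only [map_add, hx, hy]
    | tmul x y => simp [mul_comm]
  rw [h, hlam.symm, hlam.sliceRight_regTrace, map_one]

end Augmentation

/-! ### Invariance of the tensor network state -/

namespace EdgeSystem

open Coalgebra HopfAlgebra

section Site

variable {D : Type*} {L : DiskLattice D} {H A V : Type*} [Ring H] [HopfAlgebra ℂ H]
  [FiniteDimensional ℂ H] [Ring A] [Algebra ℂ A] [AddCommGroup V] [Module ℂ V]
  {M : EdgeSystem L H A V} {β : RightComoduleAlgebra H A} {lam : A ⊗[ℂ] A}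
  [StarRing H] [StarModule ℂ H] (hH : IsCStarHopfAlgebra H) [Finite D]
include hH

theorem IsInvariant.vert {ψ : V} (h : M.IsInvariant β lam ψ) {d : D}
    (hd : ¬ L.IsBdryVertex (L.origin d)) (g : H) :
    M.vert (cycleList L.rot d) g ψ = counit (R := ℂ) g • ψ := by
  conv_lhs => rw [← h.vertex d hd]
  rw [← Module.End.mul_apply, ← M.vert_mul hH.antipode_antipode (nodup_cycleList _ _),
    hH.isHaarIntegral.1, map_smul, LinearMap.smul_apply, h.vertex d hd]

theorem IsInvariant.wordOp {ψ : V} (h : M.IsInvariant β lam ψ) {d : D} (hd : ¬ L.IsOuter d)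
    (φ : Module.Dual ℂ H) : M.wordOp β φ (cycleList L.next d) ψ = φ 1 • ψ := by
  have h1 := M.sliceRight_word_mul_B β hH (nodup_cycleList L.next d)
    (L.not_isOuter_of_mem_cycleList hd) φ
  have h2 := LinearMap.congr_fun h1 ψ
  rwa [Module.End.mul_apply, LinearMap.smul_apply, h.face d hd] at h2

end Site

section Total

variable {D : Type*} {L : DiskLattice D} {H A : Type*} [Ring H] [HopfAlgebra ℂ H]
  [FiniteDimensional ℂ H] [Ring A] [Algebra ℂ A] [FiniteDimensional ℂ A] [Nontrivial A]
  {M : EdgeSystem L H A (TotalSpace L H A)} (hM : IsTotal M) {β : RightComoduleAlgebra H A}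
  {lam : A ⊗[ℂ] A} (hlam : IsSymmSeparabilityIdempotent lam)
  [StarRing H] [StarModule ℂ H] (hH : IsCStarHopfAlgebra H) [Fintype D] (ε : A →ₐ[ℂ] ℂ)
include hM hlam

omit [FiniteDimensional ℂ A] [Nontrivial A] [Fintype D] [StarRing H] [StarModule ℂ H] in
theorem bdryPair_augmentedIntegral (o : L.BdryEdge) (X : ⨂[ℂ] _ : L.BulkEdge, H) :
    M.bdryPair o lam (X ⊗ₜ (⨂ₜ[ℂ] _, augmentedIntegral lam ε)) =
      X ⊗ₜ (⨂ₜ[ℂ] _, augmentedIntegral lam ε) := by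
  classical
  have h : ∀ t : A ⊗[ℂ] A, M.bdryPair o t (X ⊗ₜ (⨂ₜ[ℂ] _, augmentedIntegral lam ε)) =
      ε (LinearMap.mul' ℂ A t) • (X ⊗ₜ (⨂ₜ[ℂ] _, augmentedIntegral lam ε)) := fun t => by
    induction t with
    | zero => simp
    | add x y hx hy => simp only [map_add, LinearMap.add_apply, add_smul, hx, hy]
    | tmul x y =>
      rw [bdryPair_tmul_tprod hM, hlam.mul_augmentedIntegral, hlam.augmentedIntegral_mul,
        MultilinearMap.map_update_smul, Function.update_comm (L.incoming_ne o),
        MultilinearMap.map_update_smul, Function.update_eq_self_iff.2, Function.update_eq_self_iff.2]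
      · simp [smul_smul]
      · rfl
      · simp
  rw [h, hlam.mul_eq_one, map_one, one_smul]

-- The product vector with labels h and h_A is pinned and, h_A being an integral of A with
-- augmentation 1, fixed by the boundary vertex operators. The product of the boundary labels is
-- h_A, whose regular trace is 1, so the face operators do not annihilate the vector.
include hH in
theorem tensorNetworkState_isInvariant (hβ : IsHIndecomposable β) :
    tensorNetworkState L β (fun _ => haarIntegral H) (fun _ => dualHaarIntegral H)
      (fun _ => augmentedIntegral lam ε) ≠ 0 ∧
    M.IsInvariant β lam (tensorNetworkState L β (fun _ => haarIntegral H)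
      (fun _ => dualHaarIntegral H) (fun _ => augmentedIntegral lam ε)) := by
  classical
  rw [tensorNetworkState_eq hM β hH]
  have hp := isPinned_haarBulk hM hH (⨂ₜ[ℂ] _, augmentedIntegral lam ε)
  refine ⟨prod_faceWords_ne_zero hM β hlam hH hβ hp ?_,
    M.isInvariant_prod_faceWords β hH hlam hp fun o => ?_⟩
  · rw [collapseTrace, LinearMap.comp_apply, collapse_haarBulk_tmul hM hH]
    have h1 : ∀ l : List L.BdryEdge, (augmentedIntegral lam ε *
        (l.map fun _ => augmentedIntegral lam ε).prod) = augmentedIntegral lam ε := fun l => by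
      induction l with
      | nil => simp
      | cons o l ih =>
        rw [List.map_cons, List.prod_cons, ih, hlam.mul_augmentedIntegral,
          hlam.augmentation_augmentedIntegral, one_smul]
    obtain ⟨o, l, o', hl, -⟩ := L.exists_bdryList_eq
    rw [hl, List.map_cons, List.prod_cons, h1, hlam.regTrace_augmentedIntegral]
    exact one_ne_zero
  · rw [M.bdryVert_apply_of_isPinned β hH hp, bdryPair_augmentedIntegral hM hlam]

end Total

end EdgeSystem

end HopfDisk

end

/-! ### Conclusion -/

open scoped TensorProduct in
theorem mainTheorem8 {H A D : Type*}
    [Ring H] [HopfAlgebra ℂ H] [StarRing H] [StarModule ℂ H] [FiniteDimensional ℂ H]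
    (hH : HopfDisk.IsCStarHopfAlgebra H)
    [Ring A] [Algebra ℂ A] [FiniteDimensional ℂ A] [Nontrivial A]
    (β : HopfDisk.RightComoduleAlgebra H A) (hβ : HopfDisk.IsHIndecomposable β)
    (lam : A ⊗[ℂ] A) (hlam : HopfDisk.IsSymmSeparabilityIdempotent lam)
    [Fintype D] (L : HopfDisk.DiskLattice D) :
    (∃ ψ : HopfDisk.TotalSpace L H A,
      HopfDisk.IsGroundState (HopfDisk.hamiltonian L β lam) ψ ∧
      ∀ ψ', HopfDisk.IsGroundState (HopfDisk.hamiltonian L β lam) ψ' → ∃ c : ℂ, ψ' = c • ψ) ∧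
    ∀ ε : A →ₐ[ℂ] ℂ, ∀ Ψ : HopfDisk.TotalSpace L H A,
      Ψ = HopfDisk.tensorNetworkState L β (fun _ => HopfDisk.haarIntegral H)
        (fun _ => HopfDisk.dualHaarIntegral H)
        (fun _ => HopfDisk.augmentedIntegral lam ε) →
      HopfDisk.IsGroundState (HopfDisk.hamiltonian L β lam) Ψ ∧
      ∀ d : D, ¬ L.IsBdryVertex (L.origin d) → ∀ (g : H) (φ : Module.Dual ℂ H),
        HopfDisk.faceOp L β d φ (HopfDisk.vertexOp L H A d g Ψ) =
          (Coalgebra.counit (R := ℂ) g * φ 1) • Ψ := by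
  classical
  have hS := hH.antipode_antipode
  have hM := HopfDisk.EdgeSystem.isTotal_total (L := L) (A := A) hS
  have hiff := HopfDisk.isGroundState_hamiltonian_iff (L := L) β hH hlam
    (HopfDisk.EdgeSystem.exists_isInvariant hM β hlam hH hβ)
  refine ⟨?_, fun ε Ψ hΨ => ?_⟩
  · obtain ⟨ψ, h0, hψ⟩ := HopfDisk.EdgeSystem.exists_isInvariant hM β hlam hH hβ
    exact ⟨ψ, (hiff ψ).2 ⟨h0, hψ⟩, fun ψ' h' =>
      HopfDisk.EdgeSystem.exists_eq_smul_of_isInvariant hM β hlam hH hβ hψ h0 ((hiff ψ').1 h').2⟩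
  · have hinv := HopfDisk.EdgeSystem.tensorNetworkState_isInvariant (β := β) hM hlam hH ε hβ
    rw [← hΨ] at hinv
    refine ⟨(hiff Ψ).2 hinv, fun d hd g φ => ?_⟩
    have hrot : L.origin (L.rot d) = L.origin d :=
      L.origin_eq_iff.2 (Equiv.Perm.sameCycle_apply_left.2 (.refl _ _))
    have h1 := hinv.2.vert hH (d := L.rot d) (by rwa [hrot]) g
    have h2 := hinv.2.wordOp hH (L.not_isOuter_of_origin hd) φ
    rw [HopfDisk.EdgeSystem.vertexOp_eq hS, h1, map_smul, HopfDisk.EdgeSystem.faceOp_eq hS, mul_smul]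
    exact congrArg _ h2
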